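/- Let $M$ be a smooth (Hausdorff, second countable, finite-dimensional) manifold with a foliation $\mathcal F$ of codimension $2n$, and let $\omega$ be a transversely symplectic form, i.e. a closed $2$-form on $M$ whose kernel at each point $x$ is the tangent space $T_x\mathcal F$ of the leaf. Let $$\Omega(M,\mathcal F)=\{\alpha\in\Omega(M)\mid \iota(X)\alpha=\mathcal L(X)\alpha=0 \text{ for all vector fields } X \text{ tangent to } \mathcal F\}$$ be the basic forms. Let $B$ be the pairing induced pointwise by $\omega$ on horizontal $p$-forms, i.e. on $\Lambda^p(T_xM/T_x\mathcal F)^*$ (so $B(\iota(X)\omega,\iota(Y)\omega)=\omega(Y,X)$ and $B(\alpha_1\wedge\dots\wedge\alpha_p,\beta_1\wedge\dots\wedge\beta_p)=\det(B(\alpha_i,\beta_j))$), let $\star$ be the symplectic Hodge star, defined pointwise by $\beta\wedge\star\alpha=B(\alpha,\beta)\,\omega^n/n!$ for all horizontal $p$-forms $\alpha,\beta$, and let $\delta\alpha=(-1)^{p+1}\star d\star\alpha$ for a basic $p$-form $\alpha$. Let $G$ be a compact connected Lie group with Lie algebra $\mathfrak g$ which acts smoothly on $M$, preserves $\omega$,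 and acts transversely, i.e. the fundamental vector field $\xi_M$ of each $\xi\in\mathfrak g$ is foliate: $[\xi_M,Y]$ is tangent to $\mathcal F$ whenever $Y$ is. Let $$\Omega_{G}=[S(\mathfrak g^*)\otimes\Omega(M,\mathcal F)]^G$$ be the equivariant basic Cartan complex, whose elements are the $G$-equivariant polynomial maps $\alpha:\mathfrak g\to\Omega(M,\mathcal F)$, graded by giving $[S^i(\mathfrak g^*)\otimes\Omega^j(M,\mathcal F)]^G$ the degree $2i+j$. On it consider the wedge product $(\alpha\wedge\beta)(\xi)=\alpha(\xi)\wedge\beta(\xi)$, the operator $(\delta\alpha)(\xi)=\delta(\alpha(\xi))$ and the equivariant differential $(d_G\alpha)(\xi)=d(\alpha(\xi))-\iota(\xi_M)\alpha(\xi)$. Then $(\Omega_G,\wedge,\delta,d_G)$ is a dGBV algebra over $\mathbb R$. That is: 1. $(\Omega_G,\wedge)$ is an associative, supercommutative graded algebra with identity; 2. $\delta$ is a well-defined linear operator of degree $-1$ on $\Omega_G$ with $\delta^2=0$; 3. with the odd bracket $[a\bullet b]=(-1)^{|a|}\bigl(\delta(a\wedge b)-(\delta a)\wedge b-(-1)^{|a|}a\wedge\delta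 b\bigr)$, all homogeneous $a,b,c$ satisfy $$[a\bullet(b\wedge c)]=[a\bullet b]\wedge c+(-1)^{(|a|+1)|b|}\,b\wedge[a\bullet c];$$ 4. $d_G$ is a well-defined linear operator of degree $+1$ on $\Omega_G$ with $d_G^2=0$ and $d_G(a\wedge b)=d_Ga\wedge b+(-1)^{|a|}a\wedge d_Gb$ for homogeneous $a,b$; 5. $d_G\delta+\delta d_G=0$. -/

import Mathlib

open scoped Manifold ContDiff Nat

noncomputable section

/-! ### Linear algebra on one tangent space -/

section Fibre

variable {W : Type*} [AddCommGroup W] [Module ℝ W] [TopologicalSpace W]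

/-- The multilinear form `v ↦ a (v₀, …, v_{p-1}) * b (v_p, …, v_{k-1})`, where `k = p + q`. -/
def altProd {p q k : ℕ} (h : p + q = k) (a : W [⋀^Fin p]→L[ℝ] ℝ) (b : W [⋀^Fin q]→L[ℝ] ℝ) :
    ContinuousMultilinearMap ℝ (fun _ : Fin k => W) ℝ where
  toMultilinearMap :=
    ((LinearMap.mul' ℝ ℝ).compMultilinearMap
      (a.toMultilinearMap.domCoprod b.toMultilinearMap)).domDomCongr
        (finSumFinEquiv.trans (finCongr h))
  cont := by
    have h1 : Continuous fun v : Fin k → W => a fun i => v (Fin.cast h (Fin.castAdd q i)) :=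
      a.cont.comp (by fun_prop)
    have h2 : Continuous fun v : Fin k → W => b fun i => v (Fin.cast h (Fin.natAdd p i)) :=
      b.cont.comp (by fun_prop)
    exact h1.mul h2

theorem altProd_apply {p q k : ℕ} (h : p + q = k) (a : W [⋀^Fin p]→L[ℝ] ℝ)
    (b : W [⋀^Fin q]→L[ℝ] ℝ) (v : Fin k → W) :
    altProd h a b v = a (fun i => v (Fin.cast h (Fin.castAdd q i))) *
      b (fun i => v (Fin.cast h (Fin.natAdd p i))) := rfl

/-- The exterior product of alternating forms,
`(a ∧ b)(v) = 1 / (p! q!) ∑_τ sign τ • a (v_{τ 0}, …) * b (v_{τ p}, …)`. -/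
def altWedge {p q k : ℕ} (h : p + q = k) (a : W [⋀^Fin p]→L[ℝ] ℝ) (b : W [⋀^Fin q]→L[ℝ] ℝ) :
    W [⋀^Fin k]→L[ℝ] ℝ :=
  ((p ! : ℝ) * (q ! : ℝ))⁻¹ • ContinuousMultilinearMap.alternatization (altProd h a b)

/-- The interior product (contraction) `a ↦ a (w, ·, …, ·)`. -/
def altInterior {k : ℕ} (w : W) (a : W [⋀^Fin (k + 1)]→L[ℝ] ℝ) : W [⋀^Fin k]→L[ℝ] ℝ where
  toMultilinearMap := (a.toAlternatingMap.curryLeft w).toMultilinearMap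
  map_eq_zero_of_eq' := (a.toAlternatingMap.curryLeft w).map_eq_zero_of_eq'
  cont := a.cont.comp (Continuous.matrixVecCons continuous_const continuous_id)

theorem altInterior_apply {k : ℕ} (w : W) (a : W [⋀^Fin (k + 1)]→L[ℝ] ℝ) (v : Fin k → W) :
    altInterior w a v = a (Matrix.vecCons w v) := rfl

/-- The power `σ ^ n` of a two-form with respect to the exterior product. -/
def altPow (σ : W [⋀^Fin 2]→L[ℝ] ℝ) : (n : ℕ) → W [⋀^Fin (2 * n)]→L[ℝ] ℝ
  | 0 =>
    haveI : IsEmpty (Fin (2 * 0)) := inferInstanceAs (IsEmpty (Fin 0))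
    ContinuousAlternatingMap.constOfIsEmpty ℝ W (Fin (2 * 0)) 1
  | n + 1 => altWedge (by ring) (altPow σ n) σ

/-- The vector `v` lies in the kernel of the two-form `σ`. -/
def InKernel (σ : W [⋀^Fin 2]→L[ℝ] ℝ) (v : W) : Prop := ∀ w : W, σ ![v, w] = 0

/-- The alternating forms that come from the quotient of `W` by the kernel of `σ`. -/
def IsHorizontal (σ : W [⋀^Fin 2]→L[ℝ] ℝ) {k : ℕ} (a : W [⋀^Fin k]→L[ℝ] ℝ) : Prop :=
  ∀ v : Fin k → W, (∃ i, InKernel σ (v i)) → a v = 0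

/-- Two families of `m` vectors that are dual to each other with respect to `σ`. If `m` is the
codimension of the kernel of `σ`, they are bases of the quotient of `W` by the kernel of `σ`, and
`∑ i, e' i ⊗ e i` is the bivector inverse to `σ`. -/
def IsDualPair (σ : W [⋀^Fin 2]→L[ℝ] ℝ) {m : ℕ} (e e' : Fin m → W) : Prop :=
  ∀ i j, σ ![e i, e' j] = if i = j then 1 else 0

open scoped Classical in
/-- The bilinear pairing `B` that `σ` (with kernel of codimension `2 * n`) induces on horizontal
`p`-forms. On one-forms it is the pairing with `B (ι(v)σ, ι(w)σ) = σ (w, v)`, and on `p`-forms it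
is determined by `B (a₁ ∧ … ∧ a_p, b₁ ∧ … ∧ b_p) = det (B (a_i, b_j))`. It is computed in an
arbitrary pair of dual frames; the result does not depend on them. -/
def symplecticPairing (σ : W [⋀^Fin 2]→L[ℝ] ℝ) (n : ℕ) {p : ℕ} (a b : W [⋀^Fin p]→L[ℝ] ℝ) : ℝ :=
  if h : ∃ f : (Fin (2 * n) → W) × (Fin (2 * n) → W), IsDualPair σ f.1 f.2 then
    (p ! : ℝ)⁻¹ * ∑ s : Fin p → Fin (2 * n),
      a (fun i => h.choose.2 (s i)) * b (fun i => h.choose.1 (s i))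
  else 0

open scoped Classical in
/-- The symplectic Hodge star: the horizontal `q`-form `⋆a`, where `p + q = 2 * n`, with
`b ∧ ⋆a = B (a, b) σ ^ n / n!` for all horizontal `p`-forms `b`. -/
def symplecticStar (σ : W [⋀^Fin 2]→L[ℝ] ℝ) (n : ℕ) {p q : ℕ} (h : p + q = 2 * n)
    (a : W [⋀^Fin p]→L[ℝ] ℝ) : W [⋀^Fin q]→L[ℝ] ℝ :=
  if hc : ∃ c : W [⋀^Fin q]→L[ℝ] ℝ, IsHorizontal σ c ∧
      ∀ b : W [⋀^Fin p]→L[ℝ] ℝ, IsHorizontal σ b →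
        altWedge h b c = symplecticPairing σ n a b • ((n ! : ℝ)⁻¹ • altPow σ n) then
    hc.choose
  else 0

end Fibre

/-! ### Differential forms on a manifold -/

section Forms

variable {E : Type*} [NormedAddCommGroup E] [NormedSpace ℝ E]
  {M : Type*} [TopologicalSpace M] [ChartedSpace E M]

variable (E M) in
/-- Fields of alternating `k`-forms on the tangent spaces of `M` (no smoothness required). -/
abbrev FormField (k : ℕ) : Type _ := (x : M) → TangentSpace 𝓘(ℝ, E) x [⋀^Fin k]→L[ℝ] ℝ

variable (E M) in
/-- Families with one field of alternating `k`-forms for each degree `k`. -/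
abbrev Forms : Type _ := (k : ℕ) → FormField E M k

/-- The expression of a form in the chart around `x₀`: its pullback under the inverse chart. -/
def chartExpr (x₀ : M) {k : ℕ} (a : FormField E M k) (y : E) : E [⋀^Fin k]→L[ℝ] ℝ :=
  (a ((extChartAt 𝓘(ℝ, E) x₀).symm y)).compContinuousLinearMap
    ((mfderiv 𝓘(ℝ, E) 𝓘(ℝ, E) (extChartAt 𝓘(ℝ, E) x₀).symm y).comp
      ((NormedSpace.fromTangentSpace (𝕜 := ℝ) y).symm : E →L[ℝ] TangentSpace 𝓘(ℝ, E) y))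

/-- A form is smooth if its expressions in the charts are. -/
def IsSmoothForm {k : ℕ} (a : FormField E M k) : Prop :=
  ∀ x₀ : M, ContDiffOn ℝ ∞ (chartExpr x₀ a) (extChartAt 𝓘(ℝ, E) x₀).target

/-- The exterior derivative, computed at `x` in the chart around `x`. -/
def extD {k : ℕ} (a : FormField E M k) : FormField E M (k + 1) := fun x =>
  (extDeriv (chartExpr x a) (extChartAt 𝓘(ℝ, E) x x)).compContinuousLinearMap
    ((NormedSpace.fromTangentSpace (𝕜 := ℝ) (extChartAt 𝓘(ℝ, E) x x) :
        TangentSpace 𝓘(ℝ, E) (extChartAt 𝓘(ℝ, E) x x) →L[ℝ] E).comp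
      (mfderiv 𝓘(ℝ, E) 𝓘(ℝ, E) (extChartAt 𝓘(ℝ, E) x) x))

namespace Forms

/-- The family concentrated in degree `0` with value the constant function `1`. -/
def one : Forms E M
  | 0 => fun x => ContinuousAlternatingMap.constOfIsEmpty ℝ (TangentSpace 𝓘(ℝ, E) x) (Fin 0) 1
  | _ + 1 => 0

/-- The exterior product. -/
def wedge (a b : Forms E M) : Forms E M := fun k x =>
  ∑ pq ∈ (Finset.HasAntidiagonal.antidiagonal k).attach,
    altWedge (Finset.HasAntidiagonal.mem_antidiagonal.1 pq.2) (a pq.1.1 x) (b pq.1.2 x)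

/-- The exterior derivative. -/
def d (a : Forms E M) : Forms E M
  | 0 => 0
  | k + 1 => extD (a k)

/-- The interior product with a vector field. -/
def interior (X : (x : M) → TangentSpace 𝓘(ℝ, E) x) (a : Forms E M) : Forms E M :=
  fun k x => altInterior (X x) (a (k + 1) x)

/-- The Lie derivative along a vector field, by Cartan's formula. -/
def lieDeriv (X : (x : M) → TangentSpace 𝓘(ℝ, E) x) (a : Forms E M) : Forms E M :=
  d (interior X a) + interior X (d a)

/-- The pullback under a map. -/
def pullback (f : M → M) (a : Forms E M) : Forms E M := fun k x =>
  (a k (f x)).compContinuousLinearMap (mfderiv 𝓘(ℝ, E) 𝓘(ℝ, E) f x)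

/-- The symplectic Hodge star operator; it sends forms of degree `p ≤ 2 * n` to forms of degree
`2 * n - p`. (There are no nonzero horizontal forms of degree above `2 * n`.) -/
def star (σ : FormField E M 2) (n : ℕ) (a : Forms E M) : Forms E M := fun q x =>
  if h : q ≤ 2 * n then symplecticStar (σ x) n (Nat.sub_add_cancel h) (a (2 * n - q) x) else 0

/-- The symplectic codifferential `δ = (-1) ^ (p + 1) ⋆ d ⋆` on forms of degree `p`; its component
of degree `q` comes from the component of degree `p = q + 1`. -/
def codiff (σ : FormField E M 2) (n : ℕ) (a : Forms E M) : Forms E M := fun q =>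
  (-1 : ℝ) ^ ((q + 1) + 1) • star σ n (d (star σ n a)) q

end Forms

/-! Linearity of the operations above. -/

theorem chartExpr_add (x₀ : M) {k : ℕ} (a b : FormField E M k) :
    chartExpr x₀ (a + b) = chartExpr x₀ a + chartExpr x₀ b := by
  ext y v; rfl

theorem chartExpr_smul (x₀ : M) {k : ℕ} (c : ℝ) (a : FormField E M k) :
    chartExpr x₀ (c • a) = c • chartExpr x₀ a := by
  ext y v; rfl

theorem chartExpr_zero (x₀ : M) {k : ℕ} : chartExpr x₀ (0 : FormField E M k) = 0 := by
  ext y v; rfl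

theorem IsSmoothForm.zero {k : ℕ} : IsSmoothForm (0 : FormField E M k) := fun x₀ => by
  rw [chartExpr_zero]; exact contDiffOn_const

theorem IsSmoothForm.add {k : ℕ} {a b : FormField E M k} (ha : IsSmoothForm a)
    (hb : IsSmoothForm b) : IsSmoothForm (a + b) := fun x₀ => by
  rw [chartExpr_add]; exact (ha x₀).add (hb x₀)

theorem IsSmoothForm.smul {k : ℕ} {a : FormField E M k} (c : ℝ) (ha : IsSmoothForm a) :
    IsSmoothForm (c • a) := fun x₀ => by
  rw [chartExpr_smul]; exact (ha x₀).const_smul c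

theorem IsSmoothForm.differentiableAt {k : ℕ} {a : FormField E M k} (ha : IsSmoothForm a) (x : M) :
    DifferentiableAt ℝ (chartExpr x a) (extChartAt 𝓘(ℝ, E) x x) :=
  ((ha x).contDiffAt ((isOpen_extChartAt_target x).mem_nhds
    (mem_extChartAt_target x))).differentiableAt (by simp)

theorem extD_add {k : ℕ} {a b : FormField E M k} (ha : IsSmoothForm a) (hb : IsSmoothForm b) :
    extD (a + b) = extD a + extD b := by
  funext x
  simp only [extD, chartExpr_add, extDeriv_add (ha.differentiableAt x) (hb.differentiableAt x)]
  rfl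

theorem extD_smul {k : ℕ} (c : ℝ) (a : FormField E M k) : extD (c • a) = c • extD a := by
  funext x
  simp only [extD, chartExpr_smul, extDeriv_smul]
  rfl

namespace Forms

theorem d_add {a b : Forms E M} (ha : ∀ k, IsSmoothForm (a k)) (hb : ∀ k, IsSmoothForm (b k)) :
    d (a + b) = d a + d b := by
  funext k
  cases k with
  | zero => exact (add_zero (0 : FormField E M 0)).symm
  | succ k => exact extD_add (ha k) (hb k)

theorem d_smul (c : ℝ) (a : Forms E M) : d (c • a) = c • d a := by
  funext k
  cases k with
  | zero => exact (smul_zero c : c • (0 : FormField E M 0) = 0).symm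
  | succ k => exact extD_smul c (a k)

theorem d_zero : d (0 : Forms E M) = 0 := by
  simpa using d_smul (0 : ℝ) (0 : Forms E M)

theorem interior_add (X : (x : M) → TangentSpace 𝓘(ℝ, E) x) (a b : Forms E M) :
    interior X (a + b) = interior X a + interior X b := by
  funext k x; ext v; rfl

theorem interior_smul (X : (x : M) → TangentSpace 𝓘(ℝ, E) x) (c : ℝ) (a : Forms E M) :
    interior X (c • a) = c • interior X a := by
  funext k x; ext v; rfl

theorem interior_zero (X : (x : M) → TangentSpace 𝓘(ℝ, E) x) :
    interior X (0 : Forms E M) = 0 := by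
  funext k x; ext v; rfl

theorem pullback_add (f : M → M) (a b : Forms E M) :
    pullback f (a + b) = pullback f a + pullback f b := by
  funext k x; ext v; rfl

theorem pullback_smul (f : M → M) (c : ℝ) (a : Forms E M) :
    pullback f (c • a) = c • pullback f a := by
  funext k x; ext v; rfl

end Forms

/-! ### Foliations -/

variable [IsManifold 𝓘(ℝ, E) ∞ M]

/-- Smooth vector fields. -/
def IsSmoothField (X : (x : M) → TangentSpace 𝓘(ℝ, E) x) : Prop :=
  ContMDiff 𝓘(ℝ, E) 𝓘(ℝ, E).tangent ∞
    (fun x => (⟨x, X x⟩ : TangentBundle 𝓘(ℝ, E) M))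

variable (E M) in
/-- A smooth foliation of codimension `m`, given by its tangent distribution: every point has an
open neighbourhood on which the leaves are the fibres of a submersion onto an open subset of
`ℝ^m`. -/
structure Foliation (m : ℕ) where
  /-- the tangent space of the leaf through `x` -/
  tangent : (x : M) → Submodule ℝ (TangentSpace 𝓘(ℝ, E) x)
  exists_submersion : ∀ x₀ : M, ∃ U : Set M, IsOpen U ∧ x₀ ∈ U ∧
    ∃ f : M → EuclideanSpace ℝ (Fin m),
      ContMDiffOn 𝓘(ℝ, E) 𝓘(ℝ, EuclideanSpace ℝ (Fin m)) ∞ f U ∧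
      ∀ x ∈ U,
        Function.Surjective (mfderiv 𝓘(ℝ, E) 𝓘(ℝ, EuclideanSpace ℝ (Fin m)) f x) ∧
        ∀ v : TangentSpace 𝓘(ℝ, E) x,
          v ∈ tangent x ↔ mfderiv 𝓘(ℝ, E) 𝓘(ℝ, EuclideanSpace ℝ (Fin m)) f x v = 0

namespace Foliation

variable {m : ℕ}

/-- Smooth vector fields that are tangent to the leaves. -/
def IsTangentField (F : Foliation E M m) (X : (x : M) → TangentSpace 𝓘(ℝ, E) x) : Prop :=
  IsSmoothField X ∧ ∀ x, X x ∈ F.tangent x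

/-- Foliate vector fields: those whose bracket with every field tangent to the leaves is tangent
to the leaves. -/
def IsFoliateField (F : Foliation E M m) (X : (x : M) → TangentSpace 𝓘(ℝ, E) x) : Prop :=
  IsSmoothField X ∧ ∀ Y : (x : M) → TangentSpace 𝓘(ℝ, E) x, F.IsTangentField Y →
    F.IsTangentField (VectorField.mlieBracket 𝓘(ℝ, E) X Y)

/-- `σ` is a transversely symplectic form: a closed smooth two-form whose kernel at each point is
the tangent space of the leaf. -/
structure IsTransverselySymplectic (F : Foliation E M m) (σ : FormField E M 2) : Prop where
  smooth : IsSmoothForm σ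
  closed : extD σ = 0
  kernel : ∀ x (v : TangentSpace 𝓘(ℝ, E) x), v ∈ F.tangent x ↔ InKernel (σ x) v

/-- `a` is a basic form: it is smooth, and `ι(X) a = 0` and `L(X) a = 0` for all vector fields `X`
tangent to the leaves. -/
structure IsBasic (F : Foliation E M m) (a : Forms E M) : Prop where
  smooth : ∀ k, IsSmoothForm (a k)
  interior : ∀ X : (x : M) → TangentSpace 𝓘(ℝ, E) x, F.IsTangentField X → Forms.interior X a = 0
  lieDeriv : ∀ X : (x : M) → TangentSpace 𝓘(ℝ, E) x, F.IsTangentField X → Forms.lieDeriv X a = 0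

end Foliation

/-- The space `Ω^j(M, F)` of basic forms of degree `j`. -/
def Foliation.basicForms {m : ℕ} (F : Foliation E M m) (j : ℕ) : Submodule ℝ (Forms E M) where
  carrier := {a | F.IsBasic a ∧ ∀ k, k ≠ j → a k = 0}
  zero_mem' := by
    refine ⟨⟨fun _ => IsSmoothForm.zero, fun X _ => Forms.interior_zero X, fun X _ => ?_⟩,
      fun _ _ => rfl⟩
    simp [Forms.lieDeriv, Forms.interior_zero, Forms.d_zero]
  add_mem' := by
    rintro a b ⟨ha, ha'⟩ ⟨hb, hb'⟩
    refine ⟨⟨fun k => (ha.smooth k).add (hb.smooth k), fun X hX => ?_, fun X hX => ?_⟩,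
      fun k hk => ?_⟩
    · rw [Forms.interior_add, ha.interior X hX, hb.interior X hX, add_zero]
    · have h1 := ha.lieDeriv X hX
      have h2 := hb.lieDeriv X hX
      simp only [Forms.lieDeriv, ha.interior X hX, hb.interior X hX, Forms.d_zero, zero_add]
        at h1 h2
      simp only [Forms.lieDeriv, Forms.interior_add, ha.interior X hX, hb.interior X hX,
        Forms.d_add ha.smooth hb.smooth, add_zero, Forms.d_zero, h1, h2]
    · rw [Pi.add_apply, ha' k hk, hb' k hk, add_zero]
  smul_mem' := by
    rintro c a ⟨ha, ha'⟩
    refine ⟨⟨fun k => (ha.smooth k).smul c, fun X hX => ?_, fun X hX => ?_⟩, fun k hk => ?_⟩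
    · rw [Forms.interior_smul, ha.interior X hX, smul_zero]
    · have h1 := ha.lieDeriv X hX
      simp only [Forms.lieDeriv] at h1
      simp only [Forms.lieDeriv, Forms.interior_smul, Forms.d_smul, ← smul_add, h1, smul_zero]
    · rw [Pi.smul_apply, ha' k hk, smul_zero]

/-! ### Lie group actions and the equivariant basic Cartan complex -/

variable {E' : Type*} [NormedAddCommGroup E'] [NormedSpace ℝ E']
  {G : Type*} [TopologicalSpace G] [ChartedSpace E' G] [Group G]

/-- The adjoint action of `g` on the Lie algebra: the derivative at the identity of `h ↦ g h g⁻¹`.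
(The target `g 1 g⁻¹` of the derivative is the identity.) -/
def adjointAction (g : G) (ξ : GroupLieAlgebra 𝓘(ℝ, E') G) : GroupLieAlgebra 𝓘(ℝ, E') G :=
  (mfderiv 𝓘(ℝ, E') 𝓘(ℝ, E') (fun h : G => g * h * g⁻¹) 1 ξ : TangentSpace 𝓘(ℝ, E') _)

/-- The fundamental vector field `x ↦ d/dt exp(-tξ) • x` at `t = 0`; with this sign the map from
the Lie algebra to vector fields is a homomorphism of Lie algebras. -/
def fundamentalField (E : Type*) [NormedAddCommGroup E] [NormedSpace ℝ E]
    {M : Type*} [TopologicalSpace M] [ChartedSpace E M] [MulAction G M]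
    (ξ : GroupLieAlgebra 𝓘(ℝ, E') G) (x : M) : TangentSpace 𝓘(ℝ, E) x :=
  -(mfderiv 𝓘(ℝ, E') 𝓘(ℝ, E) (fun g : G => g • x) 1 ξ : TangentSpace 𝓘(ℝ, E) _)

variable [MulAction G M]

variable (E' G) in
/-- The action of `G` is transverse: its fundamental vector fields are foliate. -/
def IsTransverseAction {m : ℕ} (F : Foliation E M m) : Prop :=
  ∀ ξ : GroupLieAlgebra 𝓘(ℝ, E') G, F.IsFoliateField (fundamentalField E ξ)

variable (G) in
/-- The action of `G` preserves the two-form `σ`. -/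
def PreservesForm (σ : FormField E M 2) : Prop :=
  ∀ (g : G) (x : M),
    (σ (g • x)).compContinuousLinearMap (mfderiv 𝓘(ℝ, E) 𝓘(ℝ, E) (fun y : M => g • y) x) = σ x

variable (E' G) in
/-- Maps from the Lie algebra to forms. -/
abbrev EquivForms (E : Type*) [NormedAddCommGroup E] [NormedSpace ℝ E]
    (M : Type*) [TopologicalSpace M] [ChartedSpace E M] : Type _ :=
  GroupLieAlgebra 𝓘(ℝ, E') G → Forms E M

/-- `[S^i(𝔤*) ⊗ Ω^j(M, F)]^G`: the maps from the Lie algebra to basic forms of degree `j` that are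
polynomial, homogeneous of degree `i`, and equivariant, where `g` acts on forms by the pullback
under `g⁻¹`. -/
def Foliation.cartanPiece {m : ℕ} (F : Foliation E M m) (E' : Type*) [NormedAddCommGroup E']
    [NormedSpace ℝ E'] (G : Type*) [TopologicalSpace G] [ChartedSpace E' G] [Group G]
    [MulAction G M] (i j : ℕ) : Submodule ℝ (EquivForms E' G E M) where
  carrier := {α |
    (∃ A : MultilinearMap ℝ (fun _ : Fin i => GroupLieAlgebra 𝓘(ℝ, E') G) (F.basicForms j),
      ∀ ξ, α ξ = A (fun _ => ξ)) ∧
    ∀ (g : G) (ξ : GroupLieAlgebra 𝓘(ℝ, E') G),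
      Forms.pullback (fun x : M => g • x) (α (adjointAction g ξ)) = α ξ}
  zero_mem' := ⟨⟨0, fun _ => rfl⟩, fun g ξ => by funext k x; ext v; rfl⟩
  add_mem' := by
    rintro α β ⟨⟨A, hA⟩, hα⟩ ⟨⟨B, hB⟩, hβ⟩
    refine ⟨⟨A + B, fun ξ => ?_⟩, fun g ξ => ?_⟩
    · simp [hA, hB]
    · simp only [Pi.add_apply α β]
      rw [Forms.pullback_add, hα, hβ]
  smul_mem' := by
    rintro c α ⟨⟨A, hA⟩, hα⟩
    refine ⟨⟨c • A, fun ξ => ?_⟩, fun g ξ => ?_⟩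
    · simp [hA]
    · simp only [Pi.smul_apply c α]
      rw [Forms.pullback_smul, hα]

/-- The space `Ω_G^k(M, F)` of equivariant basic forms of total degree `k`; elements of
`S^i(𝔤*) ⊗ Ω^j(M, F)` have degree `2 * i + j`. -/
def Foliation.cartanComplex {m : ℕ} (F : Foliation E M m) (E' : Type*) [NormedAddCommGroup E']
    [NormedSpace ℝ E'] (G : Type*) [TopologicalSpace G] [ChartedSpace E' G] [Group G]
    [MulAction G M] (k : ℤ) : Submodule ℝ (EquivForms E' G E M) :=
  ⨆ (i : ℕ) (j : ℕ) (_ : 2 * (i : ℤ) + (j : ℤ) = k), F.cartanPiece E' G i j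

namespace EquivForms

/-- The constant map with value the function `1`. -/
def one : EquivForms E' G E M := fun _ => Forms.one

/-- The exterior product. -/
def wedge (α β : EquivForms E' G E M) : EquivForms E' G E M := fun ξ => Forms.wedge (α ξ) (β ξ)

/-- The operator `1 ⊗ δ`. -/
def codiff (σ : FormField E M 2) (n : ℕ) (α : EquivForms E' G E M) : EquivForms E' G E M :=
  fun ξ => Forms.codiff σ n (α ξ)

/-- The equivariant exterior differential `(d_G α)(ξ) = d (α ξ) - ι(ξ_M) (α ξ)`. -/
def dG (α : EquivForms E' G E M) : EquivForms E' G E M :=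
  fun ξ => Forms.d (α ξ) - Forms.interior (fundamentalField E ξ) (α ξ)

end EquivForms

end Forms

/-! ### Differential Gerstenhaber–Batalin–Vilkovisky algebras

A graded vector space is given by subspaces `A i` (`i : ℤ`) of a vector space `V`, and the
operations by maps on `V`, of which only the restrictions to the sum of the `A i` matter. -/

section DGBV

variable {k V : Type*} [Field k] [AddCommGroup V] [Module k V]

/-- `f` restricts to a linear endomorphism, homogeneous of degree `r`, of the sum of the `A i`. -/
structure IsHomogeneousLinear (A : ℤ → Submodule k V) (r : ℤ) (f : V → V) : Prop where
  map_add : ∀ a ∈ ⨆ i, A i, ∀ b ∈ ⨆ i, A i, f (a + b) = f a + f b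
  map_smul : ∀ (c : k), ∀ a ∈ ⨆ i, A i, f (c • a) = c • f a
  map_mem : ∀ i, ∀ a ∈ A i, f a ∈ A (i + r)

/-- The sum of the `A i` is direct, and it is an associative, supercommutative graded algebra
over `k` with product `mul` and identity `one`. -/
structure IsSupercommutativeAlgebra (A : ℤ → Submodule k V) (mul : V → V → V) (one : V) :
    Prop where
  independent : iSupIndep A
  add_mul : ∀ a ∈ ⨆ i, A i, ∀ b ∈ ⨆ i, A i, ∀ c ∈ ⨆ i, A i,
    mul (a + b) c = mul a c + mul b c
  mul_add : ∀ a ∈ ⨆ i, A i, ∀ b ∈ ⨆ i, A i, ∀ c ∈ ⨆ i, A i,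
    mul a (b + c) = mul a b + mul a c
  smul_mul : ∀ (t : k), ∀ a ∈ ⨆ i, A i, ∀ b ∈ ⨆ i, A i, mul (t • a) b = t • mul a b
  mul_smul : ∀ (t : k), ∀ a ∈ ⨆ i, A i, ∀ b ∈ ⨆ i, A i, mul a (t • b) = t • mul a b
  mul_assoc : ∀ a ∈ ⨆ i, A i, ∀ b ∈ ⨆ i, A i, ∀ c ∈ ⨆ i, A i,
    mul (mul a b) c = mul a (mul b c)
  one_mem : one ∈ A 0
  one_mul : ∀ a ∈ ⨆ i, A i, mul one a = a
  mul_one : ∀ a ∈ ⨆ i, A i, mul a one = a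
  mul_mem : ∀ i j, ∀ a ∈ A i, ∀ b ∈ A j, mul a b ∈ A (i + j)
  mul_comm : ∀ i j, ∀ a ∈ A i, ∀ b ∈ A j, mul a b = (-1 : k) ^ (i * j) • mul b a

/-- The odd bracket `[a • b] = (-1)^|a| (δ(a b) - (δ a) b - (-1)^|a| a (δ b))` of an element `a`
of degree `i` with `b`. -/
def oddBracket (k : Type*) {V : Type*} [Field k] [AddCommGroup V] [Module k V]
    (mul : V → V → V) (δ : V → V) (i : ℤ) (a b : V) : V :=
  (-1 : k) ^ i • (δ (mul a b) - mul (δ a) b - (-1 : k) ^ i • mul a (δ b))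

/-- Gerstenhaber–Batalin–Vilkovisky algebras. -/
structure IsGBVAlgebra (A : ℤ → Submodule k V) (mul : V → V → V) (one : V) (δ : V → V) : Prop
    extends IsSupercommutativeAlgebra A mul one where
  delta_linear : IsHomogeneousLinear A (-1) δ
  delta_delta : ∀ a ∈ ⨆ i, A i, δ (δ a) = 0
  bracket_mul : ∀ i j l, ∀ a ∈ A i, ∀ b ∈ A j, ∀ c ∈ A l,
    oddBracket k mul δ i a (mul b c) =
      mul (oddBracket k mul δ i a b) c +
        (-1 : k) ^ ((i + 1) * j) • mul b (oddBracket k mul δ i a c)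

/-- Differential Gerstenhaber–Batalin–Vilkovisky algebras. -/
structure IsDGBVAlgebra (A : ℤ → Submodule k V) (mul : V → V → V) (one : V) (δ d : V → V) : Prop
    extends IsGBVAlgebra A mul one δ where
  d_linear : IsHomogeneousLinear A 1 d
  d_d : ∀ a ∈ ⨆ i, A i, d (d a) = 0
  d_mul : ∀ i j, ∀ a ∈ A i, ∀ b ∈ A j, d (mul a b) = mul (d a) b + (-1 : k) ^ i • mul a (d b)
  d_delta : ∀ a ∈ ⨆ i, A i, d (δ a) + δ (d a) = 0

end DGBV

end

/-! ### Contraction of exterior products: the permutation sums -/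

noncomputable section

section Fibre

variable {W : Type*} [AddCommGroup W] [Module ℝ W] [TopologicalSpace W]

/-! Everything rests on the identity `δ = dΛ - Λd` on basic forms, where `Λ = ½ ∑ ι(e i) ι(e' i)` is
computed in any frame `e`, `e'` that is dual with respect to `σ` modulo its kernel
(`Foliation.IsTransverselySymplectic.codiff_eq`). The identity comes from the representation theory
of `sl₂`. On the horizontal forms at a point let `L` be the exterior product with `σ`, and let `H`
act as `n - k` in degree `k`. Then `[L, Λ] = H` and `[H, Λ] = 2Λ`, and `L`, `Λ` are nilpotent, so
the Weyl element `w = exp L exp Λ exp L` is a finite sum. For each vector `v` the operators `ι(v)σ ∧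
·` and `ι(v)` span a two-dimensional representation under commutators, and conjugation by `w`
carries the first to the second. Together with the Euler identity `∑ ι(e i)σ ∧ ι(e' i)a = deg a`
this determines `w` by recursion on the degree, and the pairing `B` obeys the matching recursion.
Hence the star operator is `w` up to the sign `(-1) ^ (p (p - 1) / 2)` in degree `p`
(`AltFamily.IsFrame.symplecticStar_eq`), and `w² = (-1) ^ n (-1) ^ deg`
(`AltFamily.IsFrame.weyl_mul_weyl`).

The differential `d` does not act pointwise, so the algebra is repeated for endomorphisms of the
space of all basic forms. There `d` commutes with `L`, because `σ` is closed, and lowers the weight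
by one. As `ad Λ` is nilpotent, an operator that commutes with `L` and has positive weight must
vanish (`sl2_eq_zero_of_pos_weight`). Applied to `[Λ, [Λ, d]]` this shows that `d` and `C = [Λ, d]`
again span a two-dimensional representation, so `w d = C w`, and the two star operators in `δ` turn
`d` into `-C`. Now `δ² = 0` follows formally from `d² = 0` and `[Λ, C] = 0`, and `dδ + δd = 0` is
immediate.

The same principle in weight zero shows that the Lie derivative along a foliate field preserving `σ`
commutes with `Λ` (`bivec_lieDeriv`). For fields tangent to the leaves this makes `Λ` preserve basic
forms. For fundamental fields, together with `[ι(X), Λ] = 0`, it gives `ι(X)δ = -δι(X)`, whence `d_G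
δ + δ d_G = 0`.

The bracket identity holds because `Λ` is a second-order operator: its failure to be a derivation is
a sum of products with one contraction on each factor, hence a derivation in each argument
(`AltFamily.frameBracket_wedge`), and taking the commutator with the derivation `d` preserves this
(`codiffBracket_wedge`).

Finally `d_G²` is minus the Lie derivative of `α ξ` along the fundamental field of `ξ`. Along a
curve `g` in the group with velocity `ξ`, equivariance says that `g t` pulls `α (Ad (g t) ξ)` back
to `α ξ`. Since `Ad (g t) ξ` is stationary at `t = 0` (`hasDerivAt_adjointAction`), differentiating
there gives zero (`lieDeriv_cartanPiece`). Only first-order information is used, so neither flows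
nor the exponential map are needed. -/

theorem sum_perm_eq_sum_cycleRange {k : ℕ} {A : Type*} [AddCommMonoid A]
    (f : Equiv.Perm (Fin (k + 1)) → A) :
    ∑ τ, f τ = ∑ j : Fin (k + 1), ∑ e : Equiv.Perm (Fin k),
      f (Equiv.Perm.decomposeFin.symm (0, e) * Fin.cycleRange j) := by
  rw [← Fintype.sum_prod_type']
  symm
  refine Fintype.sum_bijective
    (fun x : Fin (k + 1) × Equiv.Perm (Fin k) =>
      Equiv.Perm.decomposeFin.symm (0, x.2) * Fin.cycleRange x.1) ?_ _ _ (fun _ => rfl)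
  rw [Fintype.bijective_iff_injective_and_card]
  refine ⟨?_, by simp [Fintype.card_perm, Nat.factorial_succ]⟩
  rintro ⟨j, e⟩ ⟨j', e'⟩ h
  dsimp only at h
  -- The left factor fixes 0, so `j` is recovered from the product as the slot that is sent to 0.
  have hj : j = j' := by
    have h1 := congrArg (fun τ : Equiv.Perm (Fin (k + 1)) => τ j) h
    simp only [Equiv.Perm.mul_apply, Fin.cycleRange_self,
      Equiv.Perm.decomposeFin_symm_apply_zero] at h1
    have h2 : Fin.cycleRange j' j = 0 := by
      apply (Equiv.Perm.decomposeFin.symm ((0 : Fin (k + 1)), e')).injective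
      rw [Equiv.Perm.decomposeFin_symm_apply_zero, ← h1]
    rw [← Fin.cycleRange_symm_zero j', ← h2, Equiv.symm_apply_apply]
  subst hj
  have := mul_right_cancel h
  simpa using this

theorem altWedge_apply {p q k : ℕ} (h : p + q = k) (a : W [⋀^Fin p]→L[ℝ] ℝ)
    (b : W [⋀^Fin q]→L[ℝ] ℝ) (v : Fin k → W) :
    altWedge h a b v = ((p ! : ℝ) * (q ! : ℝ))⁻¹ * ∑ τ : Equiv.Perm (Fin k),
      ((Equiv.Perm.sign τ : ℤ) : ℝ) * (a (fun i => v (τ (Fin.cast h (Fin.castAdd q i)))) *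
      b (fun i => v (τ (Fin.cast h (Fin.natAdd p i))))) := by
  simp [altWedge, ContinuousMultilinearMap.alternatization_apply_apply, altProd_apply,
    Units.smul_def]

theorem altWedge_add_left {p q k : ℕ} (h : p + q = k) (a a' : W [⋀^Fin p]→L[ℝ] ℝ)
    (b : W [⋀^Fin q]→L[ℝ] ℝ) : altWedge h (a + a') b = altWedge h a b + altWedge h a' b := by
  ext v
  simp only [ContinuousAlternatingMap.add_apply, altWedge_apply, ← mul_add,
    ← Finset.sum_add_distrib, add_mul]

theorem altWedge_add_right {p q k : ℕ} (h : p + q = k) (a : W [⋀^Fin p]→L[ℝ] ℝ)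
    (b b' : W [⋀^Fin q]→L[ℝ] ℝ) : altWedge h a (b + b') = altWedge h a b + altWedge h a b' := by
  ext v
  simp only [ContinuousAlternatingMap.add_apply, altWedge_apply, ← mul_add,
    ← Finset.sum_add_distrib]

theorem altWedge_smul_left {p q k : ℕ} (h : p + q = k) (c : ℝ) (a : W [⋀^Fin p]→L[ℝ] ℝ)
    (b : W [⋀^Fin q]→L[ℝ] ℝ) : altWedge h (c • a) b = c • altWedge h a b := by
  ext v
  simp only [ContinuousAlternatingMap.smul_apply, altWedge_apply, smul_eq_mul, Finset.mul_sum]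
  refine Finset.sum_congr rfl fun τ _ => by ring

theorem altWedge_smul_right {p q k : ℕ} (h : p + q = k) (c : ℝ) (a : W [⋀^Fin p]→L[ℝ] ℝ)
    (b : W [⋀^Fin q]→L[ℝ] ℝ) : altWedge h a (c • b) = c • altWedge h a b := by
  ext v
  simp only [ContinuousAlternatingMap.smul_apply, altWedge_apply, smul_eq_mul, Finset.mul_sum]
  refine Finset.sum_congr rfl fun τ _ => by ring

/-- Here `w` lands in slot `j` of the block of `a`. Moving it to the front of that block costs `(-1)
^ j`, which cancels the sign of the cycle, so the summand does not depend on `j`. -/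
theorem altWedge_interior_left_sum {p q k : ℕ} (h : p + 1 + q = k + 1) (h' : p + q = k) (w : W)
    (a : W [⋀^Fin (p + 1)]→L[ℝ] ℝ) (b : W [⋀^Fin q]→L[ℝ] ℝ) (u : Fin k → W)
    (e : Equiv.Perm (Fin k)) (j : Fin (k + 1)) (hj : (j : ℕ) < p + 1)
    (τ : Equiv.Perm (Fin (k + 1))) (hτ : τ = Equiv.Perm.decomposeFin.symm (0, e) * j.cycleRange) :
    ((Equiv.Perm.sign τ : ℤ) : ℝ) *
      (a (fun i => Matrix.vecCons w u (τ (Fin.cast h (Fin.castAdd q i)))) *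
        b (fun i => Matrix.vecCons w u (τ (Fin.cast h (Fin.natAdd (p + 1) i))))) =
    ((Equiv.Perm.sign e : ℤ) : ℝ) *
      (altInterior w a (fun i => u (e (Fin.cast h' (Fin.castAdd q i)))) *
        b (fun i => u (e (Fin.cast h' (Fin.natAdd p i))))) := by
  have hs : ((Equiv.Perm.sign τ : ℤ) : ℝ) = ((Equiv.Perm.sign e : ℤ) : ℝ) * (-1) ^ (j : ℕ) := by
    rw [hτ, Equiv.Perm.sign_mul, Equiv.Perm.decomposeFin.symm_sign, Fin.sign_cycleRange]
    simp
  have hb : (fun i : Fin q => Matrix.vecCons w u (τ (Fin.cast h (Fin.natAdd (p + 1) i)))) =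
      fun i => u (e (Fin.cast h' (Fin.natAdd p i))) := by
    funext i
    have h1 : Fin.cast h (Fin.natAdd (p + 1) i) =
        Fin.succ (Fin.cast h' (Fin.natAdd p i)) := by
      ext; simp; omega
    rw [hτ, Equiv.Perm.mul_apply, Fin.cycleRange_of_gt, h1,
      Equiv.Perm.decomposeFin_symm_apply_succ]
    · simp
    · rw [Fin.lt_def]; simp; omega
  let j' : Fin (p + 1) := ⟨j, hj⟩
  have ha : (fun i : Fin (p + 1) => Matrix.vecCons w u (τ (Fin.cast h (Fin.castAdd q i)))) =
      (Matrix.vecCons w (fun i => u (e (Fin.cast h' (Fin.castAdd q i))))) ∘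
        j'.cycleRange := by
    funext i
    have hcast : Fin.cycleRange j (Fin.cast h (Fin.castAdd q i)) =
        Fin.cast h (Fin.castAdd q (j'.cycleRange i)) := by
      rcases lt_trichotomy i j' with hi | hi | hi
      · have : (Fin.cast h (Fin.castAdd q i)) < j := by
          rw [Fin.lt_def] at hi ⊢; simpa [j'] using hi
        ext
        rw [Fin.coe_cycleRange_of_lt this]
        simp [Fin.coe_cycleRange_of_lt hi]
      · subst hi
        have : (Fin.cast h (Fin.castAdd q j')) = j := by ext; simp [j']
        rw [this, Fin.cycleRange_self, Fin.cycleRange_self]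
        rfl
      · have : j < (Fin.cast h (Fin.castAdd q i)) := by
          rw [Fin.lt_def] at hi ⊢; simpa [j'] using hi
        rw [Fin.cycleRange_of_gt this, Fin.cycleRange_of_gt hi]
    rw [hτ, Equiv.Perm.mul_apply, hcast, Function.comp_apply]
    refine Fin.cases ?_ (fun l => ?_) (j'.cycleRange i)
    · have : Fin.cast h (Fin.castAdd q (0 : Fin (p + 1))) = 0 := by ext; simp
      rw [this, Equiv.Perm.decomposeFin_symm_apply_zero]; rfl
    · have : Fin.cast h (Fin.castAdd q l.succ) =
        Fin.succ (Fin.cast h' (Fin.castAdd q l)) := by ext; simp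
      rw [this, Equiv.Perm.decomposeFin_symm_apply_succ]
      simp
  have hperm : ∀ v : Fin (p + 1) → W, a (v ∘ j'.cycleRange) =
      (Equiv.Perm.sign j'.cycleRange) • a v := fun v => a.toAlternatingMap.map_perm v _
  rw [hs, hb, ha, hperm, Fin.sign_cycleRange, altInterior_apply]
  have h2 : ((-1 : ℝ) ^ (j : ℕ)) * (-1) ^ (j : ℕ) = 1 := by
    rw [← mul_pow]; simp
  simp only [Units.smul_def, j', Units.val_pow_eq_pow_val, Units.val_neg, Units.val_one,
    zsmul_eq_mul, Int.cast_pow, Int.cast_neg, Int.cast_one]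
  linear_combination (((Equiv.Perm.sign e : ℤ) : ℝ) * a (Matrix.vecCons w fun i ↦ u (e (Fin.cast h' (Fin.castAdd q i)))) * b (fun i => u (e (Fin.cast h' (Fin.natAdd p i))))) * h2

/-- Here `w` lands in slot `j - p` of the block of `b`. The cycle has sign `(-1) ^ j`, but only
`(-1) ^ (j - p)` is recovered inside the block, which leaves the Koszul sign `(-1) ^ p`. -/
theorem altWedge_interior_right_sum {p q k : ℕ} (h : p + (q + 1) = k + 1) (h' : p + q = k) (w : W)
    (a : W [⋀^Fin p]→L[ℝ] ℝ) (b : W [⋀^Fin (q + 1)]→L[ℝ] ℝ) (u : Fin k → W)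
    (e : Equiv.Perm (Fin k)) (j : Fin (k + 1)) (hj : p ≤ (j : ℕ))
    (τ : Equiv.Perm (Fin (k + 1))) (hτ : τ = Equiv.Perm.decomposeFin.symm (0, e) * j.cycleRange) :
    ((Equiv.Perm.sign τ : ℤ) : ℝ) *
      (a (fun i => Matrix.vecCons w u (τ (Fin.cast h (Fin.castAdd (q + 1) i)))) *
        b (fun i => Matrix.vecCons w u (τ (Fin.cast h (Fin.natAdd p i))))) =
    (-1) ^ p * (((Equiv.Perm.sign e : ℤ) : ℝ) *
      (a (fun i => u (e (Fin.cast h' (Fin.castAdd q i)))) *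
        altInterior w b (fun i => u (e (Fin.cast h' (Fin.natAdd p i)))))) := by
  have hs : ((Equiv.Perm.sign τ : ℤ) : ℝ) = ((Equiv.Perm.sign e : ℤ) : ℝ) * (-1) ^ (j : ℕ) := by
    rw [hτ, Equiv.Perm.sign_mul, Equiv.Perm.decomposeFin.symm_sign, Fin.sign_cycleRange]
    simp
  have ha : (fun i : Fin p => Matrix.vecCons w u (τ (Fin.cast h (Fin.castAdd (q + 1) i)))) =
      fun i => u (e (Fin.cast h' (Fin.castAdd q i))) := by
    funext i
    have h0 : Fin.cast h (Fin.castAdd (q + 1) i) < j := by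
      rw [Fin.lt_def]; simp; omega
    have h1 : Fin.cycleRange j (Fin.cast h (Fin.castAdd (q + 1) i)) =
        Fin.succ (Fin.cast h' (Fin.castAdd q i)) := by
      ext; rw [Fin.coe_cycleRange_of_lt h0]; simp
    rw [hτ, Equiv.Perm.mul_apply, h1, Equiv.Perm.decomposeFin_symm_apply_succ]
    simp
  let j' : Fin (q + 1) := ⟨j - p, by omega⟩
  have hb : (fun i : Fin (q + 1) => Matrix.vecCons w u (τ (Fin.cast h (Fin.natAdd p i)))) =
      (Matrix.vecCons w (fun i => u (e (Fin.cast h' (Fin.natAdd p i))))) ∘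
        j'.cycleRange := by
    funext i
    rw [hτ, Equiv.Perm.mul_apply, Function.comp_apply]
    rcases lt_trichotomy i j' with hi | hi | hi
    · have h0 : (Fin.cast h (Fin.natAdd p i)) < j := by
        rw [Fin.lt_def] at hi ⊢; simp [j'] at hi ⊢; omega
      have hiq : (i : ℕ) < q := by
        have := j'.2
        rw [Fin.lt_def] at hi
        omega
      have h1 : Fin.cycleRange j (Fin.cast h (Fin.natAdd p i)) =
          Fin.succ (Fin.cast h' (Fin.natAdd p ⟨i, hiq⟩)) := by
        ext; rw [Fin.coe_cycleRange_of_lt h0]; simp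
      have h2 : j'.cycleRange i = Fin.succ ⟨i, hiq⟩ := by
        ext; rw [Fin.coe_cycleRange_of_lt hi]; simp
      rw [h1, h2, Equiv.Perm.decomposeFin_symm_apply_succ]
      simp
    · subst hi
      have : (Fin.cast h (Fin.natAdd p j')) = j := by ext; simp [j']; omega
      rw [this, Fin.cycleRange_self, Fin.cycleRange_self,
        Equiv.Perm.decomposeFin_symm_apply_zero]
      rfl
    · have h0 : j < (Fin.cast h (Fin.natAdd p i)) := by
        rw [Fin.lt_def] at hi ⊢; simp [j'] at hi ⊢; omega
      rw [Fin.cycleRange_of_gt h0, Fin.cycleRange_of_gt hi]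
      have hi0 : i ≠ 0 := by rintro rfl; exact absurd hi (by simp)
      obtain ⟨l, rfl⟩ := Fin.exists_succ_eq.2 hi0
      have h1 : Fin.cast h (Fin.natAdd p l.succ) =
          Fin.succ (Fin.cast h' (Fin.natAdd p l)) := by
        ext; simp; omega
      rw [h1, Equiv.Perm.decomposeFin_symm_apply_succ]
      simp
  have hperm : ∀ v : Fin (q + 1) → W, b (v ∘ j'.cycleRange) =
      (Equiv.Perm.sign j'.cycleRange) • b v := fun v => b.toAlternatingMap.map_perm v _
  rw [hs, hb, ha, hperm, Fin.sign_cycleRange, altInterior_apply]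
  have h2 : ((-1 : ℝ) ^ ((j : ℕ) - p)) * (-1) ^ (j : ℕ) = (-1) ^ p := by
    obtain ⟨d, hd⟩ := Nat.exists_eq_add_of_le hj
    rw [hd, Nat.add_sub_cancel_left, pow_add, mul_left_comm, ← mul_pow]; simp
  simp only [Units.smul_def, j', Units.val_pow_eq_pow_val, Units.val_neg, Units.val_one,
    zsmul_eq_mul, Int.cast_pow, Int.cast_neg, Int.cast_one]
  linear_combination (((Equiv.Perm.sign e : ℤ) : ℝ) * a (fun i ↦ u (e (Fin.cast h' (Fin.castAdd q i)))) * b (Matrix.vecCons w fun i => u (e (Fin.cast h' (Fin.natAdd p i))))) * h2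

theorem altInterior_altWedge_zero_left {q k : ℕ} (h : 0 + (q + 1) = k + 1) (w : W)
    (a : W [⋀^Fin 0]→L[ℝ] ℝ) (b : W [⋀^Fin (q + 1)]→L[ℝ] ℝ) :
    altInterior w (altWedge h a b) = altWedge (by omega) a (altInterior w b) := by
  ext u
  rw [altInterior_apply, altWedge_apply, altWedge_apply, sum_perm_eq_sum_cycleRange]
  rw [Finset.sum_congr rfl fun j _ => Finset.sum_congr rfl fun e _ =>
    altWedge_interior_right_sum h (by omega) w a b u e j (Nat.zero_le _) _ rfl, Finset.sum_const]
  obtain rfl : q = k := by omega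
  simp only [Finset.card_univ, Fintype.card_fin, nsmul_eq_mul, pow_zero, one_mul,
    Nat.factorial_succ, Nat.cast_mul, mul_inv, ← mul_assoc, Nat.factorial_zero]
  have : ((q + 1 : ℕ) : ℝ) ≠ 0 := by positivity
  field_simp

theorem altInterior_altWedge_zero_right {p k : ℕ} (h : p + 1 + 0 = k + 1) (w : W)
    (a : W [⋀^Fin (p + 1)]→L[ℝ] ℝ) (b : W [⋀^Fin 0]→L[ℝ] ℝ) :
    altInterior w (altWedge h a b) = altWedge (by omega) (altInterior w a) b := by
  ext u
  rw [altInterior_apply, altWedge_apply, altWedge_apply, sum_perm_eq_sum_cycleRange]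
  rw [Finset.sum_congr rfl fun j _ => Finset.sum_congr rfl fun e _ =>
    altWedge_interior_left_sum h (by omega) w a b u e j (show _ < p + 1 by omega) _ rfl, Finset.sum_const]
  obtain rfl : p = k := by omega
  simp only [Finset.card_univ, Fintype.card_fin, nsmul_eq_mul,
    Nat.factorial_succ, Nat.cast_mul, mul_inv, ← mul_assoc, Nat.factorial_zero]
  have : ((p + 1 : ℕ) : ℝ) ≠ 0 := by positivity
  field_simp

/-- Sorting the permutations by the slot that receives `w` gives `p + 1` equal terms from the first
block and `q + 1` equal terms from the second. These multiplicities turn `1 / (p + 1)!` into `1 /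
p!` and `1 / (q + 1)!` into `1 / q!`. -/
theorem altInterior_altWedge {p q k : ℕ} (h : p + 1 + (q + 1) = k + 1) (w : W)
    (a : W [⋀^Fin (p + 1)]→L[ℝ] ℝ) (b : W [⋀^Fin (q + 1)]→L[ℝ] ℝ) :
    altInterior w (altWedge h a b) = altWedge (by omega) (altInterior w a) b +
      (-1 : ℝ) ^ (p + 1) • altWedge (by omega) a (altInterior w b) := by
  ext u
  rw [altInterior_apply, ContinuousAlternatingMap.add_apply, ContinuousAlternatingMap.smul_apply,
    altWedge_apply, altWedge_apply, altWedge_apply, sum_perm_eq_sum_cycleRange]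
  obtain rfl : k = p + 1 + q := by omega
  rw [← (finCongr h).sum_comp, Fin.sum_univ_add]
  have h1 : ∀ j : Fin (p + 1), ((finCongr h (Fin.castAdd (q + 1) j)) : ℕ) < p + 1 := by
    intro j; simp; omega
  have h2 : ∀ j : Fin (q + 1), p + 1 ≤ ((finCongr h (Fin.natAdd (p + 1) j)) : ℕ) := by
    intro j; simp
  rw [Finset.sum_congr rfl fun j _ => Finset.sum_congr rfl fun e _ =>
    altWedge_interior_left_sum h (by omega) w a b u e _ (h1 j) _ rfl,
    Finset.sum_congr rfl fun j _ => Finset.sum_congr rfl fun e _ =>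
    altWedge_interior_right_sum h (by omega) w a b u e _ (h2 j) _ rfl, Finset.sum_const, Finset.sum_const]
  simp only [Finset.card_univ, Fintype.card_fin, nsmul_eq_mul,
    Nat.factorial_succ, Nat.cast_mul, mul_inv, ← Finset.mul_sum, smul_eq_mul]
  have e1 : ((p + 1 : ℕ) : ℝ) ≠ 0 := by positivity
  have e2 : ((q + 1 : ℕ) : ℝ) ≠ 0 := by positivity
  field_simp

end Fibre
end

/-! ### The exterior algebra of a vector space, all degrees together -/

noncomputable section

/-- Families with one alternating form for each degree. -/
abbrev AltFamily (W : Type*) [AddCommGroup W] [Module ℝ W] [TopologicalSpace W] : Type _ :=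
  (k : ℕ) → W [⋀^Fin k]→L[ℝ] ℝ

namespace AltFamily

variable {W : Type*} [AddCommGroup W] [Module ℝ W] [TopologicalSpace W]

/-- The exterior product of families of alternating forms. -/
def wedge (a b : AltFamily W) : AltFamily W := fun k =>
  ∑ pq ∈ (Finset.HasAntidiagonal.antidiagonal k).attach,
    altWedge (Finset.HasAntidiagonal.mem_antidiagonal.1 pq.2) (a pq.1.1) (b pq.1.2)

/-- Contraction with a vector. -/
def contract (w : W) : AltFamily W →ₗ[ℝ] AltFamily W where
  toFun a k := altInterior w (a (k + 1))
  map_add' _ _ := rfl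
  map_smul' _ _ := rfl

/-- The grade involution, `(-1) ^ k` in degree `k`. -/
def parity : AltFamily W →ₗ[ℝ] AltFamily W where
  toFun a k := (-1 : ℝ) ^ k • a k
  map_add' _ _ := by funext k; exact smul_add _ _ _
  map_smul' c a := by
    funext k
    ext v
    exact mul_left_comm _ c (a k v)

variable (W) in
/-- The unit of the exterior algebra. -/
def one : AltFamily W
  | 0 => ContinuousAlternatingMap.constOfIsEmpty ℝ W (Fin 0) 1
  | _ + 1 => 0

/-- The pullback of a family of forms under a linear map. -/
def comap {V : Type*} [AddCommGroup V] [Module ℝ V] [TopologicalSpace V] (T : V →L[ℝ] W) :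
    AltFamily W →ₗ[ℝ] AltFamily V where
  toFun a k := (a k).compContinuousLinearMap T
  map_add' _ _ := rfl
  map_smul' _ _ := rfl

theorem contract_apply (w : W) (a : AltFamily W) (k : ℕ) (v : Fin k → W) :
    contract w a k v = a (k + 1) (Matrix.vecCons w v) := rfl

theorem parity_apply (a : AltFamily W) (k : ℕ) : parity a k = (-1 : ℝ) ^ k • a k := rfl

theorem comap_apply {V : Type*} [AddCommGroup V] [Module ℝ V] [TopologicalSpace V] (T : V →L[ℝ] W)
    (a : AltFamily W) (k : ℕ) (v : Fin k → V) : comap T a k v = a k (fun i => T (v i)) := rfl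

/-- The workhorse of the file: a form of positive degree is determined by its contractions.
Associativity, commutativity, naturality, the Leibniz rule for `d` and the Euler identity are all
proved by contracting both sides and inducting on the degree. -/
theorem succ_eq_of_contract {k : ℕ} {a b : AltFamily W}
    (h : ∀ w, contract w a k = contract w b k) : a (k + 1) = b (k + 1) := by
  ext v
  have h1 := DFunLike.congr_fun (h (v 0)) (Matrix.vecTail v)
  rw [contract_apply, contract_apply] at h1
  have h2 : Matrix.vecCons (v 0) (Matrix.vecTail v) = v := Matrix.cons_head_tail v
  rwa [h2] at h1

theorem ext_contract {a b : AltFamily W} (h0 : a 0 = b 0)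
    (h : ∀ w, contract w a = contract w b) : a = b := by
  funext k
  cases k with
  | zero => exact h0
  | succ k => exact succ_eq_of_contract fun w => congrFun (h w) k

theorem wedge_eq_sum (a b : AltFamily W) (k : ℕ) :
    wedge a b k = ∑ pq ∈ Finset.HasAntidiagonal.antidiagonal k,
      if h : pq.1 + pq.2 = k then altWedge h (a pq.1) (b pq.2) else 0 := by
  rw [wedge, ← Finset.sum_attach (Finset.HasAntidiagonal.antidiagonal k)]
  refine Finset.sum_congr rfl fun pq _ => ?_
  rw [dif_pos (Finset.HasAntidiagonal.mem_antidiagonal.1 pq.2)]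

theorem contract_contract (v w : W) (a : AltFamily W) :
    contract v (contract w a) = -contract w (contract v a) := by
  funext k
  ext u
  rw [Pi.neg_apply, ContinuousAlternatingMap.neg_apply]
  simp only [contract_apply]
  have h := (a (k + 1 + 1)).toAlternatingMap.map_swap
    (Matrix.vecCons v (Matrix.vecCons w u)) (i := 0) (j := 1) (by simp)
  have h2 : Matrix.vecCons v (Matrix.vecCons w u) ∘ Equiv.swap (0 : Fin (k + 1 + 1)) 1 =
      Matrix.vecCons w (Matrix.vecCons v u) := by
    funext i
    refine Fin.cases ?_ (fun i => Fin.cases ?_ (fun i => ?_) i) i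
    · simp
    · rw [Function.comp_apply]
      simp
    · rw [Function.comp_apply, Equiv.swap_apply_of_ne_of_ne (Fin.succ_ne_zero _)
        (by rw [← Fin.succ_zero_eq_one]; exact fun h => Fin.succ_ne_zero _ (Fin.succ_injective _ h))]
      simp
  rw [h2] at h
  exact h

theorem contract_parity (w : W) (a : AltFamily W) :
    contract w (parity a) = -parity (contract w a) := by
  funext k
  ext v
  simp [contract_apply, parity_apply, pow_succ]

@[simp] theorem parity_parity (a : AltFamily W) : parity (parity a) = a := by
  funext k
  simp only [parity_apply, smul_smul, ← mul_pow]
  simp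

theorem contract_add_vec (v w : W) (a : AltFamily W) :
    contract (v + w) a = contract v a + contract w a := by
  funext k; ext u
  exact (a (k + 1)).toMultilinearMap.cons_add u v w

theorem contract_smul_vec (c : ℝ) (w : W) (a : AltFamily W) :
    contract (c • w) a = c • contract w a := by
  funext k; ext u
  exact (a (k + 1)).toMultilinearMap.cons_smul u c w

theorem contract_sum_vec {ι : Type*} (s : Finset ι) (v : ι → W) (a : AltFamily W) :
    contract (∑ i ∈ s, v i) a = ∑ i ∈ s, contract (v i) a := by
  let f : W →+ AltFamily W := AddMonoidHom.mk' (fun v => contract v a)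
    fun v w => contract_add_vec v w a
  exact map_sum f v s

theorem wedge_add_left (a a' b : AltFamily W) : wedge (a + a') b = wedge a b + wedge a' b := by
  funext k
  simp only [wedge, Pi.add_apply, altWedge_add_left, Finset.sum_add_distrib]

theorem wedge_add_right (a b b' : AltFamily W) : wedge a (b + b') = wedge a b + wedge a b' := by
  funext k
  simp only [wedge, Pi.add_apply, altWedge_add_right, Finset.sum_add_distrib]

theorem wedge_smul_left (c : ℝ) (a b : AltFamily W) : wedge (c • a) b = c • wedge a b := by
  funext k
  simp only [wedge, Pi.smul_apply, altWedge_smul_left, Finset.smul_sum]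

theorem wedge_smul_right (c : ℝ) (a b : AltFamily W) : wedge a (c • b) = c • wedge a b := by
  funext k
  simp only [wedge, Pi.smul_apply, altWedge_smul_right, Finset.smul_sum]

variable (W) in
/-- The exterior product as a bilinear map. -/
def wedgeₗ : AltFamily W →ₗ[ℝ] AltFamily W →ₗ[ℝ] AltFamily W :=
  LinearMap.mk₂ ℝ wedge wedge_add_left wedge_smul_left wedge_add_right wedge_smul_right

@[simp] theorem wedgeₗ_apply (a b : AltFamily W) : wedgeₗ W a b = wedge a b := rfl

theorem wedge_sum_left {ι : Type*} (s : Finset ι) (a : ι → AltFamily W) (b : AltFamily W) :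
    wedge (∑ i ∈ s, a i) b = ∑ i ∈ s, wedge (a i) b :=
  map_sum ((wedgeₗ W).flip b) a s

theorem wedge_sum_right {ι : Type*} (s : Finset ι) (a : AltFamily W) (b : ι → AltFamily W) :
    wedge a (∑ i ∈ s, b i) = ∑ i ∈ s, wedge a (b i) :=
  map_sum (wedgeₗ W a) b s

theorem wedge_neg_left (a b : AltFamily W) : wedge (-a) b = -wedge a b :=
  map_neg ((wedgeₗ W).flip b) a

theorem wedge_neg_right (a b : AltFamily W) : wedge a (-b) = -wedge a b :=
  map_neg (wedgeₗ W a) b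

theorem wedge_sub_left (a a' b : AltFamily W) : wedge (a - a') b = wedge a b - wedge a' b :=
  map_sub ((wedgeₗ W).flip b) a a'

theorem wedge_sub_right (a b b' : AltFamily W) : wedge a (b - b') = wedge a b - wedge a b' :=
  map_sub (wedgeₗ W a) b b'

@[simp] theorem wedge_zero_left (b : AltFamily W) : wedge 0 b = 0 :=
  map_zero ((wedgeₗ W).flip b)

@[simp] theorem wedge_zero_right (a : AltFamily W) : wedge a 0 = 0 :=
  map_zero (wedgeₗ W a)

theorem altWedge_zero_zero {k : ℕ} (h : 0 + k = k) (a : W [⋀^Fin 0]→L[ℝ] ℝ)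
    (b : W [⋀^Fin k]→L[ℝ] ℝ) : altWedge h a b = a 0 • b := by
  ext v
  rw [altWedge_apply, ContinuousAlternatingMap.smul_apply]
  have ha : ∀ v : Fin 0 → W, a v = a 0 := fun v => congrArg a (Subsingleton.elim _ _)
  have hb : ∀ τ : Equiv.Perm (Fin k), (fun i => v (τ (Fin.cast h (Fin.natAdd 0 i)))) = v ∘ τ := by
    intro τ; funext i; simp
  have hperm : ∀ τ : Equiv.Perm (Fin k), b (v ∘ τ) = (Equiv.Perm.sign τ) • b v :=
    fun τ => b.toAlternatingMap.map_perm v _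
  have hs : ∀ τ : Equiv.Perm (Fin k), ((Equiv.Perm.sign τ : ℤ) : ℝ) * (Equiv.Perm.sign τ : ℤ) = 1 := by
    intro τ; rw [← Int.cast_mul, ← Units.val_mul, Int.units_mul_self]; simp
  have : ∀ τ : Equiv.Perm (Fin k), ((Equiv.Perm.sign τ : ℤ) : ℝ) *
      (a (fun i => v (τ (Fin.cast h (Fin.castAdd k i)))) *
      b (fun i => v (τ (Fin.cast h (Fin.natAdd 0 i))))) = a 0 * b v := by
    intro τ
    rw [ha, hb, hperm, Units.smul_def, zsmul_eq_mul]
    linear_combination (a 0 * b v) * hs τ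
  simp only [this, Finset.sum_const, Finset.card_univ, Fintype.card_perm, Fintype.card_fin,
    nsmul_eq_mul, Nat.factorial_zero, smul_eq_mul, Nat.cast_one]
  have : ((k ! : ℕ) : ℝ) ≠ 0 := by positivity
  field_simp

theorem wedge_apply_zero (a b : AltFamily W) : wedge a b 0 = a 0 0 • b 0 := by
  rw [wedge_eq_sum]
  simp [altWedge_zero_zero]

theorem contract_wedge (w : W) (a b : AltFamily W) :
    contract w (wedge a b) = wedge (contract w a) b + wedge (parity a) (contract w b) := by
  funext k
  rw [Pi.add_apply]
  change altInterior w (wedge a b (k + 1)) = _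
  have hsum : ∀ (s : Finset (ℕ × ℕ)) (f : ℕ × ℕ → W [⋀^Fin (k + 1)]→L[ℝ] ℝ),
      altInterior w (∑ i ∈ s, f i) = ∑ i ∈ s, altInterior w (f i) := by
    intro s f
    let g : (W [⋀^Fin (k + 1)]→L[ℝ] ℝ) →+ (W [⋀^Fin k]→L[ℝ] ℝ) :=
      AddMonoidHom.mk' (fun v => altInterior w v) fun v w => rfl
    exact map_sum g f s
  let f1 : ℕ × ℕ → W [⋀^Fin k]→L[ℝ] ℝ := fun pq => if h : pq.1 + pq.2 = k then
    altWedge h (contract w a pq.1) (b pq.2) else 0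
  let f2 : ℕ × ℕ → W [⋀^Fin k]→L[ℝ] ℝ := fun pq => if h : pq.1 + pq.2 = k then
    altWedge h (parity a pq.1) (contract w b pq.2) else 0
  -- `g1` and `g2` shift the index of one factor and are padded by 0 where that factor has degree 0,
  -- so that both sums run over the antidiagonal of `k + 1`.
  let g1 : ℕ × ℕ → W [⋀^Fin k]→L[ℝ] ℝ := fun pq => match pq with
    | (0, _) => 0
    | (p + 1, q) => f1 (p, q)
  let g2 : ℕ × ℕ → W [⋀^Fin k]→L[ℝ] ℝ := fun pq => match pq with
    | (_, 0) => 0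
    | (p, q + 1) => f2 (p, q)
  have e1 : ∑ pq ∈ Finset.HasAntidiagonal.antidiagonal (k + 1), g1 pq = wedge (contract w a) b k := by
    rw [Finset.Nat.sum_antidiagonal_succ, wedge_eq_sum]
    simp [g1, f1]
  have e2 : ∑ pq ∈ Finset.HasAntidiagonal.antidiagonal (k + 1), g2 pq =
      wedge (parity a) (contract w b) k := by
    rw [Finset.Nat.sum_antidiagonal_succ', wedge_eq_sum]
    simp [g2, f2]
  rw [wedge_eq_sum, hsum, ← e1, ← e2, ← Finset.sum_add_distrib]
  refine Finset.sum_congr rfl ?_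
  rintro ⟨p, q⟩ hpq
  have hpq' : p + q = k + 1 := Finset.HasAntidiagonal.mem_antidiagonal.1 hpq
  rw [dif_pos hpq']
  match p, q, hpq' with
  | 0, q + 1, h =>
    have h' : 0 + q = k := by omega
    simp only [g1, g2, f1, f2, dif_pos h', altInterior_altWedge_zero_left, parity_apply, pow_zero,
      one_smul, zero_add]
    rfl
  | p + 1, 0, h =>
    have h' : p + 0 = k := by omega
    simp only [g1, g2, f1, f2, dif_pos h', altInterior_altWedge_zero_right, add_zero]
    rfl
  | p + 1, q + 1, h =>
    have h' : p + (q + 1) = k := by omega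
    have h'' : p + 1 + q = k := by omega
    simp only [g1, g2, f1, f2, dif_pos h', dif_pos h'', altInterior_altWedge, parity_apply,
      altWedge_smul_left]
    rfl

theorem parity_wedge (a b : AltFamily W) : parity (wedge a b) = wedge (parity a) (parity b) := by
  funext k
  rw [parity_apply, wedge_eq_sum, wedge_eq_sum, Finset.smul_sum]
  refine Finset.sum_congr rfl fun pq hpq => ?_
  have h := Finset.HasAntidiagonal.mem_antidiagonal.1 hpq
  rw [dif_pos h, dif_pos h, parity_apply, parity_apply, altWedge_smul_left, altWedge_smul_right,
    smul_smul, ← pow_add, h]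

/-- By the Leibniz rule, contracting either side gives the same three triple products, one degree
lower. -/
theorem wedge_assoc (a b c : AltFamily W) : wedge (wedge a b) c = wedge a (wedge b c) := by
  funext k
  induction k generalizing a b c with
  | zero => simp only [wedge_apply_zero, ContinuousAlternatingMap.smul_apply, smul_smul, smul_eq_mul]
  | succ k ih =>
    refine succ_eq_of_contract fun w => ?_
    simp only [contract_wedge, parity_wedge, wedge_add_left, wedge_add_right, Pi.add_apply, ih]
    abel

theorem contract_one (w : W) : contract w (one W) = 0 := by
  funext k; rfl

theorem parity_one : parity (one W) = one W := by
  funext k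
  cases k with
  | zero => simp [parity_apply]
  | succ k => simp [parity_apply, one]

theorem one_wedge (a : AltFamily W) : wedge (one W) a = a := by
  funext k
  induction k generalizing a with
  | zero => rw [wedge_apply_zero]; simp [one]
  | succ k ih =>
    refine succ_eq_of_contract fun w => ?_
    rw [contract_wedge, contract_one, wedge_zero_left, zero_add, parity_one, ih]

/-- Contraction exchanges even and odd `b`, so the two cases need each other in the induction. Only
`b` must have a parity; `a` is arbitrary, and its signs are carried by `parity a`. -/
theorem wedge_comm_aux (k : ℕ) : ∀ a b : AltFamily W,
    (parity b = b → wedge a b k = wedge b a k) ∧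
    (parity b = -b → wedge b a k = wedge (parity a) b k) := by
  induction k with
  | zero =>
    intro a b
    have hs : ∀ (a b : AltFamily W), wedge a b 0 = wedge b a 0 := by
      intro a b
      simp only [wedge_apply_zero]
      ext v
      rw [Subsingleton.elim v 0]
      simp [mul_comm]
    refine ⟨fun _ => hs a b, fun _ => ?_⟩
    rw [hs b a]
    simp [wedge_apply_zero, parity_apply]
  | succ k ih =>
    intro a b
    have hodd : parity b = b → ∀ w, parity (contract w b) = -contract w b := by
      intro hb w
      rw [← neg_eq_iff_eq_neg.2 (contract_parity w b), hb]
    have heven : parity b = -b → ∀ w, parity (contract w b) = contract w b := by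
      intro hb w
      rw [← neg_eq_iff_eq_neg.2 (contract_parity w b), hb, map_neg, neg_neg]
    refine ⟨fun hb => succ_eq_of_contract fun w => ?_, fun hb => succ_eq_of_contract fun w => ?_⟩
    · rw [contract_wedge, contract_wedge, Pi.add_apply, Pi.add_apply, hb,
        (ih (contract w a) b).1 hb, (ih a (contract w b)).2 (hodd hb w), add_comm]
    · rw [contract_wedge, contract_wedge, Pi.add_apply, Pi.add_apply, hb, contract_parity,
        parity_parity, wedge_neg_left, wedge_neg_left, Pi.neg_apply, Pi.neg_apply,
        (ih (contract w a) b).2 hb, (ih a (contract w b)).1 (heven hb w), add_comm]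

theorem wedge_comm_of_even {a b : AltFamily W} (hb : parity b = b) : wedge a b = wedge b a :=
  funext fun k => (wedge_comm_aux k a b).1 hb

theorem wedge_comm_of_odd {a b : AltFamily W} (hb : parity b = -b) :
    wedge b a = wedge (parity a) b :=
  funext fun k => (wedge_comm_aux k a b).2 hb

theorem wedge_one (a : AltFamily W) : wedge a (one W) = a := by
  rw [wedge_comm_of_even parity_one, one_wedge]

theorem wedge_comm_of_parity {i j : ℤ} {a b : AltFamily W} (ha : parity a = (-1 : ℝ) ^ i • a)
    (hb : parity b = (-1 : ℝ) ^ j • b) : wedge a b = (-1 : ℝ) ^ (i * j) • wedge b a := by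
  rcases Int.even_or_odd j with hj | hj
  · rw [hj.neg_one_zpow, one_smul] at hb
    rw [wedge_comm_of_even hb, (hj.mul_left i).neg_one_zpow, one_smul]
  · replace hb : parity b = -b := by rw [hb, hj.neg_one_zpow]; exact neg_one_smul ℝ b
    rw [wedge_comm_of_odd hb, ha, wedge_smul_left, smul_smul]
    rcases Int.even_or_odd i with hi | hi
    · rw [(hi.mul_right j).neg_one_zpow, hi.neg_one_zpow]; simp
    · rw [(hi.mul hj).neg_one_zpow, hi.neg_one_zpow]; simp

section comap

variable {V : Type*} [AddCommGroup V] [Module ℝ V] [TopologicalSpace V] (T : V →L[ℝ] W)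

theorem contract_comap (v : V) (a : AltFamily W) :
    contract v (comap T a) = comap T (contract (T v) a) := by
  funext k
  ext u
  rw [contract_apply, comap_apply, comap_apply, contract_apply]
  congr 1
  funext i
  refine Fin.cases ?_ (fun i => ?_) i <;> simp

theorem parity_comap (a : AltFamily W) : parity (comap T a) = comap T (parity a) := by
  funext k
  ext u
  simp [parity_apply, comap_apply]

theorem comap_wedge (a b : AltFamily W) :
    comap T (wedge a b) = wedge (comap T a) (comap T b) := by
  funext k
  induction k generalizing a b with
  | zero =>
    rw [wedge_apply_zero]
    ext u
    rw [comap_apply, wedge_apply_zero]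
    simp only [ContinuousAlternatingMap.smul_apply, comap_apply]
    congr 1
    exact congrArg (a 0) (Subsingleton.elim _ _)
  | succ k ih =>
    refine succ_eq_of_contract fun w => ?_
    rw [contract_comap, contract_wedge, contract_wedge, map_add, contract_comap, contract_comap,
      Pi.add_apply, Pi.add_apply, ih, ih, parity_comap]

theorem comap_one : comap T (one W) = one V := by
  funext k
  cases k <;> rfl

end comap

/-- The family concentrated in one degree. -/
def single (p : ℕ) (a : W [⋀^Fin p]→L[ℝ] ℝ) : AltFamily W :=
  Pi.single (M := fun k => W [⋀^Fin k]→L[ℝ] ℝ) p a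

@[simp] theorem single_same (p : ℕ) (a : W [⋀^Fin p]→L[ℝ] ℝ) : single p a p = a :=
  Pi.single_eq_same _ _

theorem single_of_ne {p k : ℕ} (h : k ≠ p) (a : W [⋀^Fin p]→L[ℝ] ℝ) : single p a k = 0 :=
  Pi.single_eq_of_ne h _

theorem wedge_single {p q k : ℕ} (h : p + q = k) (a b : AltFamily W)
    (ha : ∀ k, k ≠ p → a k = 0) : wedge a b k = altWedge h (a p) (b q) := by
  rw [wedge_eq_sum, Finset.sum_eq_single (p, q)]
  · rw [dif_pos h]
  · rintro ⟨p', q'⟩ hpq hne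
    have h1 := Finset.HasAntidiagonal.mem_antidiagonal.1 hpq
    have hp : p' ≠ p := by
      rintro rfl
      apply hne
      simp only [Prod.mk.injEq, true_and]
      simp only at h1
      omega
    simp only [ha p' hp]
    rw [dif_pos h1]
    ext v
    rw [altWedge_apply]
    simp
  · intro h'
    exact absurd (Finset.HasAntidiagonal.mem_antidiagonal.2 h) h'

theorem wedge_eq_zero_of_lt {p k : ℕ} (h : k < p) (a b : AltFamily W)
    (ha : ∀ k, k ≠ p → a k = 0) : wedge a b k = 0 := by
  rw [wedge_eq_sum]
  refine Finset.sum_eq_zero fun pq hpq => ?_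
  have h1 := Finset.HasAntidiagonal.mem_antidiagonal.1 hpq
  rw [ha pq.1 (by omega), dif_pos h1]
  ext v
  rw [altWedge_apply]
  simp

end AltFamily
end

/-! ### Nilpotent exponentials, the Weyl element and `sl₂` in an associative algebra -/

noncomputable section

section Sl2

variable {A : Type*} [Ring A] [Algebra ℝ A]

theorem pow_mul_eq_of_commute {x y z : A} (h : x * y = y * x + z) (hz : Commute x z)
    (k : ℕ) : x ^ (k + 1) * y = y * x ^ (k + 1) + ((k + 1 : ℕ) : ℝ) • (z * x ^ k) := by
  induction k with
  | zero => simpa using h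
  | succ k ih =>
    rw [pow_succ' x (k + 1), mul_assoc, ih, mul_add, ← mul_assoc, h, mul_smul_comm, ← mul_assoc x z,
      hz.eq, mul_assoc z x, ← pow_succ' x k, add_mul, mul_assoc, ← pow_succ' x (k + 1), add_assoc]
    congr 1
    rw [Nat.cast_succ (k + 1), add_smul, one_smul, add_comm]

/-- The exponential of an element with `x ^ N = 0`. -/
def truncExp (N : ℕ) (x : A) : A := ∑ i ∈ Finset.range (N + 1), (i ! : ℝ)⁻¹ • x ^ i

/-- Conjugation by `exp x` is `exp (ad x)`, and this series stops after the linear term because `z =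
[x, y]` commutes with `x`. -/
theorem truncExp_mul {N : ℕ} {x y z : A} (hN : x ^ N = 0) (h : x * y = y * x + z)
    (hz : Commute x z) : truncExp N x * y = (y + z) * truncExp N x := by
  -- The top term vanishes. The shorter sum is what remains next to `z` once a power of `x` has been
  -- used up.
  have h1 : truncExp N x = ∑ i ∈ Finset.range N, (i ! : ℝ)⁻¹ • x ^ i := by
    rw [truncExp, Finset.sum_range_succ, hN, smul_zero, add_zero]
  rw [add_mul]
  nth_rewrite 3 [h1]
  rw [truncExp, Finset.sum_range_succ', add_mul, mul_add, Finset.sum_mul, Finset.mul_sum,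
    Finset.mul_sum, add_right_comm, ← Finset.sum_add_distrib]
  congr 1
  · refine Finset.sum_congr rfl fun i _ => ?_
    rw [smul_mul_assoc, pow_mul_eq_of_commute h hz, smul_add, mul_smul_comm, smul_smul,
      mul_smul_comm]
    congr 2
    rw [Nat.factorial_succ, Nat.cast_mul, mul_inv, mul_comm, ← mul_assoc, mul_inv_cancel₀, one_mul]
    positivity
  · simp

theorem truncExp_mul_neg {N : ℕ} {x : A} (hN : x ^ N = 0) :
    truncExp N x * truncExp N (-x) = 1 := by
  -- The exponential of Mathlib has rational coefficients, so the scalars are restricted before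
  -- comparing with it.
  let : Module ℚ A := Module.compHom A (algebraMap ℚ ℝ)
  have hs : ∀ (q : ℚ) (a : A), q • a = (q : ℝ) • a := fun q a => rfl
  have key : ∀ y : A, y ^ N = 0 → truncExp N y = IsNilpotent.exp y := by
    intro y hy
    have hy' : y ^ (N + 1) = 0 := by rw [pow_succ, hy, zero_mul]
    rw [IsNilpotent.exp_eq_sum hy', truncExp]
    refine Finset.sum_congr rfl fun i _ => ?_
    rw [hs]
    push_cast
    rfl
  have hN' : (-x) ^ N = 0 := by rw [neg_pow, hN, mul_zero]
  rw [key x hN, key (-x) hN']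
  exact IsNilpotent.exp_mul_exp_neg_self ⟨N, hN⟩

/-- The Weyl element `exp L exp P exp L`. -/
def weylElement (N : ℕ) (L P : A) : A := truncExp N L * truncExp N P * truncExp N L

/-- The relations say that `D` and `D'` span a two-dimensional representation under `ad L` and `ad
P`. The Weyl element acts on it as a quarter turn: `D` goes to `D + D'` under `exp P`, and `D + D'`
goes to `D'` under `exp L`. The companion below sends `D'` to `-D`. -/
theorem weylElement_mul {N : ℕ} {L P D D' : A} (hL : L ^ N = 0) (hP : P ^ N = 0)
    (hLD : L * D = D * L) (hPD : P * D = D * P + D') (hLD' : L * D' = D' * L - D)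
    (hPD' : P * D' = D' * P) : weylElement N L P * D = D' * weylElement N L P := by
  have e1 : truncExp N L * D = D * truncExp N L := by
    have := truncExp_mul (z := 0) hL (by rw [hLD, add_zero]) (Commute.zero_right _)
    rwa [add_zero] at this
  have e2 : truncExp N P * D = (D + D') * truncExp N P := truncExp_mul hP hPD hPD'
  have e3 : truncExp N L * D' = (D' - D) * truncExp N L := by
    have := truncExp_mul (z := -D) hL (by rw [hLD', sub_eq_add_neg])
      ((show Commute L D from hLD).neg_right)
    rwa [← sub_eq_add_neg] at this
  have e4 : truncExp N L * (D + D') = D' * truncExp N L := by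
    rw [mul_add, e1, e3, ← add_mul]; congr 1; abel
  rw [weylElement, mul_assoc, e1, ← mul_assoc, mul_assoc _ _ D, e2, ← mul_assoc _ (D + D'), e4]
  simp only [mul_assoc]

theorem weylElement_mul' {N : ℕ} {L P D D' : A} (hL : L ^ N = 0) (hP : P ^ N = 0)
    (hLD : L * D = D * L) (hPD : P * D = D * P + D') (hLD' : L * D' = D' * L - D)
    (hPD' : P * D' = D' * P) : weylElement N L P * D' = -(D * weylElement N L P) := by
  have e1 : truncExp N L * D = D * truncExp N L := by
    have := truncExp_mul (z := 0) hL (by rw [hLD, add_zero]) (Commute.zero_right _)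
    rwa [add_zero] at this
  have e2 : truncExp N P * D = (D + D') * truncExp N P := truncExp_mul hP hPD hPD'
  have e2' : truncExp N P * D' = D' * truncExp N P := by
    have := truncExp_mul (z := 0) hP (by rw [hPD', add_zero]) (Commute.zero_right _)
    rwa [add_zero] at this
  have e3 : truncExp N L * D' = (D' - D) * truncExp N L := by
    have := truncExp_mul (z := -D) hL (by rw [hLD', sub_eq_add_neg])
      ((show Commute L D from hLD).neg_right)
    rwa [← sub_eq_add_neg] at this
  have e5 : truncExp N P * (D' - D) = -D * truncExp N P := by
    rw [mul_sub, e2, e2', ← sub_mul]; congr 1; abel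
  rw [weylElement, mul_assoc, e3, ← mul_assoc, mul_assoc _ _ (D' - D), e5, ← mul_assoc _ (-D),
    mul_neg, e1]
  simp only [mul_assoc, neg_mul]

/-- `ad P` is the difference of left and right multiplication by `P`, which are nilpotent and
commute. -/
theorem exists_iterate_commutator_eq_zero {P : A} {N : ℕ} (hP : P ^ N = 0) (u : A) :
    ∃ K, (fun X => P * X - X * P)^[K] u = 0 := by
  have h1 : IsNilpotent (LinearMap.mulLeft ℝ P) :=
    ⟨N, by rw [LinearMap.pow_mulLeft, hP, LinearMap.mulLeft_zero_eq_zero]⟩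
  have h2 : IsNilpotent (LinearMap.mulRight ℝ P) :=
    ⟨N, by rw [LinearMap.pow_mulRight, hP, LinearMap.mulRight_zero_eq_zero]⟩
  obtain ⟨K, hK⟩ := (LinearMap.commute_mulLeft_right P P).isNilpotent_sub h1 h2
  refine ⟨K, ?_⟩
  have h3 : (fun X => P * X - X * P) = ⇑(LinearMap.mulLeft ℝ P - LinearMap.mulRight ℝ P) := by
    funext X; simp
  rw [h3, ← Module.End.pow_apply, hK, LinearMap.zero_apply]

/-- In the adjoint action `P` raises the weight and `L` lowers it, so `u` is a lowest weight vector.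
The usual computation gives `[L, (ad P) ^ (k + 1) u] = (k + 1) (μ + k) (ad P) ^ k u`. The
coefficient is never 0 for `μ > 0`, so the vanishing of a high power of `ad P` on `u` descends to
`u` itself. No finiteness of the dimension is involved. -/
theorem sl2_eq_zero_of_pos_weight {L P H u : A} {N : ℕ} {μ : ℝ} (hP : P ^ N = 0)
    (hLP : L * P = P * L + H) (hHP : H * P = P * H + (2 : ℝ) • P)
    (hLu : L * u = u * L) (hHu : H * u = u * H + μ • u) (hμ : 0 < μ) : u = 0 := by
  set F : A → A := fun X => P * X - X * P with hF
  have hw : ∀ k : ℕ, H * F^[k] u = F^[k] u * H + (μ + 2 * k) • F^[k] u := by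
    intro k
    induction k with
    | zero => simpa using hHu
    | succ k ih =>
      rw [Function.iterate_succ_apply']
      set v := F^[k] u
      have e1 : H * (P * v) = P * v * H + (μ + 2 * k + 2) • (P * v) := by
        rw [← mul_assoc, hHP, add_mul, mul_assoc, ih, mul_add, mul_smul_comm, smul_mul_assoc,
          add_assoc, ← add_smul, mul_assoc]
      have e2 : H * (v * P) = v * P * H + (μ + 2 * k + 2) • (v * P) := by
        rw [← mul_assoc, ih, add_mul, mul_assoc v H P, hHP, mul_add, mul_smul_comm, smul_mul_assoc,
          add_assoc, ← add_smul, mul_assoc, add_comm (2 : ℝ)]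
      simp only [hF, mul_sub, e1, e2, sub_mul]
      push_cast
      module
  have hl : ∀ k : ℕ, L * F^[k + 1] u = F^[k + 1] u * L + ((k + 1) * (μ + k)) • F^[k] u := by
    intro k
    have step : ∀ (v w : A), L * v = v * L + w →
        L * F v = F v * L + F w + (H * v - v * H) := by
      intro v w hv
      simp only [hF]
      rw [mul_sub, ← mul_assoc, hLP, ← mul_assoc, hv]
      simp only [add_mul, sub_mul, mul_assoc, hv, hLP, mul_add]
      abel
    induction k with
    | zero =>
      have := step u 0 (by rw [hLu, add_zero])
      simp only [zero_add, Function.iterate_one, Function.iterate_zero, id_eq, this, hHu]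
      simp [hF]
    | succ k ih =>
      have := step _ _ ih
      rw [Function.iterate_succ_apply' F (k + 1), this, hw]
      have e3 : F (((k + 1 : ℝ) * (μ + k)) • F^[k] u) = ((k + 1 : ℝ) * (μ + k)) • F^[k + 1] u := by
        rw [Function.iterate_succ_apply' F k]
        simp only [hF, mul_smul_comm, smul_mul_assoc, smul_sub]
      rw [e3]
      push_cast
      module
  obtain ⟨K, hK⟩ := exists_iterate_commutator_eq_zero hP u
  change F^[K] u = 0 at hK
  induction K with
  | zero => simpa using hK
  | succ K ih =>
    apply ih
    have h1 := hl K
    rw [hK, mul_zero, zero_mul, zero_add] at h1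
    have h2 : ((K : ℝ) + 1) * (μ + K) ≠ 0 := by positivity
    exact (smul_eq_zero.1 h1.symm).resolve_left h2

/-- The commutator `[P, D]` has weight 2, and `[L, [P, D]] = [H, D] = 0`. -/
theorem sl2_commute_of_weight_zero {L P H D : A} {N : ℕ} (hP : P ^ N = 0)
    (hLP : L * P = P * L + H) (hHP : H * P = P * H + (2 : ℝ) • P)
    (hLD : L * D = D * L) (hHD : H * D = D * H) : P * D = D * P := by
  refine sub_eq_zero.1 (sl2_eq_zero_of_pos_weight (μ := 2) hP hLP hHP ?_ ?_ two_pos)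
  · rw [mul_sub, sub_mul, ← mul_assoc, hLP, ← mul_assoc, hLD]
    simp only [add_mul, mul_assoc, hLP, hLD, mul_add, hHD]
    abel
  · rw [mul_sub, sub_mul, ← mul_assoc, hHP, ← mul_assoc, hHD]
    simp only [add_mul, mul_assoc, hHP, hHD, mul_add, smul_sub, smul_mul_assoc, mul_smul_comm]
    abel

omit [Algebra ℝ A] in
-- The Jacobi identity: `[L, [P, D]] = [H, D]`, since `D` commutes with `L`.
theorem sl2_weight_one {L P H D D' : A} (hLP : L * P = P * L + H)
    (hLD : L * D = D * L) (hHD : H * D = D * H - D) (hD' : P * D = D * P + D') :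
    L * D' = D' * L - D := by
  rw [← sub_eq_iff_eq_add'] at hD'
  rw [← hD', mul_sub, sub_mul, ← mul_assoc, hLP, ← mul_assoc, hLD]
  simp only [add_mul, mul_assoc, hLP, hLD, mul_add, hHD]
  abel

/-- The commutator `[P, D']` has weight 3, and `[L, [P, D']] = [H, D'] + [P, [L, D']] = D' - [P, D]
= 0`. With `D = d` and `P = Λ` this becomes `[Λ, [Λ, d]] = 0`. -/
theorem sl2_commute_of_weight_one {L P H D D' : A} {N : ℕ} (hP : P ^ N = 0)
    (hLP : L * P = P * L + H) (hHP : H * P = P * H + (2 : ℝ) • P)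
    (hLD : L * D = D * L) (hHD : H * D = D * H - D) (hD' : P * D = D * P + D') :
    P * D' = D' * P := by
  have h1 := sl2_weight_one hLP hLD hHD hD'
  have h2 : H * D' = D' * H + D' := by
    rw [← sub_eq_iff_eq_add'] at hD'
    rw [← hD', mul_sub, sub_mul, ← mul_assoc, hHP, ← mul_assoc, hHD]
    simp only [add_mul, sub_mul, mul_sub, mul_assoc, hHP, hHD, mul_add, two_smul]
    abel
  refine sub_eq_zero.1 (sl2_eq_zero_of_pos_weight (μ := 3) hP hLP hHP ?_ ?_ three_pos)
  · rw [mul_sub, sub_mul, ← mul_assoc, hLP, ← mul_assoc, h1]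
    simp only [add_mul, sub_mul, mul_assoc, hLP, h1, mul_add, mul_sub, h2]
    rw [← sub_eq_iff_eq_add'] at hD'
    rw [← hD']
    abel
  · rw [mul_sub, sub_mul, ← mul_assoc, hHP, ← mul_assoc, h2]
    simp only [add_mul, mul_assoc, hHP, h2, mul_add, smul_sub, smul_mul_assoc, mul_smul_comm]
    module

end Sl2
end

/-! ### Horizontal forms, dual frames and the contraction with the inverse bivector -/

noncomputable section

namespace AltFamily

variable {W : Type*} [AddCommGroup W] [Module ℝ W] [TopologicalSpace W]

/-- The degree operator. -/
def degree : AltFamily W →ₗ[ℝ] AltFamily W where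
  toFun a k := (k : ℝ) • a k
  map_add' _ _ := by funext k; exact smul_add _ _ _
  map_smul' c a := by
    funext k
    ext v
    exact mul_left_comm _ c (a k v)

theorem degree_apply (a : AltFamily W) (k : ℕ) : degree a k = (k : ℝ) • a k := rfl

/-- The families of horizontal forms. -/
def horizontal (σ : W [⋀^Fin 2]→L[ℝ] ℝ) : Submodule ℝ (AltFamily W) where
  carrier := {a | ∀ v, InKernel σ v → contract v a = 0}
  zero_mem' v _ := map_zero _
  add_mem' ha hb v hv := by rw [map_add, ha v hv, hb v hv, add_zero]
  smul_mem' c a ha v hv := by rw [map_smul, ha v hv, smul_zero]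

theorem mem_horizontal {σ : W [⋀^Fin 2]→L[ℝ] ℝ} {a : AltFamily W} :
    a ∈ horizontal σ ↔ ∀ v, InKernel σ v → contract v a = 0 := Iff.rfl

theorem apply_eq_zero_of_contract {k : ℕ} {a : AltFamily W} {v : Fin k → W} (i : Fin k)
    (h : contract (v i) a = 0) : a k v = 0 := by
  cases k with
  | zero => exact i.elim0
  | succ k =>
    have h1 : (a (k + 1)) (v ∘ Equiv.swap 0 i) = (Equiv.Perm.sign (Equiv.swap 0 i)) • a (k + 1) v :=
      (a (k + 1)).toAlternatingMap.map_perm v _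
    have h2 : v ∘ Equiv.swap 0 i = Matrix.vecCons (v i) (Matrix.vecTail (v ∘ Equiv.swap 0 i)) := by
      have h0 := Matrix.cons_head_tail (v ∘ Equiv.swap 0 i)
      rw [show Matrix.vecHead (v ∘ Equiv.swap 0 i) = v i by simp [Matrix.vecHead]] at h0
      exact h0.symm
    rw [h2, ← contract_apply, h] at h1
    have h3 : (Equiv.Perm.sign (Equiv.swap 0 i)) • a (k + 1) v = 0 := h1.symm
    rcases Int.units_eq_one_or (Equiv.Perm.sign (Equiv.swap 0 i)) with h4 | h4
    · rwa [h4, one_smul] at h3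
    · rw [h4, Units.smul_def] at h3
      simpa using h3

theorem mem_horizontal_iff_isHorizontal {σ : W [⋀^Fin 2]→L[ℝ] ℝ} {a : AltFamily W} :
    a ∈ horizontal σ ↔ ∀ k, IsHorizontal σ (a k) := by
  refine ⟨fun h k v ⟨i, hi⟩ => apply_eq_zero_of_contract i (h _ hi), fun h v hv => ?_⟩
  funext k
  ext u
  rw [contract_apply]
  exact h _ _ ⟨0, hv⟩

theorem single_mem_horizontal {σ : W [⋀^Fin 2]→L[ℝ] ℝ} {p : ℕ} {a : W [⋀^Fin p]→L[ℝ] ℝ}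
    (ha : IsHorizontal σ a) : single p a ∈ horizontal σ := by
  refine mem_horizontal_iff_isHorizontal.2 fun k => ?_
  by_cases hk : k = p
  · subst hk; rwa [single_same]
  · rw [single_of_ne hk]; exact fun _ _ => rfl

theorem contract_single_succ (v : W) {p : ℕ} (a : W [⋀^Fin (p + 1)]→L[ℝ] ℝ) :
    contract v (single (p + 1) a) = single p (altInterior v a) := by
  funext k
  by_cases hk : k = p
  · subst hk
    rw [single_same]
    ext u
    rw [contract_apply, single_same]; rfl
  · rw [single_of_ne hk]
    ext u
    rw [contract_apply, single_of_ne (by omega)]; rfl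

theorem contract_homogeneous {v : W} {p : ℕ} {a : AltFamily W} (ha : ∀ k, k ≠ p + 1 → a k = 0) :
    ∀ k, k ≠ p → contract v a k = 0 := by
  intro k hk
  ext u
  rw [contract_apply, ha (k + 1) (by omega)]; rfl

theorem parity_of_homogeneous {p : ℕ} {a : AltFamily W} (ha : ∀ k, k ≠ p → a k = 0) :
    parity a = (-1 : ℝ) ^ p • a := by
  funext k
  by_cases hk : k = p
  · subst hk; rfl
  · rw [parity_apply, Pi.smul_apply, ha k hk, smul_zero, smul_zero]

theorem wedge_mem_horizontal {σ : W [⋀^Fin 2]→L[ℝ] ℝ} {a b : AltFamily W}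
    (ha : a ∈ horizontal σ) (hb : b ∈ horizontal σ) : wedge a b ∈ horizontal σ := by
  intro v hv
  rw [contract_wedge, ha v hv, hb v hv, wedge_zero_left, wedge_zero_right, add_zero]

theorem contract_mem_horizontal {σ : W [⋀^Fin 2]→L[ℝ] ℝ} {a : AltFamily W}
    (ha : a ∈ horizontal σ) (w : W) : contract w a ∈ horizontal σ := by
  intro v hv
  rw [contract_contract, ha v hv, map_zero, neg_zero]

theorem one_mem_horizontal (σ : W [⋀^Fin 2]→L[ℝ] ℝ) : one W ∈ horizontal σ :=
  fun v _ => contract_one v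

theorem contract_contract_single_two (σ : W [⋀^Fin 2]→L[ℝ] ℝ) (v w : W) :
    contract w (contract v (single 2 σ)) = σ ![v, w] • one W := by
  rw [contract_single_succ, contract_single_succ]
  funext k
  cases k with
  | zero =>
    rw [single_same]
    ext u
    rw [Subsingleton.elim u ![]]
    simp [altInterior_apply, one]
  | succ k =>
    rw [single_of_ne (by omega)]
    simp [one]

theorem two_form_swap (σ : W [⋀^Fin 2]→L[ℝ] ℝ) (v w : W) : σ ![v, w] = -σ ![w, v] := by
  have h := contract_contract v w (single 2 σ)
  rw [contract_contract_single_two, contract_contract_single_two] at h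
  have h2 := DFunLike.congr_fun (congrFun h 0) ![]
  simp [one] at h2
  linarith

/-- A two-form as a bilinear form. -/
def bilin (σ : W [⋀^Fin 2]→L[ℝ] ℝ) : W →ₗ[ℝ] W →ₗ[ℝ] ℝ :=
  LinearMap.mk₂ ℝ (fun v w => σ ![v, w])
    (fun v v' w => σ.toMultilinearMap.cons_add ![w] v v')
    (fun c v w => σ.toMultilinearMap.cons_smul ![w] c v)
    (fun v w w' => by
      rw [two_form_swap, two_form_swap σ v w, two_form_swap σ v w', ← neg_add]
      exact congrArg Neg.neg (σ.toMultilinearMap.cons_add ![v] w w'))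
    (fun c v w => by
      rw [two_form_swap, two_form_swap σ v w, smul_neg]
      exact congrArg Neg.neg (σ.toMultilinearMap.cons_smul ![v] c w))

theorem bilin_apply (σ : W [⋀^Fin 2]→L[ℝ] ℝ) (v w : W) : bilin σ v w = σ ![v, w] := rfl

theorem single_two_mem_horizontal (σ : W [⋀^Fin 2]→L[ℝ] ℝ) : single 2 σ ∈ horizontal σ := by
  intro v hv
  refine ext_contract ?_ fun w => ?_
  · ext u
    rw [contract_apply, single_of_ne (by omega)]; rfl
  · rw [contract_contract_single_two, hv w, zero_smul, map_zero]

theorem parity_single_two (σ : W [⋀^Fin 2]→L[ℝ] ℝ) : parity (single 2 σ) = single 2 σ := by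
  rw [parity_of_homogeneous fun k hk => single_of_ne hk σ]
  simp

theorem parity_contract_single_two (σ : W [⋀^Fin 2]→L[ℝ] ℝ) (v : W) :
    parity (contract v (single 2 σ)) = -contract v (single 2 σ) := by
  rw [← neg_eq_iff_eq_neg.2 (contract_parity v (single 2 σ)), parity_single_two]

/-- Dual families `e`, `e'` that span modulo the kernel. -/
structure IsFrame (σ : W [⋀^Fin 2]→L[ℝ] ℝ) {m : ℕ} (e e' : Fin m → W) : Prop where
  dual : IsDualPair σ e e'
  complete : ∀ v w, σ ![v, w] = ∑ i, σ ![v, e' i] * σ ![e i, w]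

/-- Half the sum of the contractions with `e i` and `e' i`. -/
def frameContract {m : ℕ} (e e' : Fin m → W) : AltFamily W →ₗ[ℝ] AltFamily W :=
  (2⁻¹ : ℝ) • ∑ i, contract (e i) ∘ₗ contract (e' i)

theorem frameContract_apply {m : ℕ} (e e' : Fin m → W) (a : AltFamily W) :
    frameContract e e' a = (2⁻¹ : ℝ) • ∑ i, contract (e i) (contract (e' i) a) := by
  simp [frameContract]

section frame

variable {σ : W [⋀^Fin 2]→L[ℝ] ℝ} {m : ℕ} {e e' : Fin m → W}

theorem contract_eq_of_inKernel_sub {v w : W} {a : AltFamily W} (ha : a ∈ horizontal σ)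
    (h : ∀ u, σ ![v, u] = σ ![w, u]) : contract v a = contract w a := by
  have h1 := ha (v - w) fun u => by
    rw [← bilin_apply, map_sub, LinearMap.sub_apply, bilin_apply, bilin_apply, h, sub_self]
  have h2 : contract v a = contract (v - w) a + contract w a := by
    rw [← contract_add_vec, sub_add_cancel]
  rw [h2, h1, zero_add]

/-- Completeness of the frame says that `v` and `∑ i, σ ![v, e' i] • e i` differ by a vector in the
kernel, which a horizontal form does not see. -/
theorem IsFrame.contract_eq (h : IsFrame σ e e') {a : AltFamily W} (ha : a ∈ horizontal σ) (v : W) :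
    contract v a = ∑ i, σ ![v, e' i] • contract (e i) a := by
  simp_rw [← contract_smul_vec]
  rw [← contract_sum_vec]
  refine contract_eq_of_inKernel_sub ha fun u => ?_
  rw [h.complete v u, ← bilin_apply σ (∑ i, _), map_sum, LinearMap.sum_apply]
  refine Finset.sum_congr rfl fun i _ => ?_
  rw [map_smul]; rfl

theorem IsFrame.contract_eq' (h : IsFrame σ e e') {a : AltFamily W} (ha : a ∈ horizontal σ)
    (v : W) : contract v a = ∑ i, σ ![e i, v] • contract (e' i) a := by
  simp_rw [← contract_smul_vec]
  rw [← contract_sum_vec]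
  refine contract_eq_of_inKernel_sub ha fun u => ?_
  rw [two_form_swap, h.complete u v, ← bilin_apply σ (∑ i, _), map_sum, LinearMap.sum_apply,
    ← Finset.sum_neg_distrib]
  refine Finset.sum_congr rfl fun i _ => ?_
  rw [map_smul, LinearMap.smul_apply, bilin_apply, two_form_swap σ (e' i) u, smul_eq_mul]
  ring

/-- Expanding `e i` in the frame `f` and collecting the coefficients on the other factor turns `e'`
into `f'`. So the operator belongs to `σ` and not to the frame. -/
theorem IsFrame.frameContract_eq {m' : ℕ} {f f' : Fin m' → W} (h : IsFrame σ e e')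
    (h' : IsFrame σ f f') {a : AltFamily W} (ha : a ∈ horizontal σ) :
    frameContract e e' a = frameContract f f' a := by
  rw [frameContract_apply, frameContract_apply]
  congr 1
  calc ∑ i, contract (e i) (contract (e' i) a)
      = ∑ i, ∑ j, σ ![e i, f' j] • contract (f j) (contract (e' i) a) :=
        Finset.sum_congr rfl fun i _ => h'.contract_eq (contract_mem_horizontal ha _) _
    _ = ∑ j, contract (f j) (∑ i, σ ![e i, f' j] • contract (e' i) a) := by
        rw [Finset.sum_comm]
        refine Finset.sum_congr rfl fun j _ => ?_
        rw [map_sum]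
        exact Finset.sum_congr rfl fun i _ => (map_smul _ _ _).symm
    _ = ∑ j, contract (f j) (contract (f' j) a) :=
        Finset.sum_congr rfl fun j _ => by rw [← h.contract_eq' ha]

theorem frameContract_mem_horizontal {a : AltFamily W} (ha : a ∈ horizontal σ) :
    frameContract e e' a ∈ horizontal σ := by
  rw [frameContract_apply]
  exact Submodule.smul_mem _ _ (Submodule.sum_mem _ fun i _ =>
    contract_mem_horizontal (contract_mem_horizontal ha _) _)

theorem contract_frameContract (v : W) (a : AltFamily W) :
    contract v (frameContract e e' a) = frameContract e e' (contract v a) := by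
  rw [frameContract_apply, frameContract_apply, map_smul, map_sum]
  congr 1
  refine Finset.sum_congr rfl fun i _ => ?_
  rw [contract_contract, contract_contract v, map_neg, neg_neg]

theorem parity_frameContract (a : AltFamily W) :
    parity (frameContract e e' a) = frameContract e e' (parity a) := by
  rw [frameContract_apply, frameContract_apply, map_smul, map_sum]
  congr 1
  refine Finset.sum_congr rfl fun i _ => ?_
  rw [contract_parity, map_neg, contract_parity, neg_neg]

/-- The Euler identity for the degree. Contracting with `v` yields one sum in which `v` meets `σ`,
and this sum is the expansion of `ι(v)a` in the frame; the remaining sum is the identity for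
`ι(v)a`, one degree lower. -/
theorem IsFrame.euler (h : IsFrame σ e e') {a : AltFamily W} (ha : a ∈ horizontal σ) :
    ∑ i, wedge (contract (e i) (single 2 σ)) (contract (e' i) a) = degree a := by
  funext k
  induction k generalizing a with
  | zero =>
    rw [Finset.sum_apply, degree_apply, Nat.cast_zero, zero_smul]
    refine Finset.sum_eq_zero fun i _ => ?_
    rw [wedge_apply_zero, contract_single_succ, single_of_ne (by omega)]
    simp
  | succ k ih =>
    refine succ_eq_of_contract fun v => ?_
    have h1 : contract v (degree a) k = contract v a k + degree (contract v a) k := by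
      ext u
      simp only [contract_apply, degree_apply, ContinuousAlternatingMap.add_apply,
        ContinuousAlternatingMap.smul_apply, smul_eq_mul]
      push_cast; ring
    rw [h1, map_sum, ← ih (contract_mem_horizontal ha v), ← Pi.add_apply, h.contract_eq' ha v,
      ← Finset.sum_add_distrib]
    refine congrFun (?_ : (_ : AltFamily W) = _) k
    refine Finset.sum_congr rfl fun i _ => ?_
    rw [contract_wedge, contract_contract_single_two, wedge_smul_left, one_wedge,
      parity_contract_single_two, contract_contract, wedge_neg_right, wedge_neg_left, neg_neg,
      ← h.contract_eq' ha v]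

/-- The antisymmetry of `σ` provides a second Euler identity, with the two families exchanged. -/
theorem IsFrame.swap (h : IsFrame σ e e') : IsFrame σ e' (fun i => -e i) where
  dual i j := by
    have := h.dual j i
    rw [← bilin_apply, map_neg, bilin_apply, ← two_form_swap, this]
    simp only [eq_comm]
  complete v w := by
    rw [two_form_swap, h.complete w v, ← Finset.sum_neg_distrib]
    refine Finset.sum_congr rfl fun i _ => ?_
    rw [← bilin_apply σ v, map_neg, bilin_apply, ← two_form_swap, two_form_swap σ w]
    ring

/-- The commutator `[Λ, L]`. The terms with one contraction on each factor are the Euler sums of the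
frame and of its swap, half of each, and give `degree a`. The terms with both contractions on `σ`
are `m` copies of `-a`, again halved. -/
theorem IsFrame.frameContract_wedge (h : IsFrame σ e e') {a : AltFamily W}
    (ha : a ∈ horizontal σ) : frameContract e e' (wedge (single 2 σ) a) =
      wedge (single 2 σ) (frameContract e e' a) + degree a - (m / 2 : ℝ) • a := by
  have h1 := h.euler ha
  have h2 := h.swap.euler ha
  have h3 : ∀ i, contract (e i) (contract (e' i) (wedge (single 2 σ) a)) =
      -a + wedge (contract (e' i) (single 2 σ)) (contract (-e i) a) +
      wedge (contract (e i) (single 2 σ)) (contract (e' i) a) +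
      wedge (single 2 σ) (contract (e i) (contract (e' i) a)) := by
    intro i
    have hd : σ ![e' i, e i] = -1 := by rw [two_form_swap, h.dual i i, if_pos rfl]
    have hn : contract (-e i) a = -contract (e i) a := by
      rw [← neg_one_smul ℝ (e i), contract_smul_vec, neg_one_smul ℝ (contract (e i) a)]
    rw [contract_wedge, parity_single_two, map_add, contract_wedge, contract_wedge,
      parity_single_two, contract_contract_single_two, parity_contract_single_two,
      wedge_smul_left, one_wedge, hd, hn, wedge_neg_left, wedge_neg_right]
    rw [neg_one_smul ℝ a]
    abel
  rw [frameContract_apply, frameContract_apply, Finset.sum_congr rfl fun i _ => h3 i,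
    Finset.sum_add_distrib, Finset.sum_add_distrib, Finset.sum_add_distrib, h1, h2,
    wedge_smul_right, wedge_sum_right, Finset.sum_const, Finset.card_univ, Fintype.card_fin,
    ← Nat.cast_smul_eq_nsmul ℝ]
  module

theorem IsFrame.frameContract_contract_wedge (h : IsFrame σ e e') {a : AltFamily W}
    (ha : a ∈ horizontal σ) (v : W) :
    frameContract e e' (wedge (contract v (single 2 σ)) a) =
      wedge (contract v (single 2 σ)) (frameContract e e' a) + contract v a := by
  have h1 := h.contract_eq ha v
  have h2 := h.contract_eq' ha v
  have h3 : ∀ i, contract (e i) (contract (e' i) (wedge (contract v (single 2 σ)) a)) =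
      σ ![v, e' i] • contract (e i) a + σ ![e i, v] • contract (e' i) a +
      wedge (contract v (single 2 σ)) (contract (e i) (contract (e' i) a)) := by
    intro i
    rw [contract_wedge, contract_contract_single_two, parity_contract_single_two, wedge_smul_left,
      one_wedge, wedge_neg_left, map_add, map_smul, map_neg, contract_wedge,
      contract_contract_single_two, parity_contract_single_two, wedge_smul_left, one_wedge,
      wedge_neg_left, two_form_swap σ (e i) v]
    module
  rw [frameContract_apply, frameContract_apply, Finset.sum_congr rfl fun i _ => h3 i,
    Finset.sum_add_distrib, Finset.sum_add_distrib, ← h1, ← h2, wedge_smul_right, wedge_sum_right]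
  module

/-- The Euler identity counted from the top. It shows that a form killed by all products with
`ι(v)σ` lives in the top degree only. -/
theorem IsFrame.sum_contract_wedge (h : IsFrame σ e e') {a : AltFamily W}
    (ha : a ∈ horizontal σ) :
    ∑ i, contract (e' i) (wedge (contract (e i) (single 2 σ)) a) = (m : ℝ) • a - degree a := by
  rw [← h.euler ha]
  have : ∀ i, contract (e' i) (wedge (contract (e i) (single 2 σ)) a) =
      a - wedge (contract (e i) (single 2 σ)) (contract (e' i) a) := by
    intro i
    rw [contract_wedge, contract_contract_single_two, parity_contract_single_two, wedge_smul_left,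
      one_wedge, wedge_neg_left, h.dual i i, if_pos rfl, one_smul, sub_eq_add_neg]
  rw [Finset.sum_congr rfl fun i _ => this i, Finset.sum_sub_distrib, Finset.sum_const,
    Finset.card_univ, Fintype.card_fin, Nat.cast_smul_eq_nsmul]

/-- A one-sided inverse of a square matrix is two-sided: completeness of `e` gives `A * B = 1` for
the two transition matrices, and `B * A = 1` is what completeness of `f` requires. Thus the dual
pair chosen arbitrarily in `symplecticPairing` is a frame. -/
theorem IsFrame.of_dual {f f' : Fin m → W} (h : IsFrame σ e e') (hf : IsDualPair σ f f') :
    IsFrame σ f f' := by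
  refine ⟨hf, fun v w => ?_⟩
  let A : Matrix (Fin m) (Fin m) ℝ := Matrix.of fun i j => σ ![f i, e' j]
  let B : Matrix (Fin m) (Fin m) ℝ := Matrix.of fun i j => σ ![e i, f' j]
  have hAB : A * B = 1 := by
    ext i j
    rw [Matrix.mul_apply, Matrix.one_apply, ← hf i j, h.complete]
    rfl
  have hBA : ∀ j k, ∑ i, σ ![e j, f' i] * σ ![f i, e' k] = if j = k then 1 else 0 := by
    intro j k
    have h1 : B * A = 1 := mul_eq_one_comm.1 hAB
    have := congrFun (congrFun h1 j) k
    rwa [Matrix.mul_apply, Matrix.one_apply] at this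
  calc σ ![v, w] = ∑ j, ∑ k, σ ![v, e' j] * (if j = k then 1 else 0) * σ ![e k, w] := by
        rw [h.complete v w]
        simp
    _ = ∑ i, (∑ j, σ ![v, e' j] * σ ![e j, f' i]) * ∑ k, σ ![f i, e' k] * σ ![e k, w] := by
        simp_rw [← hBA, Finset.mul_sum, Finset.sum_mul]
        rw [Finset.sum_comm' (t' := Finset.univ) (s' := fun _ => Finset.univ) (by simp)]
        rw [Finset.sum_congr rfl fun k _ => Finset.sum_comm]
        rw [Finset.sum_comm]
        refine Finset.sum_congr rfl fun i _ => Finset.sum_congr rfl fun k _ =>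
          Finset.sum_congr rfl fun j _ => by ring
    _ = ∑ i, σ ![v, f' i] * σ ![f i, w] := by
        refine Finset.sum_congr rfl fun i _ => ?_
        rw [← h.complete, ← h.complete]

/-- More than `m` vectors are dependent modulo the kernel. Substituting the vanishing combination
for one of the vectors only rescales the value of the form by a nonzero factor, and the form is 0
there. -/
theorem IsFrame.eq_zero_of_lt (h : IsFrame σ e e') {a : AltFamily W}
    (ha : a ∈ horizontal σ) {k : ℕ} (hk : m < k) : a k = 0 := by
  ext v
  let f : Fin k → (Fin m → ℝ) := fun i j => σ ![v i, e' j]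
  have hf : ¬LinearIndependent ℝ f := by
    intro hf
    have := hf.fintype_card_le_finrank
    simp at this
    omega
  obtain ⟨c, hc, i, hi⟩ := Fintype.not_linearIndependent_iff.1 hf
  have hker : InKernel σ (∑ l, c l • v l) := by
    intro w
    rw [h.complete]
    refine Finset.sum_eq_zero fun j _ => ?_
    have h1 := congrFun hc j
    rw [← bilin_apply, map_sum, LinearMap.sum_apply]
    simp only [Finset.sum_apply, Pi.smul_apply, Pi.zero_apply, f, ← bilin_apply σ _ (e' j)] at h1
    simp only [map_smul, LinearMap.smul_apply, h1, zero_mul]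
  have h2 : a k (Function.update v i (∑ l, c l • v l)) = 0 :=
    apply_eq_zero_of_contract i (by simpa using ha _ hker)
  have h3 : (a k).toMultilinearMap (Function.update v i (∑ l, c l • v l)) = c i * a k v := by
    rw [MultilinearMap.map_update_sum, Finset.sum_eq_single i]
    · rw [MultilinearMap.map_update_smul, Function.update_eq_self]; rfl
    · intro l _ hl
      rw [MultilinearMap.map_update_smul]
      have : a k (Function.update v i (v l)) = 0 :=
        (a k).toAlternatingMap.map_update_self v hl.symm
      exact (congrArg (c l • ·) this).trans (smul_zero _)
    · intro hi; exact absurd (Finset.mem_univ i) hi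
  have h4 : c i * a k v = 0 := h3.symm.trans h2
  exact (mul_eq_zero.1 h4).resolve_left hi

end frame

/-- `D` identifies the quotient by the kernel with `ℝ ^ m`. Lift the standard basis to `e`. The Gram
matrix of `σ` on `e` is invertible, because a null combination would lie in the kernel, and its
inverse provides `e'`. -/
theorem exists_isFrame (σ : W [⋀^Fin 2]→L[ℝ] ℝ) {m : ℕ} (D : W →ₗ[ℝ] (Fin m → ℝ))
    (hD : Function.Surjective D) (hker : ∀ v, D v = 0 → InKernel σ v)
    (hker' : ∀ v, InKernel σ v → D v = 0) : ∃ e e' : Fin m → W, IsFrame σ e e' := by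
  choose e he using fun i : Fin m => hD (Pi.single i 1)
  let Ω : Matrix (Fin m) (Fin m) ℝ := Matrix.of fun i j => σ ![e i, e j]
  have hv : ∀ v w, σ ![v, w] = ∑ i, D v i * σ ![e i, w] := by
    intro v w
    have h1 := hker (v - ∑ i, D v i • e i) (by
      rw [map_sub, map_sum]
      simp only [map_smul, he]
      rw [sub_eq_zero]
      funext j
      simp [Pi.single_apply]) w
    rw [← bilin_apply, map_sub, LinearMap.sub_apply, map_sum, LinearMap.sum_apply, sub_eq_zero] at h1
    simpa [bilin_apply] using h1
  have hΩ : IsUnit Ω := by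
    rw [← Matrix.vecMul_injective_iff_isUnit]
    change Function.Injective (Matrix.vecMulLinear Ω)
    rw [injective_iff_map_eq_zero]
    intro c hc
    have h2 : D (∑ i, c i • e i) = c := by
      rw [map_sum]
      simp only [map_smul, he]
      funext j
      simp [Pi.single_apply]
    rw [← h2]
    refine hker' _ fun w => ?_
    rw [two_form_swap, hv w, neg_eq_zero]
    refine Finset.sum_eq_zero fun j _ => ?_
    have h3 := congrFun hc j
    simp only [Matrix.vecMulLinear_apply, Matrix.vecMul, dotProduct, Ω, Matrix.of_apply,
      Pi.zero_apply] at h3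
    rw [two_form_swap, ← bilin_apply, map_sum, LinearMap.sum_apply]
    simp only [map_smul, LinearMap.smul_apply, bilin_apply, smul_eq_mul]
    rw [h3]; simp
  have hdet : IsUnit Ω.det := (Matrix.isUnit_iff_isUnit_det _).1 hΩ
  let e' : Fin m → W := fun j => ∑ k, Ω⁻¹ k j • e k
  have hdual : IsDualPair σ e e' := by
    intro i j
    have h1 := congrFun (congrFun (Matrix.mul_nonsing_inv Ω hdet) i) j
    rw [Matrix.mul_apply, Matrix.one_apply] at h1
    rw [← h1, ← bilin_apply, map_sum]
    simp only [map_smul, bilin_apply, smul_eq_mul, Ω, Matrix.of_apply, mul_comm]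
  refine ⟨e, e', hdual, fun v w => ?_⟩
  rw [hv v w]
  refine Finset.sum_congr rfl fun j _ => ?_
  congr 1
  rw [hv v (e' j), Finset.sum_congr rfl fun i _ => by rw [hdual i j]]
  simp

end AltFamily
end

/-! ### The `sl₂` action on horizontal forms, and the symplectic star as a Weyl element -/

noncomputable section

namespace AltFamily

variable {W : Type*} [AddCommGroup W] [Module ℝ W] [TopologicalSpace W]

/-- The space of families of horizontal forms. -/
def HForm (σ : W [⋀^Fin 2]→L[ℝ] ℝ) : Type _ := horizontal σ

instance (σ : W [⋀^Fin 2]→L[ℝ] ℝ) : AddCommGroup (HForm σ) :=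
  inferInstanceAs (AddCommGroup (horizontal σ))

instance (σ : W [⋀^Fin 2]→L[ℝ] ℝ) : Module ℝ (HForm σ) :=
  inferInstanceAs (Module ℝ (horizontal σ))

/-- The underlying family of forms. -/
def HForm.val {σ : W [⋀^Fin 2]→L[ℝ] ℝ} (a : HForm σ) : AltFamily W := Subtype.val a

instance (σ : W [⋀^Fin 2]→L[ℝ] ℝ) : CoeOut (HForm σ) (AltFamily W) := ⟨HForm.val⟩

/-- A family of horizontal forms as an element of `HForm`. -/
def HForm.mk {σ : W [⋀^Fin 2]→L[ℝ] ℝ} (a : AltFamily W) (ha : a ∈ horizontal σ) : HForm σ :=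
  ⟨a, ha⟩

theorem HForm.mem {σ : W [⋀^Fin 2]→L[ℝ] ℝ} (a : HForm σ) : (a : AltFamily W) ∈ horizontal σ :=
  Subtype.property a

/-- The inclusion of the horizontal forms. -/
def HForm.incl (σ : W [⋀^Fin 2]→L[ℝ] ℝ) : HForm σ →ₗ[ℝ] AltFamily W where
  toFun := HForm.val
  map_add' _ _ := rfl
  map_smul' _ _ := rfl

theorem HForm.val_injective {σ : W [⋀^Fin 2]→L[ℝ] ℝ} {a b : HForm σ}
    (h : (a : AltFamily W) = b) : a = b := Subtype.ext h

theorem HForm.ext {σ : W [⋀^Fin 2]→L[ℝ] ℝ} {a b : HForm σ}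
    (h : ∀ k, (a : AltFamily W) k = (b : AltFamily W) k) : a = b := HForm.val_injective (funext h)

theorem HForm.coe_zero {σ : W [⋀^Fin 2]→L[ℝ] ℝ} : ((0 : HForm σ) : AltFamily W) = 0 := rfl

theorem HForm.coe_smul {σ : W [⋀^Fin 2]→L[ℝ] ℝ} (c : ℝ) (a : HForm σ) :
    ((c • a : HForm σ) : AltFamily W) = c • (a : AltFamily W) := rfl

theorem HForm.coe_sum {σ : W [⋀^Fin 2]→L[ℝ] ℝ} {ι : Type*} (s : Finset ι) (a : ι → HForm σ) :
    ((∑ i ∈ s, a i : HForm σ) : AltFamily W) = ∑ i ∈ s, (a i : AltFamily W) :=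
  map_sum (HForm.incl σ) a s

/-- The Lefschetz operator on horizontal forms. -/
def lefschetz (σ : W [⋀^Fin 2]→L[ℝ] ℝ) : Module.End ℝ (HForm σ) :=
  (wedgeₗ W (single 2 σ)).restrict fun _ ha => wedge_mem_horizontal (single_two_mem_horizontal σ) ha

/-- The dual Lefschetz operator on horizontal forms, computed in a frame. -/
def dualLefschetz (σ : W [⋀^Fin 2]→L[ℝ] ℝ) {m : ℕ} (e e' : Fin m → W) :
    Module.End ℝ (HForm σ) :=
  (frameContract e e').restrict fun _ ha => frameContract_mem_horizontal ha

/-- Contraction on horizontal forms. -/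
def hContract (σ : W [⋀^Fin 2]→L[ℝ] ℝ) (v : W) : Module.End ℝ (HForm σ) :=
  (contract v).restrict fun _ ha => contract_mem_horizontal ha v

/-- The exterior product of horizontal forms with `ι(v) σ`. -/
def hWedge (σ : W [⋀^Fin 2]→L[ℝ] ℝ) (v : W) : Module.End ℝ (HForm σ) :=
  (wedgeₗ W (contract v (single 2 σ))).restrict fun _ ha =>
    wedge_mem_horizontal (contract_mem_horizontal (single_two_mem_horizontal σ) v) ha

/-- The unit as a horizontal form. -/
def hOne (σ : W [⋀^Fin 2]→L[ℝ] ℝ) : HForm σ := HForm.mk (one W) (one_mem_horizontal σ)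

section

variable {σ : W [⋀^Fin 2]→L[ℝ] ℝ}

theorem coe_lefschetz (a : HForm σ) :
    (lefschetz σ a : AltFamily W) = wedge (single 2 σ) a := rfl

theorem coe_dualLefschetz {m : ℕ} (e e' : Fin m → W) (a : HForm σ) :
    (dualLefschetz σ e e' a : AltFamily W) = frameContract e e' a := rfl

theorem coe_hContract (v : W) (a : HForm σ) :
    (hContract σ v a : AltFamily W) = contract v a := rfl

theorem coe_hWedge (v : W) (a : HForm σ) :
    (hWedge σ v a : AltFamily W) = wedge (contract v (single 2 σ)) a := rfl

theorem lefschetz_mul_hWedge (v : W) :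
    lefschetz σ * hWedge σ v = hWedge σ v * lefschetz σ := by
  ext1 a
  refine HForm.val_injective ?_
  change wedge _ (wedge _ _) = wedge _ (wedge _ _)
  rw [← wedge_assoc, ← wedge_assoc, wedge_comm_of_even (a := contract v (single 2 σ))
    (parity_single_two σ)]

theorem lefschetz_mul_hContract (v : W) :
    lefschetz σ * hContract σ v = hContract σ v * lefschetz σ - hWedge σ v := by
  ext1 a
  refine HForm.val_injective ?_
  change wedge _ (contract v a) = contract v (wedge _ a) - wedge (contract v (single 2 σ)) a
  rw [contract_wedge, parity_single_two]
  abel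

theorem lefschetz_apply_succ (a : HForm σ) (k : ℕ) (h : (a : AltFamily W) k = 0) :
    (lefschetz σ a : AltFamily W) (k + 2) = 0 := by
  rw [coe_lefschetz, wedge_single (add_comm 2 k) _ _ (fun k hk => single_of_ne hk σ), h]
  ext v
  rw [altWedge_apply]
  simp

theorem lefschetz_apply_of_lt (a : HForm σ) {k : ℕ} (h : k < 2) :
    (lefschetz σ a : AltFamily W) k = 0 := by
  rw [coe_lefschetz, wedge_eq_zero_of_lt h _ _ (fun k hk => single_of_ne hk σ)]

theorem lefschetz_pow_homogeneous {p : ℕ} (a : HForm σ)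
    (ha : ∀ k, k ≠ p → (a : AltFamily W) k = 0) (i : ℕ) :
    ∀ k, k ≠ p + 2 * i → ((lefschetz σ ^ i) a : AltFamily W) k = 0 := by
  induction i with
  | zero => simpa using ha
  | succ i ih =>
    intro k hk
    rw [pow_succ', Module.End.mul_apply]
    by_cases h : k < 2
    · exact lefschetz_apply_of_lt _ h
    · obtain ⟨k, rfl⟩ : ∃ l, k = l + 2 := ⟨k - 2, by omega⟩
      exact lefschetz_apply_succ _ _ (ih k (by omega))

theorem lefschetz_pow_apply_of_lt (a : HForm σ) (i : ℕ) :
    ∀ k, k < 2 * i → ((lefschetz σ ^ i) a : AltFamily W) k = 0 := by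
  induction i with
  | zero => intro k hk; omega
  | succ i ih =>
    intro k hk
    rw [pow_succ', Module.End.mul_apply]
    by_cases h : k < 2
    · exact lefschetz_apply_of_lt _ h
    · obtain ⟨k, rfl⟩ : ∃ l, k = l + 2 := ⟨k - 2, by omega⟩
      exact lefschetz_apply_succ _ _ (ih k (by omega))

theorem dualLefschetz_apply {m : ℕ} (e e' : Fin m → W) (a : HForm σ) (k : ℕ)
    (h : (a : AltFamily W) (k + 2) = 0) : (dualLefschetz σ e e' a : AltFamily W) k = 0 := by
  rw [coe_dualLefschetz, frameContract_apply]
  ext v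
  simp only [Pi.smul_apply, Finset.sum_apply, ContinuousAlternatingMap.smul_apply,
    ContinuousAlternatingMap.sum_apply, contract_apply]
  rw [h]
  simp

theorem dualLefschetz_pow_apply {m : ℕ} (e e' : Fin m → W) (a : HForm σ) (i : ℕ) :
    ∀ k, (a : AltFamily W) (k + 2 * i) = 0 →
      ((dualLefschetz σ e e' ^ i) a : AltFamily W) k = 0 := by
  induction i generalizing a with
  | zero => simp
  | succ i ih =>
    intro k hk
    rw [pow_succ, Module.End.mul_apply]
    exact ih _ k (dualLefschetz_apply e e' a _ hk)

theorem altPow_eq (n : ℕ) : altPow σ n = ((lefschetz σ ^ n) (hOne σ) : AltFamily W) (2 * n) := by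
  induction n with
  | zero => rfl
  | succ n ih =>
    have h0 : ∀ k, k ≠ 0 → (hOne σ : AltFamily W) k = 0 := by
      intro k hk
      obtain ⟨k, rfl⟩ := Nat.exists_eq_succ_of_ne_zero hk
      rfl
    rw [pow_succ', Module.End.mul_apply, coe_lefschetz, ← wedge_comm_of_even (parity_single_two σ),
      wedge_single (p := 2 * n) (q := 2) (by ring) _ _ (by
        simpa using lefschetz_pow_homogeneous (hOne σ) h0 n), ← ih, single_same]
    rfl

end

section weyl

variable {σ : W [⋀^Fin 2]→L[ℝ] ℝ} {n : ℕ} {e e' : Fin (2 * n) → W}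

theorem IsFrame.lefschetz_pow (h : IsFrame σ e e') : lefschetz σ ^ (n + 1) = 0 := by
  ext1 a
  refine HForm.ext fun k => ?_
  by_cases hk : k < 2 * (n + 1)
  · exact lefschetz_pow_apply_of_lt a (n + 1) k hk
  · exact h.eq_zero_of_lt (HForm.mem _) (by omega)

theorem IsFrame.dualLefschetz_pow (h : IsFrame σ e e') : dualLefschetz σ e e' ^ (n + 1) = 0 := by
  ext1 a
  refine HForm.ext fun k => ?_
  exact dualLefschetz_pow_apply e e' a (n + 1) k (h.eq_zero_of_lt a.mem (by omega))

theorem IsFrame.dualLefschetz_mul_hWedge (h : IsFrame σ e e') (v : W) :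
    dualLefschetz σ e e' * hWedge σ v = hWedge σ v * dualLefschetz σ e e' + hContract σ v := by
  ext1 a
  exact HForm.val_injective (h.frameContract_contract_wedge a.mem v)

theorem dualLefschetz_mul_hContract (v : W) :
    dualLefschetz σ e e' * hContract σ v = hContract σ v * dualLefschetz σ e e' := by
  ext1 a
  exact HForm.val_injective (contract_frameContract v _).symm

variable (σ e e') in
/-- The Weyl element acting on horizontal forms. -/
def weyl : Module.End ℝ (HForm σ) :=
  weylElement (n + 1) (lefschetz σ) (dualLefschetz σ e e')

/-- `ι(v)σ ∧ ·` and `ι(v)` form one of the two-dimensional representations to which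
`weylElement_mul` applies: the Weyl element exchanges multiplication and contraction, as a star
operator should. -/
theorem IsFrame.weyl_hWedge (h : IsFrame σ e e') (v : W) (a : HForm σ) :
    weyl σ e e' (hWedge σ v a) = hContract σ v (weyl σ e e' a) :=
  LinearMap.congr_fun (weylElement_mul h.lefschetz_pow h.dualLefschetz_pow (lefschetz_mul_hWedge v)
    (h.dualLefschetz_mul_hWedge v) (lefschetz_mul_hContract v) (dualLefschetz_mul_hContract v)) a

theorem IsFrame.weyl_hContract (h : IsFrame σ e e') (v : W) (a : HForm σ) :
    weyl σ e e' (hContract σ v a) = -hWedge σ v (weyl σ e e' a) :=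
  LinearMap.congr_fun (weylElement_mul' h.lefschetz_pow h.dualLefschetz_pow (lefschetz_mul_hWedge v)
    (h.dualLefschetz_mul_hWedge v) (lefschetz_mul_hContract v) (dualLefschetz_mul_hContract v)) a

theorem IsFrame.weyl_injective (h : IsFrame σ e e') : Function.Injective (weyl σ e e') := by
  have h1 : ∀ x : Module.End ℝ (HForm σ), x ^ (n + 1) = 0 →
      Function.Injective (truncExp (n + 1) x : Module.End ℝ (HForm σ)) := by
    intro x hx
    have hx' : (-x) ^ (n + 1) = 0 := by rw [neg_pow, hx, mul_zero]
    have := truncExp_mul_neg hx'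
    rw [neg_neg] at this
    exact Function.LeftInverse.injective fun a => LinearMap.congr_fun this a
  exact ((h1 _ h.lefschetz_pow).comp (h1 _ h.dualLefschetz_pow)).comp (h1 _ h.lefschetz_pow)

theorem hOne_apply_zero (v : Fin 0 → W) : (hOne σ : AltFamily W) 0 v = 1 := rfl

theorem hOne_apply_ne {k : ℕ} (hk : k ≠ 0) : (hOne σ : AltFamily W) k = 0 := by
  obtain ⟨k, rfl⟩ := Nat.exists_eq_succ_of_ne_zero hk
  rfl

theorem IsFrame.eq_zero_of_hWedge (h : IsFrame σ e e') {a : HForm σ}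
    (ha : ∀ v, hWedge σ v a = 0) {k : ℕ} (hk : k ≠ 2 * n) : (a : AltFamily W) k = 0 := by
  have h1 := h.sum_contract_wedge a.mem
  rw [Finset.sum_eq_zero fun i _ => by
    rw [← coe_hWedge, ha, HForm.coe_zero, map_zero]] at h1
  have h2 := congrFun h1 k
  rw [Pi.sub_apply, degree_apply, Pi.smul_apply, Pi.zero_apply] at h2
  have h3 : (((2 * n : ℕ) : ℝ) - k) • (a : AltFamily W) k = 0 := by
    have h5 : (((2 * n : ℕ) : ℝ) - k) • (a : AltFamily W) k =
      ((2 * n : ℕ) : ℝ) • (a : AltFamily W) k - (k : ℝ) • (a : AltFamily W) k := by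
      ext v
      exact sub_mul _ _ _
    rw [h5]
    exact h2.symm
  have h4 : ((2 * n : ℕ) : ℝ) - k = 0 ∨ (a : AltFamily W) k = 0 := smul_eq_zero.1 h3
  refine h4.resolve_left (sub_ne_zero.2 ?_)
  exact_mod_cast hk.symm

/-- Contractions kill 1, so multiplications kill its image. By the Euler identity from the top, this
image is a form of top degree. -/
theorem IsFrame.hWedge_weyl_one (h : IsFrame σ e e') (v : W) :
    hWedge σ v (weyl σ e e' (hOne σ)) = 0 := by
  rw [← neg_eq_zero, ← h.weyl_hContract v]
  have : hContract σ v (hOne σ) = 0 := HForm.val_injective (contract_one v)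
  rw [this, map_zero]

theorem IsFrame.weyl_one_apply_ne (h : IsFrame σ e e') {k : ℕ} (hk : k ≠ 2 * n) :
    (weyl σ e e' (hOne σ) : AltFamily W) k = 0 :=
  h.eq_zero_of_hWedge h.hWedge_weyl_one hk

theorem coe_truncExp_apply (N : ℕ) (x : Module.End ℝ (HForm σ)) (a : HForm σ) (k : ℕ) :
    (truncExp N x a : AltFamily W) k =
      ∑ i ∈ Finset.range (N + 1), (i ! : ℝ)⁻¹ • ((x ^ i) a : AltFamily W) k := by
  rw [truncExp, LinearMap.sum_apply, HForm.coe_sum, Finset.sum_apply]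
  rfl

theorem IsFrame.lefschetz_top (h : IsFrame σ e e') {a : HForm σ}
    (ha : ∀ k, k ≠ 2 * n → (a : AltFamily W) k = 0) : lefschetz σ a = 0 := by
  refine HForm.ext fun k => ?_
  by_cases hk : k = 2 * n + 2
  · exact h.eq_zero_of_lt (HForm.mem _) (by omega)
  · rw [HForm.coe_zero, Pi.zero_apply]
    simpa using lefschetz_pow_homogeneous a ha 1 k (by omega)

theorem truncExp_apply_of_eq_zero {V : Type*} [AddCommGroup V] [Module ℝ V] (N : ℕ)
    {x : Module.End ℝ V} {a : V} (h : x a = 0) : truncExp N x a = a := by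
  rw [truncExp, LinearMap.sum_apply, Finset.sum_range_succ', Finset.sum_eq_zero]
  · simp
  · intro i _
    rw [LinearMap.smul_apply, pow_succ, Module.End.mul_apply, h, map_zero, smul_zero]

theorem IsFrame.weyl_one_apply (h : IsFrame σ e e') :
    (weyl σ e e' (hOne σ) : AltFamily W) (2 * n) = (n ! : ℝ)⁻¹ • altPow σ n := by
  have hL' : (-lefschetz σ) ^ (n + 1) = 0 := by rw [neg_pow, h.lefschetz_pow, mul_zero]
  set u := truncExp (n + 1) (dualLefschetz σ e e') (truncExp (n + 1) (lefschetz σ) (hOne σ)) with hu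
  -- The image of 1 has top degree and is killed by `L`, so the outer factor `exp L` acts trivially.
  -- In `exp Λ exp L 1` the terms with a positive power of `Λ` come from degrees above `2 * n`, and
  -- only `L ^ n / n!` reaches degree `2 * n`.
  have h1 : u = weyl σ e e' (hOne σ) := by
    have h2 := LinearMap.congr_fun (truncExp_mul_neg hL') u
    rw [neg_neg, Module.End.mul_apply, Module.End.one_apply] at h2
    rw [← h2]
    refine truncExp_apply_of_eq_zero _ ?_
    rw [LinearMap.neg_apply]
    have h3 := h.lefschetz_top (fun k hk => h.weyl_one_apply_ne hk)
    exact neg_eq_zero.2 h3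
  rw [← h1, hu, coe_truncExp_apply, Finset.sum_range_succ', Finset.sum_eq_zero]
  · rw [zero_add, pow_zero, Module.End.one_apply, Nat.factorial_zero, Nat.cast_one, inv_one,
      one_smul, coe_truncExp_apply, Finset.sum_eq_single n, altPow_eq]
    · intro i _ hi
      rw [lefschetz_pow_homogeneous (hOne σ) (fun k hk => hOne_apply_ne hk) i _ (by omega),
        smul_zero]
    · intro hn
      exact absurd (Finset.mem_range.2 (by omega)) hn
  · intro i _
    rw [dualLefschetz_pow_apply e e' _ (i + 1) _ (h.eq_zero_of_lt (HForm.mem _) (by omega)),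
      smul_zero]

theorem IsFrame.smul_eq_sum (h : IsFrame σ e e') {p : ℕ} {a : HForm σ}
    (ha : ∀ k, k ≠ p → (a : AltFamily W) k = 0) :
    (p : ℝ) • a = ∑ i, hWedge σ (e i) (hContract σ (e' i) a) := by
  refine HForm.val_injective ?_
  rw [HForm.coe_sum]
  refine Eq.trans ?_ (h.euler a.mem).symm
  funext k
  rw [degree_apply]
  by_cases hk : k = p
  · subst hk; rfl
  · rw [ha k hk, smul_zero, HForm.coe_smul, Pi.smul_apply, ha k hk, smul_zero]

/-- The recursion that computes the Weyl element: write `(p + 1) a` by the Euler identity and let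
the Weyl element turn the multiplication with `ι(e i)σ` into the contraction with `e i`. -/
theorem IsFrame.smul_weyl (h : IsFrame σ e e') {p : ℕ} {a : HForm σ}
    (ha : ∀ k, k ≠ p + 1 → (a : AltFamily W) k = 0) :
    ((p + 1 : ℕ) : ℝ) • weyl σ e e' a =
      ∑ i, hContract σ (e i) (weyl σ e e' (hContract σ (e' i) a)) := by
  rw [← map_smul, h.smul_eq_sum ha, map_sum]
  exact Finset.sum_congr rfl fun i _ => h.weyl_hWedge _ _

theorem eq_smul_hOne {a : HForm σ} (ha : ∀ k, k ≠ 0 → (a : AltFamily W) k = 0) :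
    a = ((a : AltFamily W) 0 0) • hOne σ := by
  refine HForm.ext fun k => ?_
  rw [HForm.coe_smul, Pi.smul_apply]
  by_cases hk : k = 0
  · subst hk
    ext v
    rw [Subsingleton.elim v 0, ContinuousAlternatingMap.smul_apply]
    rw [hOne_apply_zero]
    exact (mul_one _).symm
  · rw [ha k hk, hOne_apply_ne hk, smul_zero]

theorem IsFrame.weyl_homogeneous (h : IsFrame σ e e') {p : ℕ} {a : HForm σ}
    (ha : ∀ k, k ≠ p → (a : AltFamily W) k = 0) :
    ∀ k, k + p ≠ 2 * n → (weyl σ e e' a : AltFamily W) k = 0 := by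
  induction p generalizing a with
  | zero =>
    intro k hk
    rw [eq_smul_hOne ha, map_smul, HForm.coe_smul, Pi.smul_apply, h.weyl_one_apply_ne (by omega),
      smul_zero]
  | succ p ih =>
    intro k hk
    have h1 := congrFun (congrArg HForm.val (h.smul_weyl ha)) k
    have h2 : ((p + 1 : ℕ) : ℝ) ≠ 0 := by positivity
    refine (smul_eq_zero.1 (h1.trans ?_)).resolve_left h2
    rw [HForm.coe_sum, Finset.sum_apply]
    refine Finset.sum_eq_zero fun i _ => ?_
    rw [coe_hContract]
    ext v
    rw [contract_apply, ih (a := hContract σ (e' i) a) (contract_homogeneous ha) (k + 1) (by omega)]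
    rfl

/-- The sign relating the Weyl element to the symplectic star operator. -/
def starSign (p : ℕ) : ℝ := (-1) ^ (p * (p - 1) / 2)

theorem starSign_zero : starSign 0 = 1 := by simp [starSign]

theorem starSign_succ (p : ℕ) : starSign (p + 1) = (-1) ^ p * starSign p := by
  rw [starSign, starSign, ← pow_add, Nat.triangle_succ, add_comm]

theorem IsFrame.contract_top (h : IsFrame σ e e') {a : AltFamily W} (ha : a ∈ horizontal σ) (v : W) :
    contract v a (2 * n) = 0 := by
  ext u
  rw [contract_apply, h.eq_zero_of_lt ha (by omega)]
  rfl

/-- The algebraic form of integration by parts: the product `b ∧ a` has no component above the top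
degree, so the top component of its contraction vanishes. -/
theorem IsFrame.wedge_contract_top (h : IsFrame σ e e') {p : ℕ} {a b : AltFamily W}
    (ha : a ∈ horizontal σ) (hb : b ∈ horizontal σ) (hb' : ∀ k, k ≠ p → b k = 0) (v : W) :
    (-1 : ℝ) ^ p • wedge b (contract v a) (2 * n) = -wedge (contract v b) a (2 * n) := by
  have h1 := h.contract_top (wedge_mem_horizontal hb ha) v
  rw [contract_wedge, parity_of_homogeneous hb', wedge_smul_left, Pi.add_apply] at h1
  exact eq_neg_of_add_eq_zero_right h1

/-- The pairing of forms computed in a frame. -/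
def framePairing {m : ℕ} (e e' : Fin m → W) {p : ℕ} (a b : W [⋀^Fin p]→L[ℝ] ℝ) : ℝ :=
  (p ! : ℝ)⁻¹ * ∑ s : Fin p → Fin m, a (fun i => e' (s i)) * b (fun i => e (s i))

theorem framePairing_succ {m : ℕ} (e e' : Fin m → W) (p : ℕ) (a b : AltFamily W) :
    ((p + 1 : ℕ) : ℝ) * framePairing e e' (a (p + 1)) (b (p + 1)) =
      ∑ i, framePairing e e' (contract (e' i) a p) (contract (e i) b p) := by
  simp only [framePairing]
  rw [← Finset.mul_sum, ← mul_assoc, Nat.factorial_succ, Nat.cast_mul, mul_inv, ← mul_assoc,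
    mul_inv_cancel₀ (by positivity), one_mul]
  congr 1
  rw [← (Fin.consEquiv fun _ : Fin (p + 1) => Fin m).sum_comp, Fintype.sum_prod_type]
  refine Finset.sum_congr rfl fun i _ => Finset.sum_congr rfl fun s _ => ?_
  rw [contract_apply, contract_apply]
  congr 2
  · funext j
    refine Fin.cases ?_ (fun j => ?_) j <;> simp [Fin.consEquiv]
  · funext j
    refine Fin.cases ?_ (fun j => ?_) j <;> simp [Fin.consEquiv]

/-- The defining property of the star, up to sign. By `IsFrame.smul_weyl` and integration by parts,
the left side reduces to forms of degree one less, contracted with `e' i` and `e i`; the pairing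
satisfies the same recursion. Each step contributes `(-1) ^ p`, and these signs accumulate to
`starSign`. -/
theorem IsFrame.wedge_weyl (h : IsFrame σ e e') {p : ℕ} {a b : HForm σ}
    (ha : ∀ k, k ≠ p → (a : AltFamily W) k = 0) (hb : ∀ k, k ≠ p → (b : AltFamily W) k = 0) :
    wedge b (weyl σ e e' a) (2 * n) =
      (starSign p * framePairing e e' ((a : AltFamily W) p) ((b : AltFamily W) p)) •
        (weyl σ e e' (hOne σ) : AltFamily W) (2 * n) := by
  induction p generalizing a b with
  | zero =>
    have hc : ∀ c : W [⋀^Fin 0]→L[ℝ] ℝ, ∀ v, c v = c 0 :=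
      fun c v => congrArg c (Subsingleton.elim _ _)
    have h1 : framePairing e e' ((a : AltFamily W) 0) ((b : AltFamily W) 0) =
        (a : AltFamily W) 0 0 * (b : AltFamily W) 0 0 := by
      rw [framePairing]
      simp only [hc ((a : AltFamily W) 0) (fun i => _), hc ((b : AltFamily W) 0) (fun i => _)]
      simp
    rw [h1, eq_smul_hOne ha, eq_smul_hOne hb, map_smul, HForm.coe_smul, HForm.coe_smul,
      wedge_smul_left, wedge_smul_right]
    change (_ • _ • wedge (one W) _) _ = _
    rw [one_wedge, starSign_zero, smul_smul, Pi.smul_apply]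
    simp only [HForm.coe_smul, Pi.smul_apply, ContinuousAlternatingMap.smul_apply,
      hOne_apply_zero, smul_eq_mul, mul_one, one_mul]
    rw [mul_comm ((a : AltFamily W) 0 0)]
  | succ p ih =>
    have hp : ((p + 1 : ℕ) : ℝ) ≠ 0 := by positivity
    have h1 : ∀ i, wedge b (hContract σ (e i) (weyl σ e e' (hContract σ (e' i) a))) (2 * n) =
        (starSign (p + 1) * framePairing e e' (contract (e' i) (a : AltFamily W) p)
          (contract (e i) (b : AltFamily W) p)) •
          (weyl σ e e' (hOne σ) : AltFamily W) (2 * n) := by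
      intro i
      have h2 := ih (a := hContract σ (e' i) a) (b := hContract σ (e i) b)
        (contract_homogeneous ha) (contract_homogeneous hb)
      have h3 := h.wedge_contract_top (weyl σ e e' (hContract σ (e' i) a)).mem b.mem hb (e i)
      rw [← coe_hContract, ← coe_hContract, h2] at h3
      have h4 := congrArg (fun x => (-1 : ℝ) ^ (p + 1) • x) h3
      simp only [smul_smul, ← mul_pow, mul_neg, mul_one, neg_neg, one_pow, one_smul] at h4
      rw [h4, starSign_succ, pow_succ, coe_hContract, coe_hContract]
      ext v
      simp only [ContinuousAlternatingMap.smul_apply, ContinuousAlternatingMap.neg_apply,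
        smul_eq_mul]
      ring
    have h5 : ((p + 1 : ℕ) : ℝ) • wedge b (weyl σ e e' a) (2 * n) = ((p + 1 : ℕ) : ℝ) •
      ((starSign (p + 1) * framePairing e e' ((a : AltFamily W) (p + 1)) ((b : AltFamily W) (p + 1))) •
        (weyl σ e e' (hOne σ) : AltFamily W) (2 * n)) := by
      rw [smul_smul, mul_left_comm, framePairing_succ, Finset.mul_sum, Finset.sum_smul,
        ← Finset.sum_congr rfl fun i _ => h1 i, ← Finset.sum_apply, ← wedge_sum_right,
        ← HForm.coe_sum, ← h.smul_weyl ha, HForm.coe_smul, wedge_smul_right, Pi.smul_apply]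
    exact smul_right_injective _ hp h5

theorem IsFrame.weyl_one_apply_top_ne_zero (h : IsFrame σ e e') :
    (weyl σ e e' (hOne σ) : AltFamily W) (2 * n) ≠ 0 := by
  intro h0
  have h1 : weyl σ e e' (hOne σ) = 0 := HForm.ext fun k => by
    by_cases hk : k = 2 * n
    · subst hk; exact h0
    · exact h.weyl_one_apply_ne hk
  have h2 := h.weyl_injective (h1.trans (map_zero _).symm)
  have h3 := hOne_apply_zero (σ := σ) 0
  rw [h2] at h3
  exact zero_ne_one h3

/-- Nondegeneracy of the exterior product into the top degree, which makes the star unique.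
Integration by parts passes the hypothesis on to every contraction of `c`; in degree 0 it is tested
against the volume form `weyl σ e e' (hOne σ)`. -/
theorem IsFrame.eq_zero_of_wedge (h : IsFrame σ e e') {p q : ℕ} (hpq : p + q = 2 * n)
    {c : HForm σ} (hc : ∀ k, k ≠ q → (c : AltFamily W) k = 0)
    (hw : ∀ b : HForm σ, (∀ k, k ≠ p → (b : AltFamily W) k = 0) → wedge (b : AltFamily W) (c : AltFamily W) (2 * n) = 0) :
    c = 0 := by
  induction q generalizing p c with
  | zero =>
    have h1 := hw (weyl σ e e' (hOne σ)) fun k hk => h.weyl_one_apply_ne (by omega)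
    rw [eq_smul_hOne hc, HForm.coe_smul, wedge_smul_right] at h1
    change (_ • wedge _ (one W)) _ = 0 at h1
    rw [wedge_one, Pi.smul_apply] at h1
    have h2 : (c : AltFamily W) 0 0 = 0 ∨ _ := smul_eq_zero.1 h1
    rw [eq_smul_hOne hc, h2.resolve_right h.weyl_one_apply_top_ne_zero, zero_smul]
  | succ q ih =>
    have h1 : ∀ v, hContract σ v c = 0 := by
      intro v
      refine ih (p := p + 1) (by omega) (contract_homogeneous hc) fun b hb => ?_
      have h2 := h.wedge_contract_top c.mem b.mem hb v
      rw [← coe_hContract, ← coe_hContract, hw (hContract σ v b) (contract_homogeneous hb),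
        neg_zero] at h2
      have h3 : (-1 : ℝ) ^ (p + 1) = 0 ∨ _ := smul_eq_zero.1 h2
      exact h3.resolve_left (by simp)
    refine HForm.val_injective (ext_contract ?_ fun v => ?_)
    · exact hc 0 (by omega)
    · rw [← coe_hContract, h1, HForm.coe_zero, map_zero]

theorem IsFrame.weyl_eq {f f' : Fin (2 * n) → W} (h : IsFrame σ e e') (h' : IsFrame σ f f') :
    weyl σ e e' = weyl σ f f' := by
  have : dualLefschetz σ e e' = dualLefschetz σ f f' := by
    ext1 a
    exact HForm.val_injective (h.frameContract_eq h' a.mem)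
  rw [weyl, weyl, this]

theorem IsFrame.symplecticPairing_eq (h : IsFrame σ e e') :
    ∃ f f' : Fin (2 * n) → W, IsFrame σ f f' ∧ ∀ (p : ℕ) (a b : W [⋀^Fin p]→L[ℝ] ℝ),
      symplecticPairing σ n a b = framePairing f f' a b := by
  have hex : ∃ f : (Fin (2 * n) → W) × (Fin (2 * n) → W), IsDualPair σ f.1 f.2 :=
    ⟨(e, e'), h.dual⟩
  refine ⟨hex.choose.1, hex.choose.2, h.of_dual hex.choose_spec, fun p a b => ?_⟩
  rw [symplecticPairing, dif_pos hex]
  rfl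

/-- `IsFrame.wedge_weyl` shows that the right side has the property by which the star was chosen,
and `IsFrame.eq_zero_of_wedge` that only one horizontal form has it. -/
theorem IsFrame.symplecticStar_eq (h : IsFrame σ e e') {p q : ℕ} (hpq : p + q = 2 * n)
    (a : HForm σ) (ha : ∀ k, k ≠ p → (a : AltFamily W) k = 0) :
    symplecticStar σ n hpq ((a : AltFamily W) p) =
      starSign p • (weyl σ e e' a : AltFamily W) q := by
  obtain ⟨f, f', hf, hB⟩ := h.symplecticPairing_eq
  rw [h.weyl_eq hf]
  have hom := hf.weyl_homogeneous ha
  have hs : starSign p * starSign p = 1 := by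
    rw [starSign, ← mul_pow]; simp
  have key : ∀ b : W [⋀^Fin p]→L[ℝ] ℝ, IsHorizontal σ b →
      altWedge hpq b (starSign p • (weyl σ f f' a : AltFamily W) q) =
        symplecticPairing σ n ((a : AltFamily W) p) b • ((n ! : ℝ)⁻¹ • altPow σ n) := by
    intro b hb
    have h1 := hf.wedge_weyl ha (b := HForm.mk (single p b) (single_mem_horizontal hb))
      (fun k hk => single_of_ne hk b)
    change wedge (single p b) _ _ = _ at h1
    rw [wedge_single hpq _ _ (fun k hk => single_of_ne hk b), single_same] at h1
    have h2 : (HForm.mk (single p b) (single_mem_horizontal hb) : AltFamily W) p = b :=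
      single_same p b
    rw [h2] at h1
    rw [altWedge_smul_right, h1, hB, hf.weyl_one_apply, smul_smul, ← mul_assoc, hs, one_mul]
  have hhor : IsHorizontal σ (starSign p • (weyl σ f f' a : AltFamily W) q) :=
    mem_horizontal_iff_isHorizontal.1 (starSign p • weyl σ f f' a).mem q
  have hc : ∃ c : W [⋀^Fin q]→L[ℝ] ℝ, IsHorizontal σ c ∧
      ∀ b : W [⋀^Fin p]→L[ℝ] ℝ, IsHorizontal σ b → altWedge hpq b c =
        symplecticPairing σ n ((a : AltFamily W) p) b • ((n ! : ℝ)⁻¹ • altPow σ n) :=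
    ⟨_, hhor, key⟩
  rw [symplecticStar, dif_pos hc]
  obtain ⟨hc1, hc2⟩ := hc.choose_spec
  set c := hc.choose
  rw [← sub_eq_zero]
  have hd : IsHorizontal σ (c - starSign p • (weyl σ f f' a : AltFamily W) q) := by
    intro v hv
    rw [ContinuousAlternatingMap.sub_apply, hc1 v hv, hhor v hv, sub_zero]
  have h3 := hf.eq_zero_of_wedge hpq (c := HForm.mk (single q _) (single_mem_horizontal hd))
    (fun k hk => single_of_ne hk _) (fun b hb => by
      rw [wedge_single hpq _ _ hb]
      have h2 : (HForm.mk (single q _) (single_mem_horizontal hd) : AltFamily W) q =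
        c - starSign p • (weyl σ f f' a : AltFamily W) q := single_same q _
      have hb' := mem_horizontal_iff_isHorizontal.1 b.mem p
      have h5 : c - starSign p • (weyl σ f f' a : AltFamily W) q =
          c + (-1 : ℝ) • (starSign p • (weyl σ f f' a : AltFamily W) q) := by
        ext v
        simp only [ContinuousAlternatingMap.sub_apply, ContinuousAlternatingMap.add_apply,
          ContinuousAlternatingMap.smul_apply, smul_eq_mul]
        ring
      rw [h2, h5, altWedge_add_right, hc2 _ hb', altWedge_smul_right, key _ hb']
      ext v
      simp only [ContinuousAlternatingMap.add_apply, ContinuousAlternatingMap.smul_apply,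
        smul_eq_mul]
      rw [neg_one_mul]
      exact add_neg_cancel _)
  have h4 := congrFun (congrArg HForm.val h3) q
  exact (single_same q _).symm.trans h4

/-- The component of degree `p` of a family of horizontal forms. -/
def HForm.component {σ : W [⋀^Fin 2]→L[ℝ] ℝ} (a : HForm σ) (p : ℕ) : HForm σ :=
  HForm.mk (single p ((a : AltFamily W) p))
    (single_mem_horizontal (mem_horizontal_iff_isHorizontal.1 a.mem p))

theorem HForm.component_same (a : HForm σ) (p : ℕ) :
    (a.component p : AltFamily W) p = (a : AltFamily W) p := single_same p _

theorem HForm.component_of_ne (a : HForm σ) {p k : ℕ} (h : k ≠ p) :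
    (a.component p : AltFamily W) k = 0 := single_of_ne h _

theorem IsFrame.sum_component (h : IsFrame σ e e') (a : HForm σ) :
    ∑ p ∈ Finset.range (2 * n + 1), a.component p = a := by
  refine HForm.ext fun k => ?_
  rw [HForm.coe_sum, Finset.sum_apply]
  by_cases hk : k < 2 * n + 1
  · rw [Finset.sum_eq_single k (fun p _ hp => a.component_of_ne hp.symm)
      (fun hk' => absurd (Finset.mem_range.2 hk) hk'), a.component_same]
  · rw [h.eq_zero_of_lt a.mem (by omega)]
    exact Finset.sum_eq_zero fun p hp =>
      a.component_of_ne (by have := Finset.mem_range.1 hp; omega)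

theorem IsFrame.linearMap_ext (h : IsFrame σ e e') {V : Type*} [AddCommGroup V] [Module ℝ V]
    {f g : HForm σ →ₗ[ℝ] V}
    (hfg : ∀ (p : ℕ) (a : HForm σ), (∀ k, k ≠ p → (a : AltFamily W) k = 0) → f a = g a) :
    f = g := by
  ext1 a
  rw [← h.sum_component a, map_sum, map_sum]
  exact Finset.sum_congr rfl fun p _ => hfg p _ fun k hk => a.component_of_ne hk

/-- Multiplication of the components of a family by scalars depending on the degree. -/
def scale (c : ℕ → ℝ) : AltFamily W →ₗ[ℝ] AltFamily W where
  toFun a := fun k => c k • a k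
  map_add' a b := by
    funext k; ext v
    exact mul_add _ _ _
  map_smul' r a := by
    funext k; ext v
    exact mul_left_comm _ _ _

theorem scale_apply (c : ℕ → ℝ) (a : AltFamily W) (k : ℕ) : scale c a k = c k • a k := rfl

theorem scale_mem_horizontal (c : ℕ → ℝ) {a : AltFamily W} (ha : a ∈ horizontal σ) :
    scale c a ∈ horizontal σ :=
  mem_horizontal_iff_isHorizontal.2 fun k v hv => by
    rw [scale_apply, ContinuousAlternatingMap.smul_apply,
      mem_horizontal_iff_isHorizontal.1 ha k v hv, smul_zero]

variable (σ) in
/-- Multiplication of the components of a family of horizontal forms by scalars depending on the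
degree. -/
def hScale (c : ℕ → ℝ) : Module.End ℝ (HForm σ) :=
  (scale c).restrict fun _ ha => scale_mem_horizontal c ha

theorem hScale_homogeneous (c : ℕ → ℝ) {p : ℕ} {a : HForm σ}
    (ha : ∀ k, k ≠ p → (a : AltFamily W) k = 0) : hScale σ c a = c p • a := by
  refine HForm.ext fun k => ?_
  change c k • (a : AltFamily W) k = c p • (a : AltFamily W) k
  by_cases hk : k = p
  · rw [hk]
  · rw [ha k hk, smul_zero, smul_zero]

theorem starSign_mul_self (p : ℕ) : starSign p * starSign p = 1 := by
  rw [starSign, ← mul_pow]; simp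

theorem starSign_add_two (p : ℕ) : starSign (p + 2) = -starSign p := by
  rw [starSign_succ, starSign_succ, pow_succ, ← mul_assoc, mul_assoc _ (-1 : ℝ), mul_comm (-1 : ℝ),
    ← mul_assoc, ← mul_pow]
  simp

/-- `starSign` changes sign under a shift by 2, so it suffices to treat `p = 0` and `p = 1`. -/
theorem starSign_of_add_eq {p q n : ℕ} (h : p + q = 2 * n) :
    starSign q = (-1) ^ n * ((-1) ^ p * starSign p) := by
  induction p using Nat.twoStepInduction generalizing n with
  | zero =>
    rw [zero_add] at h
    subst h
    rw [starSign_zero, pow_zero, mul_one, mul_one]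
    induction n with
    | zero => simp [starSign]
    | succ n ih => rw [mul_add, mul_one, starSign_add_two, ih, pow_succ]; ring
  | one =>
    obtain ⟨m, rfl⟩ : ∃ m, n = m + 1 := ⟨n - 1, by omega⟩
    obtain rfl : q = 2 * m + 1 := by omega
    clear h
    induction m with
    | zero => simp [starSign]
    | succ m ih =>
      rw [show 2 * (m + 1) + 1 = 2 * m + 1 + 2 by ring, starSign_add_two, ih, pow_succ _ (m + 1)]
      ring
  | more p ih _ =>
    obtain ⟨m, rfl⟩ : ∃ m, n = m + 1 := ⟨n - 1, by omega⟩
    rw [ih (n := m) (by omega), starSign_add_two, pow_succ, pow_add _ p]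
    ring

theorem IsFrame.hScale_starSign_mul_weyl (h : IsFrame σ e e') :
    hScale σ starSign * weyl σ e e' =
      (-1 : ℝ) ^ n • (weyl σ e e' * hScale σ (fun k => (-1) ^ k) * hScale σ starSign) := by
  refine h.linearMap_ext fun p a ha => ?_
  rw [LinearMap.smul_apply, Module.End.mul_apply, Module.End.mul_apply, Module.End.mul_apply,
    hScale_homogeneous _ ha, map_smul, hScale_homogeneous _ ha, map_smul, map_smul, smul_smul,
    smul_smul]
  by_cases hp : p ≤ 2 * n
  · rw [hScale_homogeneous (p := 2 * n - p) _ fun k hk => h.weyl_homogeneous ha k (by omega),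
      starSign_of_add_eq (p := p) (q := 2 * n - p) (n := n) (by omega)]
    congr 1
    ring
  · have : a = 0 := HForm.ext fun k => by
      by_cases hk : k = p
      · exact h.eq_zero_of_lt a.mem (by omega)
      · exact ha k hk
    rw [this, map_zero, map_zero, smul_zero]

theorem IsFrame.weyl_mul_parity (h : IsFrame σ e e') :
    weyl σ e e' * hScale σ (fun k => (-1) ^ k) = hScale σ (fun k => (-1) ^ k) * weyl σ e e' := by
  refine h.linearMap_ext fun p a ha => ?_
  rw [Module.End.mul_apply, Module.End.mul_apply, hScale_homogeneous _ ha, map_smul]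
  by_cases hp : p ≤ 2 * n
  · rw [hScale_homogeneous (p := 2 * n - p) _ fun k hk => h.weyl_homogeneous ha k (by omega)]
    congr 1
    obtain ⟨q, hq⟩ := Nat.exists_eq_add_of_le hp
    rw [hq, Nat.add_sub_cancel_left]
    have h1 : (-1 : ℝ) ^ p * (-1) ^ q = 1 := by rw [← pow_add, ← hq, pow_mul]; simp
    have h2 : (-1 : ℝ) ^ p * (-1) ^ p = 1 := by rw [← mul_pow]; simp
    exact mul_left_cancel₀ (pow_ne_zero p (by norm_num)) (h2.trans h1.symm)
  · have : a = 0 := HForm.ext fun k => by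
      by_cases hk : k = p
      · exact h.eq_zero_of_lt a.mem (by omega)
      · exact ha k hk
    rw [this, map_zero, map_zero, smul_zero]

theorem IsFrame.dualLefschetz_lefschetz (h : IsFrame σ e e') {p : ℕ} {a : HForm σ}
    (ha : ∀ k, k ≠ p → (a : AltFamily W) k = 0) :
    dualLefschetz σ e e' (lefschetz σ a) =
      lefschetz σ (dualLefschetz σ e e' a) + ((p : ℝ) - n) • a := by
  refine HForm.ext fun k => ?_
  have h1 := congrFun (h.frameContract_wedge a.mem) k
  refine h1.trans ?_
  ext v
  simp only [Pi.add_apply, Pi.sub_apply, Pi.smul_apply, degree_apply]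
  change _ = wedge (single 2 σ) (frameContract e e' a) k v + (((p : ℝ) - n) • (a : AltFamily W) k) v
  by_cases hk : k = p
  · subst hk
    simp only [ContinuousAlternatingMap.add_apply, ContinuousAlternatingMap.sub_apply,
      ContinuousAlternatingMap.smul_apply, smul_eq_mul]
    push_cast
    ring
  · simp [ha k hk]

/-- The `sl₂` string through 1, which is killed by `Λ` and has `[Λ, L]`-weight `-n`. -/
theorem IsFrame.dualLefschetz_lefschetz_pow (h : IsFrame σ e e') (k : ℕ) :
    dualLefschetz σ e e' ((lefschetz σ ^ (k + 1)) (hOne σ)) =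
      (((k : ℝ) + 1) * (k - n)) • (lefschetz σ ^ k) (hOne σ) := by
  have h0 : ∀ k, k ≠ 0 → (hOne σ : AltFamily W) k = 0 := fun k hk => hOne_apply_ne hk
  induction k with
  | zero =>
    rw [zero_add, pow_one, h.dualLefschetz_lefschetz h0, pow_zero, Module.End.one_apply]
    have : dualLefschetz σ e e' (hOne σ) = 0 := HForm.ext fun k =>
      dualLefschetz_apply e e' _ k (hOne_apply_ne (by omega))
    rw [this, map_zero, zero_add]
    congr 1
    push_cast
    ring
  | succ k ih =>
    rw [pow_succ', Module.End.mul_apply,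
      h.dualLefschetz_lefschetz (lefschetz_pow_homogeneous _ h0 (k + 1)), ih, map_smul,
      ← Module.End.mul_apply, ← pow_succ', ← add_smul]
    congr 1
    push_cast
    ring

theorem IsFrame.dualLefschetz_pow_lefschetz_pow (h : IsFrame σ e e') (k : ℕ) :
    (dualLefschetz σ e e' ^ k) ((lefschetz σ ^ k) (hOne σ)) =
      (∏ i ∈ Finset.range k, ((i : ℝ) + 1) * (i - n)) • hOne σ := by
  induction k with
  | zero => simp
  | succ k ih =>
    rw [pow_succ, Module.End.mul_apply, h.dualLefschetz_lefschetz_pow, map_smul, ih, smul_smul,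
      Finset.prod_range_succ, mul_comm]

theorem prod_range_mul_sub (n : ℕ) :
    ∏ i ∈ Finset.range n, ((i : ℝ) + 1) * (i - n) = (-1) ^ n * ((n ! : ℝ) * n !) := by
  have h1 : ∏ i ∈ Finset.range n, ((i : ℝ) + 1) = n ! := by
    rw [← Finset.prod_range_add_one_eq_factorial]
    push_cast
    rfl
  have h2 : ∏ i ∈ Finset.range n, ((i : ℝ) - n) = (-1) ^ n * n ! := by
    rw [← h1, ← Finset.prod_range_reflect, ← Finset.card_range n, ← Finset.prod_const,
      Finset.card_range, ← Finset.prod_mul_distrib]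
    refine Finset.prod_congr rfl fun i hi => ?_
    have := Finset.mem_range.1 hi
    rw [Nat.cast_sub (by omega), Nat.cast_sub (by omega)]
    push_cast
    ring
  rw [Finset.prod_mul_distrib, h1, h2]
  ring

/-- The first image is `σ ^ n / n!`, of top degree, so the inner `exp L` fixes it and the outer one
cannot reach degree 0. What is left in degree 0 is `Λ ^ n / n!` applied to `σ ^ n / n!`, and the
product of the string coefficients is `(-1) ^ n (n!) ^ 2`. -/
theorem IsFrame.weyl_weyl_hOne (h : IsFrame σ e e') :
    weyl σ e e' (weyl σ e e' (hOne σ)) = (-1 : ℝ) ^ n • hOne σ := by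
  have h0 : ∀ k, k ≠ 0 → (hOne σ : AltFamily W) k = 0 := fun k hk => hOne_apply_ne hk
  have hvol : weyl σ e e' (hOne σ) = (n ! : ℝ)⁻¹ • (lefschetz σ ^ n) (hOne σ) := by
    refine HForm.ext fun k => ?_
    rw [HForm.coe_smul, Pi.smul_apply]
    by_cases hk : k = 2 * n
    · subst hk
      rw [h.weyl_one_apply, altPow_eq]
    · rw [h.weyl_one_apply_ne hk, lefschetz_pow_homogeneous _ h0 n k (by omega), smul_zero]
  have htop : ∀ k, k ≠ 2 * n → (weyl σ e e' (hOne σ) : AltFamily W) k = 0 :=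
    fun k hk => h.weyl_one_apply_ne hk
  refine HForm.ext fun k => ?_
  rw [HForm.coe_smul, Pi.smul_apply]
  by_cases hk : k = 0
  · subst hk
    rw [weyl, weylElement, Module.End.mul_apply, Module.End.mul_apply]
    change (truncExp (n + 1) (lefschetz σ) (truncExp (n + 1) (dualLefschetz σ e e')
      (truncExp (n + 1) (lefschetz σ) (weyl σ e e' (hOne σ)))) : AltFamily W) 0 = _
    rw [truncExp_apply_of_eq_zero _ (h.lefschetz_top htop), coe_truncExp_apply,
      Finset.sum_range_succ', Finset.sum_eq_zero fun i _ => by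
        rw [lefschetz_pow_apply_of_lt _ _ _ (by omega), smul_zero],
      zero_add, pow_zero, Module.End.one_apply, Nat.factorial_zero, Nat.cast_one, inv_one, one_smul,
      coe_truncExp_apply, Finset.sum_eq_single n]
    · rw [hvol, map_smul, h.dualLefschetz_pow_lefschetz_pow, prod_range_mul_sub, smul_smul,
        HForm.coe_smul, Pi.smul_apply, smul_smul]
      congr 1
      have : (n ! : ℝ) ≠ 0 := by positivity
      field_simp
    · intro i _ hi
      rw [dualLefschetz_pow_apply e e' _ i 0 (htop _ (by omega)), smul_zero]
    · intro hn
      exact absurd (Finset.mem_range.2 (by omega)) hn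
  · rw [h.weyl_homogeneous htop k (by omega), hOne_apply_ne hk, smul_zero]

/-- The square anticommutes with every multiplication by `ι(v)σ` and every contraction, so by the
Euler identity it is determined by its value on 1, with one sign for each degree. -/
theorem IsFrame.weyl_mul_weyl (h : IsFrame σ e e') :
    weyl σ e e' * weyl σ e e' = (-1 : ℝ) ^ n • hScale σ (fun k => (-1) ^ k) := by
  refine h.linearMap_ext fun p a ha => ?_
  rw [LinearMap.smul_apply, hScale_homogeneous _ ha, Module.End.mul_apply, smul_smul]
  induction p generalizing a with
  | zero =>
    rw [eq_smul_hOne ha, map_smul, map_smul, h.weyl_weyl_hOne, pow_zero, mul_one, smul_comm]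
  | succ p ih =>
    have hp : ((p + 1 : ℕ) : ℝ) ≠ 0 := by positivity
    refine smul_right_injective _ hp ?_
    change ((p + 1 : ℕ) : ℝ) • weyl σ e e' (weyl σ e e' a) = ((p + 1 : ℕ) : ℝ) • _
    rw [← map_smul, h.smul_weyl ha, map_sum, smul_comm, h.smul_eq_sum ha, Finset.smul_sum]
    refine Finset.sum_congr rfl fun i _ => ?_
    rw [h.weyl_hContract, ih (hContract σ (e' i) a) (contract_homogeneous ha), map_smul, ← neg_smul]
    congr 1
    ring

/-- The Weyl element sends degree `2 * n - q` to degree `q`, so only that component of `a`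
contributes to component `q`. Above degree `2 * n` both sides are 0. -/
theorem IsFrame.star_eq (h : IsFrame σ e e') (a : HForm σ) (q : ℕ) :
    (if hq : q ≤ 2 * n then
      symplecticStar σ n (Nat.sub_add_cancel hq) ((a : AltFamily W) (2 * n - q)) else 0) =
      (weyl σ e e' (hScale σ starSign a) : AltFamily W) q := by
  split_ifs with hq
  · rw [← a.component_same (2 * n - q),
      h.symplecticStar_eq _ (a.component (2 * n - q)) fun k hk => a.component_of_ne hk]
    conv_rhs => rw [← h.sum_component a, map_sum, map_sum, HForm.coe_sum, Finset.sum_apply]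
    have hs : ∀ p, hScale σ starSign (a.component p) = starSign p • a.component p := fun p =>
      hScale_homogeneous _ fun k hk => a.component_of_ne hk
    rw [Finset.sum_eq_single (2 * n - q)]
    · rw [hs, map_smul]
      rfl
    · intro p _ hp
      rw [hs, map_smul, HForm.coe_smul, Pi.smul_apply,
        h.weyl_homogeneous (fun k hk => a.component_of_ne hk) q (by omega), smul_zero]
    · intro hn
      exact absurd (Finset.mem_range.2 (by omega)) hn
  · exact (h.eq_zero_of_lt (HForm.mem _) (by omega)).symm

end weyl

open scoped Classical in
/-- The contraction with the bivector inverse to `σ` (with kernel of codimension `2 * n`). -/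
def bivectorContract (σ : W [⋀^Fin 2]→L[ℝ] ℝ) (n : ℕ) : AltFamily W →ₗ[ℝ] AltFamily W :=
  if h : ∃ f : (Fin (2 * n) → W) × (Fin (2 * n) → W), IsDualPair σ f.1 f.2 then
    frameContract h.choose.1 h.choose.2
  else 0

theorem IsFrame.bivectorContract_eq {σ : W [⋀^Fin 2]→L[ℝ] ℝ} {n : ℕ} {e e' : Fin (2 * n) → W}
    (h : IsFrame σ e e') {a : AltFamily W} (ha : a ∈ horizontal σ) :
    bivectorContract σ n a = frameContract e e' a := by
  have hex : ∃ f : (Fin (2 * n) → W) × (Fin (2 * n) → W), IsDualPair σ f.1 f.2 :=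
    ⟨(e, e'), h.dual⟩
  rw [bivectorContract, dif_pos hex]
  exact (h.of_dual hex.choose_spec).frameContract_eq h ha

end AltFamily
end

/-! ### Calculus of differential forms on open sets of a vector space -/

noncomputable section

namespace AltFamily

variable {E : Type*} [NormedAddCommGroup E] [NormedSpace ℝ E]

/-- This crude bound makes the exterior product a continuous bilinear map, so that the product rule
for derivatives applies to it. -/
theorem norm_altWedge_le {p q k : ℕ} (h : p + q = k) (a : E [⋀^Fin p]→L[ℝ] ℝ)
    (b : E [⋀^Fin q]→L[ℝ] ℝ) :
    ‖altWedge h a b‖ ≤ ((p ! : ℝ) * (q ! : ℝ))⁻¹ * k ! * ‖a‖ * ‖b‖ := by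
  refine ContinuousAlternatingMap.opNorm_le_bound _ (by positivity) fun v => ?_
  subst h
  rw [altWedge_apply]
  have h1 : ∀ τ : Equiv.Perm (Fin (p + q)),
      ‖(Equiv.Perm.sign τ : ℝ) * (a (fun i => v (τ (Fin.cast rfl (Fin.castAdd q i)))) *
        b (fun i => v (τ (Fin.cast rfl (Fin.natAdd p i)))))‖ ≤ ‖a‖ * ‖b‖ * ∏ i, ‖v i‖ := by
    intro τ
    have hs : ‖(Equiv.Perm.sign τ : ℝ)‖ = 1 := by
      rcases Int.units_eq_one_or (Equiv.Perm.sign τ) with h | h <;> simp [h]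
    rw [norm_mul, hs, one_mul, norm_mul]
    refine (mul_le_mul (a.le_opNorm _) (b.le_opNorm _) (norm_nonneg _) (by positivity)).trans
      (le_of_eq ?_)
    rw [← Equiv.prod_comp τ (fun i => ‖v i‖), Fin.prod_univ_add]
    simp only [Fin.cast_eq_self]
    ring
  refine (norm_mul_le _ _).trans ?_
  rw [Real.norm_of_nonneg (by positivity)]
  have h2 := (norm_sum_le _ _).trans (Finset.sum_le_sum fun τ (_ : τ ∈ Finset.univ) => h1 τ)
  rw [Finset.sum_const, Finset.card_univ, Fintype.card_perm, Fintype.card_fin, nsmul_eq_mul] at h2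
  calc _ ≤ ((p ! : ℝ) * (q ! : ℝ))⁻¹ * (((p + q)! : ℝ) * (‖a‖ * ‖b‖ * ∏ i, ‖v i‖)) :=
        mul_le_mul_of_nonneg_left h2 (by positivity)
    _ = _ := by ring

section bilinear

variable {A B C : Type*} [NormedAddCommGroup A] [NormedSpace ℝ A] [NormedAddCommGroup B]
  [NormedSpace ℝ B] [NormedAddCommGroup C] [NormedSpace ℝ C]

theorem fderiv_bilin (L : A →L[ℝ] B →L[ℝ] C) {f : E → A} {g : E → B} {y : E}
    (hf : DifferentiableAt ℝ f y) (hg : DifferentiableAt ℝ g y) :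
    DifferentiableAt ℝ (fun z => L (f z) (g z)) y ∧ ∀ v,
      fderiv ℝ (fun z => L (f z) (g z)) y v = L (fderiv ℝ f y v) (g y) + L (f y) (fderiv ℝ g y v) := by
  have h := L.hasFDerivAt_of_bilinear hf.hasFDerivAt hg.hasFDerivAt
  refine ⟨h.differentiableAt, fun v => ?_⟩
  rw [h.fderiv, add_comm]
  rfl

theorem contDiffOn_bilin (L : A →L[ℝ] B →L[ℝ] C) {f : E → A} {g : E → B} {s : Set E}
    (hf : ContDiffOn ℝ ∞ f s) (hg : ContDiffOn ℝ ∞ g s) :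
    ContDiffOn ℝ ∞ (fun z => L (f z) (g z)) s :=
  (L.contDiff.comp_contDiffOn hf).clm_apply hg

end bilinear

/-- The exterior product as a continuous bilinear map. -/
def altWedgeL (E : Type*) [NormedAddCommGroup E] [NormedSpace ℝ E] {p q k : ℕ} (h : p + q = k) :
    (E [⋀^Fin p]→L[ℝ] ℝ) →L[ℝ] (E [⋀^Fin q]→L[ℝ] ℝ) →L[ℝ] (E [⋀^Fin k]→L[ℝ] ℝ) :=
  LinearMap.mkContinuous₂
    (LinearMap.mk₂ ℝ (altWedge h) (altWedge_add_left h) (altWedge_smul_left h)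
      (altWedge_add_right h) (fun c a b => altWedge_smul_right h c a b))
    (((p ! : ℝ) * (q ! : ℝ))⁻¹ * k !) (norm_altWedge_le h)

/-- Contraction as a continuous bilinear map. -/
def curryL (E : Type*) [NormedAddCommGroup E] [NormedSpace ℝ E] (k : ℕ) :
    (E [⋀^Fin (k + 1)]→L[ℝ] ℝ) →L[ℝ] E →L[ℝ] (E [⋀^Fin k]→L[ℝ] ℝ) :=
  ContinuousAlternatingMap.curryLeftLI.toContinuousLinearMap

/-- All components of the family of forms `u` are differentiable at `y`. -/
def DiffAt (u : E → AltFamily E) (y : E) : Prop := ∀ k, DifferentiableAt ℝ (fun z => u z k) y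

/-- All components of the family of forms `u` are smooth on `s`. -/
def SmoothOn (u : E → AltFamily E) (s : Set E) : Prop := ∀ k, ContDiffOn ℝ ∞ (fun z => u z k) s

/-- The directional derivative of a family of forms. -/
def dirDeriv (v : E) (u : E → AltFamily E) (y : E) : AltFamily E :=
  fun k => fderiv ℝ (fun z => u z k) y v

/-- The exterior derivative of a family of forms. -/
def extDer (u : E → AltFamily E) (y : E) : AltFamily E
  | 0 => 0
  | k + 1 => extDeriv (fun z => u z k) y

/-- The Lie derivative of a family of forms. -/
def lieDer (X : E → E) (u : E → AltFamily E) (y : E) : AltFamily E :=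
  extDer (fun z => contract (X z) (u z)) y + contract (X y) (extDer u y)

variable {u w : E → AltFamily E} {X Y : E → E} {s : Set E} {y : E}

theorem SmoothOn.diffAt (hu : SmoothOn u s) (hs : IsOpen s) (hy : y ∈ s) : DiffAt u y :=
  fun k => ((hu k).contDiffAt (hs.mem_nhds hy)).differentiableAt (by simp)

theorem DiffAt.contract (hu : DiffAt u y) (hX : DifferentiableAt ℝ X y) :
    DiffAt (fun z => contract (X z) (u z)) y := fun k => by
  exact (fderiv_bilin (A := E [⋀^Fin (k + 1)]→L[ℝ] ℝ) (B := E) (C := E [⋀^Fin k]→L[ℝ] ℝ)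
    (curryL E k) (hu (k + 1)) hX).1

theorem SmoothOn.contract (hu : SmoothOn u s) (hX : ContDiffOn ℝ ∞ X s) :
    SmoothOn (fun z => contract (X z) (u z)) s := fun k => by
  exact contDiffOn_bilin (A := E [⋀^Fin (k + 1)]→L[ℝ] ℝ) (B := E) (C := E [⋀^Fin k]→L[ℝ] ℝ)
    (curryL E k) (hu (k + 1)) hX

theorem dirDeriv_contract (v : E) (hu : DiffAt u y) (hX : DifferentiableAt ℝ X y) :
    dirDeriv v (fun z => contract (X z) (u z)) y =
      contract (X y) (dirDeriv v u y) + contract (fderiv ℝ X y v) (u y) := by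
  funext k
  exact (fderiv_bilin (A := E [⋀^Fin (k + 1)]→L[ℝ] ℝ) (B := E) (C := E [⋀^Fin k]→L[ℝ] ℝ)
    (curryL E k) (hu (k + 1)) hX).2 v

theorem dirDeriv_contract_const (v x : E) (hu : DiffAt u y) :
    dirDeriv v (fun z => contract x (u z)) y = contract x (dirDeriv v u y) := by
  rw [dirDeriv_contract v hu (differentiableAt_const x)]
  have : contract (fderiv ℝ (fun _ : E => x) y v) (u y) = 0 := by
    rw [fderiv_fun_const]
    have h := contract_smul_vec 0 (0 : E) (u y)
    rwa [zero_smul, zero_smul] at h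
  rw [this, add_zero]

theorem DiffAt.wedge (hu : DiffAt u y) (hw : DiffAt w y) :
    DiffAt (fun z => wedge (u z) (w z)) y := fun k => by
  refine DifferentiableAt.fun_sum fun pq _ => ?_
  exact (fderiv_bilin (A := E [⋀^Fin pq.1.1]→L[ℝ] ℝ) (B := E [⋀^Fin pq.1.2]→L[ℝ] ℝ)
    (C := E [⋀^Fin k]→L[ℝ] ℝ) (altWedgeL E (Finset.HasAntidiagonal.mem_antidiagonal.1 pq.2))
    (hu pq.1.1) (hw pq.1.2)).1

theorem SmoothOn.wedge (hu : SmoothOn u s) (hw : SmoothOn w s) :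
    SmoothOn (fun z => wedge (u z) (w z)) s := fun k => by
  refine ContDiffOn.sum fun pq _ => ?_
  exact contDiffOn_bilin (A := E [⋀^Fin pq.1.1]→L[ℝ] ℝ) (B := E [⋀^Fin pq.1.2]→L[ℝ] ℝ)
    (C := E [⋀^Fin k]→L[ℝ] ℝ) (altWedgeL E (Finset.HasAntidiagonal.mem_antidiagonal.1 pq.2))
    (hu pq.1.1) (hw pq.1.2)

theorem dirDeriv_wedge (v : E) (hu : DiffAt u y) (hw : DiffAt w y) :
    dirDeriv v (fun z => wedge (u z) (w z)) y =
      wedge (dirDeriv v u y) (w y) + wedge (u y) (dirDeriv v w y) := by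
  funext k
  have h1 : ∀ pq : {x // x ∈ Finset.HasAntidiagonal.antidiagonal k}, _ := fun pq =>
    fderiv_bilin (A := E [⋀^Fin pq.1.1]→L[ℝ] ℝ) (B := E [⋀^Fin pq.1.2]→L[ℝ] ℝ)
      (C := E [⋀^Fin k]→L[ℝ] ℝ) (altWedgeL E (Finset.HasAntidiagonal.mem_antidiagonal.1 pq.2))
      (hu pq.1.1) (hw pq.1.2)
  have h2 := fderiv_fun_sum (u := (Finset.HasAntidiagonal.antidiagonal k).attach)
    fun pq _ => (h1 pq).1
  have h3 : dirDeriv v (fun z => AltFamily.wedge (u z) (w z)) y k = _ :=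
    DFunLike.congr_fun h2 v
  rw [h3, Pi.add_apply, AltFamily.wedge, AltFamily.wedge, ← Finset.sum_add_distrib,
    sum_apply]
  exact Finset.sum_congr rfl fun pq _ => (h1 pq).2 v

theorem DiffAt.parity (hu : DiffAt u y) : DiffAt (fun z => parity (u z)) y :=
  fun k => (hu k).const_smul ((-1 : ℝ) ^ k)

theorem SmoothOn.parity (hu : SmoothOn u s) : SmoothOn (fun z => parity (u z)) s :=
  fun k => (hu k).const_smul ((-1 : ℝ) ^ k)

theorem extDer_parity :
    extDer (fun z => parity (u z)) y = -parity (extDer u y) := by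
  funext k
  cases k with
  | zero => exact (neg_eq_zero.2 (smul_zero _)).symm
  | succ k =>
    change extDeriv (fun z => (-1 : ℝ) ^ k • u z k) y = -((-1 : ℝ) ^ (k + 1) • extDeriv _ y)
    have h : extDeriv (fun z => (-1 : ℝ) ^ k • u z k) y = (-1 : ℝ) ^ k • extDeriv (fun z => u z k) y :=
      extDeriv_fun_smul ((-1 : ℝ) ^ k) (fun z => u z k)
    rw [h, pow_succ]
    ext v
    simp

theorem extDer_add (hu : DiffAt u y) (hw : DiffAt w y) :
    extDer (fun z => u z + w z) y = extDer u y + extDer w y := by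
  funext k
  cases k with
  | zero => exact (add_zero _).symm
  | succ k => exact extDeriv_fun_add (hu k) (hw k)

theorem extDer_smul (c : ℝ) : extDer (fun z => c • u z) y = c • extDer u y := by
  funext k
  cases k with
  | zero => exact (smul_zero c : c • (0 : E [⋀^Fin 0]→L[ℝ] ℝ) = 0).symm
  | succ k => exact extDeriv_fun_smul c (fun z => u z k)

theorem extDer_congr (h : ∀ k, (fun z => u z k) =ᶠ[nhds y] fun z => w z k) :
    extDer u y = extDer w y := by
  funext k
  cases k with
  | zero => rfl
  | succ k => exact (h k).extDeriv_eq

/-- Cartan's formula for a constant field, whose Lie derivative is the directional derivative. It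
singles out the first argument in the alternating sum that defines `extDeriv`, and it reduces
identities for `d` to a lower degree. -/
theorem contract_extDer (v : E) (hu : DiffAt u y) :
    contract v (extDer u y) = dirDeriv v u y - extDer (fun z => contract v (u z)) y := by
  funext k
  ext x
  rw [contract_apply, Pi.sub_apply, ContinuousAlternatingMap.sub_apply]
  change extDeriv (fun z => u z k) y _ = _
  rw [extDeriv_apply (hu k), Fin.sum_univ_succ]
  have h0 : fderiv ℝ (fun z => u z k (Fin.removeNth 0 (Matrix.vecCons v x))) y v =
      dirDeriv v u y k x := by
    rw [fderiv_continuousAlternatingMap_apply_const_apply (hu k)]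
    rfl
  have h1 : (-1 : ℤ) ^ ((0 : Fin (k + 1)) : ℕ) • fderiv ℝ
      (fun z => u z k (Fin.removeNth 0 (Matrix.vecCons v x))) y (Matrix.vecCons v x 0) =
      dirDeriv v u y k x := by
    rw [Fin.val_zero, pow_zero, one_smul]
    exact h0
  refine (congrArg₂ (· + ·) h1 rfl).trans ?_
  rw [sub_eq_add_neg]
  congr 1
  cases k with
  | zero => simp [extDer]
  | succ k =>
    change _ = -(extDeriv (fun z => contract v (u z) k) y x)
    have hd : DifferentiableAt ℝ (fun z => contract v (u z) k) y :=
      hu.contract (differentiableAt_const v) k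
    rw [extDeriv_apply hd, ← Finset.sum_neg_distrib]
    refine Finset.sum_congr rfl fun i _ => ?_
    have h2 : ∀ z, contract v (u z) k (i.removeNth x) =
        u z (k + 1) (Fin.removeNth i.succ (Matrix.vecCons v x)) := by
      intro z
      rw [contract_apply]
      congr 1
      funext j
      refine Fin.cases ?_ (fun j => ?_) j <;> simp [Fin.removeNth]
    simp only [h2]
    simp [pow_succ]

theorem extDer_wedge (hs : IsOpen s) (hu : SmoothOn u s) (hw : SmoothOn w s) (hy : y ∈ s) :
    extDer (fun z => wedge (u z) (w z)) y =
      wedge (extDer u y) (w y) + wedge (parity (u y)) (extDer w y) := by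
  funext k
  induction k generalizing u w with
  | zero =>
    rw [Pi.add_apply, wedge_apply_zero, wedge_apply_zero]
    change 0 = (0 : ℝ) • _ + _ • (0 : E [⋀^Fin 0]→L[ℝ] ℝ)
    rw [zero_smul, smul_zero, add_zero]
  | succ k ih =>
    refine succ_eq_of_contract fun v => ?_
    have hu' := hu.diffAt hs hy
    have hw' := hw.diffAt hs hy
    have huv : SmoothOn (fun z => AltFamily.contract v (u z)) s := hu.contract contDiffOn_const
    have hwv : SmoothOn (fun z => AltFamily.contract v (w z)) s := hw.contract contDiffOn_const
    have h1 : extDer (fun z => AltFamily.contract v (AltFamily.wedge (u z) (w z))) y =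
        extDer (fun z => AltFamily.wedge (AltFamily.contract v (u z)) (w z)) y +
        extDer (fun z => AltFamily.wedge (AltFamily.parity (u z)) (AltFamily.contract v (w z))) y := by
      rw [← extDer_add ((huv.diffAt hs hy).wedge hw') (hu'.parity.wedge (hwv.diffAt hs hy))]
      simp only [contract_wedge]
    rw [contract_extDer v (hu'.wedge hw'), h1, dirDeriv_wedge v hu' hw', map_add, contract_wedge,
      contract_wedge, contract_parity, contract_extDer v hu', contract_extDer v hw', Pi.sub_apply,
      Pi.add_apply (extDer _ y), ih huv hw, ih hu.parity hwv, parity_parity, extDer_parity]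
    simp only [wedge_sub_left, wedge_sub_right, wedge_neg_left, Pi.add_apply, Pi.sub_apply,
      Pi.neg_apply]
    abel

theorem SmoothOn.extDer (hs : IsOpen s) (hu : SmoothOn u s) : SmoothOn (extDer u) s := by
  intro k
  cases k with
  | zero => exact contDiffOn_const
  | succ k =>
    have h1 : ContDiffOn ℝ ∞ (fderiv ℝ fun z => u z k) s :=
      (hu k).fderiv_of_isOpen hs (by simp)
    exact (ContinuousAlternatingMap.alternatizeUncurryFinCLM ℝ E ℝ).contDiff.comp_contDiffOn h1

theorem extDer_extDer (hs : IsOpen s) (hu : SmoothOn u s) (hy : y ∈ s) :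
    extDer (extDer u) y = 0 := by
  funext k
  match k with
  | 0 => rfl
  | 1 =>
    -- The component of degree 0 of `extDer u` is 0 by definition, so here a constant is
    -- differentiated.
    change extDeriv (fun _ => (0 : E [⋀^Fin 0]→L[ℝ] ℝ)) y = 0
    rw [extDeriv, fderiv_fun_const]
    ext v
    simp [ContinuousAlternatingMap.alternatizeUncurryFin_apply]
  | k + 2 =>
    exact extDeriv_extDeriv_apply ((hu k).contDiffAt (hs.mem_nhds hy))
      (by simpa using WithTop.coe_le_coe.2 (le_top : (2 : ℕ∞) ≤ ⊤))

theorem contract_lieDer (v : E) (hs : IsOpen s) (hu : SmoothOn u s) (hX : ContDiffOn ℝ ∞ X s)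
    (hy : y ∈ s) : contract v (lieDer X u y) =
      lieDer X (fun z => contract v (u z)) y + contract (fderiv ℝ X y v) (u y) := by
  have hX' : DifferentiableAt ℝ X y :=
    (hX.contDiffAt (hs.mem_nhds hy)).differentiableAt (by simp)
  have hu' := hu.diffAt hs hy
  have huX := hu'.contract hX'
  have huv : SmoothOn (fun z => AltFamily.contract v (u z)) s := hu.contract contDiffOn_const
  have h1 : extDer (fun z => AltFamily.contract v (AltFamily.contract (X z) (u z))) y =
      -extDer (fun z => AltFamily.contract (X z) (AltFamily.contract v (u z))) y := by
    rw [← neg_one_smul ℝ (extDer _ y), ← extDer_smul]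
    refine congrArg (fun f => extDer f y) (funext fun z => ?_)
    exact (contract_contract v _ _).trans (neg_one_smul ℝ _).symm
  rw [lieDer, lieDer, map_add, contract_extDer v huX, h1, contract_contract v,
    contract_extDer v hu', dirDeriv_contract v hu' hX', map_sub]
  abel

/-- The coordinate formula: differentiate the coefficients along `X` and insert the derivative of
`X` into each slot in turn. The induction splits off the first argument by `contract_lieDer`. The
formula yields both the bracket relation below and the criterion for invariance under a flow. -/
theorem lieDer_apply (hs : IsOpen s) (hu : SmoothOn u s) (hX : ContDiffOn ℝ ∞ X s) (hy : y ∈ s)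
    (k : ℕ) (x : Fin k → E) : lieDer X u y k x = dirDeriv (X y) u y k x +
      ∑ i, u y k (Function.update x i (fderiv ℝ X y (x i))) := by
  induction k generalizing u with
  | zero =>
    rw [lieDer, contract_extDer _ (hu.diffAt hs hy)]
    simp only [Pi.add_apply, Pi.sub_apply, Finset.univ_eq_empty, Finset.sum_empty, add_zero]
    change ((0 : E [⋀^Fin 0]→L[ℝ] ℝ) + (_ - (0 : E [⋀^Fin 0]→L[ℝ] ℝ))) x = _
    rw [sub_zero, zero_add]
  | succ k ih =>
    have hx : x = Matrix.vecCons (x 0) (Matrix.vecTail x) := (Matrix.cons_head_tail x).symm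
    have huv : SmoothOn (fun z => AltFamily.contract (x 0) (u z)) s := hu.contract contDiffOn_const
    have h1 := DFunLike.congr_fun (congrFun (contract_lieDer (x 0) hs hu hX hy) k) (Matrix.vecTail x)
    rw [contract_apply, ← hx] at h1
    rw [h1, Pi.add_apply, ContinuousAlternatingMap.add_apply, ih huv,
      dirDeriv_contract_const _ _ (hu.diffAt hs hy), contract_apply, contract_apply, ← hx,
      Fin.sum_univ_succ, add_assoc, add_comm (Finset.sum _ _)]
    congr 2
    · congr 1
      funext j
      refine Fin.cases ?_ (fun j => ?_) j <;> simp [Matrix.vecTail]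
    · refine Finset.sum_congr rfl fun i _ => ?_
      rw [contract_apply]
      congr 1
      funext j
      refine Fin.cases ?_ (fun j => ?_) j
      · rw [Function.update_of_ne (Fin.succ_ne_zero i).symm]
        rfl
      · by_cases hj : j = i
        · subst hj; simp [Matrix.vecTail]
        · rw [Function.update_of_ne (fun h => hj (Fin.succ_injective _ h)), Matrix.cons_val_succ,
            Function.update_of_ne hj]
          rfl

/-- In the coordinate formula the slot filled by `Y` contributes the derivative of `X` along `Y`,
and differentiating `Y` itself contributes the derivative of `Y` along `X`; their difference is the
bracket. -/
theorem lieDer_contract (hs : IsOpen s) (hu : SmoothOn u s) (hX : ContDiffOn ℝ ∞ X s)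
    (hY : ContDiffOn ℝ ∞ Y s) (hy : y ∈ s) :
    lieDer X (fun z => contract (Y z) (u z)) y =
      contract (Y y) (lieDer X u y) + contract (VectorField.lieBracket ℝ X Y y) (u y) := by
  have hY' : DifferentiableAt ℝ Y y :=
    (hY.contDiffAt (hs.mem_nhds hy)).differentiableAt (by simp)
  rw [VectorField.lieBracket, sub_eq_add_neg, contract_add_vec, ← neg_one_smul ℝ (fderiv ℝ X y _),
    contract_smul_vec]
  funext k
  ext x
  rw [lieDer_apply hs (hu.contract hY) hX hy, dirDeriv_contract _ (hu.diffAt hs hy) hY',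
    Pi.add_apply, Pi.add_apply, Pi.add_apply, Pi.smul_apply, ContinuousAlternatingMap.add_apply,
    ContinuousAlternatingMap.add_apply, ContinuousAlternatingMap.add_apply,
    ContinuousAlternatingMap.smul_apply, contract_apply (Y y) (lieDer X u y),
    lieDer_apply hs hu hX hy, Fin.sum_univ_succ]
  have h1 : Function.update (Matrix.vecCons (Y y) x) 0 (fderiv ℝ X y (Matrix.vecCons (Y y) x 0)) =
      Matrix.vecCons (fderiv ℝ X y (Y y)) x := by
    funext j
    refine Fin.cases ?_ (fun j => ?_) j <;> simp
  have h2 : ∀ i, Function.update (Matrix.vecCons (Y y) x) i.succ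
      (fderiv ℝ X y (Matrix.vecCons (Y y) x i.succ)) =
      Matrix.vecCons (Y y) (Function.update x i (fderiv ℝ X y (x i))) := by
    intro i
    funext j
    refine Fin.cases ?_ (fun j => ?_) j
    · rw [Function.update_of_ne (Fin.succ_ne_zero i).symm]
      rfl
    · by_cases hj : j = i
      · subst hj; simp
      · rw [Function.update_of_ne (fun h => hj (Fin.succ_injective _ h)), Matrix.cons_val_succ,
          Matrix.cons_val_succ, Function.update_of_ne hj]
  simp only [h1, h2, contract_apply]
  rw [smul_eq_mul]
  ring

end AltFamily
end

/-! ### Forms in charts, and the independence of `d` of the chart -/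

noncomputable section

set_option linter.unusedSectionVars false

section Charts

variable {E : Type*} [NormedAddCommGroup E] [NormedSpace ℝ E]
  {M : Type*} [TopologicalSpace M] [ChartedSpace E M]

/-- The derivative of the inverse of the chart around `x₀`. -/
def chartMap (x₀ : M) (y : E) :
    E →L[ℝ] TangentSpace 𝓘(ℝ, E) ((extChartAt 𝓘(ℝ, E) x₀).symm y) :=
  (mfderiv 𝓘(ℝ, E) 𝓘(ℝ, E) (extChartAt 𝓘(ℝ, E) x₀).symm y).comp
    ((NormedSpace.fromTangentSpace (𝕜 := ℝ) y).symm : E →L[ℝ] TangentSpace 𝓘(ℝ, E) y)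

/-- The derivative of the chart around `x₀`. -/
def chartInv (x₀ x : M) : TangentSpace 𝓘(ℝ, E) x →L[ℝ] E :=
  (NormedSpace.fromTangentSpace (𝕜 := ℝ) (extChartAt 𝓘(ℝ, E) x₀ x) :
        TangentSpace 𝓘(ℝ, E) (extChartAt 𝓘(ℝ, E) x₀ x) →L[ℝ] E).comp
      (mfderiv 𝓘(ℝ, E) 𝓘(ℝ, E) (extChartAt 𝓘(ℝ, E) x₀) x)

theorem chartExpr_eq (x₀ : M) {k : ℕ} (a : FormField E M k) (y : E) :
    chartExpr x₀ a y = (a ((extChartAt 𝓘(ℝ, E) x₀).symm y)).compContinuousLinearMap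
      (chartMap x₀ y) := rfl

theorem extD_eq {k : ℕ} (a : FormField E M k) (x : M) :
    extD a x = (extDeriv (chartExpr x a) (extChartAt 𝓘(ℝ, E) x x)).compContinuousLinearMap
      (chartInv x x) := rfl

namespace Forms

/-- The family of forms at a point. -/
def at' (a : Forms E M) (x : M) : AltFamily (TangentSpace 𝓘(ℝ, E) x) := fun k => a k x

/-- The expression of a family of forms in the chart around `x₀`. -/
def chartFam (x₀ : M) (a : Forms E M) (y : E) : AltFamily E := fun k => chartExpr x₀ (a k) y

theorem chartFam_eq (x₀ : M) (a : Forms E M) (y : E) :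
    chartFam x₀ a y = AltFamily.comap (chartMap x₀ y) (a.at' _) := rfl

end Forms

variable [IsManifold 𝓘(ℝ, E) ∞ M]

theorem mdifferentiableAt_chart_symm {x₀ : M} {y : E} (hy : y ∈ (extChartAt 𝓘(ℝ, E) x₀).target) :
    MDifferentiableAt 𝓘(ℝ, E) 𝓘(ℝ, E) (extChartAt 𝓘(ℝ, E) x₀).symm y :=
  ((contMDiffOn_extChartAt_symm (n := ∞) x₀).contMDiffAt
    ((isOpen_extChartAt_target x₀).mem_nhds hy)).mdifferentiableAt (by simp)

theorem mdifferentiableAt_chart {x₀ x : M} (hx : x ∈ (extChartAt 𝓘(ℝ, E) x₀).source) :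
    MDifferentiableAt 𝓘(ℝ, E) 𝓘(ℝ, E) (extChartAt 𝓘(ℝ, E) x₀) x :=
  (contMDiffAt_extChartAt' (n := ∞) (by simpa using hx)).mdifferentiableAt (by simp)

/-- The derivative of a map in charts. -/
theorem chartInv_mfderiv_chartMap {x₀ x₁ : M} {f : M → M} {y : E}
    (hy : y ∈ (extChartAt 𝓘(ℝ, E) x₀).target)
    (hf : MDifferentiableAt 𝓘(ℝ, E) 𝓘(ℝ, E) f ((extChartAt 𝓘(ℝ, E) x₀).symm y))
    (hx : f ((extChartAt 𝓘(ℝ, E) x₀).symm y) ∈ (extChartAt 𝓘(ℝ, E) x₁).source) (v : E) :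
    chartInv x₁ _ (mfderiv 𝓘(ℝ, E) 𝓘(ℝ, E) f _ (chartMap x₀ y v)) =
      fderiv ℝ (fun z => extChartAt 𝓘(ℝ, E) x₁ (f ((extChartAt 𝓘(ℝ, E) x₀).symm z))) y v := by
  rw [← mfderiv_eq_fderiv]
  have h1 := mdifferentiableAt_chart_symm hy
  have h2 := mdifferentiableAt_chart hx
  have h3 : mfderiv 𝓘(ℝ, E) 𝓘(ℝ, E)
      (fun z => extChartAt 𝓘(ℝ, E) x₁ (f ((extChartAt 𝓘(ℝ, E) x₀).symm z))) y =
      (mfderiv 𝓘(ℝ, E) 𝓘(ℝ, E) (extChartAt 𝓘(ℝ, E) x₁) _).comp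
        ((mfderiv 𝓘(ℝ, E) 𝓘(ℝ, E) f _).comp
          (mfderiv 𝓘(ℝ, E) 𝓘(ℝ, E) (extChartAt 𝓘(ℝ, E) x₀).symm y)) := by
    rw [← mfderiv_comp y hf h1]
    exact mfderiv_comp y h2 (hf.comp y h1)
  rw [h3]
  rfl

theorem chartInv_chartMap {x₀ : M} {y : E} (hy : y ∈ (extChartAt 𝓘(ℝ, E) x₀).target) (v : E) :
    chartInv x₀ _ (chartMap x₀ y v) = v := by
  have h1 := chartInv_mfderiv_chartMap (x₀ := x₀) (x₁ := x₀) (f := id) hy mdifferentiableAt_id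
    ((extChartAt 𝓘(ℝ, E) x₀).map_target hy) v
  rw [mfderiv_id] at h1
  refine h1.trans ?_
  have h2 : (fun z => extChartAt 𝓘(ℝ, E) x₀ (id ((extChartAt 𝓘(ℝ, E) x₀).symm z))) =ᶠ[nhds y] id := by
    filter_upwards [(isOpen_extChartAt_target x₀).mem_nhds hy] with z hz
    exact (extChartAt 𝓘(ℝ, E) x₀).right_inv hz
  rw [h2.fderiv_eq, fderiv_id]
  rfl

/-- Both spaces are `E`, and an injective endomorphism of a finite-dimensional space is surjective,
so the left inverse is also a right inverse. -/
theorem chartMap_chartInv [FiniteDimensional ℝ E] {x₀ : M} {y : E}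
    (hy : y ∈ (extChartAt 𝓘(ℝ, E) x₀).target)
    (v : TangentSpace 𝓘(ℝ, E) ((extChartAt 𝓘(ℝ, E) x₀).symm y)) :
    chartMap x₀ y (chartInv x₀ _ v) = v := by
  let T : E →ₗ[ℝ] E := (chartMap x₀ y).toLinearMap
  have h1 : Function.Injective T :=
    Function.LeftInverse.injective (g := chartInv x₀ _) (chartInv_chartMap hy)
  obtain ⟨w, hw⟩ := LinearMap.surjective_of_injective h1 v
  have hw' : chartMap x₀ y w = v := hw
  rw [← hw', chartInv_chartMap hy w]

theorem exists_chart_symm_eq {x₀ x : M} (hx : x ∈ (extChartAt 𝓘(ℝ, E) x₀).source) :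
    ∃ y ∈ (extChartAt 𝓘(ℝ, E) x₀).target, (extChartAt 𝓘(ℝ, E) x₀).symm y = x :=
  ⟨_, (extChartAt 𝓘(ℝ, E) x₀).map_source hx, (extChartAt 𝓘(ℝ, E) x₀).left_inv hx⟩

variable [FiniteDimensional ℝ E]

theorem eq_chartExpr_comp {x₀ x : M} (hx : x ∈ (extChartAt 𝓘(ℝ, E) x₀).source) {k : ℕ}
    (a : FormField E M k) : a x =
      (chartExpr x₀ a (extChartAt 𝓘(ℝ, E) x₀ x)).compContinuousLinearMap (chartInv x₀ x) := by
  obtain ⟨y, hy, rfl⟩ := exists_chart_symm_eq hx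
  rw [(extChartAt 𝓘(ℝ, E) x₀).right_inv hy, chartExpr_eq]
  ext v
  change _ = a _ (fun i => chartMap x₀ y (chartInv x₀ _ (v i)))
  simp only [chartMap_chartInv hy]

theorem Forms.ext_chart {a b : Forms E M}
    (h : ∀ x, Forms.chartFam x a (extChartAt 𝓘(ℝ, E) x x) =
      Forms.chartFam x b (extChartAt 𝓘(ℝ, E) x x)) : a = b := by
  funext k x
  rw [eq_chartExpr_comp (mem_extChartAt_source x) (a k),
    eq_chartExpr_comp (mem_extChartAt_source x) (b k)]
  exact congrArg (fun c => ContinuousAlternatingMap.compContinuousLinearMap c _) (congrFun (h x) k)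

theorem chartExpr_pullback {x₀ x₁ : M} {f : M → M} {y : E}
    (hy : y ∈ (extChartAt 𝓘(ℝ, E) x₀).target)
    (hf : MDifferentiableAt 𝓘(ℝ, E) 𝓘(ℝ, E) f ((extChartAt 𝓘(ℝ, E) x₀).symm y))
    (hx : f ((extChartAt 𝓘(ℝ, E) x₀).symm y) ∈ (extChartAt 𝓘(ℝ, E) x₁).source) (a : Forms E M)
    (k : ℕ) : chartExpr x₀ (Forms.pullback f a k) y =
      (chartExpr x₁ (a k)
        (extChartAt 𝓘(ℝ, E) x₁ (f ((extChartAt 𝓘(ℝ, E) x₀).symm y)))).compContinuousLinearMap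
      (fderiv ℝ (fun z => extChartAt 𝓘(ℝ, E) x₁ (f ((extChartAt 𝓘(ℝ, E) x₀).symm z))) y) := by
  ext v
  change a k (f _) (fun i => mfderiv 𝓘(ℝ, E) 𝓘(ℝ, E) f _ (chartMap x₀ y (v i))) = _
  rw [eq_chartExpr_comp hx (a k)]
  change chartExpr x₁ (a k) _ (fun i => chartInv x₁ _ (mfderiv 𝓘(ℝ, E) 𝓘(ℝ, E) f _ (chartMap x₀ y (v i)))) = _
  simp only [chartInv_mfderiv_chartMap hy hf hx]
  rfl

theorem contDiffAt_chart_comp {x₀ x₁ : M} {f : M → M} {y : E}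
    (hy : y ∈ (extChartAt 𝓘(ℝ, E) x₀).target)
    (hf : ContMDiff 𝓘(ℝ, E) 𝓘(ℝ, E) ∞ f)
    (hx : f ((extChartAt 𝓘(ℝ, E) x₀).symm y) ∈ (extChartAt 𝓘(ℝ, E) x₁).source) :
    ContDiffAt ℝ ∞ (fun z => extChartAt 𝓘(ℝ, E) x₁ (f ((extChartAt 𝓘(ℝ, E) x₀).symm z))) y := by
  rw [← contMDiffAt_iff_contDiffAt]
  have h1 := (contMDiffOn_extChartAt_symm (I := 𝓘(ℝ, E)) (n := ∞) x₀).contMDiffAt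
    ((isOpen_extChartAt_target x₀).mem_nhds hy)
  have h2 : ContMDiffAt 𝓘(ℝ, E) 𝓘(ℝ, E) ∞ (extChartAt 𝓘(ℝ, E) x₁)
      (f ((extChartAt 𝓘(ℝ, E) x₀).symm y)) := contMDiffAt_extChartAt' (by simpa using hx)
  exact h2.comp y (hf.contMDiffAt.comp y h1)

theorem eventually_mem_chart {x₀ x₁ : M} {f : M → M} {y : E}
    (hy : y ∈ (extChartAt 𝓘(ℝ, E) x₀).target) (hf : Continuous f)
    (hx : f ((extChartAt 𝓘(ℝ, E) x₀).symm y) ∈ (extChartAt 𝓘(ℝ, E) x₁).source) :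
    ∀ᶠ z in nhds y, z ∈ (extChartAt 𝓘(ℝ, E) x₀).target ∧
      f ((extChartAt 𝓘(ℝ, E) x₀).symm z) ∈ (extChartAt 𝓘(ℝ, E) x₁).source := by
  have h1 : ContinuousAt (extChartAt 𝓘(ℝ, E) x₀).symm y :=
    (continuousOn_extChartAt_symm x₀).continuousAt ((isOpen_extChartAt_target x₀).mem_nhds hy)
  have h2 : ContinuousAt (fun z => f ((extChartAt 𝓘(ℝ, E) x₀).symm z)) y := hf.continuousAt.comp h1
  exact (Filter.eventually_of_mem ((isOpen_extChartAt_target x₀).mem_nhds hy) fun _ h => h).and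
    (h2 ((isOpen_extChartAt_source x₁).mem_nhds hx))

/-- Near `y`, the chart expression of the pullback is the pullback of the chart expression under the
coordinate representation of `f`, so naturality of `extDeriv` on vector spaces applies. -/
theorem extDeriv_chartExpr_pullback {x₀ x₁ : M} {f : M → M} {y : E}
    (hy : y ∈ (extChartAt 𝓘(ℝ, E) x₀).target)
    (hf : ContMDiff 𝓘(ℝ, E) 𝓘(ℝ, E) ∞ f)
    (hx : f ((extChartAt 𝓘(ℝ, E) x₀).symm y) ∈ (extChartAt 𝓘(ℝ, E) x₁).source) {a : Forms E M}
    {k : ℕ} (ha : IsSmoothForm (a k)) : extDeriv (chartExpr x₀ (Forms.pullback f a k)) y =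
      (extDeriv (chartExpr x₁ (a k))
        (extChartAt 𝓘(ℝ, E) x₁ (f ((extChartAt 𝓘(ℝ, E) x₀).symm y)))).compContinuousLinearMap
      (fderiv ℝ (fun z => extChartAt 𝓘(ℝ, E) x₁ (f ((extChartAt 𝓘(ℝ, E) x₀).symm z))) y) := by
  have h1 : chartExpr x₀ (Forms.pullback f a k) =ᶠ[nhds y] fun z =>
      (chartExpr x₁ (a k)
        (extChartAt 𝓘(ℝ, E) x₁ (f ((extChartAt 𝓘(ℝ, E) x₀).symm z)))).compContinuousLinearMap
      (fderiv ℝ (fun z => extChartAt 𝓘(ℝ, E) x₁ (f ((extChartAt 𝓘(ℝ, E) x₀).symm z))) z) := by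
    filter_upwards [eventually_mem_chart hy hf.continuous hx] with z hz
    exact chartExpr_pullback hz.1 (hf.mdifferentiableAt (by simp)) hz.2 a k
  rw [h1.extDeriv_eq]
  refine extDeriv_pullback (r := ∞) ?_ (contDiffAt_chart_comp hy hf hx)
    (by simpa using WithTop.coe_le_coe.2 (le_top : (2 : ℕ∞) ≤ ⊤))
  exact ((ha x₁).contDiffAt ((isOpen_extChartAt_target x₁).mem_nhds
    ((extChartAt 𝓘(ℝ, E) x₁).map_source hx))).differentiableAt (by simp)

theorem Forms.pullback_id (a : Forms E M) : Forms.pullback id a = a := by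
  funext k x
  rw [Forms.pullback, mfderiv_id]
  rfl

/-- `extD` uses a different chart at each point. The comparison of two charts is naturality under
the identity map, read in one chart on each side. -/
theorem chartExpr_extD {x₀ : M} {y : E} (hy : y ∈ (extChartAt 𝓘(ℝ, E) x₀).target) {k : ℕ}
    {a : FormField E M k} (ha : IsSmoothForm a) :
    chartExpr x₀ (extD a) y = extDeriv (chartExpr x₀ a) y := by
  obtain ⟨b, rfl⟩ : ∃ b : Forms E M, b k = a := ⟨Function.update 0 k a, Function.update_self ..⟩
  set x := (extChartAt 𝓘(ℝ, E) x₀).symm y with hx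
  have h1 := extDeriv_chartExpr_pullback (x₁ := x) (f := id) hy contMDiff_id
    (mem_extChartAt_source x) ha
  rw [Forms.pullback_id] at h1
  rw [h1, chartExpr_eq, ← hx, extD_eq]
  ext v
  have h2 : ∀ v, chartInv x x (chartMap x₀ y v) =
      fderiv ℝ (fun z => extChartAt 𝓘(ℝ, E) x (id ((extChartAt 𝓘(ℝ, E) x₀).symm z))) y v := by
    intro v
    have h := chartInv_mfderiv_chartMap (x₀ := x₀) (x₁ := x) (f := id) hy mdifferentiableAt_id
      (mem_extChartAt_source x) v
    rw [mfderiv_id] at h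
    exact h
  change extDeriv (chartExpr x (b k)) _ (fun i => chartInv x x (chartMap x₀ y (v i))) = _
  simp only [h2]
  rfl

namespace Forms

theorem chartFam_d {x₀ : M} {y : E} (hy : y ∈ (extChartAt 𝓘(ℝ, E) x₀).target)
    {a : Forms E M} (ha : ∀ k, IsSmoothForm (a k)) :
    chartFam x₀ (d a) y = AltFamily.extDer (chartFam x₀ a) y := by
  funext k
  cases k with
  | zero => rfl
  | succ k => exact chartExpr_extD hy (ha k)

theorem d_pullback {f : M → M} (hf : ContMDiff 𝓘(ℝ, E) 𝓘(ℝ, E) ∞ f) {a : Forms E M}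
    (ha : ∀ k, IsSmoothForm (a k)) : d (pullback f a) = pullback f (d a) := by
  funext k
  cases k with
  | zero => rfl
  | succ k =>
    funext x
    change extD (pullback f a k) x = (extD (a k) (f x)).compContinuousLinearMap _
    have hy := mem_extChartAt_target (I := 𝓘(ℝ, E)) x
    have hfx : f ((extChartAt 𝓘(ℝ, E) x).symm (extChartAt 𝓘(ℝ, E) x x)) ∈
        (extChartAt 𝓘(ℝ, E) (f x)).source := by
      rw [extChartAt_to_inv]; exact mem_extChartAt_source _
    have h1 := eq_chartExpr_comp (mem_extChartAt_source x) (pullback f (d a) (k + 1))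
    rw [chartExpr_pullback hy (hf.mdifferentiableAt (by simp)) hfx] at h1
    refine Eq.trans ?_ h1.symm
    rw [extD_eq, extDeriv_chartExpr_pullback hy hf hfx (ha k)]
    change _ = ((chartExpr (f x) (extD (a k)) _).compContinuousLinearMap _).compContinuousLinearMap _
    rw [chartExpr_extD ((extChartAt 𝓘(ℝ, E) (f x)).map_source hfx) (ha k)]

end Forms

end Charts
end

/-! ### Cartan calculus for forms on a manifold -/

noncomputable section

set_option linter.unusedSectionVars false

section FormAlgebra

variable {E : Type*} [NormedAddCommGroup E] [NormedSpace ℝ E]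
  {M : Type*} [TopologicalSpace M] [ChartedSpace E M]

namespace Forms

/-- A family of forms is smooth if all its components are. -/
def IsSmooth (a : Forms E M) : Prop := ∀ k, IsSmoothForm (a k)

/-- The grade involution, `(-1) ^ k` in degree `k`. -/
def parity (a : Forms E M) : Forms E M := fun k => (-1 : ℝ) ^ k • a k

theorem ext_at {a b : Forms E M} (h : ∀ x, a.at' x = b.at' x) : a = b := by
  funext k x
  exact congrFun (h x) k

theorem at_smul (c : ℝ) (a : Forms E M) (x : M) : (c • a).at' x = c • a.at' x := rfl
theorem at_wedge (a b : Forms E M) (x : M) : (wedge a b).at' x = AltFamily.wedge (a.at' x) (b.at' x) :=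
  rfl
theorem at_parity (a : Forms E M) (x : M) : (parity a).at' x = AltFamily.parity (a.at' x) := rfl
theorem at_interior (X : (x : M) → TangentSpace 𝓘(ℝ, E) x) (a : Forms E M) (x : M) :
    (interior X a).at' x = AltFamily.contract (X x) (a.at' x) := rfl
theorem at_one (x : M) : (one : Forms E M).at' x = AltFamily.one _ := by
  funext k
  cases k <;> rfl
theorem at_pullback (f : M → M) (a : Forms E M) (x : M) :
    (pullback f a).at' x = AltFamily.comap (mfderiv 𝓘(ℝ, E) 𝓘(ℝ, E) f x) (a.at' (f x)) := rfl

theorem isSmooth_iff {a : Forms E M} : a.IsSmooth ↔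
    ∀ x₀, AltFamily.SmoothOn (chartFam x₀ a) (extChartAt 𝓘(ℝ, E) x₀).target :=
  ⟨fun h x₀ k => h k x₀, fun h k x₀ => h x₀ k⟩

theorem chartFam_wedge (x₀ : M) (a b : Forms E M) (y : E) : chartFam x₀ (wedge a b) y =
    AltFamily.wedge (chartFam x₀ a y) (chartFam x₀ b y) :=
  by
    rw [chartFam_eq, chartFam_eq, chartFam_eq, at_wedge, AltFamily.comap_wedge]

theorem chartFam_parity (x₀ : M) (a : Forms E M) (y : E) :
    chartFam x₀ (parity a) y = AltFamily.parity (chartFam x₀ a y) := rfl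

theorem IsSmooth.add {a b : Forms E M} (ha : a.IsSmooth) (hb : b.IsSmooth) : (a + b).IsSmooth :=
  fun k => (ha k).add (hb k)

theorem IsSmooth.smul {a : Forms E M} (c : ℝ) (ha : a.IsSmooth) : (c • a).IsSmooth :=
  fun k => (ha k).smul c

theorem IsSmooth.neg {a : Forms E M} (ha : a.IsSmooth) : (-a).IsSmooth := by
  rw [← neg_one_smul ℝ a]; exact ha.smul _

theorem IsSmooth.sub {a b : Forms E M} (ha : a.IsSmooth) (hb : b.IsSmooth) : (a - b).IsSmooth := by
  rw [sub_eq_add_neg]; exact ha.add hb.neg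

theorem IsSmooth.parity {a : Forms E M} (ha : a.IsSmooth) : (parity a).IsSmooth :=
  fun k => (ha k).smul _

theorem isSmooth_zero : (0 : Forms E M).IsSmooth := fun _ => IsSmoothForm.zero

theorem IsSmooth.wedge {a b : Forms E M} (ha : a.IsSmooth) (hb : b.IsSmooth) :
    (wedge a b).IsSmooth := by
  rw [isSmooth_iff] at *
  intro x₀
  have h : chartFam x₀ (Forms.wedge a b) = fun y => _ := funext fun y => chartFam_wedge x₀ a b y
  rw [h]
  exact (ha x₀).wedge (hb x₀)

theorem isSmooth_one : (one : Forms E M).IsSmooth := by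
  intro k x₀
  cases k with
  | zero =>
    have : chartExpr x₀ (one (E := E) (M := M) 0) = fun _ => AltFamily.one E 0 := rfl
    rw [this]
    exact contDiffOn_const
  | succ k => exact IsSmoothForm.zero x₀

theorem neg_one_smul_forms (a : Forms E M) : (-1 : ℝ) • a = -a := by
  funext k x
  ext v
  exact neg_one_mul _

theorem d_neg (a : Forms E M) : d (-a) = -d a := by
  rw [← neg_one_smul_forms, d_smul, neg_one_smul_forms]

theorem d_parity (a : Forms E M) : d (parity a) = -parity (d a) := by
  funext k
  cases k with
  | zero => exact (neg_eq_zero.2 (smul_zero _)).symm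
  | succ k =>
    change extD ((-1 : ℝ) ^ k • a k) = -((-1 : ℝ) ^ (k + 1) • extD (a k))
    rw [extD_smul, pow_succ]
    funext x
    ext v
    change (-1 : ℝ) ^ k * extD (a k) x v = -((-1 : ℝ) ^ k * -1 * extD (a k) x v)
    ring

variable [IsManifold 𝓘(ℝ, E) ∞ M] [FiniteDimensional ℝ E]

theorem d_sub {a b : Forms E M} (ha : a.IsSmooth) (hb : b.IsSmooth) : d (a - b) = d a - d b := by
  rw [sub_eq_add_neg, d_add ha hb.neg, d_neg, sub_eq_add_neg]

theorem IsSmooth.d {a : Forms E M} (ha : a.IsSmooth) : (d a).IsSmooth := by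
  rw [isSmooth_iff]
  intro x₀ k
  exact (((isSmooth_iff.1 ha x₀).extDer (isOpen_extChartAt_target x₀)) k).congr fun y hy =>
    congrFun (chartFam_d hy ha) k

theorem extDer_chartFam_congr {x₀ : M} {y : E} (hy : y ∈ (extChartAt 𝓘(ℝ, E) x₀).target)
    {u w : E → AltFamily E} (h : ∀ z ∈ (extChartAt 𝓘(ℝ, E) x₀).target, u z = w z) :
    AltFamily.extDer u y = AltFamily.extDer w y :=
  AltFamily.extDer_congr fun k => by
    filter_upwards [(isOpen_extChartAt_target x₀).mem_nhds hy] with z hz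
    rw [h z hz]

theorem d_d {a : Forms E M} (ha : a.IsSmooth) : d (d a) = 0 := by
  refine ext_chart fun x => ?_
  have hy := mem_extChartAt_target (I := 𝓘(ℝ, E)) x
  rw [chartFam_d hy ha.d, extDer_chartFam_congr hy fun z hz => chartFam_d hz ha,
    AltFamily.extDer_extDer (isOpen_extChartAt_target x) (isSmooth_iff.1 ha x) hy]
  rfl

theorem d_wedge {a b : Forms E M} (ha : a.IsSmooth) (hb : b.IsSmooth) :
    d (wedge a b) = wedge (d a) b + wedge (parity a) (d b) := by
  refine ext_chart fun x => ?_
  have hy := mem_extChartAt_target (I := 𝓘(ℝ, E)) x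
  rw [chartFam_d hy (ha.wedge hb), extDer_chartFam_congr hy fun z _ => chartFam_wedge x a b z,
    AltFamily.extDer_wedge (isOpen_extChartAt_target x) (isSmooth_iff.1 ha x)
      (isSmooth_iff.1 hb x) hy]
  change _ = chartFam x (wedge (d a) b) _ + chartFam x (wedge (parity a) (d b)) _
  rw [chartFam_wedge, chartFam_wedge, chartFam_d hy ha, chartFam_d hy hb, chartFam_parity]

/-- The expression of a vector field in the chart around `x₀`. -/
def _root_.chartField (x₀ : M) (X : (x : M) → TangentSpace 𝓘(ℝ, E) x) (y : E) : E :=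
  chartInv x₀ _ (X ((extChartAt 𝓘(ℝ, E) x₀).symm y))

theorem chartFam_interior {x₀ : M} {y : E} (hy : y ∈ (extChartAt 𝓘(ℝ, E) x₀).target)
    (X : (x : M) → TangentSpace 𝓘(ℝ, E) x) (a : Forms E M) : chartFam x₀ (interior X a) y =
      AltFamily.contract (chartField x₀ X y) (chartFam x₀ a y) := by
  rw [chartFam_eq, chartFam_eq, AltFamily.contract_comap, chartField, chartMap_chartInv hy]
  rfl

theorem chartMap_comp_inverse {x₀ : M} {y : E} (hy : y ∈ (extChartAt 𝓘(ℝ, E) x₀).target) :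
    ∃ e : TangentSpace 𝓘(ℝ, E) y ≃L[ℝ] TangentSpace 𝓘(ℝ, E) ((extChartAt 𝓘(ℝ, E) x₀).symm y),
      mfderiv 𝓘(ℝ, E) 𝓘(ℝ, E) (extChartAt 𝓘(ℝ, E) x₀).symm y = e ∧
      ∀ v, e.symm v = (chartInv x₀ _ v : E) := by
  let T : _ →L[ℝ] _ := mfderiv 𝓘(ℝ, E) 𝓘(ℝ, E) (extChartAt 𝓘(ℝ, E) x₀).symm y
  let S : _ →L[ℝ] E := chartInv x₀ ((extChartAt 𝓘(ℝ, E) x₀).symm y)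
  exact ⟨{ toFun := T
           map_add' := T.map_add'
           map_smul' := T.map_smul'
           invFun := fun v => S v
           left_inv := chartInv_chartMap (E := E) hy
           right_inv := chartMap_chartInv (E := E) hy
           continuous_toFun := T.cont
           continuous_invFun := S.cont }, rfl, fun _ => rfl⟩

theorem mpullback_chart_symm {x₀ : M} {y : E} (hy : y ∈ (extChartAt 𝓘(ℝ, E) x₀).target)
    (X : (x : M) → TangentSpace 𝓘(ℝ, E) x) :
    VectorField.mpullback 𝓘(ℝ, E) 𝓘(ℝ, E) (extChartAt 𝓘(ℝ, E) x₀).symm X y = chartField x₀ X y := by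
  obtain ⟨e, he, he'⟩ := chartMap_comp_inverse hy
  rw [VectorField.mpullback_apply, he, ContinuousLinearMap.inverse_equiv]
  exact he' _

theorem contDiffOn_chartField {X : (x : M) → TangentSpace 𝓘(ℝ, E) x} (hX : IsSmoothField X)
    (x₀ : M) : ContDiffOn ℝ ∞ (chartField x₀ X) (extChartAt 𝓘(ℝ, E) x₀).target := by
  have := FiniteDimensional.complete ℝ E
  have h1 : ContDiffOn ℝ ∞ (fun y => (VectorField.mpullback 𝓘(ℝ, E) 𝓘(ℝ, E)
      (extChartAt 𝓘(ℝ, E) x₀).symm X y : E)) (extChartAt 𝓘(ℝ, E) x₀).target := by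
    rw [← contMDiffOn_vectorSpace_iff_contDiffOn]
    intro y hy
    obtain ⟨e, he, -⟩ := chartMap_comp_inverse hy
    refine (ContMDiffAt.mpullback_vectorField_preimage (n := ∞) (hX _)
      ((contMDiffOn_extChartAt_symm x₀).contMDiffAt ((isOpen_extChartAt_target x₀).mem_nhds hy))
      ⟨e, he.symm⟩ (by simp)).contMDiffWithinAt
  exact h1.congr fun y hy => (mpullback_chart_symm hy X).symm

theorem IsSmooth.interior {X : (x : M) → TangentSpace 𝓘(ℝ, E) x} (hX : IsSmoothField X)
    {a : Forms E M} (ha : a.IsSmooth) : (interior X a).IsSmooth := by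
  rw [isSmooth_iff] at *
  intro x₀ k
  exact ((ha x₀).contract (contDiffOn_chartField hX x₀) k).congr fun y hy =>
    congrFun (chartFam_interior hy X a) k

theorem chartFam_lieDeriv {X : (x : M) → TangentSpace 𝓘(ℝ, E) x} (hX : IsSmoothField X)
    {a : Forms E M} (ha : a.IsSmooth) {x₀ : M} {y : E}
    (hy : y ∈ (extChartAt 𝓘(ℝ, E) x₀).target) : chartFam x₀ (lieDeriv X a) y =
      AltFamily.lieDer (chartField x₀ X) (chartFam x₀ a) y := by
  change chartFam x₀ (d (interior X a)) y + chartFam x₀ (interior X (d a)) y = _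
  rw [chartFam_d hy (ha.interior hX), chartFam_interior hy, chartFam_d hy ha,
    extDer_chartFam_congr hy fun z hz => chartFam_interior hz X a]
  rfl

/-- The bracket on a manifold is defined at `x` through the chart at `x`, so the comparison is made
only at the centre of that chart. This is all that `Forms.ext_chart` requires. -/
theorem chartField_mlieBracket (X Y : (x : M) → TangentSpace 𝓘(ℝ, E) x) (x : M) :
    chartField x (VectorField.mlieBracket 𝓘(ℝ, E) X Y) (extChartAt 𝓘(ℝ, E) x x) =
      VectorField.lieBracket ℝ (chartField x X) (chartField x Y) (extChartAt 𝓘(ℝ, E) x x) := by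
  have hy := mem_extChartAt_target (I := 𝓘(ℝ, E)) x
  have h1 : ∀ Z : (x : M) → TangentSpace 𝓘(ℝ, E) x,
      VectorField.mpullbackWithin 𝓘(ℝ, E) 𝓘(ℝ, E) (extChartAt 𝓘(ℝ, E) x).symm Z
        (Set.range 𝓘(ℝ, E)) =ᶠ[nhds (extChartAt 𝓘(ℝ, E) x x)] chartField x Z := by
    intro Z
    filter_upwards [(isOpen_extChartAt_target x).mem_nhds hy] with y hy
    rw [ModelWithCorners.range_eq_univ, VectorField.mpullbackWithin_univ]
    exact mpullback_chart_symm hy Z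
  rw [← (h1 X).lieBracket_vectorField_eq (h1 Y)]
  have h2 : chartField x (VectorField.mlieBracket 𝓘(ℝ, E) X Y) (extChartAt 𝓘(ℝ, E) x x) =
      (chartInv x x (VectorField.mlieBracket 𝓘(ℝ, E) X Y x) : E) := by
    rw [chartField, extChartAt_to_inv]
  have h3 : ∀ w : E, (chartInv x x ((mfderiv 𝓘(ℝ, E) 𝓘(ℝ, E) (extChartAt 𝓘(ℝ, E) x) x).inverse w) :
      E) = w := by
    intro w
    obtain ⟨e, he⟩ := isInvertible_mfderiv_extChartAt (I := 𝓘(ℝ, E)) (mem_extChartAt_source x)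
    rw [← he, ContinuousLinearMap.inverse_equiv]
    refine Eq.trans ?_ (e.apply_symm_apply w)
    change mfderiv 𝓘(ℝ, E) 𝓘(ℝ, E) (extChartAt 𝓘(ℝ, E) x) x _ = _
    rw [← he]
    rfl
  rw [h2, VectorField.mlieBracket, VectorField.mlieBracketWithin_apply, Set.preimage_univ,
    ModelWithCorners.range_eq_univ, Set.univ_inter]
  exact (h3 _).trans (congrFun VectorField.lieBracketWithin_univ _)

theorem lieDeriv_interior {X Y : (x : M) → TangentSpace 𝓘(ℝ, E) x} (hX : IsSmoothField X)
    (hY : IsSmoothField Y) {a : Forms E M} (ha : a.IsSmooth) :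
    lieDeriv X (interior Y a) = interior Y (lieDeriv X a) +
      interior (VectorField.mlieBracket 𝓘(ℝ, E) X Y) a := by
  refine ext_chart fun x => ?_
  have hy := mem_extChartAt_target (I := 𝓘(ℝ, E)) x
  rw [chartFam_lieDeriv hX (ha.interior hY) hy]
  change _ = chartFam x (interior Y (lieDeriv X a)) _ +
    chartFam x (interior (VectorField.mlieBracket 𝓘(ℝ, E) X Y) a) _
  rw [chartFam_interior hy, chartFam_interior hy, chartField_mlieBracket, chartFam_lieDeriv hX ha hy,
    ← AltFamily.lieDer_contract (isOpen_extChartAt_target x) (isSmooth_iff.1 ha x)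
      (contDiffOn_chartField hX x) (contDiffOn_chartField hY x) hy,
    AltFamily.lieDer, AltFamily.lieDer]
  congr 1
  · refine extDer_chartFam_congr hy fun z hz => ?_
    rw [chartFam_interior hz]
  · rw [extDer_chartFam_congr hy fun z hz => chartFam_interior hz Y a]

end Forms

end FormAlgebra
end

/-! ### Extending vectors tangent to a leaf to global tangent fields -/

noncomputable section

set_option linter.unusedSectionVars false

section TangentFields

variable {E : Type*} [NormedAddCommGroup E] [NormedSpace ℝ E] [FiniteDimensional ℝ E]

/-- Let `R` be a right inverse of `A z₀`. Near `z₀` the operator `A z ∘ R` stays invertible, and `v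
- R (A z ∘ R)⁻¹ (A z v)` is the constant field `v` corrected so as to lie in the kernel of `A z`. -/
theorem exists_kernel_field {V : Type*} [NormedAddCommGroup V] [NormedSpace ℝ V]
    [FiniteDimensional ℝ V] {A : E → E →L[ℝ] V} {O : Set E} (hO : IsOpen O)
    (hA : ContDiffOn ℝ ∞ A O) {z₀ : E} (hz₀ : z₀ ∈ O) (hsurj : Function.Surjective (A z₀)) {v : E}
    (hv : A z₀ v = 0) : ∃ X : E → E, ∃ O' : Set E, IsOpen O' ∧ z₀ ∈ O' ∧ O' ⊆ O ∧
      ContDiffOn ℝ ∞ X O' ∧ X z₀ = v ∧ ∀ z ∈ O', A z (X z) = 0 := by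
  have := FiniteDimensional.complete ℝ V
  obtain ⟨R₀, hR₀⟩ := (A z₀).toLinearMap.exists_rightInverse_of_surjective
    (LinearMap.range_eq_top.2 hsurj)
  let R : V →L[ℝ] E := LinearMap.toContinuousLinearMap R₀
  let B : E → V →L[ℝ] V := fun z => (A z).comp R
  have hB : ContDiffOn ℝ ∞ B O := hA.clm_comp contDiffOn_const
  have hB₀ : B z₀ = 1 := by
    ext w
    exact LinearMap.congr_fun hR₀ w
  let O' : Set E := O ∩ B ⁻¹' {b | IsUnit b}
  have hO' : IsOpen O' := hB.continuousOn.isOpen_inter_preimage hO Units.isOpen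
  refine ⟨fun z => v - R (Ring.inverse (B z) (A z v)), O', hO', ⟨hz₀, ?_⟩, Set.inter_subset_left,
    ?_, ?_, ?_⟩
  · change IsUnit (B z₀)
    rw [hB₀]
    exact isUnit_one
  · have hinv : ContDiffOn ℝ ∞ (fun z => Ring.inverse (B z)) O' := by
      rintro z ⟨hz, u, hu⟩
      have h1 := contDiffAt_ringInverse (n := ∞) ℝ u
      rw [hu] at h1
      exact (h1.comp z (hB.contDiffAt (hO.mem_nhds hz))).contDiffWithinAt
    have hA' := hA.mono (Set.inter_subset_left : O' ⊆ O)
    exact contDiffOn_const.sub (R.contDiff.comp_contDiffOn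
      (hinv.clm_apply (hA'.clm_apply contDiffOn_const)))
  · change v - R (Ring.inverse (B z₀) (A z₀ v)) = v
    rw [hv, map_zero, map_zero, sub_zero]
  · rintro z ⟨hz, hu⟩
    have h1 : B z (Ring.inverse (B z) (A z v)) = A z v :=
      DFunLike.congr_fun (Ring.mul_inverse_cancel (B z) hu) (A z v)
    change A z (v - R (Ring.inverse (B z) (A z v))) = 0
    rw [map_sub, sub_eq_zero]
    exact h1.symm

variable {M : Type*} [TopologicalSpace M] [T2Space M] [ChartedSpace E M] [IsManifold 𝓘(ℝ, E) ∞ M]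

/-- Basic forms are defined by testing against global tangent fields. This extension result turns
the test into a pointwise condition. The field is built in a chart as a kernel field of the
derivative of the local submersion. -/
theorem Foliation.exists_isTangentField {m : ℕ} (F : Foliation E M m) (x : M)
    (v : TangentSpace 𝓘(ℝ, E) x) (hv : v ∈ F.tangent x) :
    ∃ X, F.IsTangentField X ∧ X x = v := by
  have := FiniteDimensional.complete ℝ E
  obtain ⟨U, hU, hxU, f, hf, hfU⟩ := F.exists_submersion x
  let κ := extChartAt 𝓘(ℝ, E) x
  have hκs : IsOpen κ.source := isOpen_extChartAt_source x
  have hxs : x ∈ κ.source := mem_extChartAt_source x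
  let g : E → EuclideanSpace ℝ (Fin m) := fun z => f (κ.symm z)
  let O : Set E := κ.target ∩ κ.symm ⁻¹' U
  have hO : IsOpen O :=
    (continuousOn_extChartAt_symm x).isOpen_inter_preimage (isOpen_extChartAt_target x) hU
  have hg : ContDiffOn ℝ ∞ g O := by
    rw [← contMDiffOn_iff_contDiffOn]
    exact hf.comp ((contMDiffOn_extChartAt_symm x).mono Set.inter_subset_left)
      fun z hz => hz.2
  have hfd : ∀ y ∈ κ.source ∩ U, ∀ w : TangentSpace 𝓘(ℝ, E) y,
      (mfderiv 𝓘(ℝ, E) 𝓘(ℝ, EuclideanSpace ℝ (Fin m)) f y w : EuclideanSpace ℝ (Fin m)) =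
        fderiv ℝ g (κ y) (chartInv x y w) := by
    rintro y ⟨hy, hyU⟩ w
    obtain ⟨z, hz, rfl⟩ := exists_chart_symm_eq hy
    have h1 : MDifferentiableAt 𝓘(ℝ, E) 𝓘(ℝ, EuclideanSpace ℝ (Fin m)) f (κ.symm z) :=
      (hf.contMDiffAt (hU.mem_nhds hyU)).mdifferentiableAt (by simp)
    have h2 : mfderiv 𝓘(ℝ, E) 𝓘(ℝ, EuclideanSpace ℝ (Fin m)) g z = _ :=
      mfderiv_comp z h1 (mdifferentiableAt_chart_symm hz)
    have h3 : κ (κ.symm z) = z := κ.right_inv hz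
    rw [h3, ← mfderiv_eq_fderiv, h2]
    change _ = mfderiv 𝓘(ℝ, E) 𝓘(ℝ, EuclideanSpace ℝ (Fin m)) f (κ.symm z)
      (chartMap x z (chartInv x _ w))
    rw [chartMap_chartInv hz]
  have hz₀ : κ x ∈ O := ⟨κ.map_source hxs, by
    change κ.symm (κ x) ∈ U
    rw [κ.left_inv hxs]; exact hxU⟩
  obtain ⟨X', O', hO', hzO', hO'O, hX', hX'v, hX'A⟩ := exists_kernel_field (A := fderiv ℝ g) hO
    (hg.fderiv_of_isOpen hO (by simp)) hz₀ (v := chartInv x x v) (by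
      intro w
      obtain ⟨u, hu⟩ := (hfU x hxU).1 w
      exact ⟨chartInv x x u, (hfd x ⟨hxs, hxU⟩ u).symm.trans hu⟩) (by
      rw [← hfd x ⟨hxs, hxU⟩]
      exact ((hfU x hxU).2 v).1 hv)
  let s : (y : M) → TangentSpace 𝓘(ℝ, E) y :=
    VectorField.mpullback 𝓘(ℝ, E) 𝓘(ℝ, E) κ (fun z => (X' z : TangentSpace 𝓘(ℝ, E) z))
  let N : Set M := κ.source ∩ κ ⁻¹' O'
  have hN : IsOpen N := (continuousOn_extChartAt x).isOpen_inter_preimage hκs hO'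
  have hNU : N ⊆ U := fun y hy => by
    have := (hO'O hy.2).2
    change κ.symm (κ y) ∈ U at this
    rwa [κ.left_inv hy.1] at this
  have hinv : ∀ y ∈ κ.source, (mfderiv 𝓘(ℝ, E) 𝓘(ℝ, E) κ y).IsInvertible := fun y hy =>
    isInvertible_mfderiv_extChartAt hy
  have hs : ∀ y ∈ κ.source, (chartInv x y (s y) : E) = X' (κ y) := fun y hy =>
    (hinv y hy).self_apply_inverse (X' (κ y))
  have hsmooth : ContMDiffOn 𝓘(ℝ, E) 𝓘(ℝ, E).tangent ∞
      (fun y => (⟨y, s y⟩ : TangentBundle 𝓘(ℝ, E) M)) N := by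
    intro y hy
    refine (ContMDiffAt.mpullback_vectorField_preimage (n := ∞) ?_
      (contMDiffAt_extChartAt' (by rw [← extChartAt_source 𝓘(ℝ, E)]; exact hy.1)) (hinv y hy.1) (by simp)).contMDiffWithinAt
    exact (contMDiffOn_vectorSpace_iff_contDiffOn.2 hX').contMDiffAt (hO'.mem_nhds hy.2)
  -- Multiplying by a bump function supported where the local field is defined makes it global.
  -- Tangency to the leaves survives, because it is a pointwise linear condition.
  obtain ⟨η, -, hη⟩ := (SmoothBumpFunction.nhds_basis_tsupport (I := 𝓘(ℝ, E)) x).mem_iff.1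
    (hN.mem_nhds ⟨hxs, hzO'⟩)
  refine ⟨fun y => η y • s y, ⟨?_, ?_⟩, ?_⟩
  · exact ContMDiffOn.smul_section_of_tsupport η.contMDiff.contMDiffOn hN hη hsmooth
  · intro y
    by_cases hy : y ∈ N
    · refine Submodule.smul_mem _ _ (((hfU y (hNU hy)).2 _).2 ?_)
      refine (hfd y ⟨hy.1, hNU hy⟩ _).trans ?_
      rw [hs y hy.1]
      exact hX'A _ hy.2
    · have : η y = 0 := image_eq_zero_of_notMem_tsupport fun h => hy (hη h)
      change η y • s y ∈ _
      rw [this, zero_smul]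
      exact Submodule.zero_mem _
  · change η x • s x = v
    rw [η.eq_one, one_smul]
    have h1 : (chartInv x x (s x) : E) = chartInv x x v := (hs x hxs).trans hX'v
    exact (hinv x hxs).injective h1

end TangentFields
end

/-! ### Naturality and smoothness of the bivector contraction -/

noncomputable section

set_option linter.unusedSectionVars false

namespace AltFamily

section naturality

variable {V W : Type*} [AddCommGroup V] [Module ℝ V] [TopologicalSpace V]
  [AddCommGroup W] [Module ℝ W] [TopologicalSpace W]
  {σ : W [⋀^Fin 2]→L[ℝ] ℝ} {T : V →L[ℝ] W}

theorem comp_two_apply (σ : W [⋀^Fin 2]→L[ℝ] ℝ) (T : V →L[ℝ] W) (v w : V) :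
    σ.compContinuousLinearMap T ![v, w] = σ ![T v, T w] := by
  change σ (fun i => T (![v, w] i)) = _
  congr 1
  funext i
  fin_cases i <;> rfl

theorem comap_mem_horizontal (hT : Function.Surjective T) {a : AltFamily W}
    (ha : a ∈ horizontal σ) : comap T a ∈ horizontal (σ.compContinuousLinearMap T) := by
  rw [mem_horizontal] at *
  intro v hv
  rw [contract_comap, ha (T v) fun w => ?_, map_zero]
  obtain ⟨w, rfl⟩ := hT w
  rw [← comp_two_apply]
  exact hv w

theorem IsFrame.comap {m : ℕ} {e e' : Fin m → V}
    (h : IsFrame σ (fun i => T (e i)) (fun i => T (e' i))) :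
    IsFrame (σ.compContinuousLinearMap T) e e' where
  dual i j := by rw [comp_two_apply]; exact h.dual i j
  complete v w := by simp only [comp_two_apply]; exact h.complete _ _

theorem IsFrame.exists_comap (hT : Function.Surjective T) {m : ℕ} {f f' : Fin m → W}
    (h : IsFrame σ f f') : ∃ e e' : Fin m → V, (∀ i, T (e i) = f i) ∧ (∀ i, T (e' i) = f' i) ∧
      IsFrame (σ.compContinuousLinearMap T) e e' := by
  choose e he using fun i => hT (f i)
  choose e' he' using fun i => hT (f' i)
  obtain rfl : (fun i => T (e i)) = f := funext he
  obtain rfl : (fun i => T (e' i)) = f' := funext he'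
  exact ⟨e, e', he, he', h.comap⟩

theorem frameContract_comap {m : ℕ} (e e' : Fin m → V) (a : AltFamily W) :
    frameContract e e' (comap T a) =
      comap T (frameContract (fun i => T (e i)) (fun i => T (e' i)) a) := by
  rw [frameContract_apply, frameContract_apply, map_smul, map_sum]
  simp only [contract_comap]

theorem bivectorContract_comap (hT : Function.Surjective T) {n : ℕ} {f f' : Fin (2 * n) → W}
    (h : IsFrame σ f f') {a : AltFamily W} (ha : a ∈ horizontal σ) :
    bivectorContract (σ.compContinuousLinearMap T) n (comap T a) =
      comap T (bivectorContract σ n a) := by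
  obtain ⟨e, e', he, he', hf⟩ := h.exists_comap hT
  obtain rfl : (fun i => T (e i)) = f := funext he
  obtain rfl : (fun i => T (e' i)) = f' := funext he'
  rw [hf.bivectorContract_eq (comap_mem_horizontal hT ha), h.bivectorContract_eq ha,
    frameContract_comap]

end naturality

section smooth

variable {E : Type*} [NormedAddCommGroup E] [NormedSpace ℝ E]

theorem contDiffOn_det {m : ℕ} {s : Set E} {A : E → Matrix (Fin m) (Fin m) ℝ}
    (hA : ∀ i j, ContDiffOn ℝ ∞ (fun y => A y i j) s) : ContDiffOn ℝ ∞ (fun y => (A y).det) s := by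
  simp only [Matrix.det_apply]
  refine ContDiffOn.sum fun τ _ => ?_
  simp only [Units.smul_def, zsmul_eq_mul]
  exact contDiffOn_const.mul (contDiffOn_prod fun i _ => hA _ _)

theorem contDiffOn_inv {m : ℕ} {s : Set E} {A : E → Matrix (Fin m) (Fin m) ℝ}
    (hA : ∀ i j, ContDiffOn ℝ ∞ (fun y => A y i j) s) (hd : ∀ y ∈ s, (A y).det ≠ 0) (i j : Fin m) :
    ContDiffOn ℝ ∞ (fun y => (A y)⁻¹ i j) s := by
  have h1 : ∀ y, (A y)⁻¹ i j = ((A y).det)⁻¹ * (A y).adjugate i j := by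
    intro y
    rw [Matrix.inv_def, Ring.inverse_eq_inv']
    rfl
  simp only [h1, Matrix.adjugate_apply]
  refine ((contDiffOn_det hA).inv hd).mul (contDiffOn_det fun k l => ?_)
  by_cases hk : k = j
  · subst hk
    simp only [Matrix.updateRow_self]
    exact contDiffOn_const
  · simp only [Matrix.updateRow_ne hk]
    exact hA k l

theorem SmoothOn.frameContract {u : E → AltFamily E} {s : Set E} (hu : SmoothOn u s) {m : ℕ}
    {e e' : E → Fin m → E} (he : ∀ i, ContDiffOn ℝ ∞ (fun y => e y i) s)
    (he' : ∀ i, ContDiffOn ℝ ∞ (fun y => e' y i) s) :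
    SmoothOn (fun y => frameContract (e y) (e' y) (u y)) s := by
  intro k
  simp only [frameContract_apply, Pi.smul_apply, Finset.sum_apply]
  refine ContDiffOn.const_smul _ (ContDiffOn.sum fun i _ => ?_)
  exact ((hu.contract (he' i)).contract (he i)) k

/-- The frame hidden in `bivectorContract` is chosen point by point without continuity, but on
horizontal forms the operator does not depend on it. So a smooth local frame is used instead: keep
the frame `e`, `e'` of the point `y₀`, and correct `e` by the inverse of the matrix `σ y ![e i, e'
j]`, which is the identity at `y₀`. -/
theorem SmoothOn.bivectorContract {u : E → AltFamily E} {s : Set E} (hs : IsOpen s)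
    (hu : SmoothOn u s) {σ : E → E [⋀^Fin 2]→L[ℝ] ℝ} (hσ : ContDiffOn ℝ ∞ σ s) {n : ℕ}
    (hf : ∀ y ∈ s, ∃ e e' : Fin (2 * n) → E, IsFrame (σ y) e e')
    (hhor : ∀ y ∈ s, u y ∈ horizontal (σ y)) :
    SmoothOn (fun y => bivectorContract (σ y) n (u y)) s := by
  intro k y₀ hy₀
  obtain ⟨e, e', he⟩ := hf y₀ hy₀
  let S : E → Matrix (Fin (2 * n)) (Fin (2 * n)) ℝ := fun y => Matrix.of fun i j => σ y ![e i, e' j]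
  have hS : ∀ i j, ContDiffOn ℝ ∞ (fun y => S y i j) s := fun i j =>
    (ContinuousAlternatingMap.apply ℝ E ℝ ![e i, e' j]).contDiff.comp_contDiffOn hσ
  let t : Set E := s ∩ (fun y => (S y).det) ⁻¹' {r | r ≠ 0}
  have ht : IsOpen t := (contDiffOn_det hS).continuousOn.isOpen_inter_preimage hs isOpen_ne
  have hS₀ : S y₀ = 1 := by
    ext i j
    rw [Matrix.one_apply]
    exact he.dual i j
  have hyt : y₀ ∈ t := ⟨hy₀, by
    change (S y₀).det ≠ 0
    rw [hS₀, Matrix.det_one]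
    exact one_ne_zero⟩
  have hts : t ⊆ s := Set.inter_subset_left
  have hinv := contDiffOn_inv (fun i j => (hS i j).mono hts) fun y hy => hy.2
  let f : E → Fin (2 * n) → E := fun y i => ∑ j, (S y)⁻¹ i j • e j
  have hfs : ∀ i, ContDiffOn ℝ ∞ (fun y => f y i) t := fun i =>
    ContDiffOn.sum fun j _ => (hinv i j).smul contDiffOn_const
  have hfr : ∀ y ∈ t, IsFrame (σ y) (f y) e' := by
    intro y hy
    obtain ⟨c, c', hc⟩ := hf y (hts hy)
    refine hc.of_dual fun i j => ?_
    have h1 : bilin (σ y) (f y i) (e' j) = ∑ l, (S y)⁻¹ i l * S y l j := by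
      simp only [f, map_sum, map_smul, LinearMap.sum_apply, LinearMap.smul_apply]
      rfl
    rw [← bilin_apply, h1, ← Matrix.mul_apply,
      Matrix.nonsing_inv_mul _ (isUnit_iff_ne_zero.2 hy.2), Matrix.one_apply]
  have h2 := ((SmoothOn.frameContract (fun k => (hu k).mono hts) hfs
    (fun i => contDiffOn_const (c := e' i))) k).contDiffAt (ht.mem_nhds hyt)
  refine (h2.congr_of_eventuallyEq ?_).contDiffWithinAt
  filter_upwards [ht.mem_nhds hyt] with y hy
  rw [(hfr y hy).bivectorContract_eq (hhor y (hts hy))]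

end smooth

end AltFamily
end

/-! ### The transversely symplectic form and its bivector on a foliated manifold -/

noncomputable section

set_option linter.unusedSectionVars false

section TransverseGeometry

variable {E : Type*} [NormedAddCommGroup E] [NormedSpace ℝ E]
  {M : Type*} [TopologicalSpace M] [ChartedSpace E M]

namespace Forms

/-- The family of forms whose only component is the two-form `σ`. -/
def ofTwo (σ : FormField E M 2) : Forms E M := Pi.single 2 σ

/-- The contraction of a family of forms with half the bivector inverse to `σ`. -/
def bivec (σ : FormField E M 2) (n : ℕ) (a : Forms E M) : Forms E M := fun k x =>
  AltFamily.bivectorContract (σ x) n (a.at' x) k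

/-- Multiplication of the components by scalars. -/
def scale (c : ℕ → ℝ) (a : Forms E M) : Forms E M := fun k => c k • a k

theorem at_ofTwo (σ : FormField E M 2) (x : M) :
    (ofTwo σ).at' x = AltFamily.single 2 (σ x) := by
  funext k
  by_cases hk : k = 2
  · subst hk
    rw [AltFamily.single_same]
    exact congrFun (Pi.single_eq_same (M := fun k => FormField E M k) 2 σ) x
  · rw [AltFamily.single_of_ne hk]
    exact congrFun (Pi.single_eq_of_ne (M := fun k => FormField E M k) hk σ) x

theorem at_bivec (σ : FormField E M 2) (n : ℕ) (a : Forms E M) (x : M) :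
    (bivec σ n a).at' x = AltFamily.bivectorContract (σ x) n (a.at' x) := rfl

theorem IsSmooth.scale {a : Forms E M} (ha : a.IsSmooth) (c : ℕ → ℝ) : (scale c a).IsSmooth :=
  fun k => (ha k).smul (c k)

theorem isSmooth_ofTwo {σ : FormField E M 2} (hσ : IsSmoothForm σ) : (ofTwo σ).IsSmooth := by
  intro k
  by_cases hk : k = 2
  · subst hk
    rw [ofTwo, Pi.single_eq_same]
    exact hσ
  · rw [ofTwo, Pi.single_eq_of_ne hk]
    exact IsSmoothForm.zero

theorem d_ofTwo {σ : FormField E M 2} (hσ : extD σ = 0) : d (ofTwo σ) = 0 := by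
  funext k
  cases k with
  | zero => rfl
  | succ k =>
    change extD (ofTwo σ k) = 0
    by_cases hk : k = 2
    · subst hk
      rw [ofTwo, Pi.single_eq_same]
      exact hσ
    · rw [ofTwo, Pi.single_eq_of_ne hk, ← zero_smul ℝ (0 : FormField E M k), extD_smul]
      funext x; ext v
      exact zero_mul _

end Forms

variable [IsManifold 𝓘(ℝ, E) ∞ M]

theorem chartMap_surjective [FiniteDimensional ℝ E] {x₀ : M} {y : E} (hy : y ∈ (extChartAt 𝓘(ℝ, E) x₀).target) :
    Function.Surjective (chartMap x₀ y) := fun v => ⟨chartInv x₀ _ v, chartMap_chartInv hy v⟩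

namespace Foliation

variable {m : ℕ} {F : Foliation E M m} {σ : FormField E M 2}

/-- The derivative of a local submersion is onto, and its kernel is the tangent space of the leaf,
that is, the kernel of `σ x`. -/
theorem IsTransverselySymplectic.exists_isFrame (hσ : F.IsTransverselySymplectic σ) (x : M) :
    ∃ e e' : Fin m → TangentSpace 𝓘(ℝ, E) x, AltFamily.IsFrame (σ x) e e' := by
  obtain ⟨U, -, hxU, f, -, hf⟩ := F.exists_submersion x
  obtain ⟨hsurj, hker⟩ := hf x hxU
  let D : TangentSpace 𝓘(ℝ, E) x →ₗ[ℝ] (Fin m → ℝ) :=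
    (EuclideanSpace.equiv (Fin m) ℝ).toLinearMap ∘ₗ
      (mfderiv 𝓘(ℝ, E) 𝓘(ℝ, EuclideanSpace ℝ (Fin m)) f x).toLinearMap
  refine AltFamily.exists_isFrame (σ x) D
    ((EuclideanSpace.equiv (Fin m) ℝ).surjective.comp hsurj) (fun v hv => ?_) fun v hv => ?_
  · refine (hσ.kernel x v).1 ((hker v).2 ((EuclideanSpace.equiv (Fin m) ℝ).injective ?_))
    exact hv.trans (map_zero (EuclideanSpace.equiv (Fin m) ℝ)).symm
  · have := (hker v).1 ((hσ.kernel x v).2 hv)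
    exact (congrArg (EuclideanSpace.equiv (Fin m) ℝ) this).trans
      (map_zero (EuclideanSpace.equiv (Fin m) ℝ))

theorem IsTransverselySymplectic.interior_eq_zero_iff [FiniteDimensional ℝ E] [T2Space M]
    (hσ : F.IsTransverselySymplectic σ) {a : Forms E M} :
    (∀ X, F.IsTangentField X → Forms.interior X a = 0) ↔
      ∀ x, a.at' x ∈ AltFamily.horizontal (σ x) := by
  refine ⟨fun h x => AltFamily.mem_horizontal.2 fun v hv => ?_, fun h X hX => Forms.ext_at fun x => ?_⟩
  · obtain ⟨X, hX, rfl⟩ := F.exists_isTangentField x v ((hσ.kernel x v).2 hv)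
    exact congrArg (fun b : Forms E M => b.at' x) (h X hX)
  · exact AltFamily.mem_horizontal.1 (h x) _ ((hσ.kernel x _).1 (hX.2 x))

end Foliation

variable {n : ℕ} {F : Foliation E M (2 * n)} {σ : FormField E M 2}

theorem Foliation.IsTransverselySymplectic.isSmooth_bivec [FiniteDimensional ℝ E]
    (hσ : F.IsTransverselySymplectic σ) {a : Forms E M}
    (ha : a.IsSmooth) (hhor : ∀ x, a.at' x ∈ AltFamily.horizontal (σ x)) :
    (Forms.bivec σ n a).IsSmooth := by
  refine Forms.isSmooth_iff.2 fun x₀ => ?_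
  have h1 := AltFamily.SmoothOn.bivectorContract (n := n) (isOpen_extChartAt_target (I := 𝓘(ℝ, E)) x₀)
    (Forms.isSmooth_iff.1 ha x₀) (hσ.smooth x₀) (fun y hy => by
      obtain ⟨e, e', he⟩ := hσ.exists_isFrame ((extChartAt 𝓘(ℝ, E) x₀).symm y)
      obtain ⟨f, f', -, -, hf⟩ := he.exists_comap (chartMap_surjective hy)
      exact ⟨f, f', hf⟩) (fun y hy => AltFamily.comap_mem_horizontal (chartMap_surjective hy) (hhor _))
  intro k
  refine (h1 k).congr fun y hy => ?_
  obtain ⟨e, e', he⟩ := hσ.exists_isFrame ((extChartAt 𝓘(ℝ, E) x₀).symm y)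
  exact (congrFun (AltFamily.bivectorContract_comap (chartMap_surjective hy) he (hhor _)) k).symm

theorem Foliation.IsTransverselySymplectic.bivec_horizontal
    (hσ : F.IsTransverselySymplectic σ) {a : Forms E M}
    (hhor : ∀ x, a.at' x ∈ AltFamily.horizontal (σ x)) (x : M) :
    (Forms.bivec σ n a).at' x ∈ AltFamily.horizontal (σ x) := by
  obtain ⟨e, e', he⟩ := hσ.exists_isFrame x
  rw [Forms.at_bivec, he.bivectorContract_eq (hhor x)]
  exact AltFamily.frameContract_mem_horizontal (hhor x)

end TransverseGeometry
end

/-! ### From relations in the fibres to relations between operators on spaces of forms -/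

noncomputable section

set_option linter.unusedSectionVars false

section FibreRelations

namespace AltFamily

variable {W : Type*} [AddCommGroup W] [Module ℝ W] [TopologicalSpace W]
  {σ : W [⋀^Fin 2]→L[ℝ] ℝ} {n : ℕ} {e e' : Fin (2 * n) → W}

theorem frameContract_scale {m : ℕ} (e e' : Fin m → W) (c : ℕ → ℝ) (a : AltFamily W) (k : ℕ) :
    frameContract e e' (scale c a) k = c (k + 2) • frameContract e e' a k := by
  ext v
  simp only [frameContract_apply, Pi.smul_apply, Finset.sum_apply,
    ContinuousAlternatingMap.smul_apply, ContinuousAlternatingMap.sum_apply, contract_apply,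
    scale_apply, smul_eq_mul, Finset.mul_sum]
  exact Finset.sum_congr rfl fun i _ => mul_left_comm _ _ _

theorem IsFrame.lefschetz_mul_dualLefschetz (h : IsFrame σ e e') :
    lefschetz σ * dualLefschetz σ e e' =
      dualLefschetz σ e e' * lefschetz σ + hScale σ (fun k => (n : ℝ) - k) := by
  refine h.linearMap_ext fun p a ha => ?_
  rw [LinearMap.add_apply, Module.End.mul_apply, Module.End.mul_apply, h.dualLefschetz_lefschetz ha,
    hScale_homogeneous _ ha, add_assoc, ← add_smul]
  simp

end AltFamily

end FibreRelations

section Intertwine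

variable {V V' : Type*} [AddCommGroup V] [Module ℝ V] [AddCommGroup V'] [Module ℝ V']
  {x : Module.End ℝ V} {y : Module.End ℝ V'} {f : V →ₗ[ℝ] V'}

theorem pow_intertwine (h : ∀ a, f (x a) = y (f a)) (i : ℕ) (a : V) :
    f ((x ^ i) a) = (y ^ i) (f a) := by
  induction i generalizing a with
  | zero => rfl
  | succ i ih => rw [pow_succ, pow_succ, Module.End.mul_apply, Module.End.mul_apply, ih, h]

theorem truncExp_intertwine (h : ∀ a, f (x a) = y (f a)) (N : ℕ) (a : V) :
    f (truncExp N x a) = truncExp N y (f a) := by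
  simp only [truncExp, LinearMap.sum_apply, map_sum, LinearMap.smul_apply, map_smul,
    pow_intertwine h]

theorem weylElement_intertwine {x' : Module.End ℝ V} {y' : Module.End ℝ V'}
    (h : ∀ a, f (x a) = y (f a)) (h' : ∀ a, f (x' a) = y' (f a)) (N : ℕ) (a : V) :
    f (weylElement N x x' a) = weylElement N y y' (f a) := by
  simp only [weylElement, Module.End.mul_apply, truncExp_intertwine h, truncExp_intertwine h']

end Intertwine

section FormSpaces

variable {E : Type*} [NormedAddCommGroup E] [NormedSpace ℝ E]
  {M : Type*} [TopologicalSpace M] [ChartedSpace E M]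

open AltFamily

namespace Forms

theorem wedge_add_left (a a' b : Forms E M) : wedge (a + a') b = wedge a b + wedge a' b :=
  ext_at fun x => AltFamily.wedge_add_left (a.at' x) (a'.at' x) (b.at' x)

theorem wedge_add_right (a b b' : Forms E M) : wedge a (b + b') = wedge a b + wedge a b' :=
  ext_at fun x => AltFamily.wedge_add_right (a.at' x) (b.at' x) (b'.at' x)

theorem wedge_smul_left (c : ℝ) (a b : Forms E M) : wedge (c • a) b = c • wedge a b :=
  ext_at fun x => AltFamily.wedge_smul_left c (a.at' x) (b.at' x)

theorem wedge_smul_right (c : ℝ) (a b : Forms E M) : wedge a (c • b) = c • wedge a b :=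
  ext_at fun x => AltFamily.wedge_smul_right c (a.at' x) (b.at' x)

end Forms

/-- A space of forms, as a type. -/
def FormSpace (S : Submodule ℝ (Forms E M)) : Type _ := S

instance (S : Submodule ℝ (Forms E M)) : AddCommGroup (FormSpace S) :=
  inferInstanceAs (AddCommGroup S)

instance (S : Submodule ℝ (Forms E M)) : Module ℝ (FormSpace S) :=
  inferInstanceAs (Module ℝ S)

namespace FormSpace

variable {S : Submodule ℝ (Forms E M)}

/-- The underlying family of forms. -/
def val (a : FormSpace S) : Forms E M := Subtype.val a

/-- A member of a space of forms as an element of the type. -/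
def mk (a : Forms E M) (ha : a ∈ S) : FormSpace S := ⟨a, ha⟩

theorem mem (a : FormSpace S) : a.val ∈ S := Subtype.property a

theorem val_injective {a b : FormSpace S} (h : a.val = b.val) : a = b := Subtype.ext h

/-- The endomorphism of a space of forms given by an operator on forms. -/
def endo (f : Forms E M → Forms E M) (hS : ∀ a ∈ S, f a ∈ S)
    (hadd : ∀ a ∈ S, ∀ b ∈ S, f (a + b) = f a + f b) (hsmul : ∀ (c : ℝ), ∀ a ∈ S, f (c • a) = c • f a) :
    Module.End ℝ (FormSpace S) where
  toFun a := mk (f a.val) (hS _ a.mem)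
  map_add' a b := val_injective (hadd _ a.mem _ b.mem)
  map_smul' c a := val_injective (hsmul c _ a.mem)

end FormSpace

/-- A space of horizontal forms that is stable under the operators given by the transversely
symplectic form `σ`. -/
structure IsLefschetzStable (σ : FormField E M 2) (n : ℕ) (S : Submodule ℝ (Forms E M)) : Prop where
  horizontal : ∀ a ∈ S, ∀ x, a.at' x ∈ AltFamily.horizontal (σ x)
  wedge_mem : ∀ a ∈ S, Forms.wedge (Forms.ofTwo σ) a ∈ S
  bivec_mem : ∀ a ∈ S, Forms.bivec σ n a ∈ S
  scale_mem : ∀ (c : ℕ → ℝ), ∀ a ∈ S, Forms.scale c a ∈ S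

namespace IsLefschetzStable

variable {σ : FormField E M 2} {n : ℕ} {S : Submodule ℝ (Forms E M)}

/-- The Lefschetz operator. -/
def lef (h : IsLefschetzStable σ n S) : Module.End ℝ (FormSpace S) :=
  FormSpace.endo (Forms.wedge (Forms.ofTwo σ)) h.wedge_mem
    (fun a _ b _ => Forms.wedge_add_right _ a b) (fun c a _ => Forms.wedge_smul_right c _ a)

/-- The dual Lefschetz operator. -/
def dualLef (h : IsLefschetzStable σ n S) : Module.End ℝ (FormSpace S) :=
  FormSpace.endo (Forms.bivec σ n) h.bivec_mem
    (fun a _ b _ => Forms.ext_at fun x => map_add (bivectorContract (σ x) n) (a.at' x) (b.at' x))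
    (fun c a _ => Forms.ext_at fun x => map_smul (bivectorContract (σ x) n) c (a.at' x))

/-- Multiplication by scalars depending on the degree. -/
def scal (h : IsLefschetzStable σ n S) (c : ℕ → ℝ) : Module.End ℝ (FormSpace S) :=
  FormSpace.endo (Forms.scale c) (h.scale_mem c)
    (fun a _ b _ => Forms.ext_at fun x => map_add (AltFamily.scale c) (a.at' x) (b.at' x))
    (fun r a _ => Forms.ext_at fun x => map_smul (AltFamily.scale c) r (a.at' x))

/-- The restriction to a point. -/
def atH (h : IsLefschetzStable σ n S) (x : M) : FormSpace S →ₗ[ℝ] HForm (σ x) where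
  toFun a := HForm.mk (a.val.at' x) (h.horizontal _ a.mem x)
  map_add' _ _ := rfl
  map_smul' _ _ := rfl

variable (h : IsLefschetzStable σ n S)
include h

theorem ext_atH {V : Type*} [AddCommGroup V] [Module ℝ V] {f g : V →ₗ[ℝ] FormSpace S}
    (hfg : ∀ x a, h.atH x (f a) = h.atH x (g a)) : f = g := by
  ext1 a
  refine FormSpace.val_injective (Forms.ext_at fun x => ?_)
  exact congrArg HForm.val (hfg x a)

theorem atH_lef (x : M) (a : FormSpace S) : h.atH x (h.lef a) = lefschetz (σ x) (h.atH x a) := by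
  have h1 : AltFamily.wedge ((Forms.ofTwo σ).at' x) (a.val.at' x) =
      AltFamily.wedge (AltFamily.single 2 (σ x)) (a.val.at' x) := by rw [Forms.at_ofTwo]
  exact HForm.val_injective h1

theorem atH_scal (x : M) (c : ℕ → ℝ) (a : FormSpace S) :
    h.atH x (h.scal c a) = hScale (σ x) c (h.atH x a) := rfl

theorem atH_dualLef {x : M} {e e' : Fin (2 * n) → TangentSpace 𝓘(ℝ, E) x} (he : IsFrame (σ x) e e')
    (a : FormSpace S) : h.atH x (h.dualLef a) = dualLefschetz (σ x) e e' (h.atH x a) :=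
  HForm.val_injective (he.bivectorContract_eq (h.horizontal _ a.mem x))

/-- The Weyl element. -/
def weylEnd : Module.End ℝ (FormSpace S) := weylElement (n + 1) h.lef h.dualLef

/-- Restriction to a point intertwines the global operators with those of the fibre. Every relation
between `L`, `Λ`, the degree scalings and the Weyl element thus holds for global forms, where it can
be combined with operators such as `d` that do not act pointwise. -/
theorem atH_weylEnd {x : M} {e e' : Fin (2 * n) → TangentSpace 𝓘(ℝ, E) x} (he : IsFrame (σ x) e e')
    (a : FormSpace S) : h.atH x (h.weylEnd a) = weyl (σ x) e e' (h.atH x a) :=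
  weylElement_intertwine (h.atH_lef x) (h.atH_dualLef he) _ a

variable (hf : ∀ x, ∃ e e' : Fin (2 * n) → TangentSpace 𝓘(ℝ, E) x, IsFrame (σ x) e e')
include hf

theorem lef_pow : h.lef ^ (n + 1) = 0 := h.ext_atH fun x a => by
  obtain ⟨e, e', he⟩ := hf x
  rw [pow_intertwine (h.atH_lef x), he.lefschetz_pow]
  rfl

theorem dualLef_pow : h.dualLef ^ (n + 1) = 0 := h.ext_atH fun x a => by
  obtain ⟨e, e', he⟩ := hf x
  rw [pow_intertwine (h.atH_dualLef he), he.dualLefschetz_pow]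
  rfl

theorem lef_mul_dualLef :
    h.lef * h.dualLef = h.dualLef * h.lef + h.scal fun k => (n : ℝ) - k := h.ext_atH fun x a => by
  obtain ⟨e, e', he⟩ := hf x
  rw [LinearMap.add_apply, map_add]
  simp only [Module.End.mul_apply, atH_lef, h.atH_dualLef he, atH_scal]
  exact LinearMap.congr_fun he.lefschetz_mul_dualLefschetz (h.atH x a)

theorem scal_mul_dualLef : (h.scal fun k => (n : ℝ) - k) * h.dualLef =
    h.dualLef * (h.scal fun k => (n : ℝ) - k) + (2 : ℝ) • h.dualLef := h.ext_atH fun x a => by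
  obtain ⟨e, e', he⟩ := hf x
  rw [LinearMap.add_apply, map_add, LinearMap.smul_apply, map_smul]
  simp only [Module.End.mul_apply, h.atH_dualLef he, atH_scal]
  refine HForm.ext fun k => ?_
  have h1 := frameContract_scale e e' (fun k => (n : ℝ) - k) (a.val.at' x) k
  change ((n : ℝ) - k) • frameContract e e' (a.val.at' x) k =
    frameContract e e' (AltFamily.scale _ (a.val.at' x)) k + (2 : ℝ) • frameContract e e' (a.val.at' x) k
  rw [h1, ← add_smul]
  congr 1
  push_cast
  ring

theorem scal_parity_mul_dualLef : (h.scal fun k => (-1) ^ k) * h.dualLef =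
    h.dualLef * (h.scal fun k => (-1) ^ k) := h.ext_atH fun x a => by
  obtain ⟨e, e', he⟩ := hf x
  simp only [Module.End.mul_apply, h.atH_dualLef he, atH_scal]
  exact HForm.val_injective (parity_frameContract _)

omit hf in
theorem scal_mul_scal (c c' : ℕ → ℝ) : h.scal c * h.scal c' = h.scal fun k => c k * c' k :=
  h.ext_atH fun x a => HForm.ext fun k => smul_smul (c k) (c' k) ((h.atH x a).val k)

omit hf in
theorem scal_one : h.scal (fun _ => 1) = 1 :=
  h.ext_atH fun x a => HForm.ext fun k => one_smul ℝ ((h.atH x a).val k)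

omit hf in
theorem scal_starSign_mul_self : h.scal starSign * h.scal starSign = 1 := by
  rw [scal_mul_scal, ← h.scal_one]
  congr 1
  exact funext starSign_mul_self

omit hf in
theorem scal_parity_mul_self : (h.scal fun k => (-1) ^ k) * (h.scal fun k => (-1) ^ k) = 1 := by
  rw [scal_mul_scal, ← h.scal_one]
  congr 1
  funext k
  rw [← mul_pow]
  simp

theorem scal_starSign_mul_weylEnd : h.scal starSign * h.weylEnd =
    (-1 : ℝ) ^ n • (h.weylEnd * (h.scal fun k => (-1) ^ k) * h.scal starSign) :=
  h.ext_atH fun x a => by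
    obtain ⟨e, e', he⟩ := hf x
    rw [LinearMap.smul_apply, map_smul]
    simp only [Module.End.mul_apply, h.atH_weylEnd he, atH_scal]
    exact LinearMap.congr_fun he.hScale_starSign_mul_weyl (h.atH x a)

theorem weylEnd_mul_parity :
    h.weylEnd * (h.scal fun k => (-1) ^ k) = (h.scal fun k => (-1) ^ k) * h.weylEnd :=
  h.ext_atH fun x a => by
    obtain ⟨e, e', he⟩ := hf x
    simp only [Module.End.mul_apply, h.atH_weylEnd he, atH_scal]
    exact LinearMap.congr_fun he.weyl_mul_parity (h.atH x a)

theorem weylEnd_mul_weylEnd : h.weylEnd * h.weylEnd = (-1 : ℝ) ^ n • h.scal fun k => (-1) ^ k :=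
  h.ext_atH fun x a => by
    obtain ⟨e, e', he⟩ := hf x
    rw [LinearMap.smul_apply, map_smul]
    simp only [Module.End.mul_apply, h.atH_weylEnd he, atH_scal]
    exact LinearMap.congr_fun he.weyl_mul_weyl (h.atH x a)

theorem star_eq (a : FormSpace S) : Forms.star σ n a.val = (h.weylEnd (h.scal starSign a)).val := by
  refine Forms.ext_at fun x => ?_
  obtain ⟨e, e', he⟩ := hf x
  funext q
  refine (he.star_eq (h.atH x a) q).trans ?_
  rw [← h.atH_scal, ← h.atH_weylEnd he]
  rfl

/-- An operator commuting with the Lefschetz operator and preserving the degree commutes with the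
dual Lefschetz operator. -/
theorem dualLef_mul_comm {D : Module.End ℝ (FormSpace S)} (hL : h.lef * D = D * h.lef)
    (hH : (h.scal fun k => (n : ℝ) - k) * D = D * (h.scal fun k => (n : ℝ) - k)) :
    h.dualLef * D = D * h.dualLef :=
  sl2_commute_of_weight_zero (h.dualLef_pow hf) (h.lef_mul_dualLef hf) (h.scal_mul_dualLef hf) hL hH

end IsLefschetzStable

end FormSpaces
end

/-! ### Lie derivatives, horizontal forms and basic forms -/

noncomputable section

set_option linter.unusedSectionVars false

section LieCalculus

variable {E : Type*} [NormedAddCommGroup E] [NormedSpace ℝ E]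
  {M : Type*} [TopologicalSpace M] [ChartedSpace E M]

namespace Forms

theorem interior_wedge (X : (x : M) → TangentSpace 𝓘(ℝ, E) x) (a b : Forms E M) :
    interior X (wedge a b) = wedge (interior X a) b + wedge (parity a) (interior X b) :=
  ext_at fun x => AltFamily.contract_wedge (X x) (a.at' x) (b.at' x)

theorem interior_parity (X : (x : M) → TangentSpace 𝓘(ℝ, E) x) (a : Forms E M) :
    interior X (parity a) = -parity (interior X a) :=
  ext_at fun x => AltFamily.contract_parity (X x) (a.at' x)

theorem interior_interior (X Y : (x : M) → TangentSpace 𝓘(ℝ, E) x) (a : Forms E M) :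
    interior X (interior Y a) = -interior Y (interior X a) :=
  ext_at fun x => AltFamily.contract_contract (X x) (Y x) (a.at' x)

theorem parity_parity (a : Forms E M) : parity (parity a) = a :=
  ext_at fun x => AltFamily.parity_parity (a.at' x)

theorem wedge_neg_left (a b : Forms E M) : wedge (-a) b = -wedge a b :=
  ext_at fun x => AltFamily.wedge_neg_left (a.at' x) (b.at' x)

theorem wedge_zero_left (b : Forms E M) : wedge 0 b = 0 :=
  ext_at fun x => AltFamily.wedge_zero_left (b.at' x)

theorem parity_ofTwo (σ : FormField E M 2) : parity (ofTwo σ) = ofTwo σ :=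
  ext_at fun x => by rw [at_parity, at_ofTwo, AltFamily.parity_single_two]

theorem d_scale_succ (c : ℕ → ℝ) (a : Forms E M) (k : ℕ) :
    d (scale c a) (k + 1) = c k • d a (k + 1) := extD_smul (c k) (a k)

variable [IsManifold 𝓘(ℝ, E) ∞ M]

theorem lieDeriv_scale (X : (x : M) → TangentSpace 𝓘(ℝ, E) x) (c : ℕ → ℝ) (a : Forms E M) :
    lieDeriv X (scale c a) = scale c (lieDeriv X a) := by
  have h1 : ∀ k, interior X (d (scale c a)) k = c k • interior X (d a) k := fun k => by
    funext x
    ext v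
    exact congrArg (fun b : FormField E M (k + 1) => b x (Matrix.vecCons (X x) v))
      (d_scale_succ c a k)
  have h2 : ∀ k, d (interior X (scale c a)) k = c k • d (interior X a) k := fun k => by
    cases k with
    | zero => exact (smul_zero (c 0)).symm
    | succ k => exact extD_smul (c (k + 1)) (interior X a k)
  funext k
  change d (interior X (scale c a)) k + interior X (d (scale c a)) k =
    c k • (d (interior X a) k + interior X (d a) k)
  rw [h1, h2, smul_add]

theorem lieDeriv_add [FiniteDimensional ℝ E] {X : (x : M) → TangentSpace 𝓘(ℝ, E) x}
    (hX : IsSmoothField X) {a b : Forms E M} (ha : a.IsSmooth) (hb : b.IsSmooth) :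
    lieDeriv X (a + b) = lieDeriv X a + lieDeriv X b := by
  simp only [lieDeriv, interior_add, d_add (ha.interior hX) (hb.interior hX), d_add ha hb]
  abel

theorem lieDeriv_smul (X : (x : M) → TangentSpace 𝓘(ℝ, E) x) (c : ℝ) (a : Forms E M) :
    lieDeriv X (c • a) = c • lieDeriv X a := lieDeriv_scale X (fun _ => c) a

theorem IsSmooth.lieDeriv [FiniteDimensional ℝ E] {X : (x : M) → TangentSpace 𝓘(ℝ, E) x}
    (hX : IsSmoothField X) {a : Forms E M} (ha : a.IsSmooth) : (lieDeriv X a).IsSmooth :=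
  (ha.interior hX).d.add (ha.d.interior hX)

theorem lieDeriv_wedge [FiniteDimensional ℝ E] {X : (x : M) → TangentSpace 𝓘(ℝ, E) x}
    (hX : IsSmoothField X) {a b : Forms E M} (ha : a.IsSmooth) (hb : b.IsSmooth) :
    lieDeriv X (wedge a b) = wedge (lieDeriv X a) b + wedge a (lieDeriv X b) := by
  simp only [lieDeriv, interior_wedge, d_wedge ha hb, interior_add, wedge_add_left, wedge_add_right,
    d_add ((ha.interior hX).wedge hb) (ha.parity.wedge (hb.interior hX)),
    d_wedge (ha.interior hX) hb, d_wedge ha.parity (hb.interior hX), interior_parity, d_parity,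
    parity_parity, wedge_neg_left]
  abel

end Forms

end LieCalculus

section Horizontal

variable {E : Type*} [NormedAddCommGroup E] [NormedSpace ℝ E]
  {M : Type*} [TopologicalSpace M] [ChartedSpace E M] [IsManifold 𝓘(ℝ, E) ∞ M]

/-- The smooth horizontal forms. -/
def horForms (σ : FormField E M 2) : Submodule ℝ (Forms E M) where
  carrier := {a | a.IsSmooth ∧ ∀ x, a.at' x ∈ AltFamily.horizontal (σ x)}
  zero_mem' := ⟨Forms.isSmooth_zero, fun _ => Submodule.zero_mem _⟩
  add_mem' ha hb := ⟨ha.1.add hb.1, fun x => Submodule.add_mem _ (ha.2 x) (hb.2 x)⟩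
  smul_mem' c _ ha := ⟨ha.1.smul c, fun x => Submodule.smul_mem _ c (ha.2 x)⟩

/-- The basic forms, as the horizontal forms with horizontal derivative. -/
def basicSubmodule (σ : FormField E M 2) : Submodule ℝ (Forms E M) where
  carrier := {a | a ∈ horForms σ ∧ Forms.d a ∈ horForms σ}
  zero_mem' := ⟨Submodule.zero_mem _, by rw [Forms.d_zero]; exact Submodule.zero_mem _⟩
  add_mem' {a b} ha hb := ⟨Submodule.add_mem _ ha.1 hb.1, by
    rw [Forms.d_add ha.1.1 hb.1.1]; exact Submodule.add_mem _ ha.2 hb.2⟩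
  smul_mem' c a ha := ⟨Submodule.smul_mem _ c ha.1, by
    rw [Forms.d_smul]; exact Submodule.smul_mem _ c ha.2⟩

variable [FiniteDimensional ℝ E] {n : ℕ} {F : Foliation E M (2 * n)} {σ : FormField E M 2}

theorem wedge_mem_horForms {a b : Forms E M} (ha : a ∈ horForms σ) (hb : b ∈ horForms σ) :
    Forms.wedge a b ∈ horForms σ :=
  ⟨ha.1.wedge hb.1, fun x => AltFamily.wedge_mem_horizontal (a := a.at' x) (b := b.at' x) (ha.2 x) (hb.2 x)⟩

theorem scale_mem_horForms (c : ℕ → ℝ) {a : Forms E M} (ha : a ∈ horForms σ) :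
    Forms.scale c a ∈ horForms σ :=
  ⟨ha.1.scale c, fun x => AltFamily.scale_mem_horizontal c (ha.2 x)⟩

theorem parity_mem_horForms {a : Forms E M} (ha : a ∈ horForms σ) :
    Forms.parity a ∈ horForms σ := scale_mem_horForms _ ha

theorem interior_mem_horForms {X : (x : M) → TangentSpace 𝓘(ℝ, E) x} (hX : IsSmoothField X)
    {a : Forms E M} (ha : a ∈ horForms σ) : Forms.interior X a ∈ horForms σ :=
  ⟨ha.1.interior hX, fun x => AltFamily.contract_mem_horizontal (ha.2 x) (X x)⟩

theorem one_mem_horForms : (Forms.one : Forms E M) ∈ horForms σ :=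
  ⟨Forms.isSmooth_one, fun x => by rw [Forms.at_one]; exact AltFamily.one_mem_horizontal _⟩

namespace Foliation.IsTransverselySymplectic

variable (hσ : F.IsTransverselySymplectic σ)
include hσ

theorem ofTwo_mem_horForms : Forms.ofTwo σ ∈ horForms σ :=
  ⟨Forms.isSmooth_ofTwo hσ.smooth, fun x => by
    rw [Forms.at_ofTwo]; exact AltFamily.single_two_mem_horizontal _⟩

theorem bivec_mem_horForms {a : Forms E M} (ha : a ∈ horForms σ) :
    Forms.bivec σ n a ∈ horForms σ :=
  ⟨hσ.isSmooth_bivec ha.1 ha.2, hσ.bivec_horizontal ha.2⟩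

theorem lefschetzStable_horForms : IsLefschetzStable σ n (horForms σ) where
  horizontal _ ha := ha.2
  wedge_mem _ ha := wedge_mem_horForms hσ.ofTwo_mem_horForms ha
  bivec_mem _ ha := hσ.bivec_mem_horForms ha
  scale_mem c _ ha := scale_mem_horForms c ha

variable [T2Space M]

theorem mem_horForms_iff {a : Forms E M} : a ∈ horForms σ ↔
    a.IsSmooth ∧ ∀ X, F.IsTangentField X → Forms.interior X a = 0 := by
  rw [hσ.interior_eq_zero_iff]
  rfl

/-- If `ι(X) a = 0`, then Cartan's formula leaves `L(X) a = ι(X) da`. So a form is basic exactly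
when it and its differential are horizontal. -/
theorem mem_basicSubmodule_iff {a : Forms E M} : a ∈ basicSubmodule σ ↔ F.IsBasic a := by
  constructor
  · intro h
    have h1 := hσ.mem_horForms_iff.1 h.1
    have h2 := hσ.mem_horForms_iff.1 h.2
    refine ⟨h1.1, h1.2, fun X hX => ?_⟩
    rw [Forms.lieDeriv, h1.2 X hX, h2.2 X hX, Forms.d_zero, add_zero]
  · intro h
    refine ⟨hσ.mem_horForms_iff.2 ⟨h.smooth, h.interior⟩,
      hσ.mem_horForms_iff.2 ⟨Forms.IsSmooth.d h.smooth, fun X hX => ?_⟩⟩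
    have h1 := h.lieDeriv X hX
    rwa [Forms.lieDeriv, h.interior X hX, Forms.d_zero, zero_add] at h1

omit [T2Space M] in
theorem lieDeriv_eq_zero_of_isTangentField {X : (x : M) → TangentSpace 𝓘(ℝ, E) x}
    (hX : F.IsTangentField X) : Forms.lieDeriv X (Forms.ofTwo σ) = 0 := by
  have h1 : Forms.interior X (Forms.ofTwo σ) = 0 := Forms.ext_at fun x =>
    AltFamily.mem_horizontal.1 (hσ.ofTwo_mem_horForms.2 x) _ ((hσ.kernel x _).1 (hX.2 x))
  rw [Forms.lieDeriv, h1, Forms.d_ofTwo hσ.closed, Forms.d_zero, Forms.interior_zero, add_zero]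

omit [T2Space M] in
theorem mem_tangent_of_interior {X : (x : M) → TangentSpace 𝓘(ℝ, E) x}
    (h : Forms.interior X (Forms.ofTwo σ) = 0) (x : M) : X x ∈ F.tangent x := by
  refine (hσ.kernel x _).2 fun w => ?_
  have h1 : AltFamily.contract (X x) ((Forms.ofTwo σ).at' x) = 0 :=
    congrArg (fun b : Forms E M => b.at' x) h
  rw [Forms.at_ofTwo] at h1
  have h2 := AltFamily.contract_contract_single_two (σ x) (X x) w
  rw [h1, map_zero] at h2
  have h3 := DFunLike.congr_fun (congrFun h2.symm 0) ![]
  have h4 : σ x ![X x, w] * 1 = 0 := h3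
  rwa [mul_one] at h4

omit [T2Space M] in
-- Involutivity of the tangent distribution, read off from the closedness of `σ`: `ι([X, Y])σ =
-- L(X)ι(Y)σ - ι(Y)L(X)σ`, and both terms vanish for tangent `X` and `Y`.
theorem isFoliateField_of_isTangentField {X : (x : M) → TangentSpace 𝓘(ℝ, E) x}
    (hX : F.IsTangentField X) : F.IsFoliateField X := by
  refine ⟨hX.1, fun Y hY => ⟨?_, hσ.mem_tangent_of_interior ?_⟩⟩
  · have := FiniteDimensional.complete ℝ E
    have h1 : IsManifold 𝓘(ℝ, E) (((⊤ : ℕ∞) : WithTop ℕ∞) + 1) M :=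
      inferInstanceAs (IsManifold 𝓘(ℝ, E) ∞ M)
    have h2 : IsManifold 𝓘(ℝ, E) (minSmoothness ℝ 2) M := by
      rw [minSmoothness_of_isRCLikeNormedField]
      exact IsManifold.of_le (n := ∞) (by simpa using WithTop.coe_le_coe.2 (le_top : (2 : ℕ∞) ≤ ⊤))
    exact ContDiff.mlieBracket_vectorField (m := ⊤) (n := ⊤) hX.1 hY.1
      (by rw [minSmoothness_of_isRCLikeNormedField]; exact le_refl _)
  · have h1 := Forms.lieDeriv_interior hX.1 hY.1 (Forms.isSmooth_ofTwo hσ.smooth)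
    have h2 : Forms.interior Y (Forms.ofTwo σ) = 0 := Forms.ext_at fun x =>
      AltFamily.mem_horizontal.1 (hσ.ofTwo_mem_horForms.2 x) _ ((hσ.kernel x _).1 (hY.2 x))
    rw [hσ.lieDeriv_eq_zero_of_isTangentField hX, h2, Forms.interior_zero, zero_add, Forms.lieDeriv,
      Forms.interior_zero, Forms.d_zero, Forms.interior_zero, add_zero] at h1
    exact h1.symm

/-- For tangent `Y` one has `ι(Y)L(X)a = L(X)ι(Y)a - ι([X, Y])a`, and `[X, Y]` is again tangent. -/
theorem lieDeriv_mem_horForms {X : (x : M) → TangentSpace 𝓘(ℝ, E) x} (hX : F.IsFoliateField X)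
    {a : Forms E M} (ha : a ∈ horForms σ) : Forms.lieDeriv X a ∈ horForms σ := by
  have h := (hσ.mem_horForms_iff.1 ha).2
  refine hσ.mem_horForms_iff.2 ⟨ha.1.lieDeriv hX.1, fun Y hY => ?_⟩
  have h1 := Forms.lieDeriv_interior hX.1 hY.1 ha.1
  rw [h Y hY, h _ (hX.2 Y hY), add_zero, Forms.lieDeriv, Forms.interior_zero, Forms.d_zero,
    Forms.interior_zero, add_zero] at h1
  exact h1.symm

/-- The Lie derivative along a foliate field that preserves `σ` commutes with the contraction with
the bivector. -/
theorem bivec_lieDeriv {X : (x : M) → TangentSpace 𝓘(ℝ, E) x} (hX : F.IsFoliateField X)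
    (hXσ : Forms.lieDeriv X (Forms.ofTwo σ) = 0) {a : Forms E M} (ha : a ∈ horForms σ) :
    Forms.bivec σ n (Forms.lieDeriv X a) = Forms.lieDeriv X (Forms.bivec σ n a) := by
  let D : Module.End ℝ (FormSpace (horForms σ)) := FormSpace.endo (Forms.lieDeriv X)
    (fun a ha => hσ.lieDeriv_mem_horForms hX ha) (fun a ha b hb => Forms.lieDeriv_add hX.1 ha.1 hb.1)
    (fun c a _ => Forms.lieDeriv_smul X c a)
  have h := hσ.lefschetzStable_horForms
  -- The weight-zero case of the `sl₂` argument. The two side goals are that the Lie derivative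
  -- commutes with the product by `σ`, as it annihilates `σ`, and that it preserves degrees.
  have h1 := h.dualLef_mul_comm hσ.exists_isFrame (D := D) ?_ ?_
  · exact congrArg FormSpace.val (LinearMap.congr_fun h1 (FormSpace.mk a ha))
  · ext1 b
    refine FormSpace.val_injective ?_
    have h2 := Forms.lieDeriv_wedge hX.1 (Forms.isSmooth_ofTwo hσ.smooth) b.mem.1
    rw [hXσ, Forms.wedge_zero_left, zero_add] at h2
    exact h2.symm
  · ext1 b
    exact FormSpace.val_injective (Forms.lieDeriv_scale X _ b.val).symm

end Foliation.IsTransverselySymplectic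

end Horizontal
end

/-! ### The codifferential as a commutator -/

noncomputable section

set_option linter.unusedSectionVars false

section WeylAlgebra

variable {A : Type*} [Ring A] [Algebra ℝ A]

/-- Here `W` is the Weyl element, `S` the star signs, `γ` the parity, `D = d` and `D' = [Λ, d]`; the
star is `W * S`. Moving `S` past `D` and `W` leaves `γ D' W W (-1) ^ n`. The sign `(-1) ^ n` appears
a second time in `W * W` and cancels, and the two parities enclosing `D'` produce the minus sign. -/
theorem conj_weyl_eq {W S γ D D' : A} {n : ℕ} (hSS : S * S = 1) (hγγ : γ * γ = 1)
    (hSW : S * W = (-1 : ℝ) ^ n • (W * γ * S)) (hWγ : W * γ = γ * W)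
    (hWW : W * W = (-1 : ℝ) ^ n • γ) (hSD : S * D = D * γ * S) (hWD : W * D = D' * W)
    (hγD' : γ * D' = -(D' * γ)) : γ * (W * (S * (D * (W * S)))) = -D' := by
  have h1 : γ * (S * (W * S)) = (-1 : ℝ) ^ n • W := by
    rw [← mul_assoc S, hSW, smul_mul_assoc, mul_assoc (W * γ), hSS, mul_one, mul_smul_comm,
      hWγ, ← mul_assoc, hγγ, one_mul]
  calc γ * (W * (S * (D * (W * S)))) = γ * ((W * D) * (γ * (S * (W * S)))) := by
        rw [← mul_assoc S D, hSD]; simp only [mul_assoc]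
    _ = γ * (D' * ((-1 : ℝ) ^ n • (W * W))) := by
        rw [h1, hWD, mul_smul_comm, mul_assoc, mul_smul_comm, mul_smul_comm, mul_smul_comm]
    _ = γ * (D' * γ) := by
        rw [hWW, smul_smul, ← mul_pow, neg_one_mul, neg_neg, one_pow, one_smul]
    _ = -D' := by rw [← mul_assoc, hγD', neg_mul, mul_assoc, hγγ, mul_one]

/-- From `D² = 0` follows `DC = -CD`. Expanding one factor of `C * C` as a commutator and moving the
other factor across then gives `C * C = -(C * C)`. -/
theorem commutator_sq {P D C : A} (hD : D * D = 0) (hC : P * D - D * P = C) (hPC : P * C = C * P) :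
    C * C = 0 := by
  have h2 : D * C = -(C * D) := by
    rw [← hC, mul_sub, sub_mul, ← mul_assoc D D, mul_assoc P D D, hD, mul_zero, zero_mul, sub_zero,
      zero_sub, neg_neg, mul_assoc]
  have h3 : C * C = -(C * C) := by
    have e1 : C * C = P * (D * C) - D * (P * C) := by
      nth_rewrite 1 [← hC]; rw [sub_mul, mul_assoc, mul_assoc]
    have e2 : C * C = C * (P * D) - C * (D * P) := by
      nth_rewrite 2 [← hC]; rw [mul_sub]
    nth_rewrite 2 [e2]
    rw [e1, h2, hPC, ← mul_assoc D, h2, mul_neg, ← mul_assoc, hPC]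
    noncomm_ring
  have h4 : (2 : ℝ) • (C * C) = 0 := by
    rw [two_smul]; nth_rewrite 1 [h3]; exact neg_add_cancel _
  exact (smul_eq_zero.1 h4).resolve_left two_ne_zero

end WeylAlgebra

section Codifferential

variable {E : Type*} [NormedAddCommGroup E] [NormedSpace ℝ E]
  {M : Type*} [TopologicalSpace M] [ChartedSpace E M]

/-- The truncated subtraction at `k = 0` is harmless, because the differential has no component of
degree 0. -/
theorem Forms.d_scale (c : ℕ → ℝ) (a : Forms E M) :
    d (scale c a) = scale (fun k => c (k - 1)) (d a) := by
  funext k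
  cases k with
  | zero => exact (smul_zero (c 0)).symm
  | succ k => exact d_scale_succ c a k

variable [IsManifold 𝓘(ℝ, E) ∞ M] [FiniteDimensional ℝ E] {n : ℕ} {F : Foliation E M (2 * n)}
  {σ : FormField E M 2}

theorem d_mem_basic {a : Forms E M} (ha : a ∈ basicSubmodule σ) : Forms.d a ∈ basicSubmodule σ :=
  ⟨ha.2, by rw [Forms.d_d ha.1.1]; exact Submodule.zero_mem _⟩

theorem scale_mem_basic (c : ℕ → ℝ) {a : Forms E M} (ha : a ∈ basicSubmodule σ) :
    Forms.scale c a ∈ basicSubmodule σ :=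
  ⟨scale_mem_horForms c ha.1, by rw [Forms.d_scale]; exact scale_mem_horForms _ ha.2⟩

theorem wedge_mem_basic {a b : Forms E M} (ha : a ∈ basicSubmodule σ) (hb : b ∈ basicSubmodule σ) :
    Forms.wedge a b ∈ basicSubmodule σ :=
  ⟨wedge_mem_horForms ha.1 hb.1, by
    rw [Forms.d_wedge ha.1.1 hb.1.1]
    exact Submodule.add_mem _ (wedge_mem_horForms ha.2 hb.1)
      (wedge_mem_horForms (parity_mem_horForms ha.1) hb.2)⟩

theorem one_mem_basic : (Forms.one : Forms E M) ∈ basicSubmodule σ := by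
  refine ⟨one_mem_horForms, ?_⟩
  -- The Leibniz rule for `1 ∧ 1 = 1` reads `d 1 = d 1 + d 1`.
  have h1 : Forms.d (Forms.one : Forms E M) = 0 := by
    have h2 := Forms.d_wedge (E := E) (M := M) Forms.isSmooth_one Forms.isSmooth_one
    have h3 : ∀ a : Forms E M, Forms.wedge Forms.one a = a := fun a => Forms.ext_at fun x => by
      rw [Forms.at_wedge, Forms.at_one, AltFamily.one_wedge]
    have h4 : ∀ a : Forms E M, Forms.wedge a Forms.one = a := fun a => Forms.ext_at fun x => by
      rw [Forms.at_wedge, Forms.at_one, AltFamily.wedge_one]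
    have h5 : Forms.parity (Forms.one : Forms E M) = Forms.one := Forms.ext_at fun x => by
      rw [Forms.at_parity, Forms.at_one, AltFamily.parity_one]
    rw [h3, h4, h5, h3] at h2
    exact left_eq_add.1 h2
  rw [h1]
  exact Submodule.zero_mem _

namespace Foliation.IsTransverselySymplectic

variable (hσ : F.IsTransverselySymplectic σ)
include hσ

theorem ofTwo_mem_basic : Forms.ofTwo σ ∈ basicSubmodule σ :=
  ⟨hσ.ofTwo_mem_horForms, by rw [Forms.d_ofTwo hσ.closed]; exact Submodule.zero_mem _⟩

variable [T2Space M]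

/-- Tangent fields are foliate and preserve `σ`, so their Lie derivatives commute with `Λ` and keep
annihilating `Λ a`. -/
theorem bivec_mem_basic {a : Forms E M} (ha : a ∈ basicSubmodule σ) :
    Forms.bivec σ n a ∈ basicSubmodule σ := by
  have h1 := hσ.mem_basicSubmodule_iff.1 ha
  have h2 := hσ.bivec_mem_horForms ha.1
  refine hσ.mem_basicSubmodule_iff.2 ⟨h2.1, (hσ.mem_horForms_iff.1 h2).2, fun X hX => ?_⟩
  rw [← hσ.bivec_lieDeriv (hσ.isFoliateField_of_isTangentField hX)
    (hσ.lieDeriv_eq_zero_of_isTangentField hX) ha.1, h1.lieDeriv X hX]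
  exact Forms.ext_at fun x => map_zero (AltFamily.bivectorContract (σ x) n)

theorem lefschetzStable_basic : IsLefschetzStable σ n (basicSubmodule σ) where
  horizontal _ ha := ha.1.2
  wedge_mem _ ha := wedge_mem_basic hσ.ofTwo_mem_basic ha
  bivec_mem _ ha := hσ.bivec_mem_basic ha
  scale_mem c _ ha := scale_mem_basic c ha

omit [T2Space M] hσ in
variable (σ) in
/-- The exterior derivative on basic forms. -/
def _root_.basicD : Module.End ℝ (FormSpace (basicSubmodule σ)) :=
  FormSpace.endo Forms.d (fun _ ha => d_mem_basic ha)
    (fun _ ha _ hb => Forms.d_add ha.1.1 hb.1.1) (fun c a _ => Forms.d_smul c a)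

omit [T2Space M] hσ in
theorem _root_.basicD_mul_basicD : basicD σ * basicD σ = 0 := by
  ext1 a
  exact FormSpace.val_injective (Forms.d_d a.mem.1.1)

theorem scal_succ_mul_basicD {c c' : ℕ → ℝ} (h : ∀ k, c (k + 1) = c' k) :
    hσ.lefschetzStable_basic.scal c * basicD σ =
      basicD σ * hσ.lefschetzStable_basic.scal c' := by
  ext1 a
  refine FormSpace.val_injective (funext fun k => ?_)
  cases k with
  | zero => exact smul_zero (c 0)
  | succ k =>
    refine Eq.trans ?_ (Forms.d_scale_succ c' a.val k).symm
    rw [← h]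
    rfl

theorem lef_mul_basicD :
    hσ.lefschetzStable_basic.lef * basicD σ = basicD σ * hσ.lefschetzStable_basic.lef := by
  ext1 a
  refine FormSpace.val_injective ?_
  have h := Forms.d_wedge (Forms.isSmooth_ofTwo hσ.smooth) a.mem.1.1
  rw [Forms.d_ofTwo hσ.closed, Forms.wedge_zero_left, zero_add, Forms.parity_ofTwo] at h
  exact h.symm

/-- The commutator of the dual Lefschetz operator with the exterior derivative. -/
def comm : Module.End ℝ (FormSpace (basicSubmodule σ)) :=
  hσ.lefschetzStable_basic.dualLef * basicD σ - basicD σ * hσ.lefschetzStable_basic.dualLef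

theorem scal_weight_mul_basicD :
    hσ.lefschetzStable_basic.scal (fun k => (n : ℝ) - k) * basicD σ =
      basicD σ * hσ.lefschetzStable_basic.scal (fun k => (n : ℝ) - k) - basicD σ := by
  rw [hσ.scal_succ_mul_basicD (c' := fun k => (n : ℝ) - (k + 1 : ℕ)) fun k => rfl]
  nth_rewrite 3 [← mul_one (basicD σ)]
  rw [← mul_sub]
  congr 1
  refine hσ.lefschetzStable_basic.ext_atH fun x a => AltFamily.HForm.ext fun k => ?_
  ext v
  change ((n : ℝ) - (k + 1 : ℕ)) * a.val k x v = ((n : ℝ) - k) * a.val k x v - a.val k x v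
  push_cast
  ring

/-- `d` commutes with `L` and has weight `-1`, so `d` and `[Λ, d]` span a two-dimensional
representation. -/
theorem dualLef_mul_comm' : hσ.lefschetzStable_basic.dualLef * hσ.comm =
    hσ.comm * hσ.lefschetzStable_basic.dualLef :=
  sl2_commute_of_weight_one (hσ.lefschetzStable_basic.dualLef_pow hσ.exists_isFrame)
    (hσ.lefschetzStable_basic.lef_mul_dualLef hσ.exists_isFrame)
    (hσ.lefschetzStable_basic.scal_mul_dualLef hσ.exists_isFrame) hσ.lef_mul_basicD
    hσ.scal_weight_mul_basicD (by rw [comm]; abel)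

theorem weylEnd_mul_basicD :
    hσ.lefschetzStable_basic.weylEnd * basicD σ = hσ.comm * hσ.lefschetzStable_basic.weylEnd :=
  weylElement_mul (hσ.lefschetzStable_basic.lef_pow hσ.exists_isFrame)
    (hσ.lefschetzStable_basic.dualLef_pow hσ.exists_isFrame) hσ.lef_mul_basicD (by rw [comm]; abel)
    (sl2_weight_one (hσ.lefschetzStable_basic.lef_mul_dualLef hσ.exists_isFrame)
      hσ.lef_mul_basicD hσ.scal_weight_mul_basicD (by rw [comm]; abel))
    hσ.dualLef_mul_comm'

theorem scal_parity_mul_basicD :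
    hσ.lefschetzStable_basic.scal (fun k => (-1) ^ k) * basicD σ =
      -(basicD σ * hσ.lefschetzStable_basic.scal (fun k => (-1) ^ k)) := by
  ext1 a
  refine FormSpace.val_injective ?_
  have h := Forms.d_parity a.val
  exact neg_eq_iff_eq_neg.1 h.symm

theorem scal_parity_mul_comm :
    hσ.lefschetzStable_basic.scal (fun k => (-1) ^ k) * hσ.comm =
      -(hσ.comm * hσ.lefschetzStable_basic.scal (fun k => (-1) ^ k)) := by
  have h1 := hσ.lefschetzStable_basic.scal_parity_mul_dualLef hσ.exists_isFrame
  have h2 := hσ.scal_parity_mul_basicD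
  rw [comm, mul_sub, ← mul_assoc, h1, mul_assoc, h2, ← mul_assoc (hσ.lefschetzStable_basic.scal _) (basicD σ), h2, sub_mul,
    mul_assoc, neg_mul, mul_assoc, h1, mul_neg, mul_assoc]
  abel

theorem scal_starSign_mul_basicD :
    hσ.lefschetzStable_basic.scal AltFamily.starSign * basicD σ = basicD σ *
      hσ.lefschetzStable_basic.scal (fun k => (-1) ^ k) *
        hσ.lefschetzStable_basic.scal AltFamily.starSign := by
  rw [mul_assoc, IsLefschetzStable.scal_mul_scal]
  exact hσ.scal_succ_mul_basicD fun k => AltFamily.starSign_succ k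

/-- On the component of degree `q = p - 1` the sign `(-1) ^ (p + 1)` is the parity of the result,
which makes the codifferential a product of endomorphisms of the space of basic forms. -/
theorem codiff_eq_conj (a : FormSpace (basicSubmodule σ)) : Forms.codiff σ n a.val =
    (hσ.lefschetzStable_basic.scal (fun k => (-1) ^ k) (hσ.lefschetzStable_basic.weylEnd
      (hσ.lefschetzStable_basic.scal AltFamily.starSign (basicD σ (hσ.lefschetzStable_basic.weylEnd
        (hσ.lefschetzStable_basic.scal AltFamily.starSign a)))))).val := by
  have h3 : Forms.codiff σ n a.val =
      Forms.parity (Forms.star σ n (Forms.d (Forms.star σ n a.val))) := by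
    funext q
    have : (-1 : ℝ) ^ (q + 1 + 1) = (-1 : ℝ) ^ q := by
      rw [pow_succ, pow_succ, mul_assoc, neg_one_mul, neg_neg, mul_one]
    exact congrArg (· • Forms.star σ n (Forms.d (Forms.star σ n a.val)) q) this
  rw [h3, hσ.lefschetzStable_basic.star_eq hσ.exists_isFrame a]
  generalize hσ.lefschetzStable_basic.weylEnd (hσ.lefschetzStable_basic.scal AltFamily.starSign a) = b
  have h4 : Forms.d b.val = (basicD σ b).val := rfl
  rw [h4, hσ.lefschetzStable_basic.star_eq hσ.exists_isFrame (basicD σ b)]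
  generalize hσ.lefschetzStable_basic.weylEnd _ = c
  rfl

theorem codiff_val (a : FormSpace (basicSubmodule σ)) :
    Forms.codiff σ n a.val = (-hσ.comm a).val := by
  have h := hσ.lefschetzStable_basic
  have h1 := conj_weyl_eq h.scal_starSign_mul_self h.scal_parity_mul_self
    (h.scal_starSign_mul_weylEnd hσ.exists_isFrame) (h.weylEnd_mul_parity hσ.exists_isFrame)
    (h.weylEnd_mul_weylEnd hσ.exists_isFrame) hσ.scal_starSign_mul_basicD hσ.weylEnd_mul_basicD
    hσ.scal_parity_mul_comm
  exact (hσ.codiff_eq_conj a).trans (congrArg FormSpace.val (LinearMap.congr_fun h1 a))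

/-- The symplectic codifferential is a commutator. -/
theorem codiff_eq {a : Forms E M} (ha : a ∈ basicSubmodule σ) : Forms.codiff σ n a =
    Forms.d (Forms.bivec σ n a) - Forms.bivec σ n (Forms.d a) := by
  have h1 : Forms.codiff σ n a = (-hσ.comm (FormSpace.mk a ha)).val :=
    hσ.codiff_val (FormSpace.mk a ha)
  have h2 : (-hσ.comm (FormSpace.mk a ha)).val =
    -(Forms.bivec σ n (Forms.d a) - Forms.d (Forms.bivec σ n a)) := rfl
  rw [h1, h2, neg_sub]

theorem comm_mul_comm : hσ.comm * hσ.comm = 0 :=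
  commutator_sq basicD_mul_basicD rfl hσ.dualLef_mul_comm'

end Foliation.IsTransverselySymplectic

end Codifferential
end

/-! ### The bivector contraction as a second-order operator -/

noncomputable section

set_option linter.unusedSectionVars false

section SecondOrder

namespace AltFamily

variable {W : Type*} [AddCommGroup W] [Module ℝ W] [TopologicalSpace W] {m : ℕ} {e e' : Fin m → W}

variable (e e') in
/-- The deviation of the contraction with a bivector from being a derivation. -/
def frameBracket (a b : AltFamily W) : AltFamily W :=
  frameContract e e' (wedge a b) - wedge (frameContract e e' a) b - wedge a (frameContract e e' b)

/-- Of the four terms of a double contraction of `a ∧ b`, those with both contractions on one factor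
are subtracted off. One contraction on each factor remains. -/
theorem frameBracket_eq (a b : AltFamily W) : frameBracket e e' a b =
    (2⁻¹ : ℝ) • ∑ i, (wedge (parity (contract (e' i) a)) (contract (e i) b) -
      wedge (parity (contract (e i) a)) (contract (e' i) b)) := by
  have h : ∀ i, contract (e i) (contract (e' i) (wedge a b)) -
      wedge (contract (e i) (contract (e' i) a)) b - wedge a (contract (e i) (contract (e' i) b)) =
      wedge (parity (contract (e' i) a)) (contract (e i) b) -
      wedge (parity (contract (e i) a)) (contract (e' i) b) := fun i => by
    simp only [contract_wedge, map_add, contract_parity, parity_parity, wedge_neg_left]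
    abel
  simp only [← h, Finset.sum_sub_distrib, smul_sub]
  rw [frameBracket, frameContract_apply, frameContract_apply, frameContract_apply, wedge_smul_left,
    wedge_smul_right, wedge_sum_left, wedge_sum_right]

theorem contract_hasParity {i : ℤ} {a : AltFamily W} (ha : parity a = (-1 : ℝ) ^ i • a) (v : W) :
    parity (contract v a) = (-1 : ℝ) ^ (i + 1) • contract v a := by
  rw [zpow_add_one₀ (by norm_num), ← neg_eq_iff_eq_neg.2 (contract_parity v a), ha, map_smul, mul_neg_one]
  exact (neg_smul _ _).symm

/-- Each summand applies a single contraction, hence an antiderivation, to the second argument.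
Moving the odd contraction of `a` past `parity b` gives `(-1) ^ ((i + 1) * j) (-1) ^ j = (-1) ^ (i *
j)`. -/
theorem frameBracket_wedge {i j : ℤ} {a b : AltFamily W} (ha : parity a = (-1 : ℝ) ^ i • a)
    (hb : parity b = (-1 : ℝ) ^ j • b) (c : AltFamily W) : frameBracket e e' a (wedge b c) =
      wedge (frameBracket e e' a b) c + (-1 : ℝ) ^ (i * j) • wedge b (frameBracket e e' a c) := by
  have h1 : ∀ v w, wedge (parity (contract v a)) (contract w (wedge b c)) =
      wedge (wedge (parity (contract v a)) (contract w b)) c +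
        (-1 : ℝ) ^ (i * j) • wedge b (wedge (parity (contract v a)) (contract w c)) := fun v w => by
    have hv := contract_hasParity ha v
    have h2 : wedge (parity (contract v a)) (parity b) =
        (-1 : ℝ) ^ (i * j) • wedge b (parity (contract v a)) := by
      rw [hv, hb, wedge_smul_left, wedge_smul_right, wedge_smul_right,
        wedge_comm_of_parity hv hb, smul_smul, smul_smul, smul_smul]
      congr 1
      have h3 : (-1 : ℝ) ^ ((i + 1) * j) = (-1) ^ (i * j) * (-1) ^ j := by
        rw [add_mul, one_mul, zpow_add₀ (by norm_num)]
      rw [h3]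
      have : (-1 : ℝ) ^ j * (-1) ^ j = 1 := by rw [← mul_zpow]; simp
      linear_combination (-1 : ℝ) ^ (i + 1) * (-1) ^ (i * j) * this
    rw [contract_wedge, wedge_add_right, wedge_assoc, ← wedge_assoc _ (parity b), h2,
      wedge_smul_left, wedge_assoc]
  simp only [frameBracket_eq, h1, wedge_smul_left, wedge_smul_right, wedge_sum_left,
    wedge_sum_right, wedge_sub_left, wedge_sub_right]
  simp only [Finset.smul_sum, ← Finset.sum_add_distrib]
  refine Finset.sum_congr rfl fun k _ => ?_
  module

end AltFamily

end SecondOrder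

section Bracket

variable {E : Type*} [NormedAddCommGroup E] [NormedSpace ℝ E]
  {M : Type*} [TopologicalSpace M] [ChartedSpace E M]

namespace Forms

/-- `a` is a sum of forms whose degrees have the parity of `i`. -/
def HasParity (i : ℤ) (a : Forms E M) : Prop := parity a = (-1 : ℝ) ^ i • a

/-- The deviation of the contraction with the bivector from being a derivation. -/
def bivecBracket (σ : FormField E M 2) (n : ℕ) (a b : Forms E M) : Forms E M :=
  bivec σ n (wedge a b) - wedge (bivec σ n a) b - wedge a (bivec σ n b)

theorem bivec_add (σ : FormField E M 2) (n : ℕ) (a b : Forms E M) :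
    bivec σ n (a + b) = bivec σ n a + bivec σ n b :=
  ext_at fun x => map_add (AltFamily.bivectorContract (σ x) n) (a.at' x) (b.at' x)

theorem bivec_smul (σ : FormField E M 2) (n : ℕ) (c : ℝ) (a : Forms E M) :
    bivec σ n (c • a) = c • bivec σ n a :=
  ext_at fun x => map_smul (AltFamily.bivectorContract (σ x) n) c (a.at' x)

theorem wedge_assoc (a b c : Forms E M) : wedge (wedge a b) c = wedge a (wedge b c) :=
  ext_at fun x => AltFamily.wedge_assoc (a.at' x) (b.at' x) (c.at' x)

theorem wedge_sub_left (a a' b : Forms E M) : wedge (a - a') b = wedge a b - wedge a' b :=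
  ext_at fun x => AltFamily.wedge_sub_left (a.at' x) (a'.at' x) (b.at' x)

theorem wedge_sub_right (a b b' : Forms E M) : wedge a (b - b') = wedge a b - wedge a b' :=
  ext_at fun x => AltFamily.wedge_sub_right (a.at' x) (b.at' x) (b'.at' x)

theorem parity_wedge (a b : Forms E M) : parity (wedge a b) = wedge (parity a) (parity b) :=
  ext_at fun x => AltFamily.parity_wedge (a.at' x) (b.at' x)

theorem parity_add (a b : Forms E M) : parity (a + b) = parity a + parity b :=
  ext_at fun x => map_add AltFamily.parity (a.at' x) (b.at' x)

theorem parity_sub (a b : Forms E M) : parity (a - b) = parity a - parity b :=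
  ext_at fun x => map_sub AltFamily.parity (a.at' x) (b.at' x)

theorem one_wedge (a : Forms E M) : wedge one a = a :=
  ext_at fun x => by rw [at_wedge, at_one, AltFamily.one_wedge]

theorem wedge_one (a : Forms E M) : wedge a one = a :=
  ext_at fun x => by rw [at_wedge, at_one, AltFamily.wedge_one]

theorem HasParity.at' {i : ℤ} {a : Forms E M} (ha : HasParity i a) (x : M) :
    AltFamily.parity (a.at' x) = (-1 : ℝ) ^ i • a.at' x :=
  congrArg (fun b : Forms E M => b.at' x) ha

theorem HasParity.wedge_comm {i j : ℤ} {a b : Forms E M} (ha : HasParity i a) (hb : HasParity j b) :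
    wedge a b = (-1 : ℝ) ^ (i * j) • wedge b a :=
  ext_at fun x => by
    rw [at_smul, at_wedge, at_wedge]
    exact AltFamily.wedge_comm_of_parity (a := a.at' x) (b := b.at' x) (ha.at' x) (hb.at' x)

theorem neg_smul_forms (r : ℝ) (a : Forms E M) : -(r • a) = (-r) • a := by
  funext k x
  ext v
  exact (neg_mul r (a k x v)).symm

theorem HasParity.d {i : ℤ} {a : Forms E M} (ha : HasParity i a) : HasParity (i + 1) (d a) := by
  have h1 : Forms.d (parity a) = (-1 : ℝ) ^ i • Forms.d a := by rw [ha, d_smul]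
  rw [d_parity, neg_eq_iff_eq_neg, neg_smul_forms] at h1
  rw [HasParity, h1, zpow_add_one₀ (by norm_num), mul_neg_one]

end Forms

variable [IsManifold 𝓘(ℝ, E) ∞ M] [FiniteDimensional ℝ E] {n : ℕ} {F : Foliation E M (2 * n)}
  {σ : FormField E M 2}

namespace Foliation.IsTransverselySymplectic

variable (hσ : F.IsTransverselySymplectic σ)
include hσ

theorem at_bivecBracket {a b : Forms E M} (ha : a ∈ horForms σ) (hb : b ∈ horForms σ) {x : M}
    {e e' : Fin (2 * n) → TangentSpace 𝓘(ℝ, E) x} (he : AltFamily.IsFrame (σ x) e e') :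
    (Forms.bivecBracket σ n a b).at' x = AltFamily.frameBracket e e' (a.at' x) (b.at' x) := by
  have h1 := he.bivectorContract_eq ((wedge_mem_horForms ha hb).2 x)
  have h2 := he.bivectorContract_eq (ha.2 x)
  have h3 := he.bivectorContract_eq (hb.2 x)
  change AltFamily.bivectorContract (σ x) n ((Forms.wedge a b).at' x) -
    AltFamily.wedge (AltFamily.bivectorContract (σ x) n (a.at' x)) (b.at' x) -
    AltFamily.wedge (a.at' x) (AltFamily.bivectorContract (σ x) n (b.at' x)) = _
  rw [h1, h2, h3]
  rfl

theorem bivecBracket_wedge {a b c : Forms E M} (ha : a ∈ horForms σ) (hb : b ∈ horForms σ)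
    (hc : c ∈ horForms σ) {i j : ℤ} (hai : a.HasParity i) (hbj : b.HasParity j) :
    Forms.bivecBracket σ n a (Forms.wedge b c) = Forms.wedge (Forms.bivecBracket σ n a b) c +
      (-1 : ℝ) ^ (i * j) • Forms.wedge b (Forms.bivecBracket σ n a c) := by
  refine Forms.ext_at fun x => ?_
  obtain ⟨e, e', he⟩ := hσ.exists_isFrame x
  rw [hσ.at_bivecBracket ha (wedge_mem_horForms hb hc) he]
  refine (AltFamily.frameBracket_wedge (hai.at' x) (hbj.at' x) (c.at' x)).trans ?_
  rw [← hσ.at_bivecBracket ha hb he, ← hσ.at_bivecBracket ha hc he]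
  rfl

theorem parity_bivec {a : Forms E M} (ha : a ∈ horForms σ) :
    Forms.parity (Forms.bivec σ n a) = Forms.bivec σ n (Forms.parity a) := by
  refine Forms.ext_at fun x => ?_
  obtain ⟨e, e', he⟩ := hσ.exists_isFrame x
  have h1 := he.bivectorContract_eq (ha.2 x)
  have h2 := he.bivectorContract_eq ((parity_mem_horForms ha).2 x)
  rw [Forms.at_parity, Forms.at_bivec, Forms.at_bivec, h1, h2]
  exact AltFamily.parity_frameContract _

theorem interior_bivec {X : (x : M) → TangentSpace 𝓘(ℝ, E) x} (hX : IsSmoothField X)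
    {a : Forms E M} (ha : a ∈ horForms σ) :
    Forms.interior X (Forms.bivec σ n a) = Forms.bivec σ n (Forms.interior X a) := by
  refine Forms.ext_at fun x => ?_
  obtain ⟨e, e', he⟩ := hσ.exists_isFrame x
  have h1 := he.bivectorContract_eq (ha.2 x)
  have h2 := he.bivectorContract_eq ((interior_mem_horForms hX ha).2 x)
  rw [Forms.at_interior, Forms.at_bivec, Forms.at_bivec, h1, h2]
  exact AltFamily.contract_frameContract _ _

theorem bivecBracket_mem_horForms {a b : Forms E M} (ha : a ∈ horForms σ) (hb : b ∈ horForms σ) :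
    Forms.bivecBracket σ n a b ∈ horForms σ :=
  Submodule.sub_mem _ (Submodule.sub_mem _ (hσ.bivec_mem_horForms (wedge_mem_horForms ha hb))
    (wedge_mem_horForms (hσ.bivec_mem_horForms ha) hb))
    (wedge_mem_horForms ha (hσ.bivec_mem_horForms hb))

theorem parity_bivecBracket {a b : Forms E M} (ha : a ∈ horForms σ) (hb : b ∈ horForms σ)
    {i j : ℤ} (hai : a.HasParity i) (hbj : b.HasParity j) :
    Forms.parity (Forms.bivecBracket σ n a b) =
      ((-1 : ℝ) ^ i * (-1) ^ j) • Forms.bivecBracket σ n a b := by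
  rw [Forms.bivecBracket, Forms.parity_sub, Forms.parity_sub, Forms.parity_wedge,
    Forms.parity_wedge, hσ.parity_bivec ha, hσ.parity_bivec hb,
    hσ.parity_bivec (wedge_mem_horForms ha hb), Forms.parity_wedge, hai, hbj]
  simp only [Forms.wedge_smul_left, Forms.wedge_smul_right, Forms.bivec_smul, smul_smul, smul_sub,
    mul_comm]

end Foliation.IsTransverselySymplectic

end Bracket
end

/-! ### Identities for the codifferential on basic forms -/

noncomputable section

set_option linter.unusedSectionVars false

section CodifferentialIdentities

variable {E : Type*} [NormedAddCommGroup E] [NormedSpace ℝ E]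
  {M : Type*} [TopologicalSpace M] [ChartedSpace E M]

/-- The algebra behind the derivation property of the bracket. -/
theorem bracket_combination {V : Type*} [AddCommGroup V] [Module ℝ V] {s t ε : ℝ}
    (hs : s * s = 1) (x₁ x₂ x₃ y₁ y₂ y₃ u w : V) :
    x₁ + (s * t) • u + ε • (w + t • y₁) - (x₂ + (ε * t) • y₂) -
      s • (x₃ + (ε * s) • w + t • (u + ε • y₃)) =
    x₁ - x₂ - s • x₃ + (ε * t) • (y₁ - y₂ - s • y₃) := by
  have h1 : s • (x₃ + (ε * s) • w + t • (u + ε • y₃)) =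
      s • x₃ + (ε * (s * s)) • w + (s * t) • u + (ε * t * s) • y₃ := by module
  rw [h1, hs]
  module

theorem neg_one_zpow_mul_self (i : ℤ) : (-1 : ℝ) ^ i * (-1) ^ i = 1 := by
  rw [← mul_zpow]; simp

theorem neg_one_zpow_add_one_mul (i j : ℤ) :
    (-1 : ℝ) ^ ((i + 1) * j) = (-1) ^ (i * j) * (-1) ^ j := by
  rw [add_mul, one_mul, zpow_add₀ (by norm_num)]

theorem neg_one_zpow_mul_add_one (i j : ℤ) :
    (-1 : ℝ) ^ (i * (j + 1)) = (-1) ^ (i * j) * (-1) ^ i := by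
  rw [mul_add, mul_one, zpow_add₀ (by norm_num)]

variable [IsManifold 𝓘(ℝ, E) ∞ M] [FiniteDimensional ℝ E] {n : ℕ} {F : Foliation E M (2 * n)}
  {σ : FormField E M 2}

namespace Foliation.IsTransverselySymplectic

variable (hσ : F.IsTransverselySymplectic σ) [T2Space M]
include hσ

theorem codiff_mem_basic {a : Forms E M} (ha : a ∈ basicSubmodule σ) :
    Forms.codiff σ n a ∈ basicSubmodule σ := by
  rw [hσ.codiff_eq ha]
  exact Submodule.sub_mem _ (d_mem_basic (hσ.bivec_mem_basic ha)) (hσ.bivec_mem_basic (d_mem_basic ha))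

theorem codiff_add {a b : Forms E M} (ha : a ∈ basicSubmodule σ) (hb : b ∈ basicSubmodule σ) :
    Forms.codiff σ n (a + b) = Forms.codiff σ n a + Forms.codiff σ n b := by
  rw [hσ.codiff_eq ha, hσ.codiff_eq hb, hσ.codiff_eq (Submodule.add_mem _ ha hb), Forms.bivec_add,
    Forms.d_add ha.1.1 hb.1.1, Forms.bivec_add,
    Forms.d_add (hσ.bivec_mem_basic ha).1.1 (hσ.bivec_mem_basic hb).1.1]
  abel

theorem codiff_smul (c : ℝ) {a : Forms E M} (ha : a ∈ basicSubmodule σ) :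
    Forms.codiff σ n (c • a) = c • Forms.codiff σ n a := by
  rw [hσ.codiff_eq ha, hσ.codiff_eq (Submodule.smul_mem _ c ha), Forms.bivec_smul, Forms.d_smul,
    Forms.d_smul, Forms.bivec_smul, smul_sub]

theorem codiff_codiff {a : Forms E M} (ha : a ∈ basicSubmodule σ) :
    Forms.codiff σ n (Forms.codiff σ n a) = 0 := by
  have h1 : Forms.codiff σ n a = (-hσ.comm (FormSpace.mk a ha)).val :=
    hσ.codiff_val (FormSpace.mk a ha)
  have h2 : hσ.comm (-hσ.comm (FormSpace.mk a ha)) = 0 := by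
    rw [map_neg]
    have := LinearMap.congr_fun hσ.comm_mul_comm (FormSpace.mk a ha)
    rw [neg_eq_zero]
    exact this
  rw [h1, hσ.codiff_val, h2, neg_zero]
  rfl

theorem d_codiff {a : Forms E M} (ha : a ∈ basicSubmodule σ) :
    Forms.d (Forms.codiff σ n a) = -Forms.codiff σ n (Forms.d a) := by
  have h1 := d_mem_basic ha
  have h2 : Forms.bivec σ n (0 : Forms E M) = 0 :=
    Forms.ext_at fun x => map_zero (AltFamily.bivectorContract (σ x) n)
  rw [hσ.codiff_eq ha, hσ.codiff_eq h1, Forms.d_d ha.1.1, h2, sub_zero,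
    Forms.d_sub (hσ.bivec_mem_basic ha).2.1 (hσ.bivec_mem_basic h1).1.1,
    Forms.d_d (hσ.bivec_mem_basic ha).1.1, zero_sub]

theorem interior_mem_basic {X : (x : M) → TangentSpace 𝓘(ℝ, E) x} (hX : F.IsFoliateField X)
    {a : Forms E M} (ha : a ∈ basicSubmodule σ) : Forms.interior X a ∈ basicSubmodule σ := by
  refine ⟨interior_mem_horForms hX.1 ha.1, ?_⟩
  have h1 : Forms.d (Forms.interior X a) = Forms.lieDeriv X a - Forms.interior X (Forms.d a) := by
    rw [Forms.lieDeriv, add_sub_cancel_right]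
  rw [h1]
  exact Submodule.sub_mem _ (hσ.lieDeriv_mem_horForms hX ha.1) (interior_mem_horForms hX.1 ha.2)

/-- `Λ` commutes with `ι(X)`, as contractions anticommute, and with `L(X) = dι(X) + ι(X)d`.
Inserting `δ = dΛ - Λd` leaves exactly the commutator of `Λ` with `L(X)`. -/
theorem interior_codiff {X : (x : M) → TangentSpace 𝓘(ℝ, E) x} (hX : F.IsFoliateField X)
    (hXσ : Forms.lieDeriv X (Forms.ofTwo σ) = 0) {a : Forms E M} (ha : a ∈ basicSubmodule σ) :
    Forms.interior X (Forms.codiff σ n a) = -Forms.codiff σ n (Forms.interior X a) := by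
  have h1 := hσ.bivec_lieDeriv hX hXσ ha.1
  have h2 : ∀ b c : Forms E M, Forms.interior X (b - c) = Forms.interior X b - Forms.interior X c :=
    fun b c => Forms.ext_at fun x => map_sub (AltFamily.contract (X x)) (b.at' x) (c.at' x)
  rw [Forms.lieDeriv, Forms.lieDeriv, Forms.bivec_add, hσ.interior_bivec hX.1 ha.1] at h1
  rw [hσ.codiff_eq ha, hσ.codiff_eq (hσ.interior_mem_basic hX ha), h2,
    hσ.interior_bivec hX.1 ha.2, neg_sub, sub_eq_sub_iff_add_eq_add, add_comm, h1, add_comm]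

/-- The failure of the codifferential to be a derivation. -/
def _root_.codiffBracket (σ : FormField E M 2) (n : ℕ) (a b : Forms E M) : Forms E M :=
  Forms.codiff σ n (Forms.wedge a b) - Forms.wedge (Forms.codiff σ n a) b -
    Forms.wedge (Forms.parity a) (Forms.codiff σ n b)

/-- Since `d` is a derivation, the defect of `dΛ - Λd` is the defect of `Λ` differentiated by `d`.
-/
theorem codiffBracket_eq {a b : Forms E M} (ha : a ∈ basicSubmodule σ) (hb : b ∈ basicSubmodule σ) :
    codiffBracket σ n a b = Forms.d (Forms.bivecBracket σ n a b) -
      Forms.bivecBracket σ n (Forms.d a) b - Forms.bivecBracket σ n (Forms.parity a) (Forms.d b) := by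
  have hPa := hσ.bivec_mem_basic ha
  have hPb := hσ.bivec_mem_basic hb
  have h1 : Forms.d (Forms.bivecBracket σ n a b) = Forms.d (Forms.bivec σ n (Forms.wedge a b)) -
      Forms.d (Forms.wedge (Forms.bivec σ n a) b) - Forms.d (Forms.wedge a (Forms.bivec σ n b)) := by
    have e1 := (hσ.bivec_mem_basic (wedge_mem_basic ha hb)).1.1
    have e2 := (wedge_mem_basic hPa hb).1.1
    have e3 := (wedge_mem_basic ha hPb).1.1
    rw [Forms.bivecBracket, Forms.d_sub (e1.sub e2) e3, Forms.d_sub e1 e2]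
  rw [codiffBracket, hσ.codiff_eq (wedge_mem_basic ha hb), hσ.codiff_eq ha, hσ.codiff_eq hb, h1,
    Forms.d_wedge ha.1.1 hb.1.1, Forms.d_wedge hPa.1.1 hb.1.1, Forms.d_wedge ha.1.1 hPb.1.1,
    Forms.bivec_add, Forms.bivecBracket, Forms.bivecBracket, hσ.parity_bivec ha.1,
    Forms.wedge_sub_left, Forms.wedge_sub_right]
  abel

omit hσ [T2Space M] in
theorem _root_.Forms.bivecBracket_smul_left (c : ℝ) (a b : Forms E M) :
    Forms.bivecBracket σ n (c • a) b = c • Forms.bivecBracket σ n a b := by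
  simp only [Forms.bivecBracket, Forms.wedge_smul_left, Forms.bivec_smul, smul_sub]

omit hσ [T2Space M] in
theorem _root_.Forms.bivecBracket_smul_right (c : ℝ) (a b : Forms E M) :
    Forms.bivecBracket σ n a (c • b) = c • Forms.bivecBracket σ n a b := by
  simp only [Forms.bivecBracket, Forms.wedge_smul_right, Forms.bivec_smul, smul_sub]

omit hσ [T2Space M] in
theorem _root_.Forms.bivecBracket_add_right (a b c : Forms E M) :
    Forms.bivecBracket σ n a (b + c) = Forms.bivecBracket σ n a b + Forms.bivecBracket σ n a c := by
  simp only [Forms.bivecBracket, Forms.wedge_add_right, Forms.bivec_add]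
  abel

/-- Write `K` for the defect of `Λ`, a derivation in its second argument. The cross terms `K(a, b) ∧
dc` and `db ∧ K(a, c)` arise once from `d K(a, b ∧ c)` and once from `K(a, d(b ∧ c))`, and cancel.
-/
theorem codiffBracket_wedge {a b c : Forms E M} (ha : a ∈ basicSubmodule σ)
    (hb : b ∈ basicSubmodule σ) (hc : c ∈ basicSubmodule σ) {i j : ℤ} (hai : a.HasParity i)
    (hbj : b.HasParity j) : codiffBracket σ n a (Forms.wedge b c) =
      Forms.wedge (codiffBracket σ n a b) c +
        (-1 : ℝ) ^ ((i + 1) * j) • Forms.wedge b (codiffBracket σ n a c) := by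
  have hKab := hσ.bivecBracket_mem_horForms ha.1 hb.1
  have hKac := hσ.bivecBracket_mem_horForms ha.1 hc.1
  have e1 : Forms.d (Forms.bivecBracket σ n a (Forms.wedge b c)) =
      Forms.wedge (Forms.d (Forms.bivecBracket σ n a b)) c +
        ((-1 : ℝ) ^ i * (-1) ^ j) • Forms.wedge (Forms.bivecBracket σ n a b) (Forms.d c) +
        (-1 : ℝ) ^ (i * j) • (Forms.wedge (Forms.d b) (Forms.bivecBracket σ n a c) +
          (-1 : ℝ) ^ j • Forms.wedge b (Forms.d (Forms.bivecBracket σ n a c))) := by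
    rw [hσ.bivecBracket_wedge ha.1 hb.1 hc.1 hai hbj,
      Forms.d_add (hKab.1.wedge hc.1.1) ((hb.1.1.wedge hKac.1).smul _), Forms.d_smul,
      Forms.d_wedge hKab.1 hc.1.1, Forms.d_wedge hb.1.1 hKac.1,
      hσ.parity_bivecBracket ha.1 hb.1 hai hbj, hbj, Forms.wedge_smul_left, Forms.wedge_smul_left]
  have e2 := hσ.bivecBracket_wedge ha.2 hb.1 hc.1 hai.d hbj
  have e3 : Forms.bivecBracket σ n a (Forms.d (Forms.wedge b c)) =
      (Forms.wedge (Forms.bivecBracket σ n a (Forms.d b)) c +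
        ((-1 : ℝ) ^ (i * j) * (-1) ^ i) • Forms.wedge (Forms.d b) (Forms.bivecBracket σ n a c)) +
      (-1 : ℝ) ^ j • (Forms.wedge (Forms.bivecBracket σ n a b) (Forms.d c) +
        (-1 : ℝ) ^ (i * j) • Forms.wedge b (Forms.bivecBracket σ n a (Forms.d c))) := by
    rw [Forms.d_wedge hb.1.1 hc.1.1, Forms.bivecBracket_add_right, hbj, Forms.wedge_smul_left,
      Forms.bivecBracket_smul_right, hσ.bivecBracket_wedge ha.1 hb.2 hc.1 hai hbj.d,
      hσ.bivecBracket_wedge ha.1 hb.1 hc.2 hai hbj, neg_one_zpow_mul_add_one]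
  have hs := neg_one_zpow_mul_self i
  rw [hσ.codiffBracket_eq ha (wedge_mem_basic hb hc), hσ.codiffBracket_eq ha hb,
    hσ.codiffBracket_eq ha hc, e1, e2, hai, Forms.bivecBracket_smul_left,
    Forms.bivecBracket_smul_left, Forms.bivecBracket_smul_left, e3, neg_one_zpow_add_one_mul]
  simp only [Forms.wedge_sub_left, Forms.wedge_sub_right, Forms.wedge_smul_left,
    Forms.wedge_smul_right]
  exact bracket_combination hs _ _ _ _ _ _ _ _

end Foliation.IsTransverselySymplectic

end CodifferentialIdentities
end

/-! ### Second derivatives, and forms invariant to first order -/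

noncomputable section

set_option linter.unusedSectionVars false

section SecondDerivatives

variable {E V : Type*} [NormedAddCommGroup E] [NormedSpace ℝ E] [NormedAddCommGroup V]
  [NormedSpace ℝ V]

open Filter Topology

theorem ContDiffAt.eventually_differentiableAt_two {f : E → V} {p : E} (hf : ContDiffAt ℝ 2 f p) :
    ∀ᶠ q in 𝓝 p, DifferentiableAt ℝ f q :=
  (hf.eventually (by simp)).mono fun _ hq => hq.differentiableAt (by simp)

theorem ContDiffAt.differentiableAt_fderiv {f : E → V} {p : E} (hf : ContDiffAt ℝ 2 f p) :
    DifferentiableAt ℝ (fderiv ℝ f) p :=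
  (hf.fderiv_right (m := 1) (by norm_num)).differentiableAt (by simp)

theorem ContDiffAt.fderiv_fderiv_swap {f : E → V} {p : E} (hf : ContDiffAt ℝ 2 f p) (v w : E) :
    fderiv ℝ (fderiv ℝ f) p v w = fderiv ℝ (fderiv ℝ f) p w v :=
  hf.isSymmSndFDerivAt (by simp) v w

theorem hasDerivAt_line (p v : E) (t : ℝ) : HasDerivAt (fun t : ℝ => p + t • v) v t := by
  have h := ((hasDerivAt_id' t).smul_const v).const_add p
  rwa [one_smul] at h

/-- The second derivative vanishes on directions in which the function is affine. -/
theorem ContDiffAt.fderiv_fderiv_self {f : E → V} {p v : E} (hf : ContDiffAt ℝ 2 f p) {a b : V}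
    (h : ∀ᶠ t : ℝ in 𝓝 0, f (p + t • v) = a + t • b) : fderiv ℝ (fderiv ℝ f) p v v = 0 := by
  have hcont : Tendsto (fun t : ℝ => p + t • v) (𝓝 0) (𝓝 p) := by
    have := (hasDerivAt_line p v 0).continuousAt.tendsto
    simpa using this
  have h1 : ∀ᶠ t : ℝ in 𝓝 0, fderiv ℝ f (p + t • v) v = b := by
    filter_upwards [h.eventually_nhds, hcont.eventually hf.eventually_differentiableAt_two]
      with t ht hd
    have e1 : HasDerivAt (fun t : ℝ => f (p + t • v)) (fderiv ℝ f (p + t • v) v) t :=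
      hd.hasFDerivAt.comp_hasDerivAt t (hasDerivAt_line p v t)
    exact e1.unique ((hasDerivAt_line a b t).congr_of_eventuallyEq ht)
  have h2 : HasFDerivAt (fderiv ℝ f) (fderiv ℝ (fderiv ℝ f) p) (p + (0 : ℝ) • v) := by
    rw [zero_smul, add_zero]; exact hf.differentiableAt_fderiv.hasFDerivAt
  have h3 : HasDerivAt (fun t : ℝ => fderiv ℝ f (p + t • v)) (fderiv ℝ (fderiv ℝ f) p v) 0 :=
    h2.comp_hasDerivAt (0 : ℝ) (hasDerivAt_line p v 0)
  have h4 : HasDerivAt (fun t : ℝ => fderiv ℝ f (p + t • v) v)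
      (fderiv ℝ (fderiv ℝ f) p v v) 0 :=
    (ContinuousLinearMap.apply ℝ V v).hasFDerivAt.comp_hasDerivAt (0 : ℝ) h3
  exact h4.unique ((hasDerivAt_const (0 : ℝ) b).congr_of_eventuallyEq h1)

/-- A mixed second derivative vanishes if the function is affine along both directions and along
their sum. -/
theorem ContDiffAt.fderiv_fderiv_mixed {f : E → V} {p u v : E} (hf : ContDiffAt ℝ 2 f p)
    {a b c b' c' b'' : V}
    (hu : ∀ᶠ t : ℝ in 𝓝 0, f (p + t • u) = a + t • b)
    (hv : ∀ᶠ t : ℝ in 𝓝 0, f (p + t • v) = c + t • b')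
    (huv : ∀ᶠ t : ℝ in 𝓝 0, f (p + t • (u + v)) = c' + t • b'') :
    fderiv ℝ (fderiv ℝ f) p u v = 0 := by
  have h1 := hf.fderiv_fderiv_self hu
  have h2 := hf.fderiv_fderiv_self hv
  have h3 := hf.fderiv_fderiv_self huv
  have h4 : fderiv ℝ (fderiv ℝ f) p (u + v) (u + v) =
      fderiv ℝ (fderiv ℝ f) p u u + fderiv ℝ (fderiv ℝ f) p u v +
        (fderiv ℝ (fderiv ℝ f) p v u + fderiv ℝ (fderiv ℝ f) p v v) := by
    simp only [map_add, add_apply]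
    abel
  rw [h4, h1, h2, hf.fderiv_fderiv_swap v u, zero_add, add_zero, ← two_smul ℝ] at h3
  exact (smul_eq_zero.1 h3).resolve_left two_ne_zero

/-- The derivative of a partial derivative in another direction. -/
theorem ContDiffAt.hasDerivAt_fderiv_slice {Ψ : ℝ × E → V} {y₀ : E}
    (h : ContDiffAt ℝ 2 Ψ (0, y₀)) {Y : E → V}
    (hY : ∀ᶠ y in 𝓝 y₀, HasDerivAt (fun t => Ψ (t, y)) (Y y) 0) :
    HasDerivAt (fun t => fderiv ℝ (fun y => Ψ (t, y)) y₀) (fderiv ℝ Y y₀) 0 := by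
  have hD := h.differentiableAt_fderiv.hasFDerivAt
  have hpair : ∀ t : ℝ, HasDerivAt (fun t : ℝ => (t, y₀)) ((1 : ℝ), (0 : E)) t := fun t =>
    (hasDerivAt_id t).prodMk (hasDerivAt_const t y₀)
  have hpair' : ∀ (t : ℝ) (y : E), HasFDerivAt (fun y : E => (t, y))
      (ContinuousLinearMap.inr ℝ ℝ E) y := fun t y => hasFDerivAt_prodMk_right t y
  have hd := h.eventually_differentiableAt_two
  have h1 : ∀ᶠ t : ℝ in 𝓝 0, fderiv ℝ (fun y => Ψ (t, y)) y₀ =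
      (fderiv ℝ Ψ (t, y₀)).comp (ContinuousLinearMap.inr ℝ ℝ E) := by
    have hc : Tendsto (fun t : ℝ => (t, y₀)) (𝓝 0) (𝓝 (0, y₀)) := (hpair 0).continuousAt
    filter_upwards [hc.eventually hd] with t ht
    exact (ht.hasFDerivAt.comp y₀ (hpair' t y₀)).fderiv
  have h2 : ∀ᶠ y in 𝓝 y₀, Y y = fderiv ℝ Ψ (0, y) (1, 0) := by
    have hc : Tendsto (fun y : E => ((0 : ℝ), y)) (𝓝 y₀) (𝓝 (0, y₀)) := (hpair' 0 y₀).continuousAt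
    filter_upwards [hY, hc.eventually hd] with y hy hdy
    have e1 : HasDerivAt (fun t : ℝ => (t, y)) ((1 : ℝ), (0 : E)) 0 :=
      (hasDerivAt_id 0).prodMk (hasDerivAt_const 0 y)
    exact hy.unique (hdy.hasFDerivAt.comp_hasDerivAt (0 : ℝ) e1)
  have h3 : HasFDerivAt Y ((ContinuousLinearMap.apply ℝ V ((1 : ℝ), (0 : E))).comp
      ((fderiv ℝ (fderiv ℝ Ψ) (0, y₀)).comp (ContinuousLinearMap.inr ℝ ℝ E))) y₀ :=
    ((ContinuousLinearMap.apply ℝ V ((1 : ℝ), (0 : E))).hasFDerivAt.comp y₀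
      (hD.comp y₀ (hpair' 0 y₀))).congr_of_eventuallyEq h2
  have h4 : fderiv ℝ Y y₀ = (fderiv ℝ (fderiv ℝ Ψ) (0, y₀) (1, 0)).comp
      (ContinuousLinearMap.inr ℝ ℝ E) := by
    rw [h3.fderiv]
    ext v
    exact h.fderiv_fderiv_swap _ _
  rw [h4]
  refine HasDerivAt.congr_of_eventuallyEq ?_ h1
  exact ((ContinuousLinearMap.compL ℝ E (ℝ × E) V).flip
    (ContinuousLinearMap.inr ℝ ℝ E)).hasFDerivAt.comp_hasDerivAt (0 : ℝ)
      (hD.comp_hasDerivAt (0 : ℝ) (hpair 0))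

end SecondDerivatives

section Invariance

open Filter Topology

namespace AltFamily

variable {E : Type*} [NormedAddCommGroup E] [NormedSpace ℝ E]

/-- A form that is invariant to first order under a local flow has vanishing Lie derivative. -/
theorem lieDer_eq_zero_of_invariant {ι : Type*} [Fintype ι] {s : Set E} (hs : IsOpen s) {y₀ : E}
    (hy₀ : y₀ ∈ s) {u : ι → E → AltFamily E} (hu : ∀ i, SmoothOn (u i) s) {c : ι → ℝ → ℝ}
    (hc : ∀ i, HasDerivAt (c i) 0 0) {Ψ : ℝ × E → E} (hΨ : ContDiffAt ℝ 2 Ψ (0, y₀))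
    (h0 : ∀ y ∈ s, Ψ (0, y) = y) {X : E → E} (hX : ContDiffOn ℝ ∞ X s)
    (hd : ∀ y ∈ s, HasDerivAt (fun t => Ψ (t, y)) (-X y) 0)
    (hinv : ∀ᶠ t in 𝓝 0, ∀ k, ∀ v : Fin k → E,
      ∑ i, c i t * u i (Ψ (t, y₀)) k (fun j => fderiv ℝ (fun y => Ψ (t, y)) y₀ (v j)) =
        ∑ i, c i 0 * u i y₀ k v) :
    lieDer X (fun y => ∑ i, c i 0 • u i y) y₀ = 0 := by
  have hU : SmoothOn (fun y => ∑ i, c i 0 • u i y) s := fun k => by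
    simp only [Finset.sum_apply, Pi.smul_apply]
    exact ContDiffOn.sum fun i _ => (hu i k).const_smul (c i 0)
  have hsn := hs.mem_nhds hy₀
  have hB : HasDerivAt (fun t => fderiv ℝ (fun y => Ψ (t, y)) y₀)
      (fderiv ℝ (fun y => -X y) y₀) 0 :=
    hΨ.hasDerivAt_fderiv_slice (Filter.eventually_of_mem hsn hd)
  have hB0 : fderiv ℝ (fun y => Ψ (0, y)) y₀ = ContinuousLinearMap.id ℝ E := by
    have : (fun y => Ψ (0, y)) =ᶠ[𝓝 y₀] id := Filter.eventually_of_mem hsn h0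
    rw [this.fderiv_eq, fderiv_id]
  have hB' : fderiv ℝ (fun y => -X y) y₀ = -fderiv ℝ X y₀ := fderiv_fun_neg
  rw [hB'] at hB
  funext k
  ext v
  rw [lieDer_apply hs hU hX hy₀ k v]
  -- The coefficients `c i` are stationary at 0 and contribute nothing. The motion of the point
  -- contributes the derivative along `-X`, and the space derivative of `Ψ` contributes minus the
  -- derivative of `X` in each slot; together they are minus the Lie derivative.
  have hterm : ∀ i, HasDerivAt (fun t => c i t * u i (Ψ (t, y₀)) k
      (fun j => fderiv ℝ (fun y => Ψ (t, y)) y₀ (v j)))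
      (c i 0 * (fderiv ℝ (fun z => u i z k) y₀ (-X y₀) v +
        ∑ j, u i y₀ k (Function.update v j (-fderiv ℝ X y₀ (v j))))) 0 := fun i => by
    have e0 : HasFDerivAt (fun z => u i z k) (fderiv ℝ (fun z => u i z k) y₀) (Ψ (0, y₀)) := by
      rw [h0 y₀ hy₀]
      exact ((hu i k).contDiffAt hsn).differentiableAt (by simp) |>.hasFDerivAt
    have e1 := (e0.comp_hasDerivAt (0 : ℝ) (hd y₀ hy₀)).hasFDerivAt
    have e2 : ∀ j, HasFDerivAt (fun t => fderiv ℝ (fun y => Ψ (t, y)) y₀ (v j)) _ 0 := fun j =>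
      (hB.clm_apply (hasDerivAt_const (0 : ℝ) (v j))).hasFDerivAt
    have e3 := (e1.continuousAlternatingMap_apply e2).hasDerivAt
    have e4 := (hc i).mul e3
    refine e4.congr_deriv ?_
    simp [hB0, h0 y₀ hy₀]
  have hsum := HasDerivAt.fun_sum (u := Finset.univ) fun i _ => hterm i
  have hconst : HasDerivAt (fun t : ℝ => ∑ i, c i t * u i (Ψ (t, y₀)) k
      (fun j => fderiv ℝ (fun y => Ψ (t, y)) y₀ (v j))) 0 0 :=
    (hasDerivAt_const (0 : ℝ) _).congr_of_eventuallyEq (hinv.mono fun t ht => ht k v)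
  have hzero := hsum.unique hconst
  have hfd : fderiv ℝ (fun z => (∑ i, c i 0 • u i z) k) y₀ (X y₀) =
      ∑ i, c i 0 • fderiv ℝ (fun z => u i z k) y₀ (X y₀) := by
    simp only [Finset.sum_apply, Pi.smul_apply]
    have e1 : HasFDerivAt (fun z => ∑ i, c i 0 • u i z k)
        (∑ i, c i 0 • fderiv ℝ (fun z => u i z k) y₀) y₀ :=
      HasFDerivAt.fun_sum fun i _ => ((((hu i k).contDiffAt hsn).differentiableAt
        (by simp)).hasFDerivAt.const_smul (c i 0))
    rw [e1.fderiv]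
    simp
  have hneg : ∀ i, fderiv ℝ (fun z => u i z k) y₀ (-X y₀) v +
        ∑ j, u i y₀ k (Function.update v j (-fderiv ℝ X y₀ (v j))) =
      -(fderiv ℝ (fun z => u i z k) y₀ (X y₀) v +
        ∑ j, u i y₀ k (Function.update v j (fderiv ℝ X y₀ (v j)))) := fun i => by
    rw [map_neg, neg_add, ← Finset.sum_neg_distrib]
    congr 1
    refine Finset.sum_congr rfl fun j _ => ?_
    have := (u i y₀ k).map_update_smul v j (-1 : ℝ) (fderiv ℝ X y₀ (v j))
    simpa using this
  simp only [hneg, mul_neg, Finset.sum_neg_distrib, neg_eq_zero, mul_add, Finset.sum_add_distrib]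
    at hzero
  rw [dirDeriv, hfd]
  simp only [Finset.sum_apply, Pi.smul_apply, ContinuousAlternatingMap.sum_apply,
    ContinuousAlternatingMap.smul_apply, smul_eq_mul]
  rw [Finset.sum_comm]
  simp only [← Finset.mul_sum]
  exact hzero

end AltFamily

end Invariance
end

/-! ### First-order invariance on manifolds, and expansion of multilinear maps -/

noncomputable section

set_option linter.unusedSectionVars false

section FlowInvariance

open Filter Topology

variable {E : Type*} [NormedAddCommGroup E] [NormedSpace ℝ E] [FiniteDimensional ℝ E]
  {M : Type*} [TopologicalSpace M] [ChartedSpace E M] [IsManifold 𝓘(ℝ, E) ∞ M]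

theorem Forms.chartFam_sum_smul {ι : Type*} [Fintype ι] (c : ι → ℝ) (w : ι → Forms E M) (x₀ : M)
    (y : E) : chartFam x₀ (∑ i, c i • w i) y = ∑ i, c i • chartFam x₀ (w i) y := by
  have h : (∑ i, c i • w i : Forms E M).at' ((extChartAt 𝓘(ℝ, E) x₀).symm y) =
      ∑ i, c i • (w i).at' ((extChartAt 𝓘(ℝ, E) x₀).symm y) := by
    funext k
    simp only [Forms.at', Finset.sum_apply, Pi.smul_apply]
  rw [chartFam_eq, h, map_sum]
  rfl

/-- A form that is invariant to first order under a family of maps has vanishing Lie derivative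
along the field that generates the family. -/
theorem Forms.lieDeriv_eq_zero_of_invariant {ι : Type*} [Fintype ι] {w : ι → Forms E M}
    (hw : ∀ i, (w i).IsSmooth) {c : ι → ℝ → ℝ} (hc : ∀ i, HasDerivAt (c i) 0 0) {Θ : ℝ → M → M}
    (hΘd : ∀ t, MDifferentiable 𝓘(ℝ, E) 𝓘(ℝ, E) (Θ t))
    (hΘc : ∀ x, ContinuousAt (fun t => Θ t x) 0)
    (hΘ : ∀ x, ContDiffAt ℝ 2 (fun p : ℝ × E => extChartAt 𝓘(ℝ, E) x
      (Θ p.1 ((extChartAt 𝓘(ℝ, E) x).symm p.2))) (0, extChartAt 𝓘(ℝ, E) x x))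
    (h0 : ∀ x, Θ 0 x = x) {X : (x : M) → TangentSpace 𝓘(ℝ, E) x} (hX : IsSmoothField X)
    (hd : ∀ x₀, ∀ y ∈ (extChartAt 𝓘(ℝ, E) x₀).target, HasDerivAt
      (fun t => extChartAt 𝓘(ℝ, E) x₀ (Θ t ((extChartAt 𝓘(ℝ, E) x₀).symm y)))
      (-chartField x₀ X y) 0)
    (hpull : ∀ t, pullback (Θ t) (∑ i, c i t • w i) = ∑ i, c i 0 • w i) :
    lieDeriv X (∑ i, c i 0 • w i) = 0 := by
  have hsm : (∑ i, c i 0 • w i : Forms E M).IsSmooth := by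
    refine Finset.sum_induction (fun i => c i 0 • w i) Forms.IsSmooth (fun _ _ => IsSmooth.add)
      isSmooth_zero fun i _ => (hw i).smul _
  refine Forms.ext_chart fun x => ?_
  have hy := mem_extChartAt_target (I := 𝓘(ℝ, E)) x
  rw [chartFam_lieDeriv hX hsm hy]
  have h1 : chartFam x (∑ i, c i 0 • w i) = fun y => ∑ i, c i 0 • chartFam x (w i) y :=
    funext fun y => chartFam_sum_smul _ _ _ _
  rw [h1]
  refine (AltFamily.lieDer_eq_zero_of_invariant (isOpen_extChartAt_target x) hy
    (fun i => isSmooth_iff.1 (hw i) x) hc (hΘ x) (fun y hy => ?_) (contDiffOn_chartField hX x)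
    (hd x) ?_).trans rfl
  · change extChartAt 𝓘(ℝ, E) x (Θ 0 _) = y
    rw [h0]
    exact (extChartAt 𝓘(ℝ, E) x).right_inv hy
  · have h2 : ∀ᶠ t in 𝓝 (0 : ℝ), Θ t x ∈ (extChartAt 𝓘(ℝ, E) x).source :=
      (hΘc x).eventually ((isOpen_extChartAt_source x).mem_nhds (by
        change Θ 0 x ∈ _; rw [h0]; exact mem_extChartAt_source x))
    filter_upwards [h2] with t ht k v
    have hx : (extChartAt 𝓘(ℝ, E) x).symm (extChartAt 𝓘(ℝ, E) x x) = x := extChartAt_to_inv x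
    have h3 := chartExpr_pullback (x₀ := x) (x₁ := x) (f := Θ t) hy (hΘd t _)
      (by rw [hx]; exact ht) (∑ i, c i t • w i) k
    rw [hpull t] at h3
    have h4 : ∀ (s : ℝ) (y : E), chartExpr x ((∑ i, c i s • w i : Forms E M) k) y =
        ∑ i, c i s • chartFam x (w i) y k := fun s y => by
      have := congrFun (chartFam_sum_smul (fun i => c i s) w x y) k
      simp only [Finset.sum_apply, Pi.smul_apply] at this
      rw [← this]
      rfl
    rw [h4, h4] at h3
    have h5 := DFunLike.congr_fun h3.symm v
    simp only [ContinuousAlternatingMap.compContinuousLinearMap_apply,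
      ContinuousAlternatingMap.sum_apply, ContinuousAlternatingMap.smul_apply, smul_eq_mul] at h5
    exact h5

end FlowInvariance

section Multilinear

/-- Expanding in a basis writes a polynomial with values in forms as a finite sum of scalar
polynomials times fixed forms, so its dependence on `ζ` can be differentiated without a topology on
the space of forms. -/
theorem MultilinearMap.exists_expansion {V N : Type*} [NormedAddCommGroup V] [NormedSpace ℝ V]
    [FiniteDimensional ℝ V] [AddCommGroup N] [Module ℝ N] {i : ℕ}
    (A : MultilinearMap ℝ (fun _ : Fin i => V) N) :
    ∃ (ι : Type) (_ : Fintype ι) (w : ι → N) (p : ι → V → ℝ), (∀ k, Differentiable ℝ (p k)) ∧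
      ∀ ζ, A (fun _ => ζ) = ∑ k, p k ζ • w k := by
  let b := Module.finBasis ℝ V
  refine ⟨Fin i → Fin (Module.finrank ℝ V), inferInstance, fun s => A fun r => b (s r),
    fun s ζ => ∏ r, b.coord (s r) ζ, fun s => ?_, fun ζ => ?_⟩
  · have h : ∀ r, ContDiff ℝ 1 fun ζ => b.coord (s r) ζ := fun r =>
      (LinearMap.toContinuousLinearMap (b.coord (s r))).contDiff
    exact (contDiff_prod fun r _ => h r).differentiable (by simp)
  · conv_lhs => rw [← b.sum_repr ζ]
    rw [A.map_sum]
    exact Finset.sum_congr rfl fun s _ => A.map_smul_univ _ _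

end Multilinear
end

/-! ### A curve in the group, and the adjoint action along it -/

noncomputable section

set_option linter.unusedSectionVars false

section Curve

open Filter Topology

variable {E' : Type*} [NormedAddCommGroup E'] [NormedSpace ℝ E'] [FiniteDimensional ℝ E']
  {G : Type*} [TopologicalSpace G] [ChartedSpace E' G] [Group G]

/-- A curve through the identity with velocity `ξ`, affine in the chart. -/
def chartCurve (ξ : GroupLieAlgebra 𝓘(ℝ, E') G) (t : ℝ) : G :=
  (extChartAt 𝓘(ℝ, E') (1 : G)).symm
    (extChartAt 𝓘(ℝ, E') (1 : G) 1 + t • (chartInv (1 : G) 1 ξ : E'))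

theorem chartCurve_zero (ξ : GroupLieAlgebra 𝓘(ℝ, E') G) : chartCurve ξ 0 = 1 := by
  rw [chartCurve, zero_smul, add_zero, extChartAt_to_inv]

theorem eventually_chart_chartCurve (ξ : GroupLieAlgebra 𝓘(ℝ, E') G) : ∀ᶠ t : ℝ in 𝓝 0,
    extChartAt 𝓘(ℝ, E') (1 : G) (chartCurve ξ t) =
      extChartAt 𝓘(ℝ, E') (1 : G) 1 + t • (chartInv (1 : G) 1 ξ : E') := by
  have hc : ContinuousAt (fun t : ℝ => extChartAt 𝓘(ℝ, E') (1 : G) 1 +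
      t • (chartInv (1 : G) 1 ξ : E')) 0 := by fun_prop
  have h := hc.eventually ((isOpen_extChartAt_target (I := 𝓘(ℝ, E')) (1 : G)).mem_nhds (by
    simp only [zero_smul, add_zero]; exact mem_extChartAt_target (I := 𝓘(ℝ, E')) (1 : G)))
  filter_upwards [h] with t ht
  exact (extChartAt 𝓘(ℝ, E') (1 : G)).right_inv ht

variable [IsManifold 𝓘(ℝ, E') ∞ G]

theorem contMDiffAt_chartCurve (ξ : GroupLieAlgebra 𝓘(ℝ, E') G) :
    ContMDiffAt 𝓘(ℝ, ℝ) 𝓘(ℝ, E') ∞ (chartCurve ξ) 0 := by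
  have h1 : ContMDiffAt 𝓘(ℝ, E') 𝓘(ℝ, E') ∞ (extChartAt 𝓘(ℝ, E') (1 : G)).symm
      (extChartAt 𝓘(ℝ, E') (1 : G) 1 + (0 : ℝ) • (chartInv (1 : G) 1 ξ : E')) := by
    rw [zero_smul, add_zero]
    exact (contMDiffOn_extChartAt_symm (I := 𝓘(ℝ, E')) (n := ∞) (1 : G)).contMDiffAt
      ((isOpen_extChartAt_target (1 : G)).mem_nhds (mem_extChartAt_target (I := 𝓘(ℝ, E')) (1 : G)))
  have h2 : ContMDiffAt 𝓘(ℝ, ℝ) 𝓘(ℝ, E') ∞ (fun t : ℝ => extChartAt 𝓘(ℝ, E') (1 : G) 1 +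
      t • (chartInv (1 : G) 1 ξ : E')) 0 := by
    rw [contMDiffAt_iff_contDiffAt]
    fun_prop
  exact ContMDiffAt.comp (0 : ℝ) h1 h2

/-- The derivative of a map along the curve. -/
theorem hasDerivAt_comp_chartCurve (ξ : GroupLieAlgebra 𝓘(ℝ, E') G)
    {E₂ : Type*} [NormedAddCommGroup E₂] [NormedSpace ℝ E₂] {N : Type*} [TopologicalSpace N]
    [ChartedSpace E₂ N] [IsManifold 𝓘(ℝ, E₂) ∞ N] {f : G → N}
    (hf : MDifferentiableAt 𝓘(ℝ, E') 𝓘(ℝ, E₂) f 1) {x₀ : N}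
    (hx : f 1 ∈ (extChartAt 𝓘(ℝ, E₂) x₀).source) :
    HasDerivAt (fun t => extChartAt 𝓘(ℝ, E₂) x₀ (f (chartCurve ξ t)))
      (chartInv x₀ (f 1) (mfderiv 𝓘(ℝ, E') 𝓘(ℝ, E₂) f 1 ξ)) 0 := by
  set κ := extChartAt 𝓘(ℝ, E') (1 : G) with hκ
  set q : E' → E₂ := fun z => extChartAt 𝓘(ℝ, E₂) x₀ (f (κ.symm z)) with hq
  have h1 : MDifferentiableAt 𝓘(ℝ, E') 𝓘(ℝ, E') κ.symm (κ 1) :=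
    mdifferentiableAt_chart_symm (mem_extChartAt_target (I := 𝓘(ℝ, E')) (1 : G))
  have hs : κ.symm (κ 1) = 1 := extChartAt_to_inv (I := 𝓘(ℝ, E')) (1 : G)
  have hq' : MDifferentiableAt 𝓘(ℝ, E') 𝓘(ℝ, E₂) q (κ 1) := by
    have h2 : MDifferentiableAt 𝓘(ℝ, E') 𝓘(ℝ, E₂) f (κ.symm (κ 1)) := by rwa [hs]
    have h3 : MDifferentiableAt 𝓘(ℝ, E₂) 𝓘(ℝ, E₂) (extChartAt 𝓘(ℝ, E₂) x₀) (f (κ.symm (κ 1))) :=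
      mdifferentiableAt_chart (by rwa [hs])
    exact h3.comp (κ 1) (h2.comp (κ 1) h1)
  have hqd : HasFDerivAt q (mfderiv 𝓘(ℝ, E') 𝓘(ℝ, E₂) q (κ 1)) (κ 1) := by
    rw [mfderiv_eq_fderiv]
    exact hq'.differentiableAt.hasFDerivAt
  have hline := hasDerivAt_line (κ 1) (chartInv (1 : G) 1 ξ : E') 0
  have h4 : HasFDerivAt q (mfderiv 𝓘(ℝ, E') 𝓘(ℝ, E₂) q (κ 1))
      (κ 1 + (0 : ℝ) • (chartInv (1 : G) 1 ξ : E')) := by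
    rw [zero_smul, add_zero]; exact hqd
  have h5 := h4.comp_hasDerivAt (0 : ℝ) hline
  refine h5.congr_deriv ?_
  have hκd : MDifferentiableAt 𝓘(ℝ, E') 𝓘(ℝ, E') κ (1 : G) :=
    mdifferentiableAt_chart (mem_extChartAt_source (I := 𝓘(ℝ, E')) (1 : G))
  have e1 : mfderiv 𝓘(ℝ, E') 𝓘(ℝ, E₂) (q ∘ κ) (1 : G) =
      (mfderiv 𝓘(ℝ, E') 𝓘(ℝ, E₂) q (κ 1)).comp (mfderiv 𝓘(ℝ, E') 𝓘(ℝ, E') κ 1) :=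
    mfderiv_comp (1 : G) hq' hκd
  have e2 : (q ∘ κ) =ᶠ[𝓝 (1 : G)] (extChartAt 𝓘(ℝ, E₂) x₀ ∘ f) := by
    filter_upwards [(isOpen_extChartAt_source (I := 𝓘(ℝ, E')) (1 : G)).mem_nhds
      (mem_extChartAt_source (I := 𝓘(ℝ, E')) (1 : G))] with g hg
    change extChartAt 𝓘(ℝ, E₂) x₀ (f (κ.symm (κ g))) = _
    rw [κ.left_inv hg]
    rfl
  have e3 : mfderiv 𝓘(ℝ, E') 𝓘(ℝ, E₂) (extChartAt 𝓘(ℝ, E₂) x₀ ∘ f) (1 : G) =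
      (mfderiv 𝓘(ℝ, E₂) 𝓘(ℝ, E₂) (extChartAt 𝓘(ℝ, E₂) x₀) (f 1)).comp
        (mfderiv 𝓘(ℝ, E') 𝓘(ℝ, E₂) f 1) :=
    mfderiv_comp (1 : G) (mdifferentiableAt_chart hx) hf
  have e4 : ∀ ξ : E', (mfderiv 𝓘(ℝ, E') 𝓘(ℝ, E₂) (q ∘ κ) (1 : G) ξ : E₂) =
      mfderiv 𝓘(ℝ, E') 𝓘(ℝ, E₂) (extChartAt 𝓘(ℝ, E₂) x₀ ∘ f) (1 : G) ξ := fun ξ => by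
    rw [e2.mfderiv_eq]
    rfl
  have e5 := e4 ξ
  rw [e1, e3] at e5
  exact e5

end Curve

section Adjoint

open Filter Topology

variable {E' : Type*} [NormedAddCommGroup E'] [NormedSpace ℝ E'] [FiniteDimensional ℝ E']
  {G : Type*} [TopologicalSpace G] [ChartedSpace E' G] [Group G] [LieGroup 𝓘(ℝ, E') ∞ G]

theorem contDiffAt_conj_chartCurve (ξ : GroupLieAlgebra 𝓘(ℝ, E') G) :
    ContDiffAt ℝ 2 (fun p : ℝ × ℝ => extChartAt 𝓘(ℝ, E') (1 : G)
      (chartCurve ξ p.1 * chartCurve ξ p.2 * (chartCurve ξ p.1)⁻¹)) (0 : ℝ × ℝ) := by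
  have h1 : ContMDiffAt 𝓘(ℝ, ℝ × ℝ) 𝓘(ℝ, E') ∞ (fun p : ℝ × ℝ => chartCurve ξ p.1) 0 :=
    ContMDiffAt.comp (g := chartCurve ξ) (f := Prod.fst) (0 : ℝ × ℝ) (contMDiffAt_chartCurve ξ)
      (contMDiffAt_iff_contDiffAt.2 contDiffAt_fst)
  have h2 : ContMDiffAt 𝓘(ℝ, ℝ × ℝ) 𝓘(ℝ, E') ∞ (fun p : ℝ × ℝ => chartCurve ξ p.2) 0 :=
    ContMDiffAt.comp (g := chartCurve ξ) (f := Prod.snd) (0 : ℝ × ℝ) (contMDiffAt_chartCurve ξ)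
      (contMDiffAt_iff_contDiffAt.2 contDiffAt_snd)
  have h3 := (h1.mul h2).mul h1.inv
  have h4 : ContMDiffAt 𝓘(ℝ, E') 𝓘(ℝ, E') ∞ (extChartAt 𝓘(ℝ, E') (1 : G))
      (chartCurve ξ (0 : ℝ × ℝ).1 * chartCurve ξ (0 : ℝ × ℝ).2 * (chartCurve ξ (0 : ℝ × ℝ).1)⁻¹) := by
    rw [Prod.fst_zero, Prod.snd_zero, chartCurve_zero, mul_one, mul_inv_cancel]
    exact contMDiffAt_extChartAt
  have h5 := ContMDiffAt.comp (0 : ℝ × ℝ) h4 h3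
  exact (contMDiffAt_iff_contDiffAt.1 h5).of_le
    (by simpa using WithTop.coe_le_coe.2 (le_top : (2 : ℕ∞) ≤ ⊤))

/-- The derivative of `t ↦ Ad (g t) ξ` vanishes if `g` has velocity `ξ`. -/
theorem hasDerivAt_adjointAction (ξ : GroupLieAlgebra 𝓘(ℝ, E') G) :
    HasDerivAt (fun t => (adjointAction (chartCurve ξ t) ξ : E')) 0 0 := by
  have hF := contDiffAt_conj_chartCurve ξ
  set F : ℝ × ℝ → E' := fun p => extChartAt 𝓘(ℝ, E') (1 : G)
      (chartCurve ξ p.1 * chartCurve ξ p.2 * (chartCurve ξ p.1)⁻¹) with hFdef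
  have hcurve := eventually_chart_chartCurve ξ
  -- `F (s, t)` is the coordinate of `g s * g t * (g s)⁻¹`. It is constant for `t = 0`, it is the
  -- coordinate of `g t` for `s = 0`, and it is again that of `g t` on the diagonal. The curve is
  -- affine in the chart, so `F` is affine in all three directions and the mixed derivative
  -- vanishes. This is `[ξ, ξ] = 0` in coordinates.
  have hmixed : fderiv ℝ (fderiv ℝ F) 0 (1, 0) (0, 1) = 0 := by
    refine hF.fderiv_fderiv_mixed (a := extChartAt 𝓘(ℝ, E') (1 : G) 1) (b := 0)
      (c := extChartAt 𝓘(ℝ, E') (1 : G) 1) (b' := (chartInv (1 : G) 1 ξ : E'))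
      (c' := extChartAt 𝓘(ℝ, E') (1 : G) 1) (b'' := (chartInv (1 : G) 1 ξ : E')) ?_ ?_ ?_
    · refine Eventually.of_forall fun t => ?_
      simp [hFdef, chartCurve_zero]
    · filter_upwards [hcurve] with t ht
      refine Eq.trans ?_ ht
      simp [hFdef, chartCurve_zero]
    · filter_upwards [hcurve] with t ht
      refine Eq.trans ?_ ht
      simp [hFdef]
  have hconj : ∀ s, MDifferentiableAt 𝓘(ℝ, E') 𝓘(ℝ, E')
      (fun h : G => chartCurve ξ s * h * (chartCurve ξ s)⁻¹) 1 := fun s =>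
    ((contMDiff_const.mul contMDiff_id).mul contMDiff_const).mdifferentiableAt (n := ∞) (by simp)
  have hA : ∀ s, HasDerivAt (fun t => F (s, t))
      (chartInv (1 : G) 1 (adjointAction (chartCurve ξ s) ξ) : E') 0 := fun s => by
    have h1 := hasDerivAt_comp_chartCurve ξ (hconj s) (x₀ := (1 : G)) (by
      rw [mul_one, mul_inv_cancel]; exact mem_extChartAt_source (I := 𝓘(ℝ, E')) (1 : G))
    refine h1.congr_deriv ?_
    have h2 : chartCurve ξ s * 1 * (chartCurve ξ s)⁻¹ = 1 := by rw [mul_one, mul_inv_cancel]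
    have h3 : ∀ (g : G) (_ : g = 1) (v : E'), (chartInv (1 : G) g v : E') = chartInv (1 : G) 1 v := by
      rintro g rfl v; rfl
    exact h3 _ h2 _
  have hpair : HasDerivAt (fun s : ℝ => (s, (0 : ℝ))) ((1 : ℝ), (0 : ℝ)) 0 :=
    (hasDerivAt_id (0 : ℝ)).prodMk (hasDerivAt_const (0 : ℝ) (0 : ℝ))
  have hpair' : ∀ s : ℝ, HasDerivAt (fun t : ℝ => (s, t)) ((0 : ℝ), (1 : ℝ)) 0 := fun s =>
    (hasDerivAt_const (0 : ℝ) s).prodMk (hasDerivAt_id (0 : ℝ))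
  have hA' : ∀ᶠ s in 𝓝 (0 : ℝ), (chartInv (1 : G) 1 (adjointAction (chartCurve ξ s) ξ) : E') =
      fderiv ℝ F (s, 0) (0, 1) := by
    have hc : Tendsto (fun s : ℝ => (s, (0 : ℝ))) (𝓝 0) (𝓝 (0 : ℝ × ℝ)) := hpair.continuousAt
    filter_upwards [hc.eventually hF.eventually_differentiableAt_two] with s hs
    exact (hA s).unique (hs.hasFDerivAt.comp_hasDerivAt (0 : ℝ) (hpair' s))
  have hD0 : HasFDerivAt (fderiv ℝ F) (fderiv ℝ (fderiv ℝ F) 0)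
      ((fun s : ℝ => (s, (0 : ℝ))) 0) := hF.differentiableAt_fderiv.hasFDerivAt
  have hD : HasDerivAt (fun s : ℝ => fderiv ℝ F (s, 0)) (fderiv ℝ (fderiv ℝ F) 0 (1, 0)) 0 :=
    HasFDerivAt.comp_hasDerivAt (f := fun s : ℝ => (s, (0 : ℝ))) (0 : ℝ) hD0 hpair
  have hD' : HasDerivAt (fun s : ℝ => fderiv ℝ F (s, 0) (0, 1)) 0 0 := by
    have := (ContinuousLinearMap.apply ℝ E' ((0 : ℝ), (1 : ℝ))).hasFDerivAt.comp_hasDerivAt (0 : ℝ) hD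
    refine this.congr_deriv ?_
    exact hmixed
  have hB := hD'.congr_of_eventuallyEq hA'
  -- The derivative of the chart at the identity is a fixed isomorphism; its inverse leads back from
  -- coordinates to the Lie algebra.
  obtain ⟨e, he⟩ := isInvertible_mfderiv_extChartAt (I := 𝓘(ℝ, E'))
    (mem_extChartAt_source (I := 𝓘(ℝ, E')) (1 : G))
  have h6 : ∀ v : E', (e.symm (chartInv (1 : G) 1 v : E') : E') = v := fun v => by
    have h7 : (chartInv (1 : G) 1 v : E') = e v := (DFunLike.congr_fun he v).symm
    rw [h7]
    exact e.symm_apply_apply v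
  let e' : E' →L[ℝ] E' := show E' →L[ℝ] E' from e.symm.toContinuousLinearMap
  have h8 := e'.hasFDerivAt.comp_hasDerivAt (0 : ℝ) hB
  rw [map_zero] at h8
  refine h8.congr_of_eventuallyEq (Eventually.of_forall fun t => ?_)
  exact (h6 _).symm

end Adjoint
end

/-! ### Equivariance and infinitesimal invariance under the group action -/

noncomputable section

set_option linter.unusedSectionVars false

section LieGroupAction

open Filter Topology

variable {E : Type*} [NormedAddCommGroup E] [NormedSpace ℝ E]
  {M : Type*} [TopologicalSpace M] [ChartedSpace E M]

theorem Differentiable.hasDerivAt_comp_zero {V N : Type*} [NormedAddCommGroup V] [NormedSpace ℝ V]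
    [NormedAddCommGroup N] [NormedSpace ℝ N] {p : V → N} (hp : Differentiable ℝ p) {γ : ℝ → V}
    {t : ℝ} (hγ : HasDerivAt γ 0 t) : HasDerivAt (fun s => p (γ s)) 0 t := by
  have h := (hp (γ t)).hasFDerivAt.comp_hasDerivAt t hγ
  rwa [map_zero] at h

theorem Forms.pullback_interior {f : M → M} {X Y : (x : M) → TangentSpace 𝓘(ℝ, E) x}
    (h : ∀ x, mfderiv 𝓘(ℝ, E) 𝓘(ℝ, E) f x (X x) = Y (f x)) (a : Forms E M) :
    pullback f (interior Y a) = interior X (pullback f a) :=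
  ext_at fun x => by
    have h1 := AltFamily.contract_comap (mfderiv 𝓘(ℝ, E) 𝓘(ℝ, E) f x) (X x) (a.at' (f x))
    rw [h] at h1
    exact h1.symm

theorem Forms.pullback_wedge (f : M → M) (a b : Forms E M) :
    pullback f (wedge a b) = wedge (pullback f a) (pullback f b) :=
  ext_at fun x => AltFamily.comap_wedge (mfderiv 𝓘(ℝ, E) 𝓘(ℝ, E) f x) (a.at' (f x)) (b.at' (f x))

theorem Forms.pullback_one (f : M → M) : pullback f (one : Forms E M) = one :=
  ext_at fun x => by rw [at_pullback, at_one, at_one, AltFamily.comap_one]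

theorem Forms.pullback_sub (f : M → M) (a b : Forms E M) :
    pullback f (a - b) = pullback f a - pullback f b := by
  funext k x; ext v; rfl

variable [IsManifold 𝓘(ℝ, E) ∞ M] [FiniteDimensional ℝ E]
  {E' : Type*} [NormedAddCommGroup E'] [NormedSpace ℝ E'] [FiniteDimensional ℝ E']
  {G : Type*} [TopologicalSpace G] [ChartedSpace E' G] [Group G] [LieGroup 𝓘(ℝ, E') ∞ G]
  [MulAction G M] [ContMDiffSMul 𝓘(ℝ, E') 𝓘(ℝ, E) ∞ G M]

variable (E E' M) in
include E' in
theorem contMDiff_smul_left (g : G) : ContMDiff 𝓘(ℝ, E) 𝓘(ℝ, E) ∞ (fun x : M => g • x) :=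
  ContMDiffSMul.contMDiff_const_smul (I := 𝓘(ℝ, E')) g

variable (E E' G) in
theorem contMDiff_orbit (x : M) : ContMDiff 𝓘(ℝ, E') 𝓘(ℝ, E) ∞ (fun g : G => g • x) :=
  ContMDiff.smul contMDiff_id contMDiff_const

variable (E E' M) in
include E' in
theorem mfderiv_smul_surjective (g : G) (x : M) :
    Function.Surjective (mfderiv 𝓘(ℝ, E) 𝓘(ℝ, E) (fun y : M => g • y) x) :=
  ((Diffeomorph.smul 𝓘(ℝ, E') 𝓘(ℝ, E) ∞ g : M ≃ₘ^∞⟮𝓘(ℝ, E), 𝓘(ℝ, E)⟯ M).mfderivToContinuousLinearEquiv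
    (by simp) (x := x)).surjective

/-- Differentiate `g • (h • x) = (g * h * g⁻¹) • (g • x)` with respect to `h` at the identity. -/
theorem mfderiv_smul_fundamentalField (g : G) (ξ : GroupLieAlgebra 𝓘(ℝ, E') G) (x : M) :
    (mfderiv 𝓘(ℝ, E) 𝓘(ℝ, E) (fun y : M => g • y) x (fundamentalField E ξ x) : E) =
      fundamentalField E (adjointAction g ξ) (g • x) := by
  have hg := fun y : M => (contMDiff_smul_left E M E' g y).mdifferentiableAt (by simp)
  have ho := fun (y : M) (h : G) => (contMDiff_orbit E E' G y h).mdifferentiableAt (by simp)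
  have hc : MDifferentiableAt 𝓘(ℝ, E') 𝓘(ℝ, E') (fun h : G => g * h * g⁻¹) 1 :=
    ((contMDiff_const.mul contMDiff_id).mul contMDiff_const).mdifferentiableAt (n := ∞) (by simp)
  have hAB : (fun y : M => g • y) ∘ (fun h : G => h • x) =
      (fun h : G => h • (g • x)) ∘ (fun h : G => g * h * g⁻¹) := by
    funext h
    simp only [Function.comp, mul_smul, inv_smul_smul]
  have e1 := mfderiv_comp (1 : G) (hg ((1 : G) • x)) (ho x 1)
  have e2 := mfderiv_comp (1 : G) (ho (g • x) (g * 1 * g⁻¹)) hc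
  have e3 : ∀ ξ : E', (mfderiv 𝓘(ℝ, E') 𝓘(ℝ, E) ((fun y : M => g • y) ∘ (fun h : G => h • x)) 1 ξ : E)
      = mfderiv 𝓘(ℝ, E') 𝓘(ℝ, E) ((fun h : G => h • (g • x)) ∘ (fun h : G => g * h * g⁻¹)) 1 ξ :=
    fun ξ => by rw [hAB]
  have e4 := e3 ξ
  rw [e1, e2] at e4
  -- The chain rule yields the base points `1 • x` and `g * 1 * g⁻¹`; `t1` and `t2` replace them by
  -- `x` and `1`, with all tangent spaces read as the model space.
  have t1 : ∀ (y z : M) (_ : y = z) (v : E), (mfderiv 𝓘(ℝ, E) 𝓘(ℝ, E) (fun y : M => g • y) y v : E) =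
      mfderiv 𝓘(ℝ, E) 𝓘(ℝ, E) (fun y : M => g • y) z v := by
    rintro y z rfl v; rfl
  have t2 : ∀ (h h' : G) (_ : h = h') (v : E'),
      (mfderiv 𝓘(ℝ, E') 𝓘(ℝ, E) (fun h : G => h • (g • x)) h v : E) =
      mfderiv 𝓘(ℝ, E') 𝓘(ℝ, E) (fun h : G => h • (g • x)) h' v := by
    rintro h h' rfl v; rfl
  have e5 : (mfderiv 𝓘(ℝ, E) 𝓘(ℝ, E) (fun y : M => g • y) x
      (mfderiv 𝓘(ℝ, E') 𝓘(ℝ, E) (fun h : G => h • x) 1 ξ : E) : E) =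
      mfderiv 𝓘(ℝ, E') 𝓘(ℝ, E) (fun h : G => h • (g • x)) 1 (adjointAction g ξ : E') :=
    (t1 _ _ (one_smul G x).symm _).trans
      (e4.trans (t2 _ _ (show g * 1 * g⁻¹ = 1 by rw [mul_one, mul_inv_cancel]) _))
  have e6 : (mfderiv 𝓘(ℝ, E) 𝓘(ℝ, E) (fun y : M => g • y) x (fundamentalField E ξ x) : E) =
    -(mfderiv 𝓘(ℝ, E) 𝓘(ℝ, E) (fun y : M => g • y) x
      (mfderiv 𝓘(ℝ, E') 𝓘(ℝ, E) (fun h : G => h • x) 1 ξ : E) : E) :=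
    map_neg (mfderiv 𝓘(ℝ, E) 𝓘(ℝ, E) (fun y : M => g • y) x) _
  rw [e6, e5]
  rfl

theorem Forms.pullback_smul_interior (g : G) (ξ : GroupLieAlgebra 𝓘(ℝ, E') G) (a : Forms E M) :
    pullback (fun x : M => g • x) (interior (fundamentalField E (adjointAction g ξ)) a) =
      interior (fundamentalField E ξ) (pullback (fun x : M => g • x) a) :=
  pullback_interior (fun x => mfderiv_smul_fundamentalField g ξ x) a

section Codifferential

variable {n : ℕ} {F : Foliation E M (2 * n)} {σ : FormField E M 2}

namespace Foliation.IsTransverselySymplectic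

variable (hσ : F.IsTransverselySymplectic σ)

include hσ

include E' in
-- The contraction is natural under surjective linear maps, and the derivative of `g` pulls `σ` back
-- to itself.
theorem bivec_pullback (hpres : PreservesForm G σ) (g : G) {a : Forms E M} (ha : a ∈ horForms σ) :
    Forms.bivec σ n (Forms.pullback (fun x : M => g • x) a) =
      Forms.pullback (fun x : M => g • x) (Forms.bivec σ n a) :=
  Forms.ext_at fun x => by
    obtain ⟨e, e', he⟩ := hσ.exists_isFrame (g • x)
    have h := AltFamily.bivectorContract_comap (mfderiv_smul_surjective E M E' g x) he (ha.2 (g • x))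
    rw [hpres g x] at h
    exact h

include E' in
theorem codiff_pullback [T2Space M] (hpres : PreservesForm G σ) (g : G) {a : Forms E M}
    (ha : a ∈ basicSubmodule σ)
    (hga : Forms.pullback (fun x : M => g • x) a ∈ basicSubmodule σ) :
    Forms.codiff σ n (Forms.pullback (fun x : M => g • x) a) =
      Forms.pullback (fun x : M => g • x) (Forms.codiff σ n a) := by
  have hg := contMDiff_smul_left E M E' g
  rw [hσ.codiff_eq ha, hσ.codiff_eq hga, Forms.pullback_sub,
    hσ.bivec_pullback (E' := E') hpres g ha.1,
    Forms.d_pullback hg (hσ.bivec_mem_basic ha).1.1, Forms.d_pullback hg ha.1.1,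
    hσ.bivec_pullback (E' := E') hpres g ha.2]

end Foliation.IsTransverselySymplectic

end Codifferential

section Invariance

/-- The minus sign is that of `fundamentalField`, which is generated by `exp(-tξ)`, while the curve
has velocity `ξ`. -/
theorem chartField_fundamentalField (ξ : GroupLieAlgebra 𝓘(ℝ, E') G) (x₀ : M) {y : E}
    (hy : y ∈ (extChartAt 𝓘(ℝ, E) x₀).target) : HasDerivAt
      (fun t => extChartAt 𝓘(ℝ, E) x₀ (chartCurve ξ t • (extChartAt 𝓘(ℝ, E) x₀).symm y))
      (-chartField x₀ (fundamentalField E ξ) y) 0 := by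
  set p := (extChartAt 𝓘(ℝ, E) x₀).symm y with hp
  have h1 := hasDerivAt_comp_chartCurve ξ (x₀ := x₀) (f := fun g : G => g • p)
    ((contMDiff_orbit E E' G p 1).mdifferentiableAt (by simp))
    (by rw [one_smul]; exact (extChartAt 𝓘(ℝ, E) x₀).map_target hy)
  refine h1.congr_deriv ?_
  have h2 : ∀ (q : M) (_ : q = p) (v : E), (chartInv x₀ q v : E) = chartInv x₀ p v := by
    rintro q rfl v; rfl
  refine (h2 _ (one_smul G p) _).trans ?_
  have h3 : chartField x₀ (fundamentalField E ξ) y = chartInv x₀ p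
    (-(mfderiv 𝓘(ℝ, E') 𝓘(ℝ, E) (fun g : G => g • p) 1 ξ : E) : E) := rfl
  rw [h3]
  have h4 := map_neg (chartInv x₀ p) (mfderiv 𝓘(ℝ, E') 𝓘(ℝ, E) (fun g : G => g • p) 1 ξ : E)
  exact (neg_eq_iff_eq_neg.2 h4).symm

theorem lieDeriv_fundamentalField_eq_zero {ι : Type*} [Fintype ι] {w : ι → Forms E M}
    (hw : ∀ i, (w i).IsSmooth) {c : ι → ℝ → ℝ} (hc : ∀ i, HasDerivAt (c i) 0 0)
    (ξ : GroupLieAlgebra 𝓘(ℝ, E') G) (hX : IsSmoothField (fundamentalField E (M := M) ξ))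
    (hpull : ∀ t, Forms.pullback (fun x : M => chartCurve ξ t • x) (∑ i, c i t • w i) =
      ∑ i, c i 0 • w i) :
    Forms.lieDeriv (fundamentalField E ξ) (∑ i, c i 0 • w i) = 0 := by
  refine Forms.lieDeriv_eq_zero_of_invariant hw hc (Θ := fun t x => chartCurve ξ t • x)
    (fun t => (contMDiff_smul_left E M E' _).mdifferentiable (by simp)) (fun x => ?_) (fun x => ?_)
    (fun x => ?_) hX (fun x₀ y hy => chartField_fundamentalField ξ x₀ hy) hpull
  · have h1 : ContinuousAt (fun g : G => g • x) (chartCurve ξ 0) :=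
      (contMDiff_orbit E E' G x).continuous.continuousAt
    exact ContinuousAt.comp (f := chartCurve ξ) h1 (contMDiffAt_chartCurve ξ).continuousAt
  · have hs : ContMDiffAt 𝓘(ℝ, E) 𝓘(ℝ, E) ∞ (extChartAt 𝓘(ℝ, E) x).symm
        (extChartAt 𝓘(ℝ, E) x x) :=
      (contMDiffOn_extChartAt_symm (I := 𝓘(ℝ, E)) (n := ∞) x).contMDiffAt
        ((isOpen_extChartAt_target x).mem_nhds (mem_extChartAt_target (I := 𝓘(ℝ, E)) x))
    have h1 : ContMDiffAt 𝓘(ℝ, ℝ × E) 𝓘(ℝ, E') ∞ (fun p : ℝ × E => chartCurve ξ p.1)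
        (0, extChartAt 𝓘(ℝ, E) x x) :=
      ContMDiffAt.comp (g := chartCurve ξ) (f := Prod.fst) (0, extChartAt 𝓘(ℝ, E) x x)
        (contMDiffAt_chartCurve ξ) (contMDiffAt_iff_contDiffAt.2 contDiffAt_fst)
    have h2 : ContMDiffAt 𝓘(ℝ, ℝ × E) 𝓘(ℝ, E) ∞
        (fun p : ℝ × E => (extChartAt 𝓘(ℝ, E) x).symm p.2) (0, extChartAt 𝓘(ℝ, E) x x) :=
      ContMDiffAt.comp (g := (extChartAt 𝓘(ℝ, E) x).symm) (f := Prod.snd)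
        (0, extChartAt 𝓘(ℝ, E) x x) hs (contMDiffAt_iff_contDiffAt.2 contDiffAt_snd)
    have h3 := h1.smul h2
    have h4 : ContMDiffAt 𝓘(ℝ, E) 𝓘(ℝ, E) ∞ (extChartAt 𝓘(ℝ, E) x)
        (chartCurve ξ ((0 : ℝ), extChartAt 𝓘(ℝ, E) x x).1 •
          (extChartAt 𝓘(ℝ, E) x).symm ((0 : ℝ), extChartAt 𝓘(ℝ, E) x x).2) := by
      rw [chartCurve_zero, one_smul, extChartAt_to_inv]
      exact contMDiffAt_extChartAt
    have h5 := ContMDiffAt.comp ((0 : ℝ), extChartAt 𝓘(ℝ, E) x x) h4 h3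
    exact (contMDiffAt_iff_contDiffAt.1 h5).of_le
      (by simpa using WithTop.coe_le_coe.2 (le_top : (2 : ℕ∞) ≤ ⊤))
  · rw [chartCurve_zero, one_smul]

theorem lieDeriv_ofTwo_eq_zero {σ : FormField E M 2} (hσ : IsSmoothForm σ)
    (hpres : PreservesForm G σ) (ξ : GroupLieAlgebra 𝓘(ℝ, E') G)
    (hX : IsSmoothField (fundamentalField E (M := M) ξ)) :
    Forms.lieDeriv (fundamentalField E ξ) (Forms.ofTwo σ) = 0 := by
  have h := lieDeriv_fundamentalField_eq_zero (ι := Unit) (w := fun _ => Forms.ofTwo σ)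
    (fun _ => Forms.isSmooth_ofTwo hσ) (c := fun _ _ => 1) (fun _ => hasDerivAt_const _ _) ξ hX
    (fun t => by
      simp only [Finset.univ_unique, Finset.sum_singleton, one_smul]
      refine Forms.ext_at fun x => ?_
      funext k
      by_cases hk : k = 2
      · subst hk
        exact hpres _ x
      · have h0 : (Forms.ofTwo σ : Forms E M) k = 0 := Pi.single_eq_of_ne hk _
        change ((Forms.ofTwo σ : Forms E M) k _).compContinuousLinearMap _ =
          (Forms.ofTwo σ : Forms E M) k x
        rw [h0]
        rfl)
  simpa only [Finset.univ_unique, Finset.sum_singleton, one_smul] using h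

/-- Expand `α ζ` as a sum of polynomials in `ζ` times fixed forms. Equivariance says that
`chartCurve ξ t` pulls `α` at `Ad (chartCurve ξ t) ξ` back to `α ξ`, and by
`hasDerivAt_adjointAction` the coefficients are stationary at `t = 0`. -/
theorem lieDeriv_cartanPiece {m : ℕ} {F : Foliation E M m} {i j : ℕ} {α : EquivForms E' G E M}
    (hα : α ∈ F.cartanPiece E' G i j) (ξ : GroupLieAlgebra 𝓘(ℝ, E') G)
    (hX : IsSmoothField (fundamentalField E (M := M) ξ)) :
    Forms.lieDeriv (fundamentalField E ξ) (α ξ) = 0 := by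
  obtain ⟨⟨A, hA⟩, hinv⟩ := hα
  obtain ⟨ι, _, w, p, hp, hAp⟩ := MultilinearMap.exists_expansion (V := E') (N := F.basicForms j)
    (show MultilinearMap ℝ (fun _ : Fin i => E') (F.basicForms j) from A)
  have hαp : ∀ ζ : GroupLieAlgebra 𝓘(ℝ, E') G, α ζ = ∑ k, p k ζ • (w k : Forms E M) := fun ζ => by
    have h1 : α ζ = ((A fun _ => ζ : F.basicForms j) : Forms E M) := hA ζ
    have h2 : ((A fun _ => ζ : F.basicForms j)) = ∑ k, p k ζ • w k := hAp ζ
    rw [h1, h2]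
    simp only [Submodule.coe_sum, Submodule.coe_smul]
  have hAd0 : (adjointAction (chartCurve ξ 0) ξ : E') = ξ := by
    rw [chartCurve_zero]
    have h : (fun h : G => 1 * h * 1⁻¹) = id := by funext h; simp
    have h2 : ∀ f : G → G, f = id → ∀ v : E', (mfderiv 𝓘(ℝ, E') 𝓘(ℝ, E') f 1 v : E') = v := by
      rintro f rfl v
      rw [mfderiv_id]
      rfl
    exact h2 _ h ξ
  have hξ : α ξ = ∑ k, p k (adjointAction (chartCurve ξ 0) ξ : E') • (w k : Forms E M) := by
    rw [hAd0]
    exact hαp ξ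
  rw [hξ]
  refine lieDeriv_fundamentalField_eq_zero (w := fun k => (w k : Forms E M))
    (c := fun k t => p k (adjointAction (chartCurve ξ t) ξ : E')) (fun k => (w k).2.1.smooth)
    (fun k => ?_) ξ hX (fun t => ?_)
  · exact (hp k).hasDerivAt_comp_zero (hasDerivAt_adjointAction ξ)
  · rw [← hξ, ← hαp]
    exact hinv _ ξ

end Invariance

end LieGroupAction
end

/-! ### Degrees, and the operations on the pieces of the Cartan complex -/

noncomputable section

set_option linter.unusedSectionVars false

section Degree

theorem AltFamily.bivectorContract_apply_eq_zero {W : Type*} [AddCommGroup W] [Module ℝ W]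
    [TopologicalSpace W] (σ : W [⋀^Fin 2]→L[ℝ] ℝ) (n : ℕ) {a : AltFamily W} {k : ℕ}
    (h : a (k + 2) = 0) : bivectorContract σ n a k = 0 := by
  rw [bivectorContract]
  split_ifs with hf
  · have h1 : ∀ v w, contract v (contract w a) k = 0 := fun v w => by
      ext u
      change a (k + 2) _ = 0
      rw [h]
      rfl
    rw [frameContract_apply]
    simp only [Pi.smul_apply, Finset.sum_apply, h1, Finset.sum_const_zero, smul_zero]
  · rfl

variable {E : Type*} [NormedAddCommGroup E] [NormedSpace ℝ E]
  {M : Type*} [TopologicalSpace M] [ChartedSpace E M]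

namespace Forms

/-- `a` is homogeneous of degree `j`. -/
def IsDegree (j : ℕ) (a : Forms E M) : Prop := ∀ k, k ≠ j → a k = 0

theorem IsDegree.wedge {i j : ℕ} {a b : Forms E M} (ha : IsDegree i a) (hb : IsDegree j b) :
    IsDegree (i + j) (wedge a b) := fun k hk => by
  funext x
  refine Finset.sum_eq_zero fun pq _ => ?_
  have hpq := Finset.HasAntidiagonal.mem_antidiagonal.1 pq.2
  by_cases h : pq.1.1 = i
  · have h0 : b pq.1.2 x = 0 := by
      rw [hb _ (by omega)]; rfl
    rw [h0]
    have h1 := altWedge_smul_right hpq (0 : ℝ) (a pq.1.1 x) 0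
    rwa [zero_smul, zero_smul] at h1
  · have h0 : a pq.1.1 x = 0 := by
      rw [ha _ h]; rfl
    rw [h0]
    have h1 := altWedge_smul_left hpq (0 : ℝ) 0 (b pq.1.2 x)
    rwa [zero_smul, zero_smul] at h1

theorem d_apply_eq_zero {a : Forms E M} {k : ℕ} (h : a k = 0) : Forms.d a (k + 1) = 0 := by
  change extD (a k) = 0
  rw [h]
  have h1 := extD_smul (0 : ℝ) (0 : FormField E M k)
  rwa [zero_smul, zero_smul] at h1

theorem IsDegree.d {j : ℕ} {a : Forms E M} (ha : IsDegree j a) : IsDegree (j + 1) (d a) :=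
  fun k hk => by
    cases k with
    | zero => rfl
    | succ k => exact d_apply_eq_zero (ha k (by omega))

theorem IsDegree.interior {j : ℕ} {a : Forms E M} (ha : IsDegree (j + 1) a)
    (X : (x : M) → TangentSpace 𝓘(ℝ, E) x) : IsDegree j (interior X a) := fun k hk => by
  funext x
  ext v
  change a (k + 1) x _ = 0
  rw [ha (k + 1) (by omega)]
  rfl

theorem IsDegree.interior_zero {a : Forms E M} (ha : IsDegree 0 a)
    (X : (x : M) → TangentSpace 𝓘(ℝ, E) x) : Forms.interior X a = 0 := by
  funext k x
  ext v
  change a (k + 1) x _ = 0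
  rw [ha (k + 1) (by omega)]
  rfl

theorem bivec_apply_eq_zero (σ : FormField E M 2) (n : ℕ) {a : Forms E M} {k : ℕ}
    (h : a (k + 2) = 0) : bivec σ n a k = 0 := by
  funext x
  exact AltFamily.bivectorContract_apply_eq_zero (σ x) n (congrFun h x)

theorem IsDegree.hasParity {j : ℕ} {a : Forms E M} (ha : IsDegree j a) {k : ℤ}
    (hk : Even ((j : ℤ) - k)) : HasParity k a := by
  funext l
  by_cases hl : l = j
  · subst hl
    have h1 : ((-1 : ℝ) ^ k) = (-1) ^ l := by
      have h2 : k = (l : ℤ) - (l - k) := by ring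
      rw [h2, zpow_sub₀ (by norm_num), hk.neg_one_zpow, div_one, zpow_natCast]
    change (-1 : ℝ) ^ l • a l = (-1 : ℝ) ^ k • a l
    rw [h1]
  · have h0 := ha l hl
    change (-1 : ℝ) ^ l • a l = (-1 : ℝ) ^ k • a l
    rw [h0, smul_zero, smul_zero]

variable [IsManifold 𝓘(ℝ, E) ∞ M] [FiniteDimensional ℝ E] {n : ℕ} {F : Foliation E M (2 * n)}
  {σ : FormField E M 2} [T2Space M]

theorem IsDegree.codiff_apply (hσ : F.IsTransverselySymplectic σ) {j : ℕ} {a : Forms E M}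
    (ha : a ∈ basicSubmodule σ) (haj : IsDegree j a) {k : ℕ} (hk : k + 1 ≠ j) :
    codiff σ n a k = 0 := by
  rw [hσ.codiff_eq ha]
  have h1 : bivec σ n (Forms.d a) k = 0 :=
    bivec_apply_eq_zero σ n (d_apply_eq_zero (haj (k + 1) hk))
  have h2 : Forms.d (bivec σ n a) k = 0 := by
    cases k with
    | zero => rfl
    | succ k => exact d_apply_eq_zero (bivec_apply_eq_zero σ n (haj _ hk))
  change Forms.d (bivec σ n a) k - bivec σ n (Forms.d a) k = 0
  rw [h1, h2, sub_zero]

end Forms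

end Degree

section Pieces

variable {E : Type*} [NormedAddCommGroup E] [NormedSpace ℝ E]
  {M : Type*} [TopologicalSpace M] [ChartedSpace E M]
  [IsManifold 𝓘(ℝ, E) ∞ M] [FiniteDimensional ℝ E] [T2Space M]
  {E' : Type*} [NormedAddCommGroup E'] [NormedSpace ℝ E'] [FiniteDimensional ℝ E']
  {G : Type*} [TopologicalSpace G] [ChartedSpace E' G] [Group G] [LieGroup 𝓘(ℝ, E') ∞ G]
  [MulAction G M] [ContMDiffSMul 𝓘(ℝ, E') 𝓘(ℝ, E) ∞ G M]
  {n : ℕ} {F : Foliation E M (2 * n)} {σ : FormField E M 2}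

theorem fundamentalField_add (ξ η : GroupLieAlgebra 𝓘(ℝ, E') G) :
    fundamentalField E (M := M) (ξ + η) = fundamentalField E ξ + fundamentalField E η := by
  funext x
  change -(mfderiv 𝓘(ℝ, E') 𝓘(ℝ, E) (fun g : G => g • x) 1 (ξ + η) : E) = _
  have h := map_add (mfderiv 𝓘(ℝ, E') 𝓘(ℝ, E) (fun g : G => g • x) 1) ξ η
  refine (congrArg (fun v : E => -v) h).trans ?_
  exact neg_add _ _

theorem fundamentalField_smul (c : ℝ) (ξ : GroupLieAlgebra 𝓘(ℝ, E') G) :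
    fundamentalField E (M := M) (c • ξ) = c • fundamentalField E ξ := by
  funext x
  have h := map_smul (mfderiv 𝓘(ℝ, E') 𝓘(ℝ, E) (fun g : G => g • x) 1) c ξ
  refine (congrArg (fun v : E => -v) h).trans ?_
  exact (smul_neg c (mfderiv 𝓘(ℝ, E') 𝓘(ℝ, E) (fun g : G => g • x) 1 ξ : E)).symm

theorem Forms.interior_add_field (X Y : (x : M) → TangentSpace 𝓘(ℝ, E) x) (a : Forms E M) :
    interior (X + Y) a = interior X a + interior Y a :=
  ext_at fun x => AltFamily.contract_add_vec (X x) (Y x) (a.at' x)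

theorem Forms.interior_smul_field (c : ℝ) (X : (x : M) → TangentSpace 𝓘(ℝ, E) x) (a : Forms E M) :
    interior (c • X) a = c • interior X a :=
  ext_at fun x => AltFamily.contract_smul_vec c (X x) (a.at' x)

theorem Forms.interior_sub (X : (x : M) → TangentSpace 𝓘(ℝ, E) x) (a b : Forms E M) :
    interior X (a - b) = interior X a - interior X b :=
  ext_at fun x => map_sub (AltFamily.contract (X x)) (a.at' x) (b.at' x)

theorem Forms.interior_fundamentalField_add (ξ η : GroupLieAlgebra 𝓘(ℝ, E') G) (a : Forms E M) :
    interior (fundamentalField E (ξ + η)) a =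
      interior (fundamentalField E ξ) a + interior (fundamentalField E η) a := by
  rw [fundamentalField_add]
  exact interior_add_field _ _ _

theorem Forms.interior_fundamentalField_smul (c : ℝ) (ξ : GroupLieAlgebra 𝓘(ℝ, E') G)
    (a : Forms E M) : interior (fundamentalField E (c • ξ)) a =
      c • interior (fundamentalField E ξ) a := by
  rw [fundamentalField_smul]
  exact interior_smul_field c _ _

namespace Foliation.IsTransverselySymplectic

variable (hσ : F.IsTransverselySymplectic σ)

include hσ

theorem codiff_sub {a b : Forms E M} (ha : a ∈ basicSubmodule σ) (hb : b ∈ basicSubmodule σ) :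
    Forms.codiff σ n (a - b) = Forms.codiff σ n a - Forms.codiff σ n b := by
  have h := hσ.codiff_add (Submodule.sub_mem _ ha hb) hb
  rw [sub_add_cancel] at h
  rw [h, add_sub_cancel_right]

theorem mem_basicForms_iff {a : Forms E M} {j : ℕ} :
    a ∈ F.basicForms j ↔ a ∈ basicSubmodule σ ∧ a.IsDegree j := by
  rw [hσ.mem_basicSubmodule_iff]
  rfl

theorem cartanPiece_apply_mem {i j : ℕ} {α : EquivForms E' G E M} (hα : α ∈ F.cartanPiece E' G i j)
    (ξ : GroupLieAlgebra 𝓘(ℝ, E') G) : α ξ ∈ basicSubmodule σ ∧ (α ξ).IsDegree j := by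
  obtain ⟨⟨A, hA⟩, -⟩ := hα
  rw [hA]
  exact hσ.mem_basicForms_iff.1 (A fun _ => ξ).2

/-- Polynomiality is witnessed by multilinear maps. For the product one takes the tensor product of
the two witnesses, with the arguments concatenated, followed by the exterior product. -/
theorem wedge_mem_cartanPiece {i j i' j' : ℕ} {α β : EquivForms E' G E M}
    (hα : α ∈ F.cartanPiece E' G i j) (hβ : β ∈ F.cartanPiece E' G i' j') :
    EquivForms.wedge α β ∈ F.cartanPiece E' G (i + i') (j + j') := by
  obtain ⟨⟨A, hA⟩, hα⟩ := hα
  obtain ⟨⟨B, hB⟩, hβ⟩ := hβ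
  let L : F.basicForms j →ₗ[ℝ] F.basicForms j' →ₗ[ℝ] F.basicForms (j + j') := LinearMap.mk₂ ℝ
    (fun a b => ⟨Forms.wedge a b, hσ.mem_basicForms_iff.2
      ⟨wedge_mem_basic (hσ.mem_basicForms_iff.1 a.2).1 (hσ.mem_basicForms_iff.1 b.2).1,
        (hσ.mem_basicForms_iff.1 a.2).2.wedge (hσ.mem_basicForms_iff.1 b.2).2⟩⟩)
    (fun a a' b => Subtype.ext (Forms.wedge_add_left (a : Forms E M) a' b))
    (fun c a b => Subtype.ext (Forms.wedge_smul_left c (a : Forms E M) b))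
    (fun a b b' => Subtype.ext (Forms.wedge_add_right (a : Forms E M) b b'))
    (fun c a b => Subtype.ext (Forms.wedge_smul_right c (a : Forms E M) b))
  refine ⟨⟨((TensorProduct.lift L).compMultilinearMap (A.domCoprod B)).domDomCongr finSumFinEquiv,
    fun ξ => ?_⟩, fun g ξ => ?_⟩
  · change Forms.wedge (α ξ) (β ξ) = _
    rw [hA, hB]
    rfl
  · change Forms.pullback _ (Forms.wedge (α _) (β _)) = Forms.wedge (α ξ) (β ξ)
    rw [Forms.pullback_wedge, hα, hβ]

theorem codiff_mem_cartanPiece (hpres : PreservesForm G σ) {i j : ℕ} {α : EquivForms E' G E M}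
    (hα : α ∈ F.cartanPiece E' G i (j + 1)) :
    EquivForms.codiff σ n α ∈ F.cartanPiece E' G i j := by
  have hmem := fun ξ => (hσ.cartanPiece_apply_mem hα ξ).1
  obtain ⟨⟨A, hA⟩, hα⟩ := hα
  let L : F.basicForms (j + 1) →ₗ[ℝ] F.basicForms j :=
    { toFun := fun a => ⟨Forms.codiff σ n a, hσ.mem_basicForms_iff.2
        ⟨hσ.codiff_mem_basic (hσ.mem_basicForms_iff.1 a.2).1, fun k hk =>
          (hσ.mem_basicForms_iff.1 a.2).2.codiff_apply hσ (hσ.mem_basicForms_iff.1 a.2).1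
            (by omega)⟩⟩
      map_add' := fun a b => Subtype.ext
        (hσ.codiff_add (hσ.mem_basicForms_iff.1 a.2).1 (hσ.mem_basicForms_iff.1 b.2).1)
      map_smul' := fun c a => Subtype.ext (hσ.codiff_smul c (hσ.mem_basicForms_iff.1 a.2).1) }
  refine ⟨⟨L.compMultilinearMap A, fun ξ => ?_⟩, fun g ξ => ?_⟩
  · change Forms.codiff σ n (α ξ) = _
    rw [hA]
    rfl
  · change Forms.pullback _ (Forms.codiff σ n (α _)) = Forms.codiff σ n (α ξ)
    rw [← hσ.codiff_pullback (E' := E') hpres g (hmem _) (by rw [hα]; exact hmem ξ), hα]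

theorem codiff_cartanPiece_zero {i : ℕ} {α : EquivForms E' G E M}
    (hα : α ∈ F.cartanPiece E' G i 0) : EquivForms.codiff σ n α = 0 := by
  funext ξ k
  obtain ⟨h1, h2⟩ := hσ.cartanPiece_apply_mem hα ξ
  exact h2.codiff_apply hσ h1 (by omega)

theorem d_mem_cartanPiece {i j : ℕ} {α : EquivForms E' G E M}
    (hα : α ∈ F.cartanPiece E' G i j) :
    (fun ξ => Forms.d (α ξ)) ∈ F.cartanPiece E' G i (j + 1) := by
  have hmem := fun ξ => (hσ.cartanPiece_apply_mem hα ξ).1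
  obtain ⟨⟨A, hA⟩, hα⟩ := hα
  let L : F.basicForms j →ₗ[ℝ] F.basicForms (j + 1) :=
    { toFun := fun a => ⟨Forms.d a, hσ.mem_basicForms_iff.2
        ⟨d_mem_basic (hσ.mem_basicForms_iff.1 a.2).1, (hσ.mem_basicForms_iff.1 a.2).2.d⟩⟩
      map_add' := fun a b => Subtype.ext
        (Forms.d_add (a := (a : Forms E M)) (b := (b : Forms E M)) a.2.1.smooth b.2.1.smooth)
      map_smul' := fun c a => Subtype.ext (Forms.d_smul c (a : Forms E M)) }
  refine ⟨⟨L.compMultilinearMap A, fun ξ => ?_⟩, fun g ξ => ?_⟩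
  · change Forms.d (α ξ) = _
    rw [hA]
    rfl
  · change Forms.pullback _ (Forms.d (α _)) = Forms.d (α ξ)
    rw [← Forms.d_pullback (contMDiff_smul_left E M E' g) (hmem _).1.1, hα]

/-- Contraction of basic forms with the fundamental vector fields of a transverse action. -/
def fundamentalInterior (htrans : IsTransverseAction E' G F) (j : ℕ) :
    GroupLieAlgebra 𝓘(ℝ, E') G →ₗ[ℝ] F.basicForms (j + 1) →ₗ[ℝ] F.basicForms j :=
  LinearMap.mk₂ ℝ (fun ξ a => ⟨Forms.interior (fundamentalField E ξ) a, hσ.mem_basicForms_iff.2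
      ⟨hσ.interior_mem_basic (htrans ξ) (hσ.mem_basicForms_iff.1 a.2).1,
        (hσ.mem_basicForms_iff.1 a.2).2.interior _⟩⟩)
    (fun ξ η a => Subtype.ext (Forms.interior_fundamentalField_add ξ η (a : Forms E M)))
    (fun c ξ a => Subtype.ext (Forms.interior_fundamentalField_smul c ξ (a : Forms E M)))
    (fun ξ a b => Subtype.ext (Forms.interior_add (fundamentalField E ξ) (a : Forms E M) b))
    (fun c ξ a => Subtype.ext (Forms.interior_smul (fundamentalField E ξ) c (a : Forms E M)))

theorem interior_mem_cartanPiece (htrans : IsTransverseAction E' G F) {i j : ℕ}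
    {α : EquivForms E' G E M} (hα : α ∈ F.cartanPiece E' G i (j + 1)) :
    (fun ξ => Forms.interior (fundamentalField E ξ) (α ξ)) ∈ F.cartanPiece E' G (i + 1) j := by
  obtain ⟨⟨A, hA⟩, hα⟩ := hα
  -- The fundamental field is linear in `ξ`, so contraction adds one argument to the multilinear map
  -- and raises the polynomial degree by one.
  let B : GroupLieAlgebra 𝓘(ℝ, E') G →ₗ[ℝ]
      MultilinearMap ℝ (fun _ : Fin i => GroupLieAlgebra 𝓘(ℝ, E') G) (F.basicForms j) :=
    { toFun := fun ξ => (fundamentalInterior hσ htrans j ξ).compMultilinearMap A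
      map_add' := fun ξ η => by rw [map_add]; rfl
      map_smul' := fun c ξ => by rw [map_smul]; rfl }
  refine ⟨⟨LinearMap.uncurryLeft (M := fun _ => GroupLieAlgebra 𝓘(ℝ, E') G) B, fun ξ => ?_⟩,
    fun g ξ => ?_⟩
  · change Forms.interior _ (α ξ) = _
    rw [hA]
    rfl
  · change Forms.pullback _ (Forms.interior _ (α _)) = Forms.interior _ (α ξ)
    rw [Forms.pullback_smul_interior, hα]

theorem interior_cartanPiece_zero {i : ℕ} {α : EquivForms E' G E M}
    (hα : α ∈ F.cartanPiece E' G i 0) :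
    (fun ξ => Forms.interior (fundamentalField E ξ) (α ξ)) = 0 := by
  funext ξ
  exact (hσ.cartanPiece_apply_mem hα ξ).2.interior_zero _

theorem one_mem_cartanPiece : (EquivForms.one : EquivForms E' G E M) ∈ F.cartanPiece E' G 0 0 := by
  have h1 : (Forms.one : Forms E M).IsDegree 0 := fun k hk => by
    cases k with
    | zero => exact absurd rfl hk
    | succ k => rfl
  refine ⟨⟨MultilinearMap.constOfIsEmpty ℝ _
    ⟨Forms.one, hσ.mem_basicForms_iff.2 ⟨one_mem_basic, h1⟩⟩, fun ξ => rfl⟩, fun g ξ => ?_⟩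
  exact Forms.pullback_one _

end Foliation.IsTransverselySymplectic

end Pieces
end

/-! ### The equivariant basic Cartan complex as a dGBV algebra -/

noncomputable section

set_option linter.unusedSectionVars false

theorem eq_zero_of_eq_neg {V : Type*} [AddCommGroup V] [Module ℝ V] {v : V} (h : v = -v) :
    v = 0 := by
  have h1 : v = (2 : ℝ)⁻¹ • (v - -v) := by module
  rw [h1, ← h, sub_self, smul_zero]

section Complex

variable {E : Type*} [NormedAddCommGroup E] [NormedSpace ℝ E]
  {M : Type*} [TopologicalSpace M] [ChartedSpace E M]
  [IsManifold 𝓘(ℝ, E) ∞ M]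
  {E' : Type*} [NormedAddCommGroup E'] [NormedSpace ℝ E']
  {G : Type*} [TopologicalSpace G] [ChartedSpace E' G] [Group G]
  [MulAction G M]

namespace Foliation

variable {m : ℕ} {F : Foliation E M m}

theorem cartanPiece_le_cartanComplex {i j : ℕ} {k : ℤ} (h : 2 * (i : ℤ) + (j : ℤ) = k) :
    F.cartanPiece E' G i j ≤ F.cartanComplex E' G k :=
  le_iSup_of_le i (le_iSup_of_le j (le_iSup_of_le h le_rfl))

theorem cartanComplex_induction {k : ℤ} {motive : EquivForms E' G E M → Prop}
    {α : EquivForms E' G E M} (hα : α ∈ F.cartanComplex E' G k)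
    (piece : ∀ i j : ℕ, 2 * (i : ℤ) + (j : ℤ) = k → ∀ α ∈ F.cartanPiece E' G i j, motive α)
    (zero : motive 0) (add : ∀ α β, motive α → motive β → motive (α + β)) : motive α := by
  refine Submodule.iSup_induction _ (motive := motive) hα (fun i α hα => ?_) zero add
  refine Submodule.iSup_induction _ (motive := motive) hα (fun j α hα => ?_) zero add
  refine Submodule.iSup_induction _ (motive := motive) hα (fun h α hα => piece i j h α hα) zero add

/-- The operator whose eigenvalue on forms of total degree `k` is `2 ^ k`. -/
def degreeOperator : Module.End ℝ (EquivForms E' G E M) where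
  toFun α ξ j := (2 : ℝ) ^ j • α ((4 : ℝ) • ξ) j
  map_add' α β := by funext ξ j; exact smul_add _ _ _
  map_smul' c α := by funext ξ j; exact smul_comm ((2 : ℝ) ^ j) c (α ((4 : ℝ) • ξ) j)

/-- Replacing `ξ` by `4 ξ` multiplies a polynomial of degree `i` by `4 ^ i = 2 ^ (2 * i)`, and the
factor `2 ^ j` accounts for the degree of the form. -/
theorem cartanPiece_le_eigenspace {i j : ℕ} {k : ℤ} (h : 2 * (i : ℤ) + (j : ℤ) = k) :
    F.cartanPiece E' G i j ≤ degreeOperator.eigenspace ((2 : ℝ) ^ k) := by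
  intro α hα
  obtain ⟨⟨A, hA⟩, -⟩ := hα
  rw [Module.End.mem_eigenspace_iff]
  funext ξ l
  have h1 : α ((4 : ℝ) • ξ) = (4 : ℝ) ^ i • α ξ := by
    rw [hA, hA]
    have h2 := A.map_smul_univ (fun _ => (4 : ℝ)) (fun _ => ξ)
    rw [h2, Finset.prod_const, Finset.card_univ, Fintype.card_fin]
    rfl
  change (2 : ℝ) ^ l • α ((4 : ℝ) • ξ) l = (2 : ℝ) ^ k • α ξ l
  rw [h1]
  by_cases hl : l = j
  · subst hl
    change (2 : ℝ) ^ l • (4 : ℝ) ^ i • α ξ l = (2 : ℝ) ^ k • α ξ l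
    rw [smul_smul, ← h, zpow_add₀ (by norm_num), zpow_mul, zpow_natCast, zpow_natCast, mul_comm]
    norm_num
  · have h0 : α ξ l = 0 := by
      rw [hA]
      exact (A fun _ => ξ).2.2 l hl
    change (2 : ℝ) ^ l • (4 : ℝ) ^ i • α ξ l = (2 : ℝ) ^ k • α ξ l
    rw [h0, smul_zero, smul_zero, smul_zero]

/-- The summands lie in eigenspaces of one operator for the distinct eigenvalues `2 ^ k`. -/
theorem iSupIndep_cartanComplex : iSupIndep (F.cartanComplex E' G) := by
  have h1 : Function.Injective fun k : ℤ => (2 : ℝ) ^ k :=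
    zpow_right_injective₀ (by norm_num) (by norm_num)
  refine ((degreeOperator (E := E) (M := M) (E' := E') (G := G)).eigenspaces_iSupIndep.comp h1).mono
    fun k => ?_
  exact iSup_le fun i => iSup_le fun j => iSup_le fun h => cartanPiece_le_eigenspace h

end Foliation

/-- Maps from the Lie algebra to basic forms. -/
def basicEquivForms (E' G : Type*) [NormedAddCommGroup E'] [NormedSpace ℝ E'] [TopologicalSpace G]
    [ChartedSpace E' G] [Group G] (σ : FormField E M 2) : Submodule ℝ (EquivForms E' G E M) where
  carrier := {α | ∀ ξ, α ξ ∈ basicSubmodule σ}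
  zero_mem' _ := Submodule.zero_mem _
  add_mem' ha hb ξ := Submodule.add_mem _ (ha ξ) (hb ξ)
  smul_mem' c _ ha ξ := Submodule.smul_mem _ c (ha ξ)

variable [FiniteDimensional ℝ E]

/-- The smooth forms with vanishing Lie derivative along a vector field. -/
def invariantForms {X : (x : M) → TangentSpace 𝓘(ℝ, E) x} (hX : IsSmoothField X) :
    Submodule ℝ (Forms E M) where
  carrier := {a | a.IsSmooth ∧ Forms.lieDeriv X a = 0}
  zero_mem' := ⟨Forms.isSmooth_zero, by
    rw [Forms.lieDeriv, Forms.interior_zero, Forms.d_zero, Forms.interior_zero, add_zero]⟩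
  add_mem' ha hb := ⟨ha.1.add hb.1, by
    rw [Forms.lieDeriv_add hX ha.1 hb.1, ha.2, hb.2, add_zero]⟩
  smul_mem' c _ ha := ⟨ha.1.smul c, by rw [Forms.lieDeriv_smul, ha.2, smul_zero]⟩

variable [T2Space M] [FiniteDimensional ℝ E'] [LieGroup 𝓘(ℝ, E') ∞ G]
  [ContMDiffSMul 𝓘(ℝ, E') 𝓘(ℝ, E) ∞ G M] {n : ℕ} {F : Foliation E M (2 * n)} {σ : FormField E M 2}

theorem EquivForms.dG_add {α β : EquivForms E' G E M} (hα : α ∈ basicEquivForms E' G σ)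
    (hβ : β ∈ basicEquivForms E' G σ) : dG (α + β) = dG α + dG β := by
  funext ξ
  have h1 := Forms.d_add (hα ξ).1.1 (hβ ξ).1.1
  have h2 := Forms.interior_add (fundamentalField E ξ) (α ξ) (β ξ)
  change Forms.d (α ξ + β ξ) - Forms.interior (fundamentalField E ξ) (α ξ + β ξ) =
    (Forms.d (α ξ) - Forms.interior (fundamentalField E ξ) (α ξ)) +
      (Forms.d (β ξ) - Forms.interior (fundamentalField E ξ) (β ξ))
  rw [h1, h2, add_sub_add_comm]

theorem EquivForms.dG_smul (c : ℝ) (α : EquivForms E' G E M) : dG (c • α) = c • dG α := by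
  funext ξ
  have h1 := Forms.d_smul c (α ξ)
  have h2 := Forms.interior_smul (fundamentalField E ξ) c (α ξ)
  change Forms.d (c • α ξ) - Forms.interior (fundamentalField E ξ) (c • α ξ) =
    c • (Forms.d (α ξ) - Forms.interior (fundamentalField E ξ) (α ξ))
  rw [h1, h2, smul_sub]

namespace Foliation.IsTransverselySymplectic

variable (hσ : F.IsTransverselySymplectic σ)

include hσ

theorem cartanComplex_le_basic (k : ℤ) : F.cartanComplex E' G k ≤ basicEquivForms E' G σ :=
  iSup_le fun _ => iSup_le fun _ => iSup_le fun _ _ hα ξ => (hσ.cartanPiece_apply_mem hα ξ).1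

theorem iSup_cartanComplex_le_basic :
    ⨆ k, F.cartanComplex E' G k ≤ basicEquivForms E' G σ :=
  iSup_le fun k => hσ.cartanComplex_le_basic k

theorem cartanComplex_hasParity {k : ℤ} {α : EquivForms E' G E M}
    (hα : α ∈ F.cartanComplex E' G k) (ξ : GroupLieAlgebra 𝓘(ℝ, E') G) : (α ξ).HasParity k := by
  refine cartanComplex_induction hα (motive := fun α => (α ξ).HasParity k)
    (fun i j h α hα => (hσ.cartanPiece_apply_mem hα ξ).2.hasParity ⟨-i, by omega⟩) ?_ ?_
  -- The zero form has every degree; the absolute value of `k` is a natural number with the parity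
  -- of `k`.
  · exact Forms.IsDegree.hasParity (j := (k.natAbs)) (fun _ _ => rfl) (by
      rcases Int.natAbs_eq k with h | h <;> [exact ⟨0, by omega⟩; exact ⟨-k, by omega⟩])
  · intro α β hα hβ
    change Forms.parity (α ξ + β ξ) = (-1 : ℝ) ^ k • (α ξ + β ξ)
    rw [Forms.parity_add, hα, hβ, smul_add]

/-- An additive operation maps the complex to itself if it does so on the pieces. -/
theorem map_mem_cartanComplex {f : EquivForms E' G E M → EquivForms E' G E M} {k l : ℤ}
    (hf : ∀ α ∈ basicEquivForms E' G σ, ∀ β ∈ basicEquivForms E' G σ, f (α + β) = f α + f β)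
    (hp : ∀ i j : ℕ, 2 * (i : ℤ) + (j : ℤ) = k → ∀ α ∈ F.cartanPiece E' G i j,
      f α ∈ F.cartanComplex E' G l) {α : EquivForms E' G E M}
    (hα : α ∈ F.cartanComplex E' G k) : f α ∈ F.cartanComplex E' G l := by
  have h0 : f 0 = 0 := by
    have h1 := hf 0 (Submodule.zero_mem _) 0 (Submodule.zero_mem _)
    rwa [add_zero, left_eq_add] at h1
  refine (cartanComplex_induction hα
    (motive := fun α => α ∈ basicEquivForms E' G σ ∧ f α ∈ F.cartanComplex E' G l)
    (fun i j h α hα => ⟨fun ξ => (hσ.cartanPiece_apply_mem hα ξ).1, hp i j h α hα⟩)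
    ⟨Submodule.zero_mem _, by rw [h0]; exact Submodule.zero_mem _⟩
    fun α β hα hβ => ⟨Submodule.add_mem _ hα.1 hβ.1, ?_⟩).2
  rw [hf α hα.1 β hβ.1]
  exact Submodule.add_mem _ hα.2 hβ.2

theorem wedge_mem_cartanComplex {k l : ℤ} {α β : EquivForms E' G E M}
    (hα : α ∈ F.cartanComplex E' G k) (hβ : β ∈ F.cartanComplex E' G l) :
    EquivForms.wedge α β ∈ F.cartanComplex E' G (k + l) := by
  refine hσ.map_mem_cartanComplex (f := fun α => EquivForms.wedge α β)
    (fun α _ α' _ => funext fun ξ => Forms.wedge_add_left (α ξ) (α' ξ) (β ξ))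
    (fun i j h α hα => ?_) hα
  refine hσ.map_mem_cartanComplex (f := fun β => EquivForms.wedge α β)
    (fun β _ β' _ => funext fun ξ => Forms.wedge_add_right (α ξ) (β ξ) (β' ξ))
    (fun i' j' h' β hβ => ?_) hβ
  exact cartanPiece_le_cartanComplex (by push_cast; omega) (hσ.wedge_mem_cartanPiece hα hβ)

theorem equivCodiff_add {α β : EquivForms E' G E M} (hα : α ∈ basicEquivForms E' G σ)
    (hβ : β ∈ basicEquivForms E' G σ) :
    EquivForms.codiff σ n (α + β) = EquivForms.codiff σ n α + EquivForms.codiff σ n β :=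
  funext fun ξ => hσ.codiff_add (hα ξ) (hβ ξ)

theorem codiff_mem_cartanComplex (hpres : PreservesForm G σ) {k : ℤ} {α : EquivForms E' G E M}
    (hα : α ∈ F.cartanComplex E' G k) :
    EquivForms.codiff σ n α ∈ F.cartanComplex E' G (k + -1) := by
  refine hσ.map_mem_cartanComplex (fun α hα β hβ => hσ.equivCodiff_add hα hβ)
    (fun i j h α hα => ?_) hα
  cases j with
  | zero =>
    rw [hσ.codiff_cartanPiece_zero hα]
    exact Submodule.zero_mem _
  | succ j =>
    exact cartanPiece_le_cartanComplex (by push_cast at h; omega) (hσ.codiff_mem_cartanPiece hpres hα)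

theorem dG_mem_cartanComplex (htrans : IsTransverseAction E' G F) {k : ℤ}
    {α : EquivForms E' G E M} (hα : α ∈ F.cartanComplex E' G k) :
    EquivForms.dG α ∈ F.cartanComplex E' G (k + 1) := by
  refine hσ.map_mem_cartanComplex (fun α hα β hβ => EquivForms.dG_add hα hβ)
    (fun i j h α hα => ?_) hα
  have h1 : (fun ξ => Forms.interior (fundamentalField E ξ) (α ξ)) ∈
      F.cartanComplex E' G (k + 1) := by
    cases j with
    | zero =>
      rw [hσ.interior_cartanPiece_zero hα]
      exact Submodule.zero_mem _
    | succ j =>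
      exact cartanPiece_le_cartanComplex (by push_cast at h ⊢; omega)
        (hσ.interior_mem_cartanPiece htrans hα)
  exact Submodule.sub_mem _
    (cartanPiece_le_cartanComplex (by push_cast; omega) (hσ.d_mem_cartanPiece hα)) h1

theorem lieDeriv_cartanComplex (htrans : IsTransverseAction E' G F) {α : EquivForms E' G E M}
    (hα : α ∈ ⨆ k, F.cartanComplex E' G k) (ξ : GroupLieAlgebra 𝓘(ℝ, E') G) :
    Forms.lieDeriv (fundamentalField E ξ) (α ξ) = 0 := by
  have hle : ⨆ k, F.cartanComplex E' G k ≤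
      (invariantForms (htrans ξ).1).comap (LinearMap.proj ξ) :=
    iSup_le fun _ => iSup_le fun _ => iSup_le fun _ => iSup_le fun _ β hβ =>
      ⟨(hσ.cartanPiece_apply_mem hβ ξ).1.1.1, lieDeriv_cartanPiece hβ ξ (htrans ξ).1⟩
  exact (hle hα).2

/-- With `d² = 0` and `ι² = 0` only `-(dι + ιd)` remains, which is minus the Lie derivative of `α ξ`
along the fundamental field of `ξ` and vanishes by equivariance. -/
theorem dG_dG (htrans : IsTransverseAction E' G F) {α : EquivForms E' G E M}
    (hα : α ∈ ⨆ k, F.cartanComplex E' G k) : EquivForms.dG (EquivForms.dG α) = 0 := by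
  funext ξ
  have hs := (hσ.iSup_cartanComplex_le_basic hα ξ).1.1
  have hX := (htrans ξ).1
  have h1 := hσ.lieDeriv_cartanComplex htrans hα ξ
  have h2 : Forms.interior (fundamentalField E ξ) (Forms.interior (fundamentalField E ξ) (α ξ)) = 0 :=
    eq_zero_of_eq_neg (Forms.interior_interior (fundamentalField E ξ) (fundamentalField E ξ) (α ξ))
  have h3 : Forms.interior (fundamentalField E ξ) (Forms.d (α ξ) -
      Forms.interior (fundamentalField E ξ) (α ξ)) =
      Forms.interior (fundamentalField E ξ) (Forms.d (α ξ)) -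
        Forms.interior (fundamentalField E ξ) (Forms.interior (fundamentalField E ξ) (α ξ)) :=
    Forms.interior_sub _ _ _
  change Forms.d (Forms.d (α ξ) - Forms.interior (fundamentalField E ξ) (α ξ)) -
    Forms.interior (fundamentalField E ξ)
      (Forms.d (α ξ) - Forms.interior (fundamentalField E ξ) (α ξ)) = 0
  rw [h3, Forms.d_sub hs.d (hs.interior hX), Forms.d_d hs, h2, sub_zero, zero_sub, ← neg_add',
    neg_eq_zero]
  exact h1

/-- The codifferential anticommutes with `d` and with `ι(ξ_M)` separately; the latter uses that
`ξ_M` is foliate and preserves `σ`. Equivariance of `α` plays no part. -/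
theorem dG_codiff (htrans : IsTransverseAction E' G F) (hpres : PreservesForm G σ)
    {α : EquivForms E' G E M} (hα : α ∈ basicEquivForms E' G σ) :
    EquivForms.dG (EquivForms.codiff σ n α) + EquivForms.codiff σ n (EquivForms.dG α) = 0 := by
  funext ξ
  have h1 := hσ.d_codiff (hα ξ)
  have h2 := hσ.interior_codiff (htrans ξ)
    (lieDeriv_ofTwo_eq_zero hσ.smooth hpres ξ (htrans ξ).1) (hα ξ)
  have h3 := hσ.codiff_sub (d_mem_basic (hα ξ)) (hσ.interior_mem_basic (htrans ξ) (hα ξ))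
  change Forms.d (Forms.codiff σ n (α ξ)) - Forms.interior (fundamentalField E ξ)
    (Forms.codiff σ n (α ξ)) + Forms.codiff σ n (Forms.d (α ξ) -
      Forms.interior (fundamentalField E ξ) (α ξ)) = 0
  rw [h1, h2, h3]
  abel

theorem dG_wedge {k : ℤ} {α β : EquivForms E' G E M} (hα : α ∈ basicEquivForms E' G σ)
    (hβ : β ∈ basicEquivForms E' G σ) (hk : ∀ ξ, (α ξ).HasParity k) :
    EquivForms.dG (EquivForms.wedge α β) = EquivForms.wedge (EquivForms.dG α) β +
      (-1 : ℝ) ^ k • EquivForms.wedge α (EquivForms.dG β) := by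
  funext ξ
  change Forms.d (Forms.wedge (α ξ) (β ξ)) -
      Forms.interior (fundamentalField E ξ) (Forms.wedge (α ξ) (β ξ)) =
    Forms.wedge (Forms.d (α ξ) - Forms.interior (fundamentalField E ξ) (α ξ)) (β ξ) +
      (-1 : ℝ) ^ k • Forms.wedge (α ξ)
        (Forms.d (β ξ) - Forms.interior (fundamentalField E ξ) (β ξ))
  rw [Forms.d_wedge (hα ξ).1.1 (hβ ξ).1.1, Forms.interior_wedge, hk ξ, Forms.wedge_smul_left,
    Forms.wedge_smul_left, Forms.wedge_sub_left, Forms.wedge_sub_right, smul_sub]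
  abel

theorem oddBracket_apply {k : ℤ} {α β : EquivForms E' G E M} (hk : ∀ ξ, (α ξ).HasParity k)
    (ξ : GroupLieAlgebra 𝓘(ℝ, E') G) :
    oddBracket ℝ EquivForms.wedge (EquivForms.codiff σ n) k α β ξ =
      (-1 : ℝ) ^ k • codiffBracket σ n (α ξ) (β ξ) := by
  rw [codiffBracket, hk ξ, Forms.wedge_smul_left]
  rfl

theorem oddBracket_wedge {k l : ℤ} {α β γ : EquivForms E' G E M} (hα : α ∈ basicEquivForms E' G σ)
    (hβ : β ∈ basicEquivForms E' G σ) (hγ : γ ∈ basicEquivForms E' G σ)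
    (hk : ∀ ξ, (α ξ).HasParity k) (hl : ∀ ξ, (β ξ).HasParity l) :
    oddBracket ℝ EquivForms.wedge (EquivForms.codiff σ n) k α (EquivForms.wedge β γ) =
      EquivForms.wedge (oddBracket ℝ EquivForms.wedge (EquivForms.codiff σ n) k α β) γ +
        (-1 : ℝ) ^ ((k + 1) * l) •
          EquivForms.wedge β (oddBracket ℝ EquivForms.wedge (EquivForms.codiff σ n) k α γ) := by
  funext ξ
  have h1 := hσ.oddBracket_apply (β := EquivForms.wedge β γ) hk ξ
  have h2 := hσ.oddBracket_apply (β := β) hk ξ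
  have h3 := hσ.oddBracket_apply (β := γ) hk ξ
  have h4 := hσ.codiffBracket_wedge (hα ξ) (hβ ξ) (hγ ξ) (hk ξ) (hl ξ)
  change oddBracket ℝ EquivForms.wedge (EquivForms.codiff σ n) k α (EquivForms.wedge β γ) ξ =
    Forms.wedge (oddBracket ℝ EquivForms.wedge (EquivForms.codiff σ n) k α β ξ) (γ ξ) +
      (-1 : ℝ) ^ ((k + 1) * l) • Forms.wedge (β ξ)
        (oddBracket ℝ EquivForms.wedge (EquivForms.codiff σ n) k α γ ξ)
  rw [h1, h2, h3]
  change (-1 : ℝ) ^ k • codiffBracket σ n (α ξ) (Forms.wedge (β ξ) (γ ξ)) = _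
  rw [h4, Forms.wedge_smul_left, Forms.wedge_smul_right, smul_add, smul_comm]

end Foliation.IsTransverselySymplectic

end Complex

theorem mainTheorem5
    {E : Type*} [NormedAddCommGroup E] [NormedSpace ℝ E] [FiniteDimensional ℝ E]
    {M : Type*} [TopologicalSpace M] [T2Space M] [SecondCountableTopology M]
    [ChartedSpace E M] [IsManifold 𝓘(ℝ, E) ∞ M]
    {E' : Type*} [NormedAddCommGroup E'] [NormedSpace ℝ E'] [FiniteDimensional ℝ E']
    {G : Type*} [TopologicalSpace G] [T2Space G] [CompactSpace G] [ConnectedSpace G]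
    [ChartedSpace E' G] [Group G] [LieGroup 𝓘(ℝ, E') ∞ G]
    [MulAction G M] [ContMDiffSMul 𝓘(ℝ, E') 𝓘(ℝ, E) ∞ G M]
    (n : ℕ) (F : Foliation E M (2 * n)) (σ : FormField E M 2)
    (hσ : F.IsTransverselySymplectic σ)
    (htrans : IsTransverseAction E' G F)
    (hpres : PreservesForm G σ) :
    IsDGBVAlgebra (F.cartanComplex E' G) EquivForms.wedge EquivForms.one
      (EquivForms.codiff σ n) EquivForms.dG := by
  have hle : ⨆ k, F.cartanComplex E' G k ≤ basicEquivForms E' G σ :=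
    hσ.iSup_cartanComplex_le_basic
  have hle' : ∀ k, F.cartanComplex E' G k ≤ basicEquivForms E' G σ := hσ.cartanComplex_le_basic
  exact
    { independent := Foliation.iSupIndep_cartanComplex
      add_mul := fun a _ b _ c _ => funext fun ξ => Forms.wedge_add_left (a ξ) (b ξ) (c ξ)
      mul_add := fun a _ b _ c _ => funext fun ξ => Forms.wedge_add_right (a ξ) (b ξ) (c ξ)
      smul_mul := fun t a _ b _ => funext fun ξ => Forms.wedge_smul_left t (a ξ) (b ξ)
      mul_smul := fun t a _ b _ => funext fun ξ => Forms.wedge_smul_right t (a ξ) (b ξ)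
      mul_assoc := fun a _ b _ c _ => funext fun ξ => Forms.wedge_assoc (a ξ) (b ξ) (c ξ)
      one_mem := Foliation.cartanPiece_le_cartanComplex (by norm_num) hσ.one_mem_cartanPiece
      one_mul := fun a _ => funext fun ξ => Forms.one_wedge (a ξ)
      mul_one := fun a _ => funext fun ξ => Forms.wedge_one (a ξ)
      mul_mem := fun i j a ha b hb => hσ.wedge_mem_cartanComplex ha hb
      mul_comm := fun i j a ha b hb => funext fun ξ =>
        (hσ.cartanComplex_hasParity ha ξ).wedge_comm (hσ.cartanComplex_hasParity hb ξ)
      delta_linear :=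
        { map_add := fun a ha b hb => hσ.equivCodiff_add (hle ha) (hle hb)
          map_smul := fun c a ha => funext fun ξ => hσ.codiff_smul c (hle ha ξ)
          map_mem := fun i a ha => hσ.codiff_mem_cartanComplex hpres ha }
      delta_delta := fun a ha => funext fun ξ => hσ.codiff_codiff (hle ha ξ)
      bracket_mul := fun i j l a ha b hb c hc => hσ.oddBracket_wedge (hle' i ha) (hle' j hb)
        (hle' l hc) (hσ.cartanComplex_hasParity ha) (hσ.cartanComplex_hasParity hb)
      d_linear :=
        { map_add := fun a ha b hb => EquivForms.dG_add (hle ha) (hle hb)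
          map_smul := fun c a _ => EquivForms.dG_smul c a
          map_mem := fun i a ha => hσ.dG_mem_cartanComplex htrans ha }
      d_d := fun a ha => hσ.dG_dG htrans ha
      d_mul := fun i j a ha b hb => hσ.dG_wedge (hle' i ha) (hle' j hb)
        (hσ.cartanComplex_hasParity ha)
      d_delta := fun a ha => hσ.dG_codiff htrans hpres (hle ha) }
end
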